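/- **Setting.** Let $\mathscr S$ be the space of real smooth functions $f$ on the unit sphere $\mathbb S^2$ with $\mathcal L_\sigma f=0$ ($\sigma=\partial/\partial\sigma$ generating the rotations about the third axis), with its $C^\infty$ topology; $\langle f,g\rangle=\int_{\mathbb S^2}fg$; $Y_{\ell0}=\big(\tfrac{2\ell+1}{4\pi}\big)^{1/2}\mathscr P_\ell(\cos\theta)$; $f_\ell=\langle f,Y_{\ell0}\rangle$. Let $\mathscr S'$ be the topological dual with the $\sigma$-algebra generated by the cylinder sets, and $\tilde Q_\ell=\tilde Q(Y_{\ell0})$ for $\tilde Q\in\mathscr S'$. Let $\rho_\ell>0$, $\nu_\ell\in\mathbb R$ $(\ell\ge0)$ satisfy $\sum_\ell(\rho_\ell-\sqrt{\pi/2})^2<\infty$ and $\sum_\ell\nu_\ell^2<\infty$, and put, for $t\in(0,\pi)$, $$z_\ell(t)=\sqrt{\tfrac{\sin t}{2}}\Big(\rho_\ell\mathscr P_\ell(\cos t)+(\nu_\ell+i\rho_\ell^{-1})\mathscr Q_\ell(\cos t)\Big),$$ with $\mathscr P_\ell,\mathscr Q_\ell$ the Legendre functions of the first and second kind. These solve $\ddot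 z_\ell+\big(\tfrac14(1+\csc^2t)+\ell(\ell+1)\big)z_\ell=0$ and $z_\ell\dot{\bar z}_\ell-\bar z_\ell\dot z_\ell=i$. On Cauchy data $w=(Q,P)\in\mathbf P=\mathscr S\times\mathscr S$ let $\omega((Q_1,P_1),(Q_2,P_2))=\int_{\mathbb S^2}(Q_2P_1-Q_1P_2)$, let $b_\ell(w;t)=i\bar z_\ell(t)P_\ell-i\dot{\bar z}_\ell(t)Q_\ell$ be the mode coefficients of the solution $\sum_\ell(b_\ell z_\ell+\overline{b_\ell z_\ell})Y_{\ell0}$ with data $w$ at time $t$, and let $J_t$ be the complex structure on $\mathbf P$ given by $b_\ell\mapsto ib_\ell$. The time evolution $\tau_{(t_1,t_0)}$ on $\mathbf P$ maps the data of a solution at $t_0$ to its data at $t_1$. Put $$\alpha_\ell=i\big(\bar z_\ell(t_0)\dot z_\ell(t_1)-z_\ell(t_1)\dot{\bar z}_\ell(t_0)\big),\qquad \beta_\ell=i\big(\bar z_\ell(t_0)\dot{\bar z}_\ell(t_1)-\bar z_\ell(t_1)\dot{\bar z}_\ell(t_0)\big).$$ **Theorem.** (1) For each $t\in(0,\pi)$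 there is exactly one probability measure $\mu_t$ on $\mathscr S'$ with $\int e^{i\tilde Q(f)}\,d\mu_t=\exp\big(-\tfrac12\sum_\ell|z_\ell(t)|^2f_\ell^2\big)$ for all $f\in\mathscr S$. On $\mathscr H_s(t)=L^2(\mathscr S',\mu_t)$, with vacuum $\Psi_0^{(t)}=1$, there is exactly one family of unitary operators $\pi_t(W(w))$, $w\in\mathbf P$ (the Schrödinger representation at time $t$), such that $\pi_t(W(w_1))\pi_t(W(w_2))=e^{\frac i2\omega(w_1,w_2)}\pi_t(W(w_1+w_2))$, $\pi_t(W(0,f))$ is multiplication by $e^{i\tilde Q(f)}$, and $\langle\Psi_0^{(t)}|\pi_t(W(w))\Psi_0^{(t)}\rangle=\exp(-\tfrac14\omega(J_tw,w))$. Let $\hat Q_\ell(t),\hat P_\ell(t)$ be the self-adjoint generators of $s\mapsto\pi_t(W(0,sY_{\ell0}))$ and $s\mapsto\pi_t(W(-sY_{\ell0},0))$, and, on $D(\hat Q_\ell(t))\cap D(\hat P_\ell(t))$, let $\hat b_\ell(t)=i\bar z_\ell(t)\hat P_\ell(t)-i\dot{\bar z}_\ell(t)\hat Q_\ell(t)$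 and $\hat b_\ell^\dagger(t)=-iz_\ell(t)\hat P_\ell(t)+i\dot z_\ell(t)\hat Q_\ell(t)$. For all $t_0,t_1\in(0,\pi)$: (2) The dynamics is unitarily implementable: $\sum_\ell|\beta_\ell|^2<\infty$, and there is a unitary $U$ on $\mathscr H_s(t_0)$ with $U^{-1}\pi_{t_0}(W(w))U=\pi_{t_0}(W(\tau_{(t_1,t_0)}w))$ for all $w$. (3) The Schrödinger representations at $t_0$ and $t_1$ are unitarily equivalent. The finite products $$f_n[\tilde Q]=\prod_{\ell<n}\frac{|z_\ell(t_1)|^{1/2}}{|z_\ell(t_0)|^{1/2}}\exp\Big(-\frac12\frac{\beta_\ell}{\bar z_\ell(t_0)\bar z_\ell(t_1)}\tilde Q_\ell^2\Big)$$ are normalized vectors of $\mathscr H_s(t_1)$. With $\chi_n=\tfrac12\sum_{\ell<n}\mathrm{Im}\big(\beta_\ell z_\ell(t_1)/\bar z_\ell(t_0)\big)$, there is a unitary $V:\mathscr H_s(t_0)\to\mathscr H_s(t_1)$ with $V\pi_{t_0}(W(w))V^{-1}=\pi_{t_1}(W(w))$ for all $w\in\mathbf P$, with $$V\hat b_\ell(t_0)V^{-1}=\alpha_\ell\hat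 b_\ell(t_1)+\beta_\ell\hat b_\ell^\dagger(t_1),\qquad V\hat b_\ell^\dagger(t_0)V^{-1}=\bar\beta_\ell\hat b_\ell(t_1)+\bar\alpha_\ell\hat b_\ell^\dagger(t_1)\qquad(\ell\ge0)$$ (including equality of domains), and with $V\Psi_0^{(t_0)}=\lim_{n\to\infty}e^{i\chi_n}f_n$ in $\mathscr H_s(t_1)$. It is the only unitary that satisfies the last two displayed relations and has this value on $\Psi_0^{(t_0)}$. There is an equivalence $V$ of the two representations with $V\Psi_0^{(t_0)}=\lim_nf_n$ (no phases) if and only if the real sequence $(\chi_n)$ converges; this is the case whenever $\sum_\ell|\rho_\ell-\sqrt{\pi/2}|<\infty$ and $\sum_\ell|\nu_\ell|<\infty$. (4) $\sum_\ell\big(|z_\ell(t_1)|^2-|z_\ell(t_0)|^2\big)^2<\infty$, and $\mu_{t_0}$ and $\mu_{t_1}$ are mutually absolutely continuous. -/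

import Mathlib

open MeasureTheory Filter Topology
open scoped Manifold ContDiff UniformConvergence

noncomputable section

namespace Gowdy

/-! ### Test functions on the 2-sphere -/

abbrev E3 : Type := EuclideanSpace ℝ (Fin 3)

abbrev S2 : Type := Metric.sphere (0 : E3) 1

/-- The area measure of the round unit sphere (total mass `4π`). -/
def area : Measure S2 := (volume : Measure E3).toSphere

/-- The rotation of the sphere by the angle `a` about the third axis, i.e. the flow of `∂/∂σ`. -/
def rot (a : ℝ) (s : S2) : S2 :=
  ⟨!₂[Real.cos a * s.1 0 - Real.sin a * s.1 1, Real.sin a * s.1 0 + Real.cos a * s.1 1, s.1 2], by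
    have h : ‖s.1‖ = 1 := mem_sphere_zero_iff_norm.1 s.2
    rw [EuclideanSpace.norm_eq, Real.sqrt_eq_one] at h
    rw [mem_sphere_zero_iff_norm, EuclideanSpace.norm_eq, Real.sqrt_eq_one]
    simp only [Fin.sum_univ_three, Real.norm_eq_abs, sq_abs] at h ⊢
    simp only [Matrix.cons_val_zero, Matrix.cons_val_one, Matrix.cons_val]
    nlinarith [Real.sin_sq_add_cos_sq a]⟩

/-- Real smooth functions `f` on the sphere with vanishing Lie derivative along `∂/∂σ`. -/
def zonal : Submodule ℝ C^∞⟮𝓡 2, S2; 𝓘(ℝ, ℝ), ℝ⟯ where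
  carrier := {f | ∀ s, HasDerivAt (fun a : ℝ => f (rot a s)) 0 0}
  zero_mem' := fun s => by simp [hasDerivAt_const]
  add_mem' := fun {f g} hf hg s => by
    have h := (hf s).fun_add (hg s)
    rw [add_zero] at h
    exact h
  smul_mem' := fun c f hf s => by simpa using (hf s).const_mul c

/-- The space of smooth axially symmetric test functions on the sphere. -/
def TestFn : Type := zonal

instance : AddCommGroup TestFn := inferInstanceAs (AddCommGroup zonal)
instance : Module ℝ TestFn := inferInstanceAs (Module ℝ zonal)
instance : CoeFun TestFn (fun _ => S2 → ℝ) := ⟨fun f => (f.1 : S2 → ℝ)⟩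

open Classical in
/-- The extension of a function on the sphere that is constant along rays from the origin. -/
def radialExt (f : S2 → ℝ) (x : E3) : ℝ :=
  if h : x ≠ 0 then f ⟨‖x‖⁻¹ • x, by
    rw [mem_sphere_zero_iff_norm, norm_smul, norm_inv, norm_norm,
      inv_mul_cancel₀ (norm_ne_zero_iff.2 h)]⟩ else 0

/-- The (nuclear Fréchet) `C^∞` topology: uniform convergence on the sphere of the derivatives of
every order (of the extensions that are constant along rays). -/
instance : TopologicalSpace TestFn :=
  ⨅ n : ℕ, TopologicalSpace.induced
    (fun f : TestFn => (UniformFun.ofFun (fun s : S2 => iteratedFDeriv ℝ n (radialExt f) s.1) :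
      S2 →ᵤ (E3 [×n]→L[ℝ] ℝ))) inferInstance

/-! ### Legendre functions, spherical harmonics, modes -/

/-- Legendre polynomials, by Bonnet's recursion. -/
def legendreP : ℕ → ℝ → ℝ
  | 0 => fun _ => 1
  | 1 => fun x => x
  | n + 2 => fun x =>
      ((2 * n + 3) * x * legendreP (n + 1) x - (n + 1) * legendreP n x) / (n + 2)

/-- Legendre functions of the second kind on `(-1, 1)`, by the same recursion. -/
def legendreQ : ℕ → ℝ → ℝ
  | 0 => fun x => Real.log ((1 + x) / (1 - x)) / 2
  | 1 => fun x => x * (Real.log ((1 + x) / (1 - x)) / 2) - 1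
  | n + 2 => fun x =>
      ((2 * n + 3) * x * legendreQ (n + 1) x - (n + 1) * legendreQ n x) / (n + 2)

theorem contDiff_legendreP (n : ℕ) : ContDiff ℝ ∞ (legendreP n) := by
  induction n using Nat.twoStepInduction with
  | zero => exact contDiff_const
  | one => exact contDiff_id
  | more n h0 h1 =>
    show ContDiff ℝ ∞ fun x : ℝ =>
      ((2 * n + 3) * x * legendreP (n + 1) x - (n + 1) * legendreP n x) / (n + 2)
    exact (((contDiff_const.mul contDiff_id).mul h1).sub (contDiff_const.mul h0)).div_const _

theorem contMDiff_Y (l : ℕ) : ContMDiff (𝓡 2) 𝓘(ℝ, ℝ) ∞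
    (fun s : S2 => Real.sqrt ((2 * l + 1) / (4 * Real.pi)) * legendreP l (s.1 2)) := by
  have h1 : ContDiff ℝ ∞ (fun x : E3 =>
      Real.sqrt ((2 * l + 1) / (4 * Real.pi)) * legendreP l (x 2)) :=
    contDiff_const.mul ((contDiff_legendreP l).comp
      (EuclideanSpace.proj (𝕜 := ℝ) (2 : Fin 3)).contDiff)
  have : Fact (Module.finrank ℝ E3 = 2 + 1) := ⟨by simp⟩
  exact h1.contMDiff.comp (contMDiff_coe_sphere (n := 2))

/-- The axially symmetric spherical harmonic `Y_{ℓ0} = √((2ℓ+1)/4π) P_ℓ(cos θ)`, where `cos θ` is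
the third coordinate. -/
def Y (l : ℕ) : TestFn :=
  ⟨⟨fun s => Real.sqrt ((2 * l + 1) / (4 * Real.pi)) * legendreP l (s.1 2), contMDiff_Y l⟩,
    fun s => by simpa [rot] using hasDerivAt_const (0 : ℝ) _⟩

/-- The `L²` product on the sphere. -/
def pairing (f g : TestFn) : ℝ := ∫ s, f s * g s ∂area

/-- The coefficient `f_ℓ` of `f` in the expansion `f = ∑ f_ℓ Y_{ℓ0}`. -/
def coeff (f : TestFn) (l : ℕ) : ℝ := pairing f (Y l)

/-- The mode functions `z_ℓ(t) = √(sin t) (ρ_ℓ u_{0ℓ}(t) + (ν_ℓ + i/ρ_ℓ) v_{0ℓ}(t))` with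
`u_{0ℓ} = P_ℓ(cos t)/√2` and `v_{0ℓ} = Q_ℓ(cos t)/√2`. -/
def modeFn (ρ ν : ℕ → ℝ) (l : ℕ) (t : ℝ) : ℂ :=
  (Real.sqrt (Real.sin t) : ℂ) *
    ((ρ l : ℂ) * (legendreP l (Real.cos t) / Real.sqrt 2 : ℝ)
      + ((ν l : ℂ) + Complex.I * ((ρ l)⁻¹ : ℝ)) * (legendreQ l (Real.cos t) / Real.sqrt 2 : ℝ))

/-! ### Canonical phase space and complex structure -/

/-- Cauchy data `(Q, P)`. -/
abbrev PhaseSpace : Type := TestFn × TestFn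

/-- The symplectic form `∫ (Q₂ P₁ - Q₁ P₂)`. -/
def symp (w₁ w₂ : PhaseSpace) : ℝ := pairing w₂.1 w₁.2 - pairing w₁.1 w₂.2

open ComplexConjugate in
/-- The mode coefficient `b_ℓ = i z̄_ℓ(t) P_ℓ - i z̄_ℓ'(t) Q_ℓ` of the solution
`∑ (b_ℓ z_ℓ + c.c.) Y_{ℓ0}` with Cauchy data `w = (Q, P)` at time `t`. -/
def modeCoeff (z : ℕ → ℝ → ℂ) (t : ℝ) (w : PhaseSpace) (l : ℕ) : ℂ :=
  Complex.I * conj (z l t) * coeff w.2 l - Complex.I * conj (deriv (z l) t) * coeff w.1 l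

/-- The `ℓ`-th harmonic coefficients of `J_t w`, where the complex structure `J_t` on Cauchy data at
time `t` is induced by `b_ℓ ↦ i b_ℓ`. -/
def Jcoeff (z : ℕ → ℝ → ℂ) (t : ℝ) (w : PhaseSpace) (l : ℕ) : ℝ × ℝ :=
  (2 * (Complex.I * modeCoeff z t w l * z l t).re,
    2 * (Complex.I * modeCoeff z t w l * deriv (z l) t).re)

/-- `ω(J_t w, w)`, expanded in spherical harmonics. -/
def sympJ (z : ℕ → ℝ → ℂ) (t : ℝ) (w : PhaseSpace) : ℝ :=
  ∑' l, (coeff w.1 l * (Jcoeff z t w l).2 - (Jcoeff z t w l).1 * coeff w.2 l)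

/-- `w'` is the Cauchy datum at time `t₁` of the solution with Cauchy datum `w` at time `t₀`. -/
def Evolves (z : ℕ → ℝ → ℂ) (t₀ t₁ : ℝ) (w w' : PhaseSpace) : Prop :=
  ∀ l, modeCoeff z t₁ w' l = modeCoeff z t₀ w l

open ComplexConjugate in
/-- Bogoliubov coefficient `α_ℓ(t₁, t₀)`. -/
def bogAlpha (z : ℕ → ℝ → ℂ) (t₁ t₀ : ℝ) (l : ℕ) : ℂ :=
  Complex.I * (conj (z l t₀) * deriv (z l) t₁ - z l t₁ * conj (deriv (z l) t₀))

open ComplexConjugate in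
/-- Bogoliubov coefficient `β_ℓ(t₁, t₀)`. -/
def bogBeta (z : ℕ → ℝ → ℂ) (t₁ t₀ : ℝ) (l : ℕ) : ℂ :=
  Complex.I * (conj (z l t₀) * conj (deriv (z l) t₁) - conj (z l t₁) * conj (deriv (z l) t₀))

/-! ### Distributions, the Gaussian measure, the Schrödinger representation -/

/-- Continuous linear functionals on the test functions. -/
def Distr : Type := TestFn →L[ℝ] ℝ

instance : CoeFun Distr (fun _ => TestFn → ℝ) :=
  ⟨fun T => ((show TestFn →L[ℝ] ℝ from T) : TestFn → ℝ)⟩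

/-- The σ-algebra generated by the cylinder sets. -/
instance : MeasurableSpace Distr := ⨆ f : TestFn, (borel ℝ).comap (fun T : Distr => T f)

/-- The quadratic form `⟨f, C(t) f⟩` of the covariance operator
`C(t) f = ∑ |z_ℓ(t)|² f_ℓ Y_{ℓ0}`. -/
def covForm (z : ℕ → ℝ → ℂ) (t : ℝ) (f : TestFn) : ℝ := ∑' l, ‖z l t‖ ^ 2 * coeff f l ^ 2

/-- `μ` is the centred Gaussian measure with covariance `C(t)`, given by its Fourier transform. -/
def IsFieldMeasure (z : ℕ → ℝ → ℂ) (t : ℝ) (μ : ProbabilityMeasure Distr) : Prop :=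
  ∀ f : TestFn, ∫ T, Complex.exp (Complex.I * (T f : ℝ)) ∂(μ : Measure Distr)
    = Complex.exp (-(covForm z t f : ℂ) / 2)

/-- The Hilbert space `L²(μ)`. -/
abbrev HS (μ : ProbabilityMeasure Distr) : Type := Lp ℂ 2 (μ : Measure Distr)

/-- The vacuum, i.e. the constant functional `1`. -/
def vac (μ : ProbabilityMeasure Distr) : HS μ := (memLp_const (1 : ℂ)).toLp (fun _ => (1 : ℂ))

/-- A family of operators labelled by phase space (the images of the Weyl generators). -/
abbrev WeylFamily (μ : ProbabilityMeasure Distr) : Type := PhaseSpace → (HS μ ≃ₗᵢ[ℂ] HS μ)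

/-- `W` is the Schrödinger representation at time `t` on `L²(μ)`: unitary operators satisfying the
Weyl relations (with `[Q, P] = i`), with the configuration observables acting by multiplication, and
such that the constant functional `1` induces the state `W(w) ↦ exp(-ω(J_t w, w)/4)`.
With `w = (-g, f)`, `W w` is `exp(i (Q̂[f] + P̂[g]))`. -/
structure IsSchrodingerRep (z : ℕ → ℝ → ℂ) (t : ℝ) (μ : ProbabilityMeasure Distr)
    (W : WeylFamily μ) : Prop where
  weyl : ∀ (w₁ w₂ : PhaseSpace) (ψ : HS μ),
    W w₁ (W w₂ ψ) = Complex.exp (Complex.I / 2 * (symp w₁ w₂ : ℝ)) • W (w₁ + w₂) ψ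
  config : ∀ (f : TestFn) (ψ : HS μ),
    W (0, f) ψ =ᵐ[(μ : Measure Distr)] fun T => Complex.exp (Complex.I * (T f : ℝ)) * ψ T
  state : ∀ w : PhaseSpace,
    inner ℂ (vac μ) (W w (vac μ)) = Complex.exp (-(sympJ z t w : ℂ) / 4)

/-- `ψ` is in the domain of the self-adjoint generator of `s ↦ W(s w) = exp(i s L)`, and
`L ψ = χ`. -/
def IsGen {μ : ProbabilityMeasure Distr} (W : WeylFamily μ) (w : PhaseSpace) (ψ χ : HS μ) : Prop :=
  HasDerivAt (fun s : ℝ => W (s • w) ψ) (Complex.I • χ) 0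

open ComplexConjugate in
/-- `b_ℓ(t) ψ = χ`, where `b_ℓ(t) = i z̄_ℓ(t) P̂_ℓ - i z̄_ℓ'(t) Q̂_ℓ` on `D(Q̂_ℓ) ∩ D(P̂_ℓ)`. -/
def IsAnnih (z : ℕ → ℝ → ℂ) (t : ℝ) {μ : ProbabilityMeasure Distr} (W : WeylFamily μ) (l : ℕ)
    (ψ χ : HS μ) : Prop :=
  ∃ q p : HS μ, IsGen W (0, Y l) ψ q ∧ IsGen W (-Y l, 0) ψ p ∧
    χ = (Complex.I * conj (z l t)) • p - (Complex.I * conj (deriv (z l) t)) • q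

/-- `b_ℓ†(t) ψ = χ`, where `b_ℓ†(t) = -i z_ℓ(t) P̂_ℓ + i z_ℓ'(t) Q̂_ℓ` on `D(Q̂_ℓ) ∩ D(P̂_ℓ)`. -/
def IsCreat (z : ℕ → ℝ → ℂ) (t : ℝ) {μ : ProbabilityMeasure Distr} (W : WeylFamily μ) (l : ℕ)
    (ψ χ : HS μ) : Prop :=
  ∃ q p : HS μ, IsGen W (0, Y l) ψ q ∧ IsGen W (-Y l, 0) ψ p ∧
    χ = (Complex.I * deriv (z l) t) • q - (Complex.I * z l t) • p

/-! ### Unitary equivalence -/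

/-- `V` is a unitary equivalence of the representations `W₀` and `W₁`: `V W₀(w) V⁻¹ = W₁(w)`. -/
def Intertwines {μ₀ μ₁ : ProbabilityMeasure Distr} (W₀ : WeylFamily μ₀) (W₁ : WeylFamily μ₁)
    (V : HS μ₀ ≃ₗᵢ[ℂ] HS μ₁) : Prop :=
  ∀ (w : PhaseSpace) (ψ : HS μ₀), V (W₀ w ψ) = W₁ w (V ψ)

open ComplexConjugate in
/-- The operator identities `V b_ℓ(t₀) V⁻¹ = α_ℓ b_ℓ(t₁) + β_ℓ b_ℓ†(t₁)` and
`V b_ℓ†(t₀) V⁻¹ = β̄_ℓ b_ℓ(t₁) + ᾱ_ℓ b_ℓ†(t₁)` for all `ℓ`, including equality of domains. -/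
def Bogoliubov (z : ℕ → ℝ → ℂ) (t₀ t₁ : ℝ) {μ₀ μ₁ : ProbabilityMeasure Distr}
    (W₀ : WeylFamily μ₀) (W₁ : WeylFamily μ₁) (V : HS μ₀ ≃ₗᵢ[ℂ] HS μ₁) : Prop :=
  ∀ (l : ℕ) (ψ χ : HS μ₀),
    (IsAnnih z t₀ W₀ l ψ χ ↔ ∃ a c : HS μ₁,
      IsAnnih z t₁ W₁ l (V ψ) a ∧ IsCreat z t₁ W₁ l (V ψ) c ∧
        V χ = bogAlpha z t₁ t₀ l • a + bogBeta z t₁ t₀ l • c) ∧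
    (IsCreat z t₀ W₀ l ψ χ ↔ ∃ a c : HS μ₁,
      IsAnnih z t₁ W₁ l (V ψ) a ∧ IsCreat z t₁ W₁ l (V ψ) c ∧
        V χ = conj (bogBeta z t₁ t₀ l) • a + conj (bogAlpha z t₁ t₀ l) • c)

open ComplexConjugate in
/-- The product over `ℓ < n` of the factors
`|z_ℓ(t₁)|^{1/2} / |z_ℓ(t₀)|^{1/2} · exp(-½ β_ℓ / (z̄_ℓ(t₀) z̄_ℓ(t₁)) T(Y_{ℓ0})²)`. -/
def vacProd (z : ℕ → ℝ → ℂ) (t₀ t₁ : ℝ) (n : ℕ) (T : Distr) : ℂ :=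
  ∏ l ∈ Finset.range n,
    ((‖z l t₁‖ ^ (1 / 2 : ℝ) / ‖z l t₀‖ ^ (1 / 2 : ℝ) : ℝ) : ℂ) *
      Complex.exp (-(1 / 2) * (bogBeta z t₁ t₀ l / (conj (z l t₀) * conj (z l t₁))) *
        ((T (Y l) : ℝ) : ℂ) ^ 2)

open ComplexConjugate in
/-- The phase `½ ∑_{ℓ < n} Im(β_ℓ z_ℓ(t₁) / z̄_ℓ(t₀))`. -/
def vacPhase (z : ℕ → ℝ → ℂ) (t₀ t₁ : ℝ) (n : ℕ) : ℝ :=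
  (1 / 2) * ∑ l ∈ Finset.range n, (bogBeta z t₁ t₀ l * z l t₁ / conj (z l t₀)).im

/-- `F n → ψ` in the norm of `L²(μ)`, for square-integrable functions `F n`. -/
def TendstoL2 (μ : ProbabilityMeasure Distr) (F : ℕ → Distr → ℂ) (ψ : HS μ) : Prop :=
  (∀ n, MemLp (F n) 2 (μ : Measure Distr)) ∧
    Tendsto (fun n => eLpNorm (fun T => F n T - ψ T) 2 (μ : Measure Distr)) atTop (𝓝 0)

end Gowdy

end

/-! Two ingredients carry the theorem: a bound of |β_ℓ| by a constant times `modeDev`, and the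
description of all relevant states by infinite products of one-mode Gaussians.

The estimate. Let λ = ℓ + 1/2 and let ω = λ + 1/(8λ sin²t) be the first-order WKB frequency. Once
the WKB phase is removed, the defect ż + iωz has a derivative of size O(1/λ)·|z|, and the Wronskian
bounds |z| by the defect. Grönwall therefore carries a bound on the defect from t = π/2 to any other
time (`IsMode.wkbDefect_le`). At π/2 the data are values of Legendre functions at 0, which Wallis'
product gives with relative error O(ℓ⁻²); this is where √(π/2) comes from
(`wkbDefect_modeFn_half_pi`). Since β_ℓ is a two-time Wronskian of z_ℓ, it is bilinear in z and the
defects up to a frequency difference O(1/λ), whence `bogBeta_modeFn_le`. After that, the modes enter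
only through `ModeData` (Wronskian and growth at one time) and the summability of β.

The field. Two integrations by parts give decay of the harmonic coefficients (`abs_coeff_le`). The
product of Gaussians with variances |z_ℓ|² then lives on coefficient sequences of distributions, and
μ_t is its image. Parseval's identity turns ω and J_t into sums over modes. Division by the vacuum
packet identifies one-mode wave functions with elements of L² of a Gaussian, and infinite products
converge when their overlaps with the vacuum differ from 1 by a summable amount
(`ModeData.exists_tendsto_prodVec`). Displaced packets form a total family of coherent vectors whose
Gram matrix contains only ω and J_t. Unitaries between total families with equal Gram matrices give
the Weyl operators (`ModeData.exists_weyl`) and the evolution between time slices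
(`exists_evolution_unitary`).

The equivalence. Seen at t₁, the vacuum of t₀ is a product of packets with the shapes of t₀. With η
= β z(t₁)/z̄(t₀), the one-mode overlap is |α|^(-1/2) exp(-(i/2) Im log(1+η)) for |η| < 1. Its
modulus is 1 + O(|β|²), but its argument is of first order in β and need not be summable; the factor
exp(i Im η/2) removes exactly the linear term (`packetOverlap_vac`). This is the origin of the
phases χ_n. The limit Φ has the vacuum expectation values of t₀, so |Φ|² is the density of μ_{t₀}
with respect to μ_{t₁}. Exchanging the times gives mutual absolute continuity, so Φ vanishes almost
nowhere and is cyclic, and the GNS argument yields V (`exists_intertwiner`). For uniqueness, the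
Bogoliubov relations determine how the position generators are transported, and these generate a
total set from the vacuum (`Bogoliubov.eq_of_vac`). The criterion for phases follows from ‖f_n‖ = 1,
which gives ⟨f_n, e^{iχ_n} f_n⟩ = e^{iχ_n}. -/

noncomputable section

namespace Gowdy

/-! ### Legendre functions -/

/-- Sequences of functions on `(-1, 1)` obeying Bonnet's recursion and the first-order ladder
relations. -/
structure IsLegendreLike (R : ℕ → ℝ → ℝ) : Prop where
  bonnet : ∀ (n : ℕ) (x : ℝ), (n + 2) * R (n + 2) x = (2 * n + 3) * x * R (n + 1) x - (n + 1) * R n x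
  ladder : ∀ (n : ℕ) (x : ℝ), x ∈ Set.Ioo (-1 : ℝ) 1 →
    HasDerivAt (R n) ((n + 1) * (x * R n x - R (n + 1) x) / (1 - x ^ 2)) x

/-- The ladder relation propagates: differentiate Bonnet's recursion and insert the two preceding
ladder relations. Functions of the first and second kind then differ only in the two initial checks.
-/
theorem isLegendreLike_of_initial {R : ℕ → ℝ → ℝ}
    (hR : ∀ n, R (n + 2) = fun x => ((2 * n + 3) * x * R (n + 1) x - (n + 1) * R n x) / (n + 2))
    (h0 : ∀ x ∈ Set.Ioo (-1 : ℝ) 1, HasDerivAt (R 0) ((x * R 0 x - R 1 x) / (1 - x ^ 2)) x)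
    (h1 : ∀ x ∈ Set.Ioo (-1 : ℝ) 1, HasDerivAt (R 1) ((R 0 x - x * R 1 x) / (1 - x ^ 2)) x) :
    IsLegendreLike R := by
  have hb : ∀ (n : ℕ) (x : ℝ),
      (n + 2) * R (n + 2) x = (2 * n + 3) * x * R (n + 1) x - (n + 1) * R n x := by
    intro n x
    rw [hR n]
    field_simp
  refine ⟨hb, fun n x hx => ?_⟩
  have hx' : 1 - x ^ 2 ≠ 0 := by nlinarith [hx.1, hx.2]
  induction n using Nat.twoStepInduction with
  | zero => simpa using h0 x hx
  | one =>
    convert h1 x hx using 1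
    have := hb 0 x
    push_cast at this ⊢
    congr 1
    norm_num at this ⊢
    linarith
  | more n ih0 ih1 =>
    have h2 := hb (n + 1) x
    have h3 := hb n x
    have hd := ((((hasDerivAt_id x).const_mul (2 * (n : ℝ) + 3)).mul ih1).sub
      (ih0.const_mul ((n : ℝ) + 1))).div_const ((n : ℝ) + 2)
    rw [hR n]
    refine hd.congr_deriv ?_
    simp only [id]
    push_cast at h2 ⊢
    have e3 : R (n + 1 + 2) x = ((2 * (n + 1) + 3) * x * R (n + 1 + 1) x - (n + 1 + 1) * R (n + 1) x)
      / (n + 1 + 2) := by rw [← h2]; field_simp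
    have e2 : R (n + 1 + 1) x = ((2 * n + 3) * x * R (n + 1) x - (n + 1) * R n x) / (n + 2) := by
      rw [← h3]; field_simp
    have n3 : (n : ℝ) + 3 ≠ 0 := by positivity
    have n3' : (n : ℝ) + 1 + 2 ≠ 0 := by positivity
    rw [show n + 2 + 1 = n + 1 + 2 from rfl, e3, show n + 2 = n + 1 + 1 from rfl, e2]
    field_simp
    ring

theorem isLegendreLike_legendreP : IsLegendreLike legendreP := by
  refine isLegendreLike_of_initial (fun n => rfl) (fun x hx => ?_) (fun x hx => ?_)
  · refine (hasDerivAt_const x (1 : ℝ)).congr_deriv ?_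
    simp [legendreP]
  · have hx' : 1 - x ^ 2 ≠ 0 := by nlinarith [hx.1, hx.2]
    refine (hasDerivAt_id x).congr_deriv ?_
    simp only [legendreP]
    rw [eq_comm, div_eq_one_iff_eq hx']; ring

theorem hasDerivAt_artanh_log {x : ℝ} (hx : x ∈ Set.Ioo (-1 : ℝ) 1) :
    HasDerivAt (fun x : ℝ => Real.log ((1 + x) / (1 - x)) / 2) (1 / (1 - x ^ 2)) x := by
  have h1 : 0 < 1 + x := by linarith [hx.1]
  have h2 : 0 < 1 - x := by linarith [hx.2]
  have h3 : 1 - x ^ 2 ≠ 0 := by nlinarith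
  have h := ((((hasDerivAt_id x).const_add 1).div ((hasDerivAt_id x).const_sub 1) h2.ne').log
    (div_pos h1 h2).ne').div_const 2
  refine h.congr_deriv ?_
  simp only [id, Pi.div_apply]
  field_simp
  ring

theorem isLegendreLike_legendreQ : IsLegendreLike legendreQ := by
  refine isLegendreLike_of_initial (fun n => rfl) (fun x hx => ?_) (fun x hx => ?_)
  · refine (hasDerivAt_artanh_log hx).congr_deriv ?_
    simp [legendreQ]
  · have hx' : 1 - x ^ 2 ≠ 0 := by nlinarith [hx.1, hx.2]
    refine (((hasDerivAt_id x).mul (hasDerivAt_artanh_log hx)).sub_const 1).congr_deriv ?_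
    simp only [legendreQ, id]
    field_simp
    ring

theorem IsLegendreLike.ladder_succ {R : ℕ → ℝ → ℝ} (h : IsLegendreLike R) (n : ℕ) {x : ℝ}
    (hx : x ∈ Set.Ioo (-1 : ℝ) 1) :
    HasDerivAt (R (n + 1)) ((n + 1) * (R n x - x * R (n + 1) x) / (1 - x ^ 2)) x := by
  refine (h.ladder (n + 1) x hx).congr_deriv ?_
  have := h.bonnet n x
  push_cast
  congr 1
  linear_combination -this

/-- The Casorati determinant of two solutions of Bonnet's recursion, multiplied by n + 1, does not
depend on n. It later supplies the Wronskian of the modes and links the values of the two kinds at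
0. -/
theorem legendre_casorati (n : ℕ) (x : ℝ) :
    (n + 1) * (legendreP (n + 1) x * legendreQ n x - legendreP n x * legendreQ (n + 1) x) = 1 := by
  induction n with
  | zero => simp [legendreP, legendreQ]
  | succ n ih =>
    have h1 := isLegendreLike_legendreP.bonnet n x
    have h2 := isLegendreLike_legendreQ.bonnet n x
    push_cast
    linear_combination ih + legendreQ (n + 1) x * h1 - legendreP (n + 1) x * h2

theorem IsLegendreLike.hasDerivAt_comp_cos {R : ℕ → ℝ → ℝ} (h : IsLegendreLike R) (n : ℕ) {t : ℝ}
    (ht : t ∈ Set.Ioo 0 Real.pi) :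
    HasDerivAt (fun t => R n (Real.cos t))
      ((n + 1) * (R (n + 1) (Real.cos t) - Real.cos t * R n (Real.cos t)) / Real.sin t) t := by
  have hs := Real.sin_pos_of_mem_Ioo ht
  have hx : Real.cos t ∈ Set.Ioo (-1 : ℝ) 1 := by
    constructor <;> nlinarith [Real.sin_sq_add_cos_sq t]
  refine ((h.ladder n _ hx).comp t (Real.hasDerivAt_cos t)).congr_deriv ?_
  rw [← Real.sin_sq]
  field_simp
  ring

theorem IsLegendreLike.hasDerivAt_comp_cos_succ {R : ℕ → ℝ → ℝ} (h : IsLegendreLike R) (n : ℕ)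
    {t : ℝ} (ht : t ∈ Set.Ioo 0 Real.pi) :
    HasDerivAt (fun t => R (n + 1) (Real.cos t))
      ((n + 1) * (Real.cos t * R (n + 1) (Real.cos t) - R n (Real.cos t)) / Real.sin t) t := by
  have hs := Real.sin_pos_of_mem_Ioo ht
  have hx : Real.cos t ∈ Set.Ioo (-1 : ℝ) 1 := by
    constructor <;> nlinarith [Real.sin_sq_add_cos_sq t]
  refine ((h.ladder_succ n hx).comp t (Real.hasDerivAt_cos t)).congr_deriv ?_
  rw [← Real.sin_sq]
  field_simp
  ring

/-- At the origin the middle term of the recursion drops out and the parities decouple. -/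
theorem IsLegendreLike.at_zero {R : ℕ → ℝ → ℝ} (h : IsLegendreLike R) (n : ℕ) :
    (n + 2) * R (n + 2) 0 = -((n + 1) * R n 0) := by
  have := h.bonnet n 0
  linarith

theorem legendreP_odd_zero (k : ℕ) : legendreP (2 * k + 1) 0 = 0 := by
  induction k with
  | zero => simp [legendreP]
  | succ k ih =>
    have := isLegendreLike_legendreP.at_zero (2 * k + 1)
    rw [ih, mul_zero, neg_zero] at this
    exact (mul_eq_zero.1 this).resolve_left (by positivity)

theorem legendreQ_even_zero (k : ℕ) : legendreQ (2 * k) 0 = 0 := by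
  induction k with
  | zero => simp [legendreQ]
  | succ k ih =>
    have := isLegendreLike_legendreQ.at_zero (2 * k)
    rw [ih, mul_zero, neg_zero] at this
    exact (mul_eq_zero.1 this).resolve_left (by positivity)

theorem legendreP_even_succ_sq (k : ℕ) :
    (2 * k + 2) ^ 2 * legendreP (2 * (k + 1)) 0 ^ 2 = (2 * k + 1) ^ 2 * legendreP (2 * k) 0 ^ 2 := by
  have := isLegendreLike_legendreP.at_zero (2 * k)
  push_cast at this
  rw [show 2 * (k + 1) = 2 * k + 2 by ring, ← mul_pow, ← mul_pow, this]
  ring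

/-- The recursion at 0 for (2k+1) P_{2k}(0)² is the reciprocal of that for Wallis' partial products.
This brings π into the asymptotics of the modes. -/
theorem wallis_mul_legendreP (k : ℕ) : Real.Wallis.W k * ((2 * k + 1) * legendreP (2 * k) 0 ^ 2) = 1 := by
  induction k with
  | zero => simp [Real.Wallis.W, legendreP]
  | succ k ih =>
    have h := legendreP_even_succ_sq k
    have e : legendreP (2 * (k + 1)) 0 ^ 2 = (2 * k + 1) ^ 2 * legendreP (2 * k) 0 ^ 2 / (2 * k + 2) ^ 2 := by
      rw [← h]; field_simp
    rw [Real.Wallis.W_succ, e]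
    push_cast
    have : (2 : ℝ) * k + 3 ≠ 0 := by positivity
    field_simp
    linear_combination (2 * (k : ℝ) + 3) * ih

theorem legendreP_even_pos (k : ℕ) : 0 < legendreP (2 * k) 0 ^ 2 := by
  rcases (sq_nonneg (legendreP (2 * k) 0)).lt_or_eq with h | h
  · exact h
  · have := wallis_mul_legendreP k
    rw [← h] at this
    simp at this

theorem tendsto_legendreP_even_zero :
    Tendsto (fun k : ℕ => (k + 1 / 4 : ℝ) * legendreP (2 * k) 0 ^ 2) atTop (𝓝 (1 / Real.pi)) := by
  have h1 := Real.Wallis.tendsto_W_nhds_pi_div_two.inv₀ (by positivity)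
  have h2 : Tendsto (fun k : ℕ => ((k + 1 / 4 : ℝ) / (2 * k + 1))) atTop (𝓝 (1 / 2)) := by
    have h3 : Tendsto (fun k : ℕ => (1 / 2 : ℝ) - (1 / 4) * (1 / ((2 * k + 1 : ℕ) : ℝ))) atTop
        (𝓝 (1 / 2 - 1 / 4 * 0)) := by
      refine tendsto_const_nhds.sub (Tendsto.const_mul _ ?_)
      have := tendsto_one_div_atTop_nhds_zero_nat (𝕜 := ℝ)
      refine this.comp (tendsto_atTop_mono (fun k => ?_) tendsto_id)
      simp only [id]; omega
    rw [mul_zero, sub_zero] at h3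
    refine h3.congr fun k => ?_
    push_cast
    field_simp
    ring
  have h4 := h2.mul h1
  rw [show (1 / 2 : ℝ) * (Real.pi / 2)⁻¹ = 1 / Real.pi by field_simp] at h4
  refine h4.congr fun k => ?_
  have hw : (Real.Wallis.W k)⁻¹ = (2 * k + 1) * legendreP (2 * k) 0 ^ 2 :=
    inv_eq_of_mul_eq_one_right (wallis_mul_legendreP k)
  rw [hw]
  field_simp

/-- With the shift 1/4 consecutive ratios are 1 + O(k⁻³) and at least 1, so the sequence increases
to its limit. The shift is also the natural one: 2(k + 1/4) is λ for ℓ = 2k. -/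
theorem legendreP_even_zero_le (k : ℕ) :
    (k + 1 / 4 : ℝ) * legendreP (2 * k) 0 ^ 2 ≤ 1 / Real.pi := by
  have hm : Monotone (fun k : ℕ => (k + 1 / 4 : ℝ) * legendreP (2 * k) 0 ^ 2) := by
    refine monotone_nat_of_le_succ fun k => ?_
    have h := legendreP_even_succ_sq k
    have hp := legendreP_even_pos k
    have e : legendreP (2 * (k + 1)) 0 ^ 2 = (2 * k + 1) ^ 2 * legendreP (2 * k) 0 ^ 2 / (2 * k + 2) ^ 2 := by
      rw [← h]; field_simp
    rw [e]
    push_cast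
    rw [mul_div_assoc', le_div_iff₀ (by positivity)]
    nlinarith
  exact hm.ge_of_tendsto tendsto_legendreP_even_zero k

/-- The extra factor tends to 1 but falls faster than the sequence grows, so the product decreases
to the same limit. Together with the upper bound this fixes the value up to a relative error O(k⁻²).
-/
theorem le_legendreP_even_zero (k : ℕ) :
    1 / Real.pi ≤ (k + 1 / 4 : ℝ) * legendreP (2 * k) 0 ^ 2 * (1 + 1 / (k + 1) ^ 2) := by
  have hm : Antitone (fun k : ℕ => (k + 1 / 4 : ℝ) * legendreP (2 * k) 0 ^ 2 * (1 + 1 / ((k : ℝ) + 1) ^ 2)) := by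
    refine antitone_nat_of_succ_le fun k => ?_
    have h := legendreP_even_succ_sq k
    have hp := legendreP_even_pos k
    have e : legendreP (2 * (k + 1)) 0 ^ 2 = (2 * k + 1) ^ 2 / (2 * k + 2) ^ 2 * legendreP (2 * k) 0 ^ 2 := by
      rw [div_mul_eq_mul_div, ← h]; field_simp
    have key : ((k : ℝ) + 1 + 1 / 4) * ((2 * k + 1) ^ 2 / (2 * k + 2) ^ 2) * (1 + 1 / ((k : ℝ) + 1 + 1) ^ 2)
        ≤ (k + 1 / 4 : ℝ) * (1 + 1 / ((k : ℝ) + 1) ^ 2) := by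
      rw [← sub_nonneg]
      have : (k + 1 / 4 : ℝ) * (1 + 1 / ((k : ℝ) + 1) ^ 2) -
        ((k : ℝ) + 1 + 1 / 4) * ((2 * k + 1) ^ 2 / (2 * k + 2) ^ 2) * (1 + 1 / ((k : ℝ) + 1 + 1) ^ 2)
        = (31 * k ^ 2 + 52 * k + 7) / (16 * (k + 1) ^ 2 * (k + 2) ^ 2) := by
        field_simp
        ring
      rw [this]
      positivity
    rw [e]
    push_cast
    nlinarith
  have ht : Tendsto (fun k : ℕ => (k + 1 / 4 : ℝ) * legendreP (2 * k) 0 ^ 2 * (1 + 1 / ((k : ℝ) + 1) ^ 2))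
      atTop (𝓝 (1 / Real.pi * (1 + 0))) := by
    refine tendsto_legendreP_even_zero.mul (tendsto_const_nhds.add ?_)
    have := (tendsto_one_div_add_atTop_nhds_zero_nat (𝕜 := ℝ)).pow 2
    simpa using this
  rw [add_zero, mul_one] at ht
  exact hm.le_of_tendsto ht k

end Gowdy

end

noncomputable section

namespace Gowdy

/-! ### Mode functions -/

open ComplexConjugate

/-- Follows from eʸ − 1 ≤ y eʸ; the resulting bound has no division by K. -/
theorem gronwallBound_le {δ K ε x : ℝ} (hK : 0 ≤ K) (hε : 0 ≤ ε) :
    gronwallBound δ K ε x ≤ (δ + ε * x) * Real.exp (K * x) := by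
  rcases hK.eq_or_lt with rfl | hK
  · simp [gronwallBound_K0]
  · rw [gronwallBound_of_K_ne_0 hK.ne', add_mul]
    have h1 : Real.exp (K * x) - 1 ≤ K * x * Real.exp (K * x) := by
      have h2 := Real.add_one_le_exp (-(K * x))
      have h3 : Real.exp (K * x) * Real.exp (-(K * x)) = 1 := by rw [← Real.exp_add]; simp
      nlinarith [Real.exp_pos (K * x)]
    have h4 : ε / K * (Real.exp (K * x) - 1) ≤ ε / K * (K * x * Real.exp (K * x)) := by gcongr
    have h5 : ε / K * (K * x * Real.exp (K * x)) = ε * x * Real.exp (K * x) := by field_simp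
    linarith

theorem norm_le_of_norm_deriv_le_aux {f f' : ℝ → ℂ} {K ε s t : ℝ} (hK : 0 ≤ K) (hε : 0 ≤ ε)
    (hst : s ≤ t) (hf : ∀ x ∈ Set.Icc s t, HasDerivAt f (f' x) x)
    (hb : ∀ x ∈ Set.Icc s t, ‖f' x‖ ≤ K * ‖f x‖ + ε) :
    ‖f t‖ ≤ (‖f s‖ + ε * (t - s)) * Real.exp (K * (t - s)) :=
  (norm_le_gronwallBound_of_norm_deriv_right_le
    (fun x hx => (hf x hx).continuousAt.continuousWithinAt)
    (fun x hx => (hf x (Set.Ico_subset_Icc_self hx)).hasDerivWithinAt) le_rfl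
    (fun x hx => hb x (Set.Ico_subset_Icc_self hx)) t (Set.right_mem_Icc.2 hst)).trans
    (gronwallBound_le hK hε)

theorem norm_le_of_norm_deriv_le {f f' : ℝ → ℂ} {K ε s t : ℝ} (hK : 0 ≤ K) (hε : 0 ≤ ε)
    (hf : ∀ x ∈ Set.uIcc s t, HasDerivAt f (f' x) x)
    (hb : ∀ x ∈ Set.uIcc s t, ‖f' x‖ ≤ K * ‖f x‖ + ε) :
    ‖f t‖ ≤ (‖f s‖ + ε * |t - s|) * Real.exp (K * |t - s|) := by
  rcases le_total s t with h | h
  · rw [abs_of_nonneg (sub_nonneg.2 h)]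
    rw [Set.uIcc_of_le h] at hf hb
    exact norm_le_of_norm_deriv_le_aux hK hε h hf hb
  · rw [abs_of_nonpos (sub_nonpos.2 h)]
    rw [Set.uIcc_of_ge h] at hf hb
    -- Backward in time the estimate is applied to the reflected curve x ↦ f(−x).
    have hm : ∀ x ∈ Set.Icc (-s) (-t), -x ∈ Set.Icc t s := fun x hx =>
      ⟨by linarith [hx.2], by linarith [hx.1]⟩
    have := norm_le_of_norm_deriv_le_aux (f := fun x => f (-x)) (f' := fun x => -f' (-x)) hK hε
      (neg_le_neg h) (fun x hx => by
        have := (hf (-x) (hm x hx)).scomp x (hasDerivAt_neg x)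
        simpa [Function.comp_def] using this)
      (fun x hx => by simpa using hb (-x) (hm x hx))
    simp only [neg_neg] at this
    convert this using 3 <;> ring

/-- Solutions of the mode equation with frequency `lam`, normalized by the Wronskian. -/
structure IsMode (lam : ℝ) (z : ℝ → ℂ) : Prop where
  hasDerivAt : ∀ t ∈ Set.Ioo 0 Real.pi, HasDerivAt z (deriv z t) t
  hasDerivAt_deriv : ∀ t ∈ Set.Ioo 0 Real.pi,
    HasDerivAt (deriv z) (-((lam ^ 2 + 1 / (4 * Real.sin t ^ 2) : ℝ) * z t)) t
  wronskian : ∀ t ∈ Set.Ioo 0 Real.pi,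
    z t * conj (deriv z t) - conj (z t) * deriv z t = Complex.I

/-- The radial part of the mode functions, with the Legendre functions of degree `k`. -/
def modeRadial (ρ ν : ℕ → ℝ) (l k : ℕ) (t : ℝ) : ℂ :=
  (ρ l : ℂ) * (legendreP k (Real.cos t) / Real.sqrt 2 : ℝ)
      + ((ν l : ℂ) + Complex.I * ((ρ l)⁻¹ : ℝ)) * (legendreQ k (Real.cos t) / Real.sqrt 2 : ℝ)

/-- The derivative of the mode functions. -/
def modeDeriv (ρ ν : ℕ → ℝ) (l : ℕ) (t : ℝ) : ℂ :=
  (Real.sqrt (Real.sin t) : ℂ) * (((Real.cos t / (2 * Real.sin t) : ℝ) : ℂ) * modeRadial ρ ν l l t +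
    ((l + 1 : ℝ) : ℂ) * (modeRadial ρ ν l (l + 1) t - (Real.cos t : ℝ) * modeRadial ρ ν l l t) /
      (Real.sin t : ℝ))

theorem modeFn_eq (ρ ν : ℕ → ℝ) (l : ℕ) (t : ℝ) :
    modeFn ρ ν l t = (Real.sqrt (Real.sin t) : ℂ) * modeRadial ρ ν l l t := rfl

theorem hasDerivAt_modeRadial (ρ ν : ℕ → ℝ) (l : ℕ) {t : ℝ} (ht : t ∈ Set.Ioo 0 Real.pi) :
    HasDerivAt (modeRadial ρ ν l l) (((l + 1 : ℝ) : ℂ) * (modeRadial ρ ν l (l + 1) t -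
      (Real.cos t : ℝ) * modeRadial ρ ν l l t) / (Real.sin t : ℝ)) t := by
  have hs := (Real.sin_pos_of_mem_Ioo ht).ne'
  have hs' : (Real.sin t : ℂ) ≠ 0 := by exact_mod_cast hs
  have hP := ((isLegendreLike_legendreP.hasDerivAt_comp_cos l ht).div_const (√2)).ofReal_comp
  have hQ := ((isLegendreLike_legendreQ.hasDerivAt_comp_cos l ht).div_const (√2)).ofReal_comp
  refine ((hP.const_mul (ρ l : ℂ)).add
    (hQ.const_mul ((ν l : ℂ) + Complex.I * ((ρ l)⁻¹ : ℝ)))).congr_deriv ?_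
  simp only [modeRadial, Complex.ofReal_div, Complex.ofReal_mul, Complex.ofReal_sub]
  ring

theorem hasDerivAt_modeRadial_succ (ρ ν : ℕ → ℝ) (l : ℕ) {t : ℝ} (ht : t ∈ Set.Ioo 0 Real.pi) :
    HasDerivAt (modeRadial ρ ν l (l + 1)) (((l + 1 : ℝ) : ℂ) * ((Real.cos t : ℝ) *
      modeRadial ρ ν l (l + 1) t - modeRadial ρ ν l l t) / (Real.sin t : ℝ)) t := by
  have hP := ((isLegendreLike_legendreP.hasDerivAt_comp_cos_succ l ht).div_const (√2)).ofReal_comp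
  have hQ := ((isLegendreLike_legendreQ.hasDerivAt_comp_cos_succ l ht).div_const (√2)).ofReal_comp
  refine ((hP.const_mul (ρ l : ℂ)).add
    (hQ.const_mul ((ν l : ℂ) + Complex.I * ((ρ l)⁻¹ : ℝ)))).congr_deriv ?_
  simp only [modeRadial, Complex.ofReal_div, Complex.ofReal_mul, Complex.ofReal_sub]
  ring

theorem hasDerivAt_sqrt_sin {t : ℝ} (ht : t ∈ Set.Ioo 0 Real.pi) :
    HasDerivAt (fun t => (Real.sqrt (Real.sin t) : ℂ))
      ((Real.sqrt (Real.sin t) : ℂ) * ((Real.cos t / (2 * Real.sin t) : ℝ) : ℂ)) t := by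
  have hs := Real.sin_pos_of_mem_Ioo ht
  refine (((Real.hasDerivAt_sin t).sqrt hs.ne').ofReal_comp).congr_deriv ?_
  rw [← Complex.ofReal_mul]
  congr 1
  rw [div_eq_iff (by positivity)]
  nth_rewrite 2 [← Real.sq_sqrt hs.le]
  have := (Real.sqrt_pos.2 hs).ne'
  field_simp

theorem hasDerivAt_modeFn (ρ ν : ℕ → ℝ) (l : ℕ) {t : ℝ} (ht : t ∈ Set.Ioo 0 Real.pi) :
    HasDerivAt (modeFn ρ ν l) (modeDeriv ρ ν l t) t := by
  refine ((hasDerivAt_sqrt_sin ht).mul (hasDerivAt_modeRadial ρ ν l ht)).congr_deriv ?_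
  simp only [modeDeriv]
  ring

theorem deriv_modeFn (ρ ν : ℕ → ℝ) (l : ℕ) {t : ℝ} (ht : t ∈ Set.Ioo 0 Real.pi) :
    deriv (modeFn ρ ν l) t = modeDeriv ρ ν l t := (hasDerivAt_modeFn ρ ν l ht).deriv

/-- The second-order equation results from the two first-order ladder relations between the degrees
l and l + 1; the constants l(l+1) and 1/4 combine to (l + 1/2)². -/
theorem hasDerivAt_modeDeriv (ρ ν : ℕ → ℝ) (l : ℕ) {t : ℝ} (ht : t ∈ Set.Ioo 0 Real.pi) :
    HasDerivAt (modeDeriv ρ ν l)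
      (-(((l + 1 / 2 : ℝ) ^ 2 + 1 / (4 * Real.sin t ^ 2) : ℝ) * modeFn ρ ν l t)) t := by
  have hs := (Real.sin_pos_of_mem_Ioo ht).ne'
  have hs' : Complex.sin (t : ℂ) ≠ 0 := by
    rw [← Complex.ofReal_sin]; exact_mod_cast hs
  have h0 := hasDerivAt_modeRadial ρ ν l ht
  have h1 := hasDerivAt_modeRadial_succ ρ ν l ht
  have hc := (Real.hasDerivAt_cos t).ofReal_comp
  have hsn := (Real.hasDerivAt_sin t).ofReal_comp
  have hcs := ((Real.hasDerivAt_cos t).div ((Real.hasDerivAt_sin t).const_mul 2)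
    (mul_ne_zero two_ne_zero hs)).ofReal_comp
  have := (hasDerivAt_sqrt_sin ht).mul ((hcs.mul h0).add
    (((h1.sub (hc.mul h0)).const_mul ((l + 1 : ℝ) : ℂ)).div hsn (by exact_mod_cast hs)))
  refine this.congr_deriv ?_
  rw [modeFn_eq]
  simp only [Pi.div_apply, Pi.add_apply, Pi.mul_apply, Pi.sub_apply]
  push_cast
  have e : Complex.cos (t : ℂ) ^ 2 = 1 - Complex.sin (t : ℂ) ^ 2 := by
    rw [← Complex.sin_sq_add_cos_sq (t : ℂ)]; ring
  field_simp
  ring_nf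
  simp only [e]
  ring

/-- Terms of the derivative that are real multiples of z cancel. In the rest the two factors √sin t
compensate 1/sin t, and what remains is the Casorati determinant with coefficient ρ·ρ⁻¹. -/
theorem modeFn_wronskian {ρ ν : ℕ → ℝ} (hρ : ∀ l, 0 < ρ l) (l : ℕ) {t : ℝ}
    (ht : t ∈ Set.Ioo 0 Real.pi) :
    modeFn ρ ν l t * conj (modeDeriv ρ ν l t) - conj (modeFn ρ ν l t) * modeDeriv ρ ν l t =
      Complex.I := by
  have hs := Real.sin_pos_of_mem_Ioo ht
  have hs' : Complex.sin (t : ℂ) ≠ 0 := by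
    rw [← Complex.ofReal_sin]; exact_mod_cast hs.ne'
  have hr : (ρ l : ℂ) ≠ 0 := by exact_mod_cast (hρ l).ne'
  have hsq : ((√(Real.sin t) : ℝ) : ℂ) ^ 2 = Complex.sin t := by
    rw [← Complex.ofReal_pow, Real.sq_sqrt hs.le, Complex.ofReal_sin]
  have h2 : ((√2 : ℝ) : ℂ) ^ 2 = 2 := by
    rw [← Complex.ofReal_pow, Real.sq_sqrt zero_le_two]; norm_num
  have h2' : ((√2 : ℝ) : ℂ) ≠ 0 := by
    intro h
    rw [h] at h2
    norm_num at h2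
  have hC : ((l : ℂ) + 1) * (legendreP (l + 1) (Real.cos t) * legendreQ l (Real.cos t) -
      legendreP l (Real.cos t) * legendreQ (l + 1) (Real.cos t)) = 1 := by
    exact_mod_cast legendre_casorati l (Real.cos t)
  rw [modeFn_eq]
  simp only [modeDeriv, modeRadial, map_mul, map_add, map_sub, map_div₀, Complex.conj_ofReal,
    Complex.conj_I]
  push_cast at hC ⊢
  field_simp
  rw [hsq, h2]
  linear_combination (4 * Complex.sin t * (ρ l : ℂ) ^ 2 * Complex.I) * hC

theorem isMode_modeFn {ρ ν : ℕ → ℝ} (hρ : ∀ l, 0 < ρ l) (l : ℕ) :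
    IsMode (l + 1 / 2) (modeFn ρ ν l) where
  hasDerivAt t ht := by
    rw [deriv_modeFn ρ ν l ht]
    exact hasDerivAt_modeFn ρ ν l ht
  hasDerivAt_deriv t ht := by
    refine (hasDerivAt_modeDeriv ρ ν l ht).congr_of_eventuallyEq ?_
    filter_upwards [isOpen_Ioo.mem_nhds ht] with s hs using deriv_modeFn ρ ν l hs
  wronskian t ht := by
    rw [deriv_modeFn ρ ν l ht]
    exact modeFn_wronskian hρ l ht

end Gowdy

end

noncomputable section

namespace Gowdy

/-! ### WKB estimates -/

open ComplexConjugate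

/-- The first-order WKB frequency. -/
def wkbFreq (lam t : ℝ) : ℝ := lam + 1 / (8 * lam * Real.sin t ^ 2)

/-- The negative-frequency part of a solution. -/
def wkbDefect (lam : ℝ) (z : ℝ → ℂ) (t : ℝ) : ℂ := deriv z t + Complex.I * wkbFreq lam t * z t

theorem le_wkbFreq {lam : ℝ} (h : 0 < lam) (t : ℝ) : lam ≤ wkbFreq lam t := by
  have : 0 ≤ 1 / (8 * lam * Real.sin t ^ 2) := by positivity
  unfold wkbFreq
  linarith

/-- The cross terms of the two squares are a multiple of Im(z̄ ż), which the Wronskian fixes to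
−1/2. -/
theorem IsMode.norm_sq_sub {lam t : ℝ} {z : ℝ → ℂ} (hz : IsMode lam z) (ht : t ∈ Set.Ioo 0 Real.pi)
    (w : ℝ) : ‖deriv z t - Complex.I * w * z t‖ ^ 2 = 2 * w + ‖deriv z t + Complex.I * w * z t‖ ^ 2 := by
  have h := hz.wronskian t ht
  have h' : ((‖deriv z t - Complex.I * w * z t‖ ^ 2 : ℝ) : ℂ) =
      ((2 * w + ‖deriv z t + Complex.I * w * z t‖ ^ 2 : ℝ) : ℂ) := by
    push_cast
    rw [← Complex.mul_conj', ← Complex.mul_conj']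
    simp only [map_sub, map_add, map_mul, Complex.conj_I, Complex.conj_ofReal]
    linear_combination (-2 * Complex.I * w) * h - 2 * w * Complex.I_sq
  exact_mod_cast h'

/-- The vector 2iwz is the difference of the two frequency parts, and by `IsMode.norm_sq_sub` the
larger one exceeds the smaller one by at most √(2w). Control of the defect therefore suffices to
control z. -/
theorem IsMode.norm_le {lam t : ℝ} {z : ℝ → ℂ} (hz : IsMode lam z) (ht : t ∈ Set.Ioo 0 Real.pi)
    {w : ℝ} (hw : 0 < w) : 2 * w * ‖z t‖ ≤ √(2 * w) + 2 * ‖deriv z t + Complex.I * w * z t‖ := by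
  have h := hz.norm_sq_sub ht w
  set A := deriv z t - Complex.I * w * z t
  set D := deriv z t + Complex.I * w * z t
  have hA : ‖A‖ ≤ √(2 * w) + ‖D‖ := by
    refine abs_le_of_sq_le_sq' ?_ (by positivity) |>.2
    rw [h]
    nlinarith [Real.sq_sqrt (show 0 ≤ 2 * w by positivity), Real.sqrt_nonneg (2 * w), norm_nonneg D]
  have h2 : 2 * Complex.I * w * z t = D - A := by simp only [A, D]; ring
  have h3 := norm_sub_le D A
  rw [← h2] at h3
  simp only [norm_mul, Complex.norm_I, Complex.norm_real, Complex.norm_ofNat, Real.norm_eq_abs,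
    abs_of_pos hw] at h3
  linarith

theorem hasDerivAt_wkbFreq (lam : ℝ) {t : ℝ} (ht : t ∈ Set.Ioo 0 Real.pi) :
    HasDerivAt (wkbFreq lam) (-(Real.cos t / (4 * lam * Real.sin t ^ 3))) t := by
  have hs := (Real.sin_pos_of_mem_Ioo ht).ne'
  have h := ((((Real.hasDerivAt_sin t).fun_pow 2).inv (pow_ne_zero 2 hs)).const_mul
    (1 / (8 * lam))).const_add lam
  have e : wkbFreq lam = fun t => lam + 1 / (8 * lam) * (fun t => Real.sin t ^ 2)⁻¹ t := by
    funext t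
    simp only [wkbFreq, Pi.inv_apply, one_div, mul_inv]
  rw [e]
  refine h.congr_deriv ?_
  rcases eq_or_ne lam 0 with rfl | hl
  · simp
  · field_simp
    norm_num
    ring

/-- The WKB phase. -/
def wkbPhase (lam t : ℝ) : ℝ := lam * t - Real.cos t / (8 * lam * Real.sin t)

theorem hasDerivAt_wkbPhase {lam : ℝ} (hl : lam ≠ 0) {t : ℝ} (ht : t ∈ Set.Ioo 0 Real.pi) :
    HasDerivAt (wkbPhase lam) (wkbFreq lam t) t := by
  have hs := (Real.sin_pos_of_mem_Ioo ht).ne'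
  have h := ((hasDerivAt_id t).const_mul lam).sub ((Real.hasDerivAt_cos t).div
    ((Real.hasDerivAt_sin t).const_mul (8 * lam)) (by positivity))
  refine h.congr_deriv ?_
  have e := Real.sin_sq_add_cos_sq t
  simp only [wkbFreq]
  field_simp
  linear_combination e

/-- The derivative is the phase times z̈ + ω²z + iω̇z. The choice of ω makes ω² − λ² − 1/(4 sin²t)
equal to 1/(64λ² sin⁴t), so the whole coefficient of z is O(1/λ). -/
theorem IsMode.hasDerivAt_wkb {lam t : ℝ} {z : ℝ → ℂ} (hz : IsMode lam z) (hl : lam ≠ 0)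
    (ht : t ∈ Set.Ioo 0 Real.pi) :
    HasDerivAt (fun t => Complex.exp (-(Complex.I * wkbPhase lam t)) * wkbDefect lam z t)
      (Complex.exp (-(Complex.I * wkbPhase lam t)) * ((1 / (64 * lam ^ 2 * Real.sin t ^ 4) -
        Complex.I * (Real.cos t / (4 * lam * Real.sin t ^ 3)) : ℂ) * z t)) t := by
  have hs : (Real.sin t : ℂ) ≠ 0 := by exact_mod_cast (Real.sin_pos_of_mem_Ioo ht).ne'
  have hl' : (lam : ℂ) ≠ 0 := by exact_mod_cast hl
  have h1 := (((hasDerivAt_wkbPhase hl ht).ofReal_comp.const_mul Complex.I).neg).cexp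
  have h2 := (hz.hasDerivAt_deriv t ht).add
    (((hasDerivAt_wkbFreq lam ht).ofReal_comp.const_mul Complex.I).mul (hz.hasDerivAt t ht))
  refine (h1.mul h2).congr_deriv ?_
  simp only [wkbFreq, Pi.add_apply, Pi.mul_apply, Pi.neg_apply]
  rw [mul_assoc, ← mul_add]
  congr 1
  push_cast at hs ⊢
  field_simp
  ring_nf
  simp only [Complex.I_sq]
  ring

theorem sin_le_sin_of_mem_uIcc {t x : ℝ} (ht : t ∈ Set.Ioo 0 Real.pi)
    (hx : x ∈ Set.uIcc (Real.pi / 2) t) : Real.sin t ≤ Real.sin x := by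
  rcases le_total (Real.pi / 2) t with h | h
  · rw [Set.uIcc_of_le h] at hx
    rw [← Real.sin_pi_sub t, ← Real.sin_pi_sub x]
    exact Real.sin_le_sin_of_le_of_le_pi_div_two (by linarith [ht.2]) (by linarith [hx.1])
      (by linarith [hx.2])
  · rw [Set.uIcc_of_ge h] at hx
    exact Real.sin_le_sin_of_le_of_le_pi_div_two (by linarith [ht.1]) hx.2 hx.1

/-- Grönwall's inequality between π/2 and t. The source is O(1/λ)·|z| with |z| ≤ λ^(-1/2) +
defect/λ, which leaves an inhomogeneity λ^(-3/2). The essential point is that C serves all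
frequencies at once. -/
theorem IsMode.wkbDefect_le {t : ℝ} (ht : t ∈ Set.Ioo 0 Real.pi) : ∃ C, 0 ≤ C ∧ ∀ lam : ℝ, 1 / 2 ≤ lam →
    ∀ z, IsMode lam z →
      ‖wkbDefect lam z t‖ ≤ C * (‖wkbDefect lam z (Real.pi / 2)‖ + 1 / (lam * √lam)) := by
  set s := Real.sin t with hs_def
  have hs : 0 < s := Real.sin_pos_of_mem_Ioo ht
  -- K/λ dominates the coefficient in `IsMode.hasDerivAt_wkb`, one factor 1/λ of its first term
  -- being replaced by 2. The Grönwall rate 4K below comes from 1/λ² ≤ 4.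
  set K := 1 / (32 * s ^ 4) + 1 / (4 * s ^ 3) with hK
  have hK0 : 0 ≤ K := by positivity
  refine ⟨(1 + K * |t - Real.pi / 2|) * Real.exp (4 * K * |t - Real.pi / 2|), by positivity,
    fun lam hl z hz => ?_⟩
  have hl0 : 0 < lam := by linarith
  have hmem : ∀ x ∈ Set.uIcc (Real.pi / 2) t, x ∈ Set.Ioo 0 Real.pi := fun x hx =>
    Set.OrdConnected.uIcc_subset Set.ordConnected_Ioo
      ⟨by linarith [Real.pi_pos], by linarith [Real.pi_pos]⟩ ht hx
  have hnorm : ∀ x, ‖Complex.exp (-(Complex.I * wkbPhase lam x))‖ = 1 := fun x => by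
    rw [show -(Complex.I * wkbPhase lam x) = ((-wkbPhase lam x : ℝ) : ℂ) * Complex.I by
      push_cast; ring, Complex.norm_exp_ofReal_mul_I]
  have key := norm_le_of_norm_deriv_le (K := 4 * K) (ε := K * (1 / (lam * √lam))) (s := Real.pi / 2)
    (t := t) (by positivity) (by positivity)
    (fun x hx => hz.hasDerivAt_wkb hl0.ne' (hmem x hx)) (fun x hx => by
      have hsx := sin_le_sin_of_mem_uIcc ht hx
      rw [← hs_def] at hsx
      have hzx := hz.norm_le (hmem x hx) (hl0.trans_le (le_wkbFreq hl0 x))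
      set w := wkbFreq lam x
      have hw : lam ≤ w := le_wkbFreq hl0 x
      rw [norm_mul, norm_mul, norm_mul, hnorm, one_mul, one_mul]
      have hD : wkbDefect lam z x = deriv z x + Complex.I * w * z x := rfl
      rw [← hD] at hzx
      set d := ‖wkbDefect lam z x‖
      have hsl : 0 < √lam := Real.sqrt_pos.2 hl0
      have hz' : ‖z x‖ ≤ 1 / √lam + d / lam := by
        have hw0 : 0 < w := hl0.trans_le hw
        have h1 : √(2 * w) * √lam ≤ 2 * w := by
          rw [← Real.sqrt_mul (by positivity)]
          refine Real.sqrt_le_iff.2 ⟨by positivity, by nlinarith⟩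
        have h2 : ‖z x‖ ≤ √(2 * w) / (2 * w) + d / w := by
          rw [← sub_nonneg]
          have : √(2 * w) / (2 * w) + d / w - ‖z x‖ = (√(2 * w) + 2 * d - 2 * w * ‖z x‖) / (2 * w) := by
            field_simp
          rw [this]
          exact div_nonneg (by linarith) (by positivity)
        have h3 : √(2 * w) / (2 * w) ≤ 1 / √lam := by
          rw [div_le_div_iff₀ (by positivity) hsl]; linarith
        have h4 : d / w ≤ d / lam := by gcongr
        linarith
      have hr : ‖(1 / (64 * lam ^ 2 * Real.sin x ^ 4) -
          Complex.I * (Real.cos x / (4 * lam * Real.sin x ^ 3)) : ℂ)‖ ≤ K / lam := by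
        have e1 : (1 / (64 * lam ^ 2 * Real.sin x ^ 4) : ℂ) =
          ((1 / (64 * lam ^ 2 * Real.sin x ^ 4) : ℝ) : ℂ) := by push_cast; ring
        have e2 : (Real.cos x / (4 * lam * Real.sin x ^ 3) : ℂ) =
          ((Real.cos x / (4 * lam * Real.sin x ^ 3) : ℝ) : ℂ) := by push_cast; ring
        refine (norm_sub_le _ _).trans ?_
        rw [norm_mul, Complex.norm_I, one_mul, e1, e2, Complex.norm_real, Complex.norm_real,
          Real.norm_eq_abs, Real.norm_eq_abs, hK, add_div]
        have hx0 : 0 < Real.sin x := hs.trans_le hsx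
        refine add_le_add ?_ ?_
        · rw [abs_of_nonneg (by positivity), div_div]
          have h64 : 32 * s ^ 4 * lam ≤ 64 * lam ^ 2 * Real.sin x ^ 4 := by
            have : s ^ 4 ≤ Real.sin x ^ 4 := by gcongr
            have h1 : 32 * lam ≤ 64 * lam ^ 2 := by nlinarith
            calc 32 * s ^ 4 * lam = 32 * lam * s ^ 4 := by ring
              _ ≤ _ := by gcongr
          gcongr
        · rw [abs_div, abs_of_pos (show 0 < 4 * lam * Real.sin x ^ 3 by positivity), div_div]
          refine div_le_div₀ zero_le_one (Real.abs_cos_le_one x) (by positivity) ?_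
          have : s ^ 3 ≤ Real.sin x ^ 3 := by gcongr
          nlinarith
      calc _ ≤ K / lam * (1 / √lam + d / lam) := by gcongr
        _ = K / lam ^ 2 * d + K * (1 / (lam * √lam)) := by field_simp; ring
        _ ≤ 4 * K * d + K * (1 / (lam * √lam)) := by
          have : K / lam ^ 2 ≤ 4 * K := by
            rw [div_le_iff₀ (by positivity)]
            nlinarith [mul_nonneg hK0 (show 0 ≤ 4 * lam ^ 2 - 1 by nlinarith)]
          gcongr)
  rw [norm_mul, norm_mul, hnorm, hnorm, one_mul, one_mul] at key
  refine key.trans ?_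
  rw [mul_right_comm (1 + _)]
  refine mul_le_mul_of_nonneg_right ?_ (Real.exp_pos _).le
  have h1 : 0 ≤ 1 / (lam * √lam) := by positivity
  have h2 : 0 ≤ K * |t - Real.pi / 2| := by positivity
  nlinarith [mul_nonneg h2 (norm_nonneg (wkbDefect lam z (Real.pi / 2)))]

end Gowdy

end

/-! ### Initial data at t = π/2: Legendre functions at the origin. -/

noncomputable section

namespace Gowdy

open ComplexConjugate

/-- The size of the deviation of the `l`-th mode from the adiabatic vacuum. -/
def modeDev (ρ ν : ℕ → ℝ) (l : ℕ) : ℝ :=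
  |ρ l - √(Real.pi / 2)| + |ν l| + 1 / ((l : ℝ) + 1) ^ 2

theorem modeDev_pos (ρ ν : ℕ → ℝ) (l : ℕ) : 0 < modeDev ρ ν l := by
  unfold modeDev
  positivity

/-- Even degrees, with x = P_ℓ(0) and Q_{ℓ+1}(0) eliminated by the Casorati relation. After
extraction of 1/(√2 x), the size is governed by n and by r·wx² − 1/r, and the latter vanishes for r²
= π/2 and wx² = 2/π; the bound is linear in the deviations from these values. -/
theorem norm_le_of_legendre_values {r n m M u x w lam B : ℝ} (hm : 0 < m) (hr : m ≤ r) (hrM : r ≤ M)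
    (hlam : 1 / 2 ≤ lam) (hx : x ≠ 0) (hB : 0 ≤ B) (hu : 0 ≤ u)
    (hxl : 1 / |x| ≤ B * √lam) (hw : |w * x ^ 2 - 2 / Real.pi| ≤ B * u) :
    ‖(-(n + Complex.I / r) / (√2 * x) + Complex.I * w * (r * x / √2) : ℂ)‖ ≤
      B * (1 + (M ^ 2 * B + 2 / Real.pi * (M + √(Real.pi / 2))) / m) * √lam *
        (|r - √(Real.pi / 2)| + |n| + u) := by
  have hr0 : 0 < r := hm.trans_le hr
  have hM : 0 < M := hr0.trans_le hrM
  have h2 : ((√2 : ℝ) : ℂ) ≠ 0 := by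
    exact_mod_cast (Real.sqrt_pos.2 zero_lt_two).ne'
  have hxC : (x : ℂ) ≠ 0 := by exact_mod_cast hx
  have hrC : (r : ℂ) ≠ 0 := by exact_mod_cast hr0.ne'
  set p := √(Real.pi / 2) with hp
  have hp2 : p ^ 2 = Real.pi / 2 := Real.sq_sqrt (by positivity)
  have hp0 : 0 < p := Real.sqrt_pos.2 (by positivity)
  have e : (-(n + Complex.I / r) / (√2 * x) + Complex.I * w * (r * x / √2) : ℂ) =
      ((1 / (√2 * x) : ℝ) : ℂ) * (-(n : ℝ) + Complex.I * ((r * (w * x ^ 2) - 1 / r : ℝ) : ℂ)) := by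
    push_cast
    field_simp
    ring
  rw [e, norm_mul, Complex.norm_real, Real.norm_eq_abs, abs_div, abs_one, abs_mul,
    abs_of_pos (Real.sqrt_pos.2 zero_lt_two)]
  have h3 : 1 / (√2 * |x|) ≤ B * √lam := by
    refine le_trans ?_ hxl
    have : 0 < |x| := abs_pos.2 hx
    have h1 : (1 : ℝ) ≤ √2 := by rw [Real.one_le_sqrt]; norm_num
    gcongr
    nlinarith
  have h4 : |r * (w * x ^ 2) - 1 / r| ≤ (M ^ 2 * (B * u) + 2 / Real.pi * (M + p) * |r - p|) / m := by
    have e4 : r * (w * x ^ 2) - 1 / r =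
        (r ^ 2 * (w * x ^ 2 - 2 / Real.pi) + 2 / Real.pi * (r + p) * (r - p)) / r := by
      have : r ^ 2 * (w * x ^ 2 - 2 / Real.pi) + 2 / Real.pi * (r + p) * (r - p) =
        r ^ 2 * (w * x ^ 2) - 2 / Real.pi * p ^ 2 := by ring
      rw [this, hp2]
      field_simp
    rw [e4, abs_div, abs_of_pos hr0]
    refine div_le_div₀ (by positivity) ?_ hm hr
    refine (abs_add_le _ _).trans (add_le_add ?_ ?_)
    · rw [abs_mul, abs_of_nonneg (sq_nonneg r)]
      gcongr
    · rw [abs_mul, abs_of_nonneg (by positivity)]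
      gcongr
  have h5 : ‖(-(n : ℝ) + Complex.I * ((r * (w * x ^ 2) - 1 / r : ℝ) : ℂ) : ℂ)‖ ≤
      |n| + (M ^ 2 * (B * u) + 2 / Real.pi * (M + p) * |r - p|) / m := by
    refine (norm_add_le _ _).trans ?_
    rw [norm_neg, norm_mul, Complex.norm_I, one_mul, Complex.norm_real, Complex.norm_real,
      Real.norm_eq_abs, Real.norm_eq_abs]
    gcongr
  have h6 : |n| + (M ^ 2 * (B * u) + 2 / Real.pi * (M + p) * |r - p|) / m ≤
      (1 + (M ^ 2 * B + 2 / Real.pi * (M + p)) / m) * (|r - p| + |n| + u) := by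
    have a1 : 0 ≤ M ^ 2 * B / m := by positivity
    have a2 : 0 ≤ 2 / Real.pi * (M + p) / m := by positivity
    have e1 : (M ^ 2 * (B * u) + 2 / Real.pi * (M + p) * |r - p|) / m =
      M ^ 2 * B / m * u + 2 / Real.pi * (M + p) / m * |r - p| := by ring
    rw [e1, add_div]
    nlinarith [mul_nonneg a1 (abs_nonneg n), mul_nonneg a2 (abs_nonneg n), abs_nonneg n,
      mul_nonneg a1 (abs_nonneg (r - p)), mul_nonneg a2 hu, abs_nonneg (r - p)]
  calc _ ≤ B * √lam * ((1 + (M ^ 2 * B + 2 / Real.pi * (M + p)) / m) * (|r - p| + |n| + u)) := by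
        gcongr
        exact h5.trans h6
    _ = _ := by ring

theorem legendreP_even_estimate (k : ℕ) :
    |2 * (k + 1 / 4 : ℝ) * legendreP (2 * k) 0 ^ 2 - 2 / Real.pi| ≤ 4 / ((2 * k : ℝ) + 1) ^ 2 := by
  have h1 := legendreP_even_zero_le k
  have h2 := le_legendreP_even_zero k
  have hpi : 1 / Real.pi ≤ 1 / 3 := one_div_le_one_div_of_le (by norm_num) Real.pi_gt_three.le
  set a := (k + 1 / 4 : ℝ) * legendreP (2 * k) 0 ^ 2
  have e1 : 2 * (k + 1 / 4 : ℝ) * legendreP (2 * k) 0 ^ 2 = 2 * a := by simp only [a]; ring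
  have e2 : 2 / Real.pi = 2 * (1 / Real.pi) := by ring
  rw [e1, e2, abs_sub_comm, abs_of_nonneg (by linarith)]
  have h3 : a * (1 / ((k : ℝ) + 1) ^ 2) ≤ 1 / 3 * (1 / ((k : ℝ) + 1) ^ 2) := by
    have := h1.trans hpi
    gcongr
  have h4 : 2 * (1 / Real.pi) - 2 * a ≤ 1 / ((k : ℝ) + 1) ^ 2 := by
    have : 0 ≤ 1 / ((k : ℝ) + 1) ^ 2 := by positivity
    linarith
  refine h4.trans ?_
  rw [div_le_div_iff₀ (by positivity) (by positivity)]
  nlinarith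

theorem legendreP_even_lower (k : ℕ) : 1 / |legendreP (2 * k) 0| ≤ 4 * √((2 * k : ℝ) + 1 / 2) := by
  have h2 := le_legendreP_even_zero k
  have hpi : 1 / 4 ≤ 1 / Real.pi := one_div_le_one_div_of_le Real.pi_pos Real.pi_lt_four.le
  have hp := legendreP_even_pos k
  have h0 : 0 < |legendreP (2 * k) 0| := abs_pos.2 fun h => by simp [h] at hp
  have h3 : 1 + 1 / ((k : ℝ) + 1) ^ 2 ≤ 2 := by
    have : 1 / ((k : ℝ) + 1) ^ 2 ≤ 1 := by
      rw [div_le_one (by positivity)]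
      nlinarith [(Nat.cast_nonneg k : (0 : ℝ) ≤ k)]
    linarith
  have h4 : 1 / 4 ≤ (k + 1 / 4 : ℝ) * legendreP (2 * k) 0 ^ 2 * 2 :=
    (hpi.trans h2).trans (by gcongr)
  rw [div_le_iff₀ h0]
  refine abs_le_of_sq_le_sq' ?_ (by positivity) |>.2
  rw [mul_pow, mul_pow, Real.sq_sqrt (by positivity), sq_abs]
  nlinarith

/-- The correction 1/(8λ) to the frequency costs only O(λ⁻²), because P_ℓ(0)² is itself O(1/λ). -/
theorem legendre_initial_even (k : ℕ) : |wkbFreq ((2 * k : ℝ) + 1 / 2) (Real.pi / 2) *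
    legendreP (2 * k) 0 ^ 2 - 2 / Real.pi| ≤ 5 / ((2 * k : ℝ) + 1) ^ 2 := by
  have h1 := legendreP_even_estimate k
  have h2 := legendreP_even_zero_le k
  have hpi : 1 / Real.pi ≤ 1 / 3 := one_div_le_one_div_of_le (by norm_num) Real.pi_gt_three.le
  have e : wkbFreq ((2 * k : ℝ) + 1 / 2) (Real.pi / 2) * legendreP (2 * k) 0 ^ 2 - 2 / Real.pi =
    (2 * (k + 1 / 4 : ℝ) * legendreP (2 * k) 0 ^ 2 - 2 / Real.pi) +
      1 / (8 * ((2 * k : ℝ) + 1 / 2)) * legendreP (2 * k) 0 ^ 2 := by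
    simp only [wkbFreq, Real.sin_pi_div_two]
    ring
  rw [e]
  refine (abs_add_le _ _).trans ?_
  have h3 : |1 / (8 * ((2 * k : ℝ) + 1 / 2)) * legendreP (2 * k) 0 ^ 2| ≤ 1 / ((2 * k : ℝ) + 1) ^ 2 := by
    rw [abs_of_nonneg (by positivity), div_mul_eq_mul_div, one_mul,
      div_le_div_iff₀ (by positivity) (by positivity)]
    have h4 : legendreP (2 * k) 0 ^ 2 * (2 * k + 1 : ℝ) ^ 2 ≤
        legendreP (2 * k) 0 ^ 2 * (4 * (2 * k + 1 / 2 : ℝ) * (2 * k + 1 / 2)) := by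
      gcongr
      nlinarith [(Nat.cast_nonneg k : (0 : ℝ) ≤ k)]
    nlinarith [h2.trans hpi, (Nat.cast_nonneg k : (0 : ℝ) ≤ k)]
  rw [show (5 : ℝ) = 4 + 1 by norm_num, add_div]
  linarith

/-- Odd degrees, with x = Q_ℓ(0) and P_{ℓ+1}(0) eliminated. The expression vanishes for n = 0 and
wx² = r². Since n appears multiplied by wx, an upper bound on w|x| is needed as well. -/
theorem norm_le_of_legendre_values_odd {r n m M u x w lam B : ℝ} (hm : 0 < m) (hr : m ≤ r)
    (hrM : r ≤ M) (hx : x ≠ 0) (hB : 0 ≤ B) (hu : 0 ≤ u) (hw0 : 0 ≤ w)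
    (hxl : 1 / |x| ≤ B * √lam) (hxu : w * |x| ≤ B * √lam) (hw : |w * x ^ 2 - Real.pi / 2| ≤ B * u) :
    ‖(r / (√2 * x) + Complex.I * w * ((n + Complex.I / r) * x / √2) : ℂ)‖ ≤
      B * (1 + (B + (M + √(Real.pi / 2))) / m) * √lam *
        (|r - √(Real.pi / 2)| + |n| + u) := by
  have hr0 : 0 < r := hm.trans_le hr
  have hM : 0 < M := hr0.trans_le hrM
  have h2 : ((√2 : ℝ) : ℂ) ≠ 0 := by
    exact_mod_cast (Real.sqrt_pos.2 zero_lt_two).ne'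
  have hxC : (x : ℂ) ≠ 0 := by exact_mod_cast hx
  have hrC : (r : ℂ) ≠ 0 := by exact_mod_cast hr0.ne'
  set p := √(Real.pi / 2) with hp
  have hp2 : p ^ 2 = Real.pi / 2 := Real.sq_sqrt (by positivity)
  have hp0 : 0 < p := Real.sqrt_pos.2 (by positivity)
  have e : (r / (√2 * x) + Complex.I * w * ((n + Complex.I / r) * x / √2) : ℂ) =
      ((1 / √2 : ℝ) : ℂ) * ((((r ^ 2 - w * x ^ 2) / r * (1 / x) : ℝ) : ℂ) +
        Complex.I * ((w * x * n : ℝ) : ℂ)) := by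
    push_cast
    field_simp
    linear_combination (w * (x : ℂ) ^ 2) * Complex.I_sq
  have h1 : 1 / √2 ≤ 1 := by
    rw [div_le_one (Real.sqrt_pos.2 zero_lt_two), Real.one_le_sqrt]
    norm_num
  have h4 : |(r ^ 2 - w * x ^ 2) / r| ≤ (B * u + (M + p) * |r - p|) / m := by
    rw [abs_div, abs_of_pos hr0]
    refine div_le_div₀ (by positivity) ?_ hm hr
    have e4 : r ^ 2 - w * x ^ 2 = (Real.pi / 2 - w * x ^ 2) + (r + p) * (r - p) := by
      rw [← hp2]; ring
    rw [e4]
    refine (abs_add_le _ _).trans (add_le_add (by rwa [abs_sub_comm]) ?_)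
    rw [abs_mul, abs_of_nonneg (by positivity)]
    gcongr
  have h5 : ‖((((r ^ 2 - w * x ^ 2) / r * (1 / x) : ℝ) : ℂ) + Complex.I * ((w * x * n : ℝ) : ℂ))‖ ≤
      (B * u + (M + p) * |r - p|) / m * (B * √lam) + B * √lam * |n| := by
    refine (norm_add_le _ _).trans ?_
    rw [norm_mul, Complex.norm_I, one_mul, Complex.norm_real, Complex.norm_real,
      Real.norm_eq_abs, Real.norm_eq_abs, abs_mul, abs_mul, abs_mul, abs_div 1 x, abs_one,
      abs_of_nonneg hw0]
    gcongr
  rw [e, norm_mul, Complex.norm_real, Real.norm_eq_abs, abs_of_pos (by positivity)]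
  refine (mul_le_of_le_one_left (norm_nonneg _) h1).trans (h5.trans ?_)
  have a1 : 0 ≤ B / m := by positivity
  have a2 : 0 ≤ (M + p) / m := by positivity
  have h6 : B / m * u + (M + p) / m * |r - p| + |n| ≤
      (1 + (B + (M + p)) / m) * (|r - p| + |n| + u) := by
    rw [add_div B]
    nlinarith [mul_nonneg a1 (abs_nonneg n), mul_nonneg a2 (abs_nonneg n), abs_nonneg n,
      mul_nonneg a1 (abs_nonneg (r - p)), mul_nonneg a2 hu, abs_nonneg (r - p)]
  calc _ = B * √lam * (B / m * u + (M + p) / m * |r - p| + |n|) := by ring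
    _ ≤ B * √lam * ((1 + (B + (M + p)) / m) * (|r - p| + |n| + u)) := by gcongr
    _ = _ := by ring

theorem legendreQ_odd_zero (k : ℕ) : (2 * k + 1) * legendreP (2 * k) 0 * legendreQ (2 * k + 1) 0 = -1 := by
  have h := legendre_casorati (2 * k) 0
  rw [legendreQ_even_zero] at h
  push_cast at h
  linarith

/-- By `legendreQ_odd_zero`, Q² is the reciprocal of (2k+1)² P². The identity (2k+1/2)(2k+3/2) =
(2k+1)² − 1/4 then turns the estimates for P into estimates for Q, with one more error of order k⁻².
-/
theorem legendreQ_odd_estimate (k : ℕ) :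
    |((2 * k : ℝ) + 3 / 2) * legendreQ (2 * k + 1) 0 ^ 2 - Real.pi / 2| ≤ 8 / ((2 * k : ℝ) + 2) ^ 2 := by
  have h1 := legendreP_even_zero_le k
  have h2 := le_legendreP_even_zero k
  have h0 := legendreQ_odd_zero k
  have hp := legendreP_even_pos k
  set a := (k + 1 / 4 : ℝ) * legendreP (2 * k) 0 ^ 2 with ha_def
  have ha : 0 < a := by positivity
  have hk : (0 : ℝ) ≤ k := Nat.cast_nonneg k
  have e : ((2 * k : ℝ) + 3 / 2) * legendreQ (2 * k + 1) 0 ^ 2 =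
      1 / (2 * a) * (1 - 1 / (4 * (2 * k + 1) ^ 2)) := by
    have hq : legendreQ (2 * k + 1) 0 ^ 2 = 1 / ((2 * k + 1) ^ 2 * legendreP (2 * k) 0 ^ 2) := by
      rw [eq_div_iff (by positivity)]
      have : ((2 * k + 1) * legendreP (2 * k) 0 * legendreQ (2 * k + 1) 0) ^ 2 = (-1) ^ 2 := by rw [h0]
      linarith
    rw [hq, ha_def]
    field_simp
    ring
  have hpi : 0 < Real.pi := Real.pi_pos
  have hl : Real.pi / 2 ≤ 1 / (2 * a) := by
    rw [div_le_div_iff₀ two_pos (by positivity)]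
    rw [le_div_iff₀ hpi] at h1
    linarith
  have hu : 1 / (2 * a) ≤ Real.pi / 2 * (1 + 1 / ((k : ℝ) + 1) ^ 2) := by
    rw [div_le_iff₀ (by positivity)]
    rw [div_le_iff₀ hpi] at h2
    nlinarith
  have hpi4 := Real.pi_lt_four
  have hs : (1 : ℝ) / (4 * (2 * k + 1) ^ 2) ≤ 1 / 4 * (1 / ((k : ℝ) + 1) ^ 2) := by
    rw [← one_div_mul_one_div]
    gcongr
    linarith
  have hs0 : (0 : ℝ) ≤ 1 / (4 * (2 * k + 1) ^ 2) := by positivity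
  have hs1 : 1 / ((k : ℝ) + 1) ^ 2 ≤ 1 := by
    rw [div_le_one (by positivity)]
    nlinarith
  have hv0 : 0 ≤ 1 / ((k : ℝ) + 1) ^ 2 := by positivity
  have e8 : 8 / ((2 * k : ℝ) + 2) ^ 2 = 2 * (1 / ((k : ℝ) + 1) ^ 2) := by
    field_simp
    ring
  rw [e, e8]
  set v := 1 / ((k : ℝ) + 1) ^ 2
  set s := (1 : ℝ) / (4 * (2 * k + 1) ^ 2)
  set b := 1 / (2 * a)
  rw [abs_le]
  constructor
  · have : b * s ≤ 4 * (1 / 4 * v) := by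
      refine mul_le_mul (by nlinarith) hs hs0 (by norm_num)
    nlinarith
  · have : 0 ≤ b * s := mul_nonneg (by linarith [Real.pi_pos]) hs0
    nlinarith

theorem legendre_initial_odd (k : ℕ) :
    |wkbFreq ((2 * k : ℝ) + 3 / 2) (Real.pi / 2) * legendreQ (2 * k + 1) 0 ^ 2 - Real.pi / 2| ≤
        10 / ((2 * k : ℝ) + 2) ^ 2 ∧
      1 / |legendreQ (2 * k + 1) 0| ≤ √((2 * k : ℝ) + 3 / 2) ∧
      wkbFreq ((2 * k : ℝ) + 3 / 2) (Real.pi / 2) * |legendreQ (2 * k + 1) 0| ≤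
        4 * √((2 * k : ℝ) + 3 / 2) := by
  have h1 := legendreQ_odd_estimate k
  have h0 := legendreQ_odd_zero k
  have hP := legendreP_even_zero_le k
  have hpi : 1 / Real.pi ≤ 1 / 3 := one_div_le_one_div_of_le (by norm_num) Real.pi_gt_three.le
  have hk : (0 : ℝ) ≤ k := Nat.cast_nonneg k
  set q := legendreQ (2 * k + 1) 0
  set lam := (2 * k : ℝ) + 3 / 2 with hlam
  have hl0 : 0 < lam := by positivity
  have hq4 : lam * q ^ 2 ≤ 4 := by
    have h2 : 8 / ((2 * k : ℝ) + 2) ^ 2 ≤ 2 := by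
      rw [div_le_iff₀ (by positivity)]
      nlinarith
    have := (abs_le.1 h1).2
    linarith [Real.pi_lt_four]
  have hq0 : q ≠ 0 := fun h => by simp [h] at h0
  have hqp : 0 < |q| := abs_pos.2 hq0
  refine ⟨?_, ?_, ?_⟩
  · have e : wkbFreq lam (Real.pi / 2) * q ^ 2 - Real.pi / 2 =
        (lam * q ^ 2 - Real.pi / 2) + 1 / (8 * lam) * q ^ 2 := by
      simp only [wkbFreq, Real.sin_pi_div_two]
      ring
    rw [e]
    refine (abs_add_le _ _).trans ?_
    have h3 : |1 / (8 * lam) * q ^ 2| ≤ 2 / ((2 * k : ℝ) + 2) ^ 2 := by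
      rw [abs_of_nonneg (by positivity), div_mul_eq_mul_div, one_mul,
        div_le_div_iff₀ (by positivity) (by positivity)]
      have : (2 * k + 2 : ℝ) ^ 2 ≤ 4 * lam ^ 2 := by
        rw [hlam]; nlinarith
      nlinarith [mul_le_mul_of_nonneg_left this (sq_nonneg q)]
    rw [show (10 : ℝ) = 8 + 2 by norm_num, add_div]
    linarith
  · have e : 1 / |q| = |(2 * k + 1) * legendreP (2 * k) 0| := by
      rw [div_eq_iff hqp.ne', ← abs_mul, h0]
      simp
    rw [e]
    refine Real.le_sqrt_of_sq_le ?_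
    rw [sq_abs, mul_pow]
    have h5 : (k + 1 / 4 : ℝ) * legendreP (2 * k) 0 ^ 2 ≤ 1 / 3 := hP.trans hpi
    have h6 : (2 * k + 1 : ℝ) ^ 2 * ((k + 1 / 4 : ℝ) * legendreP (2 * k) 0 ^ 2) ≤
        (2 * k + 1 : ℝ) ^ 2 * (1 / 3) := by gcongr
    have h7 : (2 * k + 1 : ℝ) ^ 2 * (1 / 3) ≤ lam * (k + 1 / 4) := by
      rw [hlam]; nlinarith
    have h8 : (0 : ℝ) < k + 1 / 4 := by positivity
    refine le_of_mul_le_mul_right ?_ h8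
    linarith
  · have hw : wkbFreq lam (Real.pi / 2) ≤ 2 * lam := by
      simp only [wkbFreq, Real.sin_pi_div_two]
      have : 1 / (8 * lam * 1 ^ 2) ≤ lam := by
        rw [div_le_iff₀ (by positivity)]
        rw [hlam]; nlinarith
      linarith
    have h9 : √lam * |q| ≤ 2 := by
      refine abs_le_of_sq_le_sq' ?_ two_pos.le |>.2
      rw [mul_pow, Real.sq_sqrt hl0.le, sq_abs]
      linarith
    have h10 := Real.mul_self_sqrt hl0.le
    calc _ ≤ 2 * lam * |q| := by gcongr
      _ = 2 * √lam * (√lam * |q|) := by linear_combination (-2 * |q|) * h10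
      _ ≤ 2 * √lam * 2 := by gcongr
      _ = _ := by ring

end Gowdy

end

/-! ### From the defect estimates to the summability of the Bogoliubov coefficients. -/

noncomputable section

namespace Gowdy

open ComplexConjugate

/-- At π/2 all Legendre functions are evaluated at 0, where parity removes half of the terms. P_ℓ
and Q_{ℓ+1} survive for even ℓ, Q_ℓ and P_{ℓ+1} for odd ℓ; in each pair the Casorati relation
expresses one value by the other. -/
theorem wkbDefect_modeFn_half_pi {ρ ν : ℕ → ℝ} {m M : ℝ} (hm : 0 < m) (hmr : ∀ l, m ≤ ρ l)
    (hrM : ∀ l, ρ l ≤ M) : ∃ C, 0 ≤ C ∧ ∀ l : ℕ,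
      ‖wkbDefect (l + 1 / 2) (modeFn ρ ν l) (Real.pi / 2)‖ ≤ C * √(l + 1 / 2) * modeDev ρ ν l := by
  have hpi : Real.pi / 2 ∈ Set.Ioo 0 Real.pi :=
    ⟨by linarith [Real.pi_pos], by linarith [Real.pi_pos]⟩
  have hM : 0 < M := hm.trans_le ((hmr 0).trans (hrM 0))
  have h2 : ((√2 : ℝ) : ℂ) ≠ 0 := by
    exact_mod_cast (Real.sqrt_pos.2 zero_lt_two).ne'
  set C₁ := 5 * (1 + (M ^ 2 * 5 + 2 / Real.pi * (M + √(Real.pi / 2))) / m)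
  set C₂ := 10 * (1 + (10 + (M + √(Real.pi / 2))) / m)
  have hC₁ : 0 ≤ C₁ := by positivity
  have hC₂ : 0 ≤ C₂ := by positivity
  refine ⟨C₁ + C₂, by positivity, fun l => ?_⟩
  have hdev := (modeDev_pos ρ ν l).le
  have hrl : (ρ l : ℂ) ≠ 0 := by exact_mod_cast (hm.trans_le (hmr l)).ne'
  have hD : wkbDefect (l + 1 / 2) (modeFn ρ ν l) (Real.pi / 2) =
      (l + 1) * modeRadial ρ ν l (l + 1) (Real.pi / 2) +
        Complex.I * wkbFreq (l + 1 / 2) (Real.pi / 2) * modeRadial ρ ν l l (Real.pi / 2) := by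
    rw [wkbDefect, deriv_modeFn ρ ν l hpi, modeDeriv, modeFn_eq]
    simp only [Real.sin_pi_div_two, Real.cos_pi_div_two, Real.sqrt_one]
    push_cast
    ring
  rcases Nat.even_or_odd' l with ⟨k, hk | hk⟩
  · have hp := legendreP_even_pos k
    have hx : legendreP (2 * k) 0 ≠ 0 := fun h => by simp [h] at hp
    have hQ := legendreQ_odd_zero k
    have key := norm_le_of_legendre_values (r := ρ l) (n := ν l) (u := 1 / ((l : ℝ) + 1) ^ 2)
      (x := legendreP (2 * k) 0) (w := wkbFreq (l + 1 / 2) (Real.pi / 2)) (lam := l + 1 / 2) (B := 5)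
      hm (hmr l) (hrM l) (by linarith [(Nat.cast_nonneg l : (0 : ℝ) ≤ l)]) hx (by norm_num)
      (by positivity)
      (by
        have := legendreP_even_lower k
        rw [hk]
        push_cast
        refine this.trans ?_
        gcongr
        norm_num)
      (by
        have := legendre_initial_even k
        rw [hk]
        push_cast
        rwa [mul_one_div])
    have e : wkbDefect (l + 1 / 2) (modeFn ρ ν l) (Real.pi / 2) =
        -(ν l + Complex.I / ρ l) / (√2 * legendreP (2 * k) 0) +
          Complex.I * wkbFreq (l + 1 / 2) (Real.pi / 2) * (ρ l * legendreP (2 * k) 0 / √2) := by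
      have hxC : (legendreP (2 * k) 0 : ℂ) ≠ 0 := by exact_mod_cast hx
      have hQC : ((l : ℂ) + 1) * legendreP (2 * k) 0 * legendreQ (2 * k + 1) 0 = -1 := by
        rw [hk]
        exact_mod_cast hQ
      rw [hD]
      congr 1
      · simp only [modeRadial, Real.cos_pi_div_two]
        rw [hk, legendreP_odd_zero k]
        rw [hk] at hQC hrl
        push_cast at hQC ⊢
        field_simp
        linear_combination ((ν (2 * k) : ℂ) * ρ (2 * k) + Complex.I) * hQC
      · simp only [modeRadial, Real.cos_pi_div_two]
        rw [hk, legendreQ_even_zero k]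
        push_cast
        ring
    rw [e]
    refine key.trans ?_
    rw [show |ρ l - √(Real.pi / 2)| + |ν l| + 1 / ((l : ℝ) + 1) ^ 2 = modeDev ρ ν l from rfl]
    gcongr
    linarith
  · have h0 := legendreQ_odd_zero k
    have hx : legendreQ (2 * k + 1) 0 ≠ 0 := fun h => by simp [h] at h0
    obtain ⟨i1, i2, i3⟩ := legendre_initial_odd k
    have hl : (l : ℝ) + 1 / 2 = 2 * k + 3 / 2 := by
      rw [hk]; push_cast; ring
    have key := norm_le_of_legendre_values_odd (r := ρ l) (n := ν l) (u := 1 / ((l : ℝ) + 1) ^ 2)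
      (x := legendreQ (2 * k + 1) 0) (w := wkbFreq (l + 1 / 2) (Real.pi / 2)) (lam := l + 1 / 2)
      (B := 10) hm (hmr l) (hrM l) hx (by norm_num) (by positivity)
      ((by positivity : (0 : ℝ) ≤ l + 1 / 2).trans (le_wkbFreq (by positivity) _))
      (by
        rw [hl]
        exact i2.trans (le_mul_of_one_le_left (Real.sqrt_nonneg _) (by norm_num)))
      (by
        rw [hl]
        exact i3.trans (mul_le_mul_of_nonneg_right (by norm_num) (Real.sqrt_nonneg _)))
      (by
        rw [hl, show (l : ℝ) + 1 = 2 * k + 2 by linarith, mul_one_div]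
        exact i1)
    have e : wkbDefect (l + 1 / 2) (modeFn ρ ν l) (Real.pi / 2) =
        ρ l / (√2 * legendreQ (2 * k + 1) 0) +
          Complex.I * wkbFreq (l + 1 / 2) (Real.pi / 2) *
            ((ν l + Complex.I / ρ l) * legendreQ (2 * k + 1) 0 / √2) := by
      have hxC : (legendreQ (2 * k + 1) 0 : ℂ) ≠ 0 := by exact_mod_cast hx
      have hQC : ((l : ℂ) + 1) * legendreP (2 * k + 1 + 1) 0 * legendreQ (2 * k + 1) 0 = 1 := by
        have := legendre_casorati (2 * k + 1) 0
        rw [legendreP_odd_zero, zero_mul, sub_zero, ← mul_assoc] at this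
        rw [hk]
        exact_mod_cast this
      rw [hD]
      congr 1
      · simp only [modeRadial, Real.cos_pi_div_two]
        have hz : legendreQ (2 * k + 1 + 1) 0 = 0 := legendreQ_even_zero (k + 1)
        rw [hk, hz]
        rw [hk] at hQC
        push_cast at hQC ⊢
        field_simp
        linear_combination (ρ (2 * k + 1) : ℂ) * hQC
      · simp only [modeRadial, Real.cos_pi_div_two]
        rw [hk, legendreP_odd_zero k]
        push_cast
        ring
    rw [e]
    refine key.trans ?_
    rw [show |ρ l - √(Real.pi / 2)| + |ν l| + 1 / ((l : ℝ) + 1) ^ 2 = modeDev ρ ν l from rfl]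
    gcongr
    linarith

/-- Square summability forces ρ to converge to √(π/2) > 0, so ρ and 1/ρ are both bounded. -/
theorem exists_bounds_of_summable {ρ : ℕ → ℝ} (hρ : ∀ l, 0 < ρ l)
    (hρ2 : Summable fun l => (ρ l - √(Real.pi / 2)) ^ 2) :
    ∃ m M : ℝ, 0 < m ∧ (∀ l, m ≤ ρ l) ∧ ∀ l, ρ l ≤ M := by
  have h0 : Tendsto ρ atTop (𝓝 (√(Real.pi / 2))) := by
    rw [tendsto_iff_norm_sub_tendsto_zero]
    have := hρ2.tendsto_atTop_zero.sqrt
    simpa [Real.sqrt_sq_eq_abs] using this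
  have hp : √(Real.pi / 2) ≠ 0 := (Real.sqrt_pos.2 (by positivity)).ne'
  obtain ⟨M, hM⟩ := h0.bddAbove_range
  obtain ⟨N, hN⟩ := (h0.inv₀ hp).bddAbove_range
  have hN' : ∀ l, (ρ l)⁻¹ ≤ N := fun l => hN ⟨l, rfl⟩
  have hNp : 0 < N := (inv_pos.2 (hρ 0)).trans_le (hN' 0)
  exact ⟨N⁻¹, M, inv_pos.2 hNp, fun l => inv_le_of_inv_le₀ (hρ l) (hN' l), fun l => hM ⟨l, rfl⟩⟩

theorem summable_one_div_add_one_pow {k : ℕ} (hk : 1 < k) : Summable fun l : ℕ => 1 / ((l : ℝ) + 1) ^ k := by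
  have := (summable_nat_add_iff 1).2 (Real.summable_one_div_nat_pow.2 hk)
  exact_mod_cast this

theorem summable_modeDev_sq {ρ ν : ℕ → ℝ} (hρ2 : Summable fun l => (ρ l - √(Real.pi / 2)) ^ 2)
    (hν2 : Summable fun l => ν l ^ 2) : Summable fun l => modeDev ρ ν l ^ 2 := by
  have h4 := summable_one_div_add_one_pow (k := 4) (by norm_num)
  refine Summable.of_nonneg_of_le (fun l => sq_nonneg _) (fun l => ?_)
    (((hρ2.add hν2).add h4).mul_left 3)
  have e : 1 / ((l : ℝ) + 1) ^ 4 = (1 / ((l : ℝ) + 1) ^ 2) ^ 2 := by field_simp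
  rw [e, ← sq_abs (ρ l - _), ← sq_abs (ν l), modeDev]
  nlinarith [sq_nonneg (|ρ l - √(Real.pi / 2)| - |ν l|),
    sq_nonneg (|ρ l - √(Real.pi / 2)| - 1 / ((l : ℝ) + 1) ^ 2), sq_nonneg (|ν l| - 1 / ((l : ℝ) + 1) ^ 2)]

theorem summable_modeDev {ρ ν : ℕ → ℝ} (hρ1 : Summable fun l => |ρ l - √(Real.pi / 2)|)
    (hν1 : Summable fun l => |ν l|) : Summable (modeDev ρ ν) :=
  (hρ1.add hν1).add (summable_one_div_add_one_pow (by norm_num))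

theorem exists_le_of_summable_sq {f : ℕ → ℝ} (hf : Summable fun l => f l ^ 2) :
    ∃ C, 0 ≤ C ∧ ∀ l, |f l| ≤ C := by
  obtain ⟨C, hC⟩ := hf.tendsto_atTop_zero.bddAbove_range
  refine ⟨√C, Real.sqrt_nonneg _, fun l => Real.abs_le_sqrt (hC ⟨l, rfl⟩)⟩

/-- The Grönwall error λ^(-3/2) is comparable to √λ/(ℓ+1)², and the last summand of `modeDev`
absorbs it. -/
theorem wkbDefect_modeFn_le {ρ ν : ℕ → ℝ} (hρ : ∀ l, 0 < ρ l)
    (hρ2 : Summable fun l => (ρ l - √(Real.pi / 2)) ^ 2) {t : ℝ} (ht : t ∈ Set.Ioo 0 Real.pi) :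
    ∃ C, 0 ≤ C ∧ ∀ l : ℕ,
      ‖wkbDefect (l + 1 / 2) (modeFn ρ ν l) t‖ ≤ C * √(l + 1 / 2) * modeDev ρ ν l := by
  obtain ⟨m, M, hm, hmr, hrM⟩ := exists_bounds_of_summable hρ hρ2
  obtain ⟨C₀, hC₀, h₀⟩ := wkbDefect_modeFn_half_pi (ν := ν) hm hmr hrM
  obtain ⟨C₁, hC₁, h₁⟩ := IsMode.wkbDefect_le ht
  refine ⟨C₁ * (C₀ + 4), by positivity, fun l => ?_⟩
  have hl : (0 : ℝ) ≤ l := Nat.cast_nonneg l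
  have hlam : (1 / 2 : ℝ) ≤ l + 1 / 2 := by linarith
  refine (h₁ _ hlam _ (isMode_modeFn hρ l)).trans ?_
  rw [mul_assoc, mul_assoc]
  refine mul_le_mul_of_nonneg_left ?_ hC₁
  have h2 : 1 / (((l : ℝ) + 1 / 2) * √(l + 1 / 2)) ≤ 4 * (√(l + 1 / 2) * modeDev ρ ν l) := by
    have h3 : 1 / ((l : ℝ) + 1) ^ 2 ≤ modeDev ρ ν l := by
      unfold modeDev
      linarith [abs_nonneg (ρ l - √(Real.pi / 2)), abs_nonneg (ν l)]
    have h4 : 1 / (((l : ℝ) + 1 / 2) * √(l + 1 / 2)) ≤ 4 * (√(l + 1 / 2) * (1 / ((l : ℝ) + 1) ^ 2)) := by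
      have hs : 0 < √((l : ℝ) + 1 / 2) := Real.sqrt_pos.2 (by linarith)
      have hs2 : √((l : ℝ) + 1 / 2) * √((l : ℝ) + 1 / 2) = l + 1 / 2 := Real.mul_self_sqrt (by linarith)
      rw [mul_one_div, mul_div_assoc', div_le_div_iff₀ (by positivity) (by positivity), one_mul]
      calc ((l : ℝ) + 1) ^ 2 ≤ 4 * (l + 1 / 2) * (l + 1 / 2) := by nlinarith
        _ = 4 * √(l + 1 / 2) * ((l + 1 / 2) * √(l + 1 / 2)) := by
          linear_combination (-4 * ((l : ℝ) + 1 / 2)) * hs2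
    exact h4.trans (by gcongr)
  linarith [h₀ l]

/-- The Wronskian normalization and growth of the Cauchy data of the modes at one time. -/
structure ModeData (z : ℕ → ℝ → ℂ) (t : ℝ) : Prop where
  wronskian : ∀ l, z l t * conj (deriv (z l) t) - conj (z l t) * deriv (z l) t = Complex.I
  bound : ∃ C, 0 ≤ C ∧ ∀ l : ℕ, ‖z l t‖ * √(l + 1 / 2) ≤ C ∧ ‖deriv (z l) t‖ ≤ C * √(l + 1 / 2)

theorem wkbFreq_le (l : ℕ) (t : ℝ) :
    wkbFreq (l + 1 / 2) t ≤ (1 + 1 / Real.sin t ^ 2) * (l + 1 / 2) := by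
  have hl : (0 : ℝ) ≤ l := Nat.cast_nonneg l
  have h : 1 / (8 * ((l : ℝ) + 1 / 2) * Real.sin t ^ 2) ≤ 1 / Real.sin t ^ 2 * (l + 1 / 2) := by
    rw [← one_div_mul_one_div, mul_comm]
    refine mul_le_mul_of_nonneg_left ?_ (by positivity)
    rw [div_le_iff₀ (by positivity)]
    nlinarith
  unfold wkbFreq
  linarith

/-- A defect of order √λ gives z = O(λ^(-1/2)) by `IsMode.norm_le`, and ż = defect − iωz is then
O(√λ). -/
theorem modeData_modeFn {ρ ν : ℕ → ℝ} (hρ : ∀ l, 0 < ρ l)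
    (hρ2 : Summable fun l => (ρ l - √(Real.pi / 2)) ^ 2) (hν2 : Summable fun l => ν l ^ 2)
    {t : ℝ} (ht : t ∈ Set.Ioo 0 Real.pi) : ModeData (modeFn ρ ν) t where
  wronskian l := (isMode_modeFn hρ l).wronskian t ht
  bound := by
    obtain ⟨C, hC, h⟩ := wkbDefect_modeFn_le (ν := ν) hρ hρ2 ht
    obtain ⟨E, hE, hdev⟩ := exists_le_of_summable_sq (summable_modeDev_sq hρ2 hν2)
    set S := 1 / Real.sin t ^ 2
    have hS : 0 ≤ S := by positivity
    refine ⟨C * E + (1 + S) * (1 + C * E), by positivity, fun l => ?_⟩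
    have hl : (0 : ℝ) ≤ l := Nat.cast_nonneg l
    have hD : ‖wkbDefect (l + 1 / 2) (modeFn ρ ν l) t‖ ≤ C * E * √(l + 1 / 2) := by
      refine (h l).trans ?_
      have := (le_abs_self _).trans (hdev l)
      calc _ ≤ C * √(l + 1 / 2) * E := by gcongr
        _ = _ := by ring
    have hlam : (0 : ℝ) < l + 1 / 2 := by positivity
    have hw := le_wkbFreq hlam t
    have hz := (isMode_modeFn (ν := ν) hρ l).norm_le ht (hlam.trans_le hw)
    have hwu := wkbFreq_le l t
    set w := wkbFreq (l + 1 / 2) t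
    have hDe : wkbDefect (l + 1 / 2) (modeFn ρ ν l) t =
      deriv (modeFn ρ ν l) t + Complex.I * w * modeFn ρ ν l t := rfl
    rw [← hDe] at hz
    have hs : 0 < √((l : ℝ) + 1 / 2) := Real.sqrt_pos.2 hlam
    have hs2 : √((l : ℝ) + 1 / 2) ^ 2 = l + 1 / 2 := Real.sq_sqrt hlam.le
    have hsw : √(2 * w) * √(l + 1 / 2) ≤ 2 * w := by
      rw [← Real.sqrt_mul (by linarith)]
      exact Real.sqrt_le_iff.2 ⟨by linarith, by nlinarith⟩
    have h1 : ‖modeFn ρ ν l t‖ * √(l + 1 / 2) ≤ 1 + C * E := by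
      have hw2 : 0 < 2 * w := by linarith
      refine le_of_mul_le_mul_left ?_ hw2
      have h3 := mul_le_mul_of_nonneg_right hz hs.le
      have h4 := mul_le_mul_of_nonneg_right hD hs.le
      have h5 : C * E * √(l + 1 / 2) * √(l + 1 / 2) ≤ C * E * w := by
        rw [mul_assoc, ← sq, hs2]
        gcongr
      nlinarith
    have hCE : 0 ≤ C * E := by positivity
    refine ⟨by nlinarith, ?_⟩
    have h6 : deriv (modeFn ρ ν l) t = wkbDefect (l + 1 / 2) (modeFn ρ ν l) t -
        Complex.I * w * modeFn ρ ν l t := by rw [hDe]; ring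
    have h7 : ‖deriv (modeFn ρ ν l) t‖ ≤ ‖wkbDefect (l + 1 / 2) (modeFn ρ ν l) t‖ +
        w * ‖modeFn ρ ν l t‖ := by
      rw [h6]
      refine (norm_sub_le _ _).trans ?_
      rw [norm_mul, norm_mul, Complex.norm_I, one_mul, Complex.norm_real, Real.norm_eq_abs,
        abs_of_pos (hlam.trans_le hw)]
    have h8 : w * ‖modeFn ρ ν l t‖ ≤ (1 + S) * (1 + C * E) * √(l + 1 / 2) := by
      calc _ ≤ (1 + S) * (l + 1 / 2) * ‖modeFn ρ ν l t‖ := by gcongr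
        _ = (1 + S) * (‖modeFn ρ ν l t‖ * √(l + 1 / 2)) * √(l + 1 / 2) := by
          linear_combination (-(1 + S) * ‖modeFn ρ ν l t‖) * hs2
        _ ≤ _ := by gcongr
    linarith

theorem norm_bogBeta (z : ℕ → ℝ → ℂ) (t₁ t₀ : ℝ) (l : ℕ) :
    ‖bogBeta z t₁ t₀ l‖ = ‖z l t₀ * deriv (z l) t₁ - z l t₁ * deriv (z l) t₀‖ := by
  rw [bogBeta, norm_mul, Complex.norm_I, one_mul, ← map_mul, ← map_mul, ← map_sub,
    Complex.norm_conj]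

/-- Substituting ż = D − iωz in z(t₀)ż(t₁) − z(t₁)ż(t₀) leaves z₀D₁ − z₁D₀ and a term with ω(t₁) −
ω(t₀). The leading λ cancels in this difference, which is O(1/λ), and z₀z₁ is also O(1/λ). -/
theorem bogBeta_modeFn_le {ρ ν : ℕ → ℝ} (hρ : ∀ l, 0 < ρ l)
    (hρ2 : Summable fun l => (ρ l - √(Real.pi / 2)) ^ 2) (hν2 : Summable fun l => ν l ^ 2)
    {t₀ t₁ : ℝ} (ht₀ : t₀ ∈ Set.Ioo 0 Real.pi) (ht₁ : t₁ ∈ Set.Ioo 0 Real.pi) :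
    ∃ C, 0 ≤ C ∧ ∀ l : ℕ, ‖bogBeta (modeFn ρ ν) t₁ t₀ l‖ ≤ C * modeDev ρ ν l := by
  obtain ⟨C₀, hC₀, h₀⟩ := wkbDefect_modeFn_le (ν := ν) hρ hρ2 ht₀
  obtain ⟨C₁, hC₁, h₁⟩ := wkbDefect_modeFn_le (ν := ν) hρ hρ2 ht₁
  obtain ⟨B₀, hB₀, b₀⟩ := (modeData_modeFn hρ hρ2 hν2 ht₀).bound
  obtain ⟨B₁, hB₁, b₁⟩ := (modeData_modeFn hρ hρ2 hν2 ht₁).bound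
  set S := 1 / Real.sin t₁ ^ 2 + 1 / Real.sin t₀ ^ 2
  have hS : 0 ≤ S := by positivity
  refine ⟨B₀ * C₁ + B₁ * C₀ + S * B₀ * B₁, by positivity, fun l => ?_⟩
  have hl : (0 : ℝ) ≤ l := Nat.cast_nonneg l
  have hlam : (0 : ℝ) < l + 1 / 2 := by positivity
  have hs : 0 < √((l : ℝ) + 1 / 2) := Real.sqrt_pos.2 hlam
  have hs2 : √((l : ℝ) + 1 / 2) ^ 2 = l + 1 / 2 := Real.sq_sqrt hlam.le
  obtain ⟨hz₀, -⟩ := b₀ l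
  obtain ⟨hz₁, -⟩ := b₁ l
  have hd0 := h₀ l
  have hd1 := h₁ l
  have hdev := modeDev_pos ρ ν l
  have h3 : 1 / ((l : ℝ) + 1) ^ 2 ≤ modeDev ρ ν l := by
    unfold modeDev
    linarith [abs_nonneg (ρ l - √(Real.pi / 2)), abs_nonneg (ν l)]
  set D₀ := wkbDefect (l + 1 / 2) (modeFn ρ ν l) t₀ with hD₀
  set D₁ := wkbDefect (l + 1 / 2) (modeFn ρ ν l) t₁ with hD₁
  set z₀ := modeFn ρ ν l t₀ with hz0
  set z₁ := modeFn ρ ν l t₁ with hz1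
  have e : z₀ * deriv (modeFn ρ ν l) t₁ - z₁ * deriv (modeFn ρ ν l) t₀ = z₀ * D₁ - z₁ * D₀ -
      Complex.I * ((wkbFreq (l + 1 / 2) t₁ - wkbFreq (l + 1 / 2) t₀ : ℝ) : ℂ) * (z₀ * z₁) := by
    rw [hD₀, hD₁]
    simp only [wkbDefect, ← hz0, ← hz1]
    push_cast
    ring
  have hw : |wkbFreq (l + 1 / 2) t₁ - wkbFreq (l + 1 / 2) t₀| ≤ 1 / (8 * (l + 1 / 2)) * S := by
    have e1 : wkbFreq (l + 1 / 2) t₁ - wkbFreq (l + 1 / 2) t₀ = 1 / (8 * ((l : ℝ) + 1 / 2)) *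
        (1 / Real.sin t₁ ^ 2 - 1 / Real.sin t₀ ^ 2) := by
      simp only [wkbFreq, ← one_div_mul_one_div]
      ring
    rw [e1, abs_mul, abs_of_pos (show 0 < 1 / (8 * ((l : ℝ) + 1 / 2)) by positivity)]
    gcongr
    refine (abs_sub _ _).trans (le_of_eq ?_)
    rw [abs_of_nonneg (by positivity), abs_of_nonneg (by positivity)]
  rw [norm_bogBeta, ← hz0, ← hz1, e]
  have n1 : ‖z₀ * D₁‖ ≤ B₀ * C₁ * modeDev ρ ν l := by
    rw [norm_mul]
    calc _ ≤ ‖z₀‖ * (C₁ * √(l + 1 / 2) * modeDev ρ ν l) := by gcongr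
      _ = ‖z₀‖ * √(l + 1 / 2) * (C₁ * modeDev ρ ν l) := by ring
      _ ≤ B₀ * (C₁ * modeDev ρ ν l) := by gcongr
      _ = _ := by ring
  have n2 : ‖z₁ * D₀‖ ≤ B₁ * C₀ * modeDev ρ ν l := by
    rw [norm_mul]
    calc _ ≤ ‖z₁‖ * (C₀ * √(l + 1 / 2) * modeDev ρ ν l) := by gcongr
      _ = ‖z₁‖ * √(l + 1 / 2) * (C₀ * modeDev ρ ν l) := by ring
      _ ≤ B₁ * (C₀ * modeDev ρ ν l) := by gcongr
      _ = _ := by ring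
  have n3 : ‖Complex.I * ((wkbFreq (l + 1 / 2) t₁ - wkbFreq (l + 1 / 2) t₀ : ℝ) : ℂ) * (z₀ * z₁)‖ ≤
      S * B₀ * B₁ * modeDev ρ ν l := by
    rw [norm_mul, norm_mul, norm_mul, Complex.norm_I, one_mul, Complex.norm_real, Real.norm_eq_abs]
    have p1 : ‖z₀‖ * ‖z₁‖ * (l + 1 / 2) ≤ B₀ * B₁ := by
      rw [← hs2]
      calc _ = (‖z₀‖ * √(l + 1 / 2)) * (‖z₁‖ * √(l + 1 / 2)) := by ring
        _ ≤ _ := by gcongr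
    have p2 : ‖z₀‖ * ‖z₁‖ ≤ B₀ * B₁ / (l + 1 / 2) := by rwa [le_div_iff₀ hlam]
    have p3 : 1 / (8 * ((l : ℝ) + 1 / 2)) * (1 / (l + 1 / 2)) ≤ 1 / ((l : ℝ) + 1) ^ 2 := by
      rw [one_div_mul_one_div]
      refine one_div_le_one_div_of_le (by positivity) ?_
      nlinarith
    calc _ ≤ 1 / (8 * (l + 1 / 2)) * S * (B₀ * B₁ / (l + 1 / 2)) := by gcongr
      _ = S * B₀ * B₁ * (1 / (8 * ((l : ℝ) + 1 / 2)) * (1 / (l + 1 / 2))) := by ring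
      _ ≤ S * B₀ * B₁ * modeDev ρ ν l := by
        gcongr
        exact p3.trans h3
  have := norm_sub_le (z₀ * D₁ - z₁ * D₀)
    (Complex.I * ((wkbFreq (l + 1 / 2) t₁ - wkbFreq (l + 1 / 2) t₀ : ℝ) : ℂ) * (z₀ * z₁))
  have := norm_sub_le (z₀ * D₁) (z₁ * D₀)
  linarith

end Gowdy

end

noncomputable section

namespace Gowdy

/-! ### Integration over the sphere -/

instance : IsFiniteMeasure area := inferInstanceAs (IsFiniteMeasure (volume : Measure E3).toSphere)

theorem integral_pow_mul_gauss_Ioi (n : ℕ) :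
    ∫ r in Set.Ioi (0 : ℝ), r ^ n * Real.exp (-r ^ 2) = Real.Gamma ((n + 1) / 2) / 2 := by
  have h := integral_rpow_mul_exp_neg_rpow (p := 2) (q := n) two_pos
    (by linarith [(Nat.cast_nonneg n : (0 : ℝ) ≤ n)])
  rw [one_div_mul_eq_div] at h
  rw [← h]
  refine setIntegral_congr_fun measurableSet_Ioi fun x _ => ?_
  simp only [Real.rpow_natCast]
  norm_num

/-- Polar coordinates: the exponent k + 2 is k from homogeneity plus 2 from the Jacobian. -/
theorem integral_sphere_mul_radial (k : ℕ) :
    ∫ x : E3, x 2 ^ k * Real.exp (-‖x‖ ^ 2) =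
      (∫ s : S2, s.1 2 ^ k ∂area) * ∫ r in Set.Ioi (0 : ℝ), r ^ (k + 2) * Real.exp (-r ^ 2) := by
  have hdim : Module.finrank ℝ E3 = 3 := by simp
  calc ∫ x : E3, x 2 ^ k * Real.exp (-‖x‖ ^ 2)
      = ∫ x : ({(0)}ᶜ : Set E3), x.1 2 ^ k * Real.exp (-‖x.1‖ ^ 2)
          ∂((volume : Measure E3).comap (↑)) := by
        rw [integral_subtype_comap (measurableSet_singleton _).compl
          fun x : E3 => x 2 ^ k * Real.exp (-‖x‖ ^ 2), restrict_compl_singleton]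
    _ = ∫ p : S2 × Set.Ioi (0 : ℝ), (p.1.1 2 ^ k) * (p.2.1 ^ k * Real.exp (-p.2.1 ^ 2))
          ∂(area.prod (.volumeIoiPow (Module.finrank ℝ E3 - 1))) := by
        have := (volume : Measure E3).measurePreserving_homeomorphUnitSphereProd.integral_comp
          (Homeomorph.measurableEmbedding _)
          (fun p : S2 × Set.Ioi (0 : ℝ) => (p.1.1 2 ^ k) * (p.2.1 ^ k * Real.exp (-p.2.1 ^ 2)))
        rw [area, ← this]
        refine integral_congr_ae (.of_forall fun x => ?_)
        have hx : ‖x.1‖ ≠ 0 := norm_ne_zero_iff.2 x.2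
        simp only [homeomorphUnitSphereProd_apply_fst_coe, homeomorphUnitSphereProd_apply_snd_coe,
          PiLp.smul_apply, smul_eq_mul]
        rw [← mul_assoc, ← mul_pow]
        field_simp
    _ = _ := by
        rw [integral_prod_mul (fun s : S2 => s.1 2 ^ k)
          (fun r : Set.Ioi (0 : ℝ) => r.1 ^ k * Real.exp (-r.1 ^ 2))]
        congr 1
        simp only [Measure.volumeIoiPow, ENNReal.ofReal]
        rw [integral_withDensity_eq_integral_smul
            (measurable_subtype_coe.pow_const _).real_toNNReal,
          integral_subtype_comap measurableSet_Ioi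
            fun a : ℝ => Real.toNNReal (a ^ (Module.finrank ℝ E3 - 1)) • (a ^ k * Real.exp (-a ^ 2))]
        refine setIntegral_congr_fun measurableSet_Ioi fun x hx => ?_
        rw [NNReal.smul_def, Real.coe_toNNReal _ (pow_nonneg hx.out.le _), hdim, smul_eq_mul]
        ring

theorem integral_E3_pow (k : ℕ) :
    ∫ x : E3, x 2 ^ k * Real.exp (-‖x‖ ^ 2) =
      Real.pi * ∫ x : ℝ, x ^ k * Real.exp (-x ^ 2) := by
  have h := (EuclideanSpace.volume_preserving_symm_measurableEquiv_toLp (Fin 3)).integral_comp'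
    (g := fun x : Fin 3 → ℝ => ∏ i, (![fun x => Real.exp (-x ^ 2), fun x => Real.exp (-x ^ 2),
      fun x => x ^ k * Real.exp (-x ^ 2)] : Fin 3 → ℝ → ℝ) i (x i))
  rw [integral_fintype_prod_volume_eq_prod (fun i => (![fun x => Real.exp (-x ^ 2),
    fun x => Real.exp (-x ^ 2), fun x => x ^ k * Real.exp (-x ^ 2)] : Fin 3 → ℝ → ℝ) i)] at h
  have hg : ∫ x : ℝ, Real.exp (-x ^ 2) = √Real.pi := by
    have := integral_gaussian 1
    simpa using this
  simp only [Fin.prod_univ_three, Matrix.cons_val_zero, Matrix.cons_val_one, Matrix.cons_val, hg,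
    Real.mul_self_sqrt Real.pi_pos.le] at h
  rw [← h]
  refine integral_congr_ae (.of_forall fun x => ?_)
  simp only [EuclideanSpace.norm_sq_eq, Fin.sum_univ_three, Real.norm_eq_abs, sq_abs, neg_add,
    Real.exp_add, MeasurableEquiv.coe_toLp_symm]
  ring

theorem integral_pow_mul_gauss (k : ℕ) : ∫ x : ℝ, x ^ k * Real.exp (-x ^ 2) =
    (1 + (-1) ^ k) * ∫ r in Set.Ioi (0 : ℝ), r ^ k * Real.exp (-r ^ 2) := by
  have hint : Integrable (fun x : ℝ => x ^ k * Real.exp (-x ^ 2)) := by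
    have := integrable_rpow_mul_exp_neg_mul_sq one_pos (s := k)
      (by linarith [(Nat.cast_nonneg k : (0 : ℝ) ≤ k)])
    simpa using this
  rw [← integral_add_compl (measurableSet_Ioi (a := (0 : ℝ))) hint, Set.compl_Ioi, add_mul, one_mul]
  congr 1
  have := integral_comp_neg_Ioi (0 : ℝ) (fun x : ℝ => x ^ k * Real.exp (-x ^ 2))
  rw [neg_zero] at this
  rw [← this, ← integral_const_mul]
  refine setIntegral_congr_fun measurableSet_Ioi fun x hx => ?_
  simp only [neg_pow x k, neg_sq]
  ring

/-- The integral of x₃ᵏ exp(−|x|²) over space is computed in polar and in Cartesian coordinates. The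
Gamma factors cancel because Γ((k+3)/2) = ((k+1)/2) Γ((k+1)/2). -/
theorem integral_area_pow (k : ℕ) :
    ∫ s : S2, s.1 2 ^ k ∂area = 2 * Real.pi * ∫ x in (-1 : ℝ)..1, x ^ k := by
  have h := integral_sphere_mul_radial k
  rw [integral_E3_pow, integral_pow_mul_gauss, integral_pow_mul_gauss_Ioi,
    integral_pow_mul_gauss_Ioi] at h
  have hk : (0 : ℝ) ≤ k := Nat.cast_nonneg k
  have hG : 0 < Real.Gamma (((k : ℝ) + 1) / 2) := Real.Gamma_pos_of_pos (by positivity)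
  have h2 : Real.Gamma ((((k + 2 : ℕ) : ℝ) + 1) / 2) = ((k : ℝ) + 1) / 2 * Real.Gamma ((k + 1) / 2) := by
    rw [← Real.Gamma_add_one (by positivity)]
    congr 1
    push_cast
    ring
  rw [h2] at h
  rw [integral_pow]
  have h3 : (∫ s : S2, s.1 2 ^ k ∂area) * (((k : ℝ) + 1) / 2 * Real.Gamma ((k + 1) / 2) / 2) =
      2 * Real.pi * ((1 ^ (k + 1) - (-1) ^ (k + 1)) / (k + 1)) *
        (((k : ℝ) + 1) / 2 * Real.Gamma ((k + 1) / 2) / 2) := by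
    rw [← h, pow_succ (-1 : ℝ) k]
    field_simp
    ring
  exact mul_right_cancel₀ (by positivity) h3

theorem abs_apply_le_one (s : S2) (i : Fin 3) : |s.1 i| ≤ 1 := by
  have h : ‖s.1‖ = 1 := mem_sphere_zero_iff_norm.1 s.2
  exact (PiLp.norm_apply_le s.1 i).trans h.le

theorem continuous_apply_two : Continuous fun s : S2 => s.1 2 :=
  (EuclideanSpace.proj (𝕜 := ℝ) (2 : Fin 3)).continuous.comp continuous_subtype_val

theorem integrable_area_of_continuous {f : S2 → ℝ} (hf : Continuous f) : Integrable f area :=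
  hf.integrable_of_hasCompactSupport (HasCompactSupport.of_compactSpace f)

theorem integrable_area_polynomial (p : Polynomial ℝ) :
    Integrable (fun s : S2 => p.eval (s.1 2)) area :=
  integrable_area_of_continuous (p.continuous.comp continuous_apply_two)

theorem integral_area_polynomial (p : Polynomial ℝ) :
    ∫ s : S2, p.eval (s.1 2) ∂area = 2 * Real.pi * ∫ x in (-1 : ℝ)..1, p.eval x := by
  induction p using Polynomial.induction_on' with
  | add p q hp hq =>
    simp only [Polynomial.eval_add]
    rw [integral_add (integrable_area_polynomial p) (integrable_area_polynomial q), hp, hq,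
      intervalIntegral.integral_add (p.continuous.intervalIntegrable _ _)
      (q.continuous.intervalIntegrable _ _), mul_add]
  | monomial n a =>
    simp only [Polynomial.eval_monomial]
    rw [integral_const_mul, intervalIntegral.integral_const_mul, integral_area_pow]
    ring

/-- Archimedes' theorem on the height coordinate, extended from polynomials by uniform
approximation. -/
theorem integral_area_comp {h : ℝ → ℝ} (hh : ContinuousOn h (Set.Icc (-1) 1)) :
    ∫ s : S2, h (s.1 2) ∂area = 2 * Real.pi * ∫ x in (-1 : ℝ)..1, h x := by
  have hmem : ∀ s : S2, s.1 2 ∈ Set.Icc (-1 : ℝ) 1 := fun s => abs_le.1 (abs_apply_le_one s 2)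
  have hc : Continuous fun s : S2 => h (s.1 2) :=
    hh.comp_continuous continuous_apply_two hmem
  rw [← sub_eq_zero, ← abs_nonpos_iff]
  refine le_of_forall_pos_lt_add fun ε hε => ?_
  -- With accuracy ε/A the two approximation errors add up to (ε/A)(A − 1) < ε.
  set A := area.real Set.univ + 4 * Real.pi + 1 with hA
  have hA0 : 0 < A := by positivity
  obtain ⟨p, hp⟩ := exists_polynomial_near_of_continuousOn (-1) 1 h hh (ε / A) (by positivity)
  have e1 : |(∫ s : S2, h (s.1 2) ∂area) - ∫ s : S2, p.eval (s.1 2) ∂area| ≤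
      ε / A * area.real Set.univ := by
    rw [← integral_sub (integrable_area_of_continuous hc)
      (integrable_area_polynomial p), ← Real.norm_eq_abs]
    refine norm_integral_le_of_norm_le_const (.of_forall fun s => ?_)
    rw [Real.norm_eq_abs, abs_sub_comm]
    exact (hp _ (hmem s)).le
  have e2 : |(∫ x in (-1 : ℝ)..1, p.eval x) - ∫ x in (-1 : ℝ)..1, h x| ≤ ε / A * 2 := by
    rw [← intervalIntegral.integral_sub (p.continuous.intervalIntegrable _ _)
      (hh.intervalIntegrable_of_Icc (by norm_num))]
    have := intervalIntegral.norm_integral_le_of_norm_le_const (a := (-1 : ℝ)) (b := 1)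
      (f := fun x => p.eval x - h x) (C := ε / A) (fun x hx => by
        rw [Set.uIoc_of_le (by norm_num)] at hx
        exact (hp x ⟨hx.1.le, hx.2⟩).le)
    rw [Real.norm_eq_abs] at this
    refine this.trans (le_of_eq ?_)
    norm_num
  have e3 : (∫ s : S2, h (s.1 2) ∂area) - 2 * Real.pi * ∫ x in (-1 : ℝ)..1, h x =
      ((∫ s : S2, h (s.1 2) ∂area) - ∫ s : S2, p.eval (s.1 2) ∂area) +
        2 * Real.pi * ((∫ x in (-1 : ℝ)..1, p.eval x) - ∫ x in (-1 : ℝ)..1, h x) := by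
    rw [integral_area_polynomial]
    ring
  rw [e3, zero_add]
  refine (abs_add_le _ _).trans_lt ?_
  rw [abs_mul, abs_of_pos (show 0 < 2 * Real.pi by positivity)]
  calc _ ≤ ε / A * area.real Set.univ + 2 * Real.pi * (ε / A * 2) := by gcongr
    _ = ε / A * (A - 1) := by rw [hA]; ring
    _ < ε / A * A := by
      have : 0 < ε / A := by positivity
      nlinarith
    _ = ε := by field_simp

theorem integral_area_comp_cos {F : ℝ → ℝ} (hF : ContinuousOn F (Set.Icc 0 Real.pi)) :
    ∫ s : S2, F (Real.arccos (s.1 2)) ∂area =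
      2 * Real.pi * ∫ x in (0 : ℝ)..Real.pi, F x * Real.sin x := by
  rw [integral_area_comp (h := fun x => F (Real.arccos x)) (hF.comp Real.continuous_arccos.continuousOn
    fun x _ => ⟨Real.arccos_nonneg x, Real.arccos_le_pi x⟩)]
  congr 1
  have h := intervalIntegral.integral_comp_mul_deriv''' (a := 0) (b := Real.pi)
    (f := Real.cos) (f' := fun x => -Real.sin x) (g := fun x => F (Real.arccos x))
    Real.continuous_cos.continuousOn (fun x _ => (Real.hasDerivAt_cos x).hasDerivWithinAt)
    ?_ ?_ ?_
  · rw [Real.cos_zero, Real.cos_pi] at h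
    rw [intervalIntegral.integral_symm, ← h, ← intervalIntegral.integral_neg]
    refine intervalIntegral.integral_congr fun x hx => ?_
    rw [Set.uIcc_of_le Real.pi_pos.le] at hx
    simp only [Function.comp]
    rw [Real.arccos_cos hx.1 hx.2]
    ring
  · exact (hF.comp Real.continuous_arccos.continuousOn
      fun x _ => ⟨Real.arccos_nonneg x, Real.arccos_le_pi x⟩ :
        ContinuousOn (fun x => F (Real.arccos x)) _)
  · refine (ContinuousOn.integrableOn_compact (isCompact_uIcc.image Real.continuous_cos) ?_)
    exact (hF.comp Real.continuous_arccos.continuousOn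
      fun x _ => ⟨Real.arccos_nonneg x, Real.arccos_le_pi x⟩ :
        ContinuousOn (fun x => F (Real.arccos x)) _)
  · refine ContinuousOn.integrableOn_compact isCompact_uIcc (ContinuousOn.mul ?_ (by fun_prop))
    refine ContinuousOn.comp (t := Set.univ) (hF.comp Real.continuous_arccos.continuousOn
      fun x _ => ⟨Real.arccos_nonneg x, Real.arccos_le_pi x⟩ :
        ContinuousOn (fun x => F (Real.arccos x)) _) Real.continuous_cos.continuousOn
        fun x _ => Set.mem_univ _

end Gowdy

end

noncomputable section

namespace Gowdy

/-! ### Bounds on Legendre polynomials -/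

theorem legendreP_one (n : ℕ) : legendreP n 1 = 1 := by
  induction n using Nat.twoStepInduction with
  | zero => rfl
  | one => rfl
  | more n h0 h1 =>
    have := isLegendreLike_legendreP.bonnet n 1
    rw [h0, h1] at this
    have h : (n : ℝ) + 2 ≠ 0 := by positivity
    refine mul_left_cancel₀ h ?_
    rw [this]
    ring

theorem legendreP_neg_one (n : ℕ) : legendreP n (-1) = (-1) ^ n := by
  induction n using Nat.twoStepInduction with
  | zero => rfl
  | one => simp [legendreP]
  | more n h0 h1 =>
    have := isLegendreLike_legendreP.bonnet n (-1)
    rw [h0, h1] at this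
    have h : (n : ℝ) + 2 ≠ 0 := by positivity
    refine mul_left_cancel₀ h ?_
    rw [this, pow_succ, pow_add]
    ring

theorem legendreP_one_sub_sq_mul_deriv (n : ℕ) {x : ℝ} (hx : x ∈ Set.Ioo (-1 : ℝ) 1) :
    (1 - x ^ 2) * deriv (legendreP n) x = (n + 1) * (x * legendreP n x - legendreP (n + 1) x) := by
  have hx' : 1 - x ^ 2 ≠ 0 := by nlinarith [hx.1, hx.2]
  rw [(isLegendreLike_legendreP.ladder n x hx).deriv]
  field_simp

/-- Legendre's equation in divergence form, with (1 − x²)Pₙ' written without a derivative so that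
the ladder relations apply once more. -/
theorem hasDerivAt_legendreP_flux (n : ℕ) {x : ℝ} (hx : x ∈ Set.Ioo (-1 : ℝ) 1) :
    HasDerivAt (fun x => (n + 1) * (x * legendreP n x - legendreP (n + 1) x))
      (-(n * (n + 1) * legendreP n x)) x := by
  have hx' : 1 - x ^ 2 ≠ 0 := by nlinarith [hx.1, hx.2]
  have h := (((hasDerivAt_id x).mul (isLegendreLike_legendreP.ladder n x hx)).sub
    (isLegendreLike_legendreP.ladder_succ n hx)).const_mul ((n : ℝ) + 1)
  refine h.congr_deriv ?_
  simp only [id]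
  field_simp
  ring

/-- The energy of the Legendre equation. -/
def legendreEnergy (n : ℕ) (x : ℝ) : ℝ :=
  legendreP n x ^ 2 + (1 - x ^ 2) * deriv (legendreP n) x ^ 2 / (n * (n + 1))

theorem continuous_legendreP (n : ℕ) : Continuous (legendreP n) := (contDiff_legendreP n).continuous

theorem continuous_legendreEnergy (n : ℕ) : Continuous (legendreEnergy n) := by
  have h1 := continuous_legendreP n
  have h2 : Continuous (deriv (legendreP n)) := (contDiff_legendreP n).continuous_deriv (by simp)
  unfold legendreEnergy
  fun_prop

theorem hasDerivAt_legendreEnergy {n : ℕ} (hn : 0 < n) {x : ℝ} (hx : x ∈ Set.Ioo (-1 : ℝ) 1) :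
    HasDerivAt (legendreEnergy n) (2 * x * deriv (legendreP n) x ^ 2 / (n * (n + 1))) x := by
  have hx' : 1 - x ^ 2 ≠ 0 := by nlinarith [hx.1, hx.2]
  have hn' : (n : ℝ) ≠ 0 := by positivity
  have hP : HasDerivAt (legendreP n) (deriv (legendreP n) x) x :=
    ((contDiff_legendreP n).differentiable (by simp) x).hasDerivAt
  have hH := hasDerivAt_legendreP_flux n hx
  have hq : HasDerivAt (fun x : ℝ => 1 - x ^ 2) (-(2 * x)) x := by
    simpa using ((hasDerivAt_id x).fun_pow 2).const_sub 1
  have h := (hP.fun_pow 2).fun_add (((hH.fun_pow 2).fun_div hq hx').div_const ((n : ℝ) * (n + 1)))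
  have e : ∀ᶠ y in 𝓝 x, legendreEnergy n y = legendreP n y ^ 2 +
      ((n + 1) * (y * legendreP n y - legendreP (n + 1) y)) ^ 2 / (1 - y ^ 2) / (n * (n + 1)) := by
    filter_upwards [isOpen_Ioo.mem_nhds hx] with y hy
    have hy' : 1 - y ^ 2 ≠ 0 := by nlinarith [hy.1, hy.2]
    rw [← legendreP_one_sub_sq_mul_deriv n hy, legendreEnergy]
    field_simp
  refine (h.congr_of_eventuallyEq e).congr_deriv ?_
  rw [← legendreP_one_sub_sq_mul_deriv n hx]
  field_simp
  ring

/-- The energy dominates Pₙ², decreases on [−1, 0], increases on [0, 1], and equals 1 at both ends.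
-/
theorem abs_legendreP_le_one (n : ℕ) {x : ℝ} (hx : x ∈ Set.Icc (-1 : ℝ) 1) : |legendreP n x| ≤ 1 := by
  rcases Nat.eq_zero_or_pos n with rfl | hn
  · simp [legendreP]
  have hle : legendreP n x ^ 2 ≤ legendreEnergy n x := by
    have : 0 ≤ (1 - x ^ 2) * deriv (legendreP n) x ^ 2 / (n * (n + 1)) := by
      have : 0 ≤ 1 - x ^ 2 := by nlinarith [hx.1, hx.2]
      positivity
    unfold legendreEnergy
    linarith
  have hc := continuous_legendreEnergy n
  have hE : legendreEnergy n x ≤ 1 := by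
    rcases le_total 0 x with h | h
    · have hm : MonotoneOn (legendreEnergy n) (Set.Icc 0 1) := by
        refine monotoneOn_of_hasDerivWithinAt_nonneg (convex_Icc 0 1) hc.continuousOn
          (f' := fun x => 2 * x * deriv (legendreP n) x ^ 2 / (n * (n + 1))) (fun y hy => ?_)
          fun y hy => ?_
        · rw [interior_Icc] at hy
          exact (hasDerivAt_legendreEnergy hn ⟨by linarith [hy.1], hy.2⟩).hasDerivWithinAt
        · rw [interior_Icc] at hy
          have := hy.1
          positivity
      refine (hm ⟨h, hx.2⟩ ⟨zero_le_one, le_rfl⟩ hx.2).trans ?_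
      simp [legendreEnergy, legendreP_one]
    · have hm : AntitoneOn (legendreEnergy n) (Set.Icc (-1) 0) := by
        refine antitoneOn_of_hasDerivWithinAt_nonpos (convex_Icc (-1) 0) hc.continuousOn
          (f' := fun x => 2 * x * deriv (legendreP n) x ^ 2 / (n * (n + 1))) (fun y hy => ?_)
          fun y hy => ?_
        · rw [interior_Icc] at hy
          exact (hasDerivAt_legendreEnergy hn ⟨hy.1, by linarith [hy.2]⟩).hasDerivWithinAt
        · rw [interior_Icc] at hy
          have h1 : 0 ≤ deriv (legendreP n) y ^ 2 / (n * (n + 1)) := by positivity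
          rw [mul_div_assoc]
          exact mul_nonpos_of_nonpos_of_nonneg (by linarith [hy.2]) h1
      refine (hm ⟨le_rfl, by norm_num⟩ ⟨hx.1, h⟩ hx.1).trans ?_
      simp [legendreEnergy, legendreP_neg_one, ← pow_mul, mul_comm n 2]
  rw [← sq_le_one_iff_abs_le_one]
  exact hle.trans hE

/-! ### Decay of the harmonic coefficients -/

instance : Fact (Module.finrank ℝ E3 = 2 + 1) := ⟨by simp⟩

/-- Away from the origin the extension is f composed with the smooth retraction x ↦ x/‖x‖. -/
theorem contDiffAt_radialExt (f : C^∞⟮𝓡 2, S2; 𝓘(ℝ, ℝ), ℝ⟯) {x : E3} (hx : x ≠ 0) :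
    ContDiffAt ℝ ∞ (radialExt f) x := by
  let U : TopologicalSpace.Opens E3 := ⟨{0}ᶜ, isOpen_compl_singleton⟩
  have h1 : ContMDiff 𝓘(ℝ, E3) 𝓘(ℝ, E3) ∞ (fun x : U => ‖x.1‖⁻¹ • x.1) := fun y => by
    refine (contMDiffAt_subtype_iff (f := fun x : E3 => ‖x‖⁻¹ • x) (x := y)).2 ?_
    have hy : y.1 ≠ 0 := y.2
    exact (((contDiffAt_norm ℝ hy).inv (norm_ne_zero_iff.2 hy)).smul contDiffAt_id).contMDiffAt
  have h2 := f.2.comp (h1.codRestrict_sphere (n := 2) (fun y => by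
    have hy : y.1 ≠ 0 := y.2
    rw [mem_sphere_zero_iff_norm, norm_smul, norm_inv, norm_norm,
      inv_mul_cancel₀ (norm_ne_zero_iff.2 hy)]))
  have h3 := h2 ⟨x, hx⟩
  have h4 : ContMDiffAt 𝓘(ℝ, E3) 𝓘(ℝ, ℝ) ∞ (fun y : U => radialExt f y.1) ⟨x, hx⟩ := by
    refine h3.congr_of_eventuallyEq (.of_forall fun y => ?_)
    have hy : y.1 ≠ 0 := y.2
    simp only [radialExt, dif_pos hy]
    rfl
  exact (contMDiffAt_subtype_iff.1 h4).contDiffAt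

/-- The prime meridian. -/
def meridian (a : ℝ) : E3 := !₂[Real.sin a, 0, Real.cos a]

theorem norm_meridian (a : ℝ) : ‖meridian a‖ = 1 := by
  rw [EuclideanSpace.norm_eq, Real.sqrt_eq_one]
  simp [Fin.sum_univ_three, meridian]

/-- The prime meridian as a curve on the sphere. -/
def meridianS (a : ℝ) : S2 := ⟨meridian a, by simp [norm_meridian]⟩

theorem hasDerivAt_meridian (a : ℝ) : HasDerivAt meridian (meridian (a + Real.pi / 2)) a := by
  have e : ∀ a, meridian a =
      Real.sin a • EuclideanSpace.single 0 1 + Real.cos a • EuclideanSpace.single 2 1 := fun a => by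
    ext i
    fin_cases i <;> simp [meridian]
  rw [show meridian = _ from funext e]
  simp only [Real.sin_add_pi_div_two, Real.cos_add_pi_div_two]
  exact ((Real.hasDerivAt_sin a).smul_const _).add ((Real.hasDerivAt_cos a).smul_const _)

theorem radialExt_coe (f : S2 → ℝ) (s : S2) : radialExt f s.1 = f s := by
  have hs : ‖s.1‖ = 1 := mem_sphere_zero_iff_norm.1 s.2
  have h0 : s.1 ≠ 0 := norm_ne_zero_iff.1 (by rw [hs]; exact one_ne_zero)
  rw [radialExt, dif_pos h0]
  congr 1
  exact Subtype.ext (by simp [hs])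

theorem rot_add (a b : ℝ) (s : S2) : rot a (rot b s) = rot (a + b) s := by
  apply Subtype.ext
  ext i
  fin_cases i <;> simp [rot, Real.sin_add, Real.cos_add] <;> ring

/-- The infinitesimal condition is imposed at angle 0 but at every point. The group law transports
it along the orbit, so f is constant there. -/
theorem apply_rot (f : TestFn) (a : ℝ) (s : S2) : f (rot a s) = f s := by
  have h : ∀ b : ℝ, HasDerivAt (fun a : ℝ => f (rot a s)) 0 b := fun b => by
    have h0 := f.2 (rot b s)
    have h1 : HasDerivAt (fun a : ℝ => f (rot (a - b) (rot b s))) 0 b := by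
      have h2 : HasDerivAt (fun a : ℝ => f (rot a (rot b s))) 0 (b - b) := by rw [sub_self]; exact h0
      have h3 := HasDerivAt.comp b (h₂ := fun a : ℝ => f (rot a (rot b s)))
        (h := fun a : ℝ => a - b) h2
        ((hasDerivAt_id b).sub_const b)
      rw [zero_mul] at h3
      exact h3
    have e : (fun a : ℝ => f (rot (a - b) (rot b s))) = fun a : ℝ => f (rot a s) := by
      funext a
      rw [rot_add, sub_add_cancel]
    rwa [e] at h1
  have hc := is_const_of_deriv_eq_zero (fun b => (h b).differentiableAt) (fun b => (h b).deriv) a 0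
  have h0 : rot 0 s = s := by
    apply Subtype.ext
    ext i
    fin_cases i <;> simp [rot]
  exact hc.trans (congrArg (fun s => f s) h0)

theorem apply_eq_meridian (f : TestFn) (s : S2) : f s = f (meridianS (Real.arccos (s.1 2))) := by
  have h2 := abs_le.1 (abs_apply_le_one s 2)
  have hn : s.1 0 ^ 2 + s.1 1 ^ 2 + s.1 2 ^ 2 = 1 := by
    have h : ‖s.1‖ = 1 := mem_sphere_zero_iff_norm.1 s.2
    rw [EuclideanSpace.norm_eq, Real.sqrt_eq_one] at h
    simpa [Fin.sum_univ_three] using h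
  -- The argument of x₁ + ix₂ is the angle of the rotation that carries the meridian to s.
  set w : ℂ := ⟨s.1 0, s.1 1⟩ with hw
  have hr : ‖w‖ = Real.sin (Real.arccos (s.1 2)) := by
    rw [Real.sin_arccos, Complex.norm_def, Complex.normSq_mk]
    congr 1
    linarith
  rw [← apply_rot f w.arg (meridianS (Real.arccos (s.1 2)))]
  refine congrArg (fun s => f s) ?_
  apply Subtype.ext
  have e0 := Complex.norm_mul_cos_arg w
  have e1 := Complex.norm_mul_sin_arg w
  rw [hr] at e0 e1
  have e0' : s.1 0 = Real.sin (Real.arccos (s.1 2)) * Real.cos w.arg := e0.symm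
  have e1' : s.1 1 = Real.sin (Real.arccos (s.1 2)) * Real.sin w.arg := e1.symm
  have e2' : s.1 2 = Real.cos (Real.arccos (s.1 2)) := (Real.cos_arccos h2.1 h2.2).symm
  ext i
  fin_cases i
  · simpa [rot, meridianS, meridian, mul_comm] using e0'
  · simpa [rot, meridianS, meridian, mul_comm] using e1'
  · simp [rot, meridianS, meridian, ← e2']

end Gowdy

end

/-! ### Meridian profiles and bounds on harmonic coefficients by two derivatives. -/

noncomputable section

namespace Gowdy

/-- The restriction of a test function to the prime meridian. -/
def profile (f : TestFn) (a : ℝ) : ℝ := radialExt f (meridian a)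

theorem meridian_ne_zero (a : ℝ) : meridian a ≠ 0 :=
  norm_ne_zero_iff.1 (by rw [norm_meridian]; exact one_ne_zero)

theorem apply_eq_profile (f : TestFn) (s : S2) : f s = profile f (Real.arccos (s.1 2)) := by
  rw [apply_eq_meridian]
  exact (radialExt_coe _ (meridianS (Real.arccos (s.1 2)))).symm

/-- The first derivative of the profile. -/
def profile' (f : TestFn) (a : ℝ) : ℝ :=
  fderiv ℝ (radialExt f) (meridian a) (meridian (a + Real.pi / 2))

/-- The second derivative of the profile. -/
def profile'' (f : TestFn) (a : ℝ) : ℝ :=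
  fderiv ℝ (fderiv ℝ (radialExt f)) (meridian a) (meridian (a + Real.pi / 2))
    (meridian (a + Real.pi / 2)) +
  fderiv ℝ (radialExt f) (meridian a) (meridian (a + Real.pi / 2 + Real.pi / 2))

theorem hasDerivAt_profile (f : TestFn) (a : ℝ) : HasDerivAt (profile f) (profile' f a) a :=
  (((contDiffAt_radialExt f.1 (meridian_ne_zero a)).differentiableAt
    (by simp)).hasFDerivAt.comp_hasDerivAt a (hasDerivAt_meridian a))

theorem hasDerivAt_profile' (f : TestFn) (a : ℝ) : HasDerivAt (profile' f) (profile'' f a) a := by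
  have h1 : DifferentiableAt ℝ (fderiv ℝ (radialExt f)) (meridian a) :=
    ((contDiffAt_radialExt f.1 (meridian_ne_zero a)).fderiv_right (m := 1)
      (by exact WithTop.coe_le_coe.2 le_top)).differentiableAt one_ne_zero
  have h2 := h1.hasFDerivAt.comp_hasDerivAt a (hasDerivAt_meridian a)
  have h3 : HasDerivAt (fun a => meridian (a + Real.pi / 2))
      (meridian (a + Real.pi / 2 + Real.pi / 2)) a := by
    have := (hasDerivAt_meridian (a + Real.pi / 2)).scomp a ((hasDerivAt_id a).add_const _)
    rw [one_smul] at this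
    exact this
  exact h2.clm_apply h3

theorem continuous_meridian : Continuous meridian :=
  continuous_iff_continuousAt.2 fun a => (hasDerivAt_meridian a).continuousAt

theorem continuous_profile'' (f : TestFn) : Continuous (profile'' f) := by
  have hm := continuous_meridian
  have h1 : Continuous fun a => fderiv ℝ (radialExt f) (meridian a) := by
    refine continuous_iff_continuousAt.2 fun a => ?_
    exact ContinuousAt.comp (f := meridian) (g := fderiv ℝ (radialExt f))
      ((contDiffAt_radialExt f.1 (meridian_ne_zero a)).fderiv_right (m := 0)
        (by exact WithTop.coe_le_coe.2 le_top)).continuousAt hm.continuousAt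
  have h2 : Continuous fun a => fderiv ℝ (fderiv ℝ (radialExt f)) (meridian a) := by
    refine continuous_iff_continuousAt.2 fun a => ?_
    exact ContinuousAt.comp (f := meridian) (g := fderiv ℝ (fderiv ℝ (radialExt f)))
      (((contDiffAt_radialExt f.1 (meridian_ne_zero a)).fderiv_right (m := 1)
        (by exact WithTop.coe_le_coe.2 le_top)).fderiv_right (m := 0) (by norm_num)).continuousAt
      hm.continuousAt
  exact ((h2.clm_apply (hm.comp (by fun_prop))).clm_apply (hm.comp (by fun_prop))).add
    (h1.clm_apply (hm.comp (by fun_prop)))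

/-- `A` bounds the derivatives of order at most two of `f`. -/
def DerivBound (f : TestFn) (A : ℝ) : Prop :=
  ∀ n ≤ 2, ∀ s : S2, ‖iteratedFDeriv ℝ n (radialExt f) s.1‖ ≤ A

theorem DerivBound.profile_le {f : TestFn} {A : ℝ} (h : DerivBound f A) (a : ℝ) :
    |profile f a| ≤ A := by
  have := h 0 (by norm_num) (meridianS a)
  rwa [norm_iteratedFDeriv_zero] at this

theorem DerivBound.fderiv_le {f : TestFn} {A : ℝ} (h : DerivBound f A) (a b : ℝ) :
    |fderiv ℝ (radialExt f) (meridian a) (meridian b)| ≤ A := by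
  have h1 := h 1 (by norm_num) (meridianS a)
  rw [norm_iteratedFDeriv_one] at h1
  have h2 := (fderiv ℝ (radialExt f) (meridian a)).le_opNorm (meridian b)
  rw [norm_meridian, mul_one] at h2
  exact h2.trans h1

theorem DerivBound.profile''_le {f : TestFn} {A : ℝ} (h : DerivBound f A) (a : ℝ) :
    |profile'' f a| ≤ 2 * A := by
  have h1 := h 2 le_rfl (meridianS a)
  have h2 := (iteratedFDeriv ℝ 2 (radialExt f) (meridian a)).le_opNorm
    (fun _ => meridian (a + Real.pi / 2))
  rw [iteratedFDeriv_two_apply] at h2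
  simp only [norm_meridian, Finset.prod_const_one, mul_one] at h2
  have h3 := h.fderiv_le a (a + Real.pi / 2 + Real.pi / 2)
  have h4 := h2.trans h1
  rw [Real.norm_eq_abs] at h4
  refine (abs_add_le _ _).trans ?_
  linarith

theorem coeff_eq_integral (f : TestFn) (l : ℕ) : coeff f l = √((2 * l + 1) / (4 * Real.pi)) *
    (2 * Real.pi * ∫ x in (0 : ℝ)..Real.pi, profile f x * legendreP l (Real.cos x) * Real.sin x) := by
  have hF : Continuous fun x => profile f x * legendreP l (Real.cos x) :=
    (continuous_iff_continuousAt.2 fun a => (hasDerivAt_profile f a).continuousAt).mul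
      ((continuous_legendreP l).comp Real.continuous_cos)
  rw [← integral_area_comp_cos hF.continuousOn, ← integral_const_mul, coeff, pairing]
  refine integral_congr_ae (.of_forall fun s => ?_)
  have h2 := abs_le.1 (abs_apply_le_one s 2)
  have e : Y l s = √((2 * l + 1) / (4 * Real.pi)) * legendreP l (s.1 2) := rfl
  simp only
  rw [e, apply_eq_profile, Real.cos_arccos h2.1 h2.2]
  ring

/-- Two integrations by parts move the Legendre operator to the profile. The boundary terms vanish
because the flux and sin are zero at both poles. -/
theorem integral_profile_legendre (f : TestFn) (l : ℕ) :
    l * (l + 1) * (∫ x in (0 : ℝ)..Real.pi, profile f x * legendreP l (Real.cos x) * Real.sin x) =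
      -∫ x in (0 : ℝ)..Real.pi, (profile'' f x * Real.sin x + profile' f x * Real.cos x) *
        legendreP l (Real.cos x) := by
  set G : ℝ → ℝ := fun x => (l + 1) * (legendreP (l + 1) (Real.cos x) -
    Real.cos x * legendreP l (Real.cos x)) with hG
  have hpc : ∀ n, Continuous fun x => legendreP n (Real.cos x) := fun n =>
    (continuous_legendreP n).comp Real.continuous_cos
  have hGc : Continuous G := by
    have h0 := hpc l
    have h1 := hpc (l + 1)
    fun_prop
  have hF : Continuous (profile f) :=
    continuous_iff_continuousAt.2 fun a => (hasDerivAt_profile f a).continuousAt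
  have hF' : Continuous (profile' f) :=
    continuous_iff_continuousAt.2 fun a => (hasDerivAt_profile' f a).continuousAt
  have hF'' := continuous_profile'' f
  have hGd : ∀ x ∈ Set.Ioo (min 0 Real.pi) (max 0 Real.pi),
      HasDerivAt G (-(l * (l + 1) * (legendreP l (Real.cos x) * Real.sin x))) x := by
    intro x hx
    rw [min_eq_left Real.pi_pos.le, max_eq_right Real.pi_pos.le] at hx
    have hs := (Real.sin_pos_of_mem_Ioo hx).ne'
    have h0 := isLegendreLike_legendreP.hasDerivAt_comp_cos l hx
    have h1 := isLegendreLike_legendreP.hasDerivAt_comp_cos_succ l hx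
    refine ((h1.sub ((Real.hasDerivAt_cos x).mul h0)).const_mul ((l : ℝ) + 1)).congr_deriv ?_
    have e := Real.sin_sq_add_cos_sq x
    field_simp
    linear_combination (((l : ℝ) + 1) * legendreP l (Real.cos x)) * e
  have i1 := intervalIntegral.integral_mul_deriv_eq_deriv_mul_of_hasDerivAt (a := 0) (b := Real.pi)
    hF.continuousOn hGc.continuousOn (fun x _ => hasDerivAt_profile f x) hGd
    (hF'.intervalIntegrable _ _)
    (Continuous.intervalIntegrable (by have := hpc l; fun_prop) _ _)
  have i2 := intervalIntegral.integral_mul_deriv_eq_deriv_mul_of_hasDerivAt (a := 0) (b := Real.pi)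
    (u := fun x => profile' f x * Real.sin x)
    (u' := fun x => profile'' f x * Real.sin x + profile' f x * Real.cos x)
    (v := fun x => legendreP l (Real.cos x))
    (v' := fun x => deriv (legendreP l) (Real.cos x) * -Real.sin x)
    (by fun_prop) (hpc l).continuousOn
    (fun x _ => (hasDerivAt_profile' f x).mul (Real.hasDerivAt_sin x))
    (fun x _ => (((contDiff_legendreP l).differentiable (by simp) _).hasDerivAt).comp x
      (Real.hasDerivAt_cos x))
    (Continuous.intervalIntegrable (by fun_prop) _ _)
    (Continuous.intervalIntegrable (((contDiff_legendreP l).continuous_deriv (by simp)).comp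
      Real.continuous_cos |>.mul (by fun_prop)) _ _)
  have e1 : ∀ x ∈ Set.uIcc 0 Real.pi, profile' f x * Real.sin x *
      (deriv (legendreP l) (Real.cos x) * -Real.sin x) = profile' f x * G x := by
    intro x hx
    rw [Set.uIcc_of_le Real.pi_pos.le] at hx
    rcases hx.1.eq_or_lt with rfl | h0
    · simp [hG, legendreP_one]
    rcases hx.2.eq_or_lt with rfl | h1
    · simp [hG, legendreP_neg_one, pow_succ]
    have hs := Real.sin_pos_of_mem_Ioo ⟨h0, h1⟩
    have hc : Real.cos x ∈ Set.Ioo (-1 : ℝ) 1 := by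
      constructor <;> nlinarith [Real.sin_sq_add_cos_sq x]
    have := legendreP_one_sub_sq_mul_deriv l hc
    rw [← Real.sin_sq] at this
    simp only [hG]
    linear_combination (-profile' f x) * this
  rw [intervalIntegral.integral_congr e1] at i2
  simp only [Real.sin_zero, Real.sin_pi, mul_zero, zero_mul, sub_zero, zero_sub] at i2
  rw [← i2]
  have g0 : G 0 = 0 := by simp [hG, legendreP_one]
  have gp : G Real.pi = 0 := by simp [hG, legendreP_neg_one, pow_succ]
  rw [g0, gp] at i1
  simp only [mul_zero, sub_zero, zero_sub] at i1
  rw [← neg_eq_iff_eq_neg.2 i1, ← intervalIntegral.integral_const_mul,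
    ← intervalIntegral.integral_neg]
  refine intervalIntegral.integral_congr fun x _ => ?_
  ring

theorem abs_integral_le_pi {g : ℝ → ℝ} {A : ℝ} (h : ∀ x, |g x| ≤ A) :
    |∫ x in (0 : ℝ)..Real.pi, g x| ≤ A * Real.pi := by
  have := intervalIntegral.norm_integral_le_of_norm_le_const (a := 0) (b := Real.pi) (f := g) (C := A)
    fun x _ => h x
  rwa [sub_zero, abs_of_pos Real.pi_pos] at this

/-- The second-order operator gains (l+1)⁻² and the normalization of Y_l costs √(l+1/2). Linearity
in A is what makes sums over coefficients continuous functionals. The constant 120 majorizes 12π².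
-/
theorem abs_coeff_le {f : TestFn} {A : ℝ} (h : DerivBound f A) (l : ℕ) :
    |coeff f l| ≤ 120 * A * (√(l + 1 / 2) / (l + 1) ^ 2) := by
  have hA : 0 ≤ A := (abs_nonneg _).trans (h.profile_le 0)
  have hp : ∀ x, |legendreP l (Real.cos x)| ≤ 1 := fun x =>
    abs_legendreP_le_one l ⟨Real.neg_one_le_cos x, Real.cos_le_one x⟩
  have hpi := Real.pi_gt_three
  have hpi' : Real.pi < 3.15 := Real.pi_lt_d2
  set J := ∫ x in (0 : ℝ)..Real.pi, profile f x * legendreP l (Real.cos x) * Real.sin x with hJ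
  have hl : (0 : ℝ) ≤ l := Nat.cast_nonneg l
  have hJb : |J| * (l + 1) ^ 2 ≤ 6 * A * Real.pi := by
    -- For l = 0 the factor l(l+1) vanishes and the identity says nothing about J, which is then
    -- bounded directly.
    rcases Nat.eq_zero_or_pos l with rfl | hl0
    · have := abs_integral_le_pi (g := fun x => profile f x * legendreP 0 (Real.cos x) * Real.sin x)
        (A := A) fun x => by
          rw [abs_mul, abs_mul]
          have h1 := Real.abs_sin_le_one x
          calc _ ≤ A * 1 * 1 := by
                gcongr
                exacts [h.profile_le x, hp x]
            _ = A := by ring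
      rw [← hJ] at this
      norm_num
      nlinarith [mul_nonneg hA Real.pi_pos.le]
    · have hl1 : (1 : ℝ) ≤ l := by exact_mod_cast hl0
      have h2 := integral_profile_legendre f l
      rw [← hJ] at h2
      have h3 := abs_integral_le_pi (g := fun x => (profile'' f x * Real.sin x +
        profile' f x * Real.cos x) * legendreP l (Real.cos x)) (A := 3 * A) fun x => by
          rw [abs_mul]
          have h1 := Real.abs_sin_le_one x
          have h1' := Real.abs_cos_le_one x
          have h4 : |profile'' f x * Real.sin x + profile' f x * Real.cos x| ≤ 3 * A := by
            refine (abs_add_le _ _).trans ?_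
            rw [abs_mul, abs_mul]
            have h5 := h.profile''_le x
            have h6 : |profile' f x| ≤ A := h.fderiv_le x _
            nlinarith [abs_nonneg (profile'' f x), abs_nonneg (profile' f x)]
          calc _ ≤ 3 * A * 1 := by
                gcongr
                exact hp x
            _ = 3 * A := by ring
      rw [← abs_neg, ← h2, abs_mul, abs_of_nonneg (by positivity)] at h3
      have h5 : ((l : ℝ) + 1) ^ 2 ≤ 2 * (l * (l + 1)) := by nlinarith
      nlinarith [abs_nonneg J, mul_le_mul_of_nonneg_left h5 (abs_nonneg J)]
  rw [coeff_eq_integral, abs_mul, abs_mul, ← hJ, abs_of_nonneg (Real.sqrt_nonneg _),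
    abs_of_pos (show 0 < 2 * Real.pi by positivity)]
  have hN : √((2 * l + 1) / (4 * Real.pi)) ≤ √(l + 1 / 2) := by
    refine Real.sqrt_le_sqrt ?_
    rw [div_le_iff₀ (by positivity)]
    nlinarith
  have hJ2 : |J| ≤ 6 * A * Real.pi / (l + 1) ^ 2 := by rwa [le_div_iff₀ (by positivity)]
  calc _ ≤ √(l + 1 / 2) * (2 * Real.pi * (6 * A * Real.pi / (l + 1) ^ 2)) := by gcongr
    _ = (12 * Real.pi ^ 2) * A * (√(l + 1 / 2) / (l + 1) ^ 2) := by ring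
    _ ≤ _ := by
      gcongr
      nlinarith

end Gowdy

end

noncomputable section

namespace Gowdy

/-! ### Linear functionals on test functions -/

theorem TestFn.continuous (f : TestFn) : Continuous f := f.1.contMDiff.continuous

theorem TestFn.add_apply (f g : TestFn) (s : S2) : (f + g) s = f s + g s := rfl

theorem TestFn.sub_apply (f g : TestFn) (s : S2) : (f - g) s = f s - g s := rfl

theorem TestFn.smul_apply (c : ℝ) (f : TestFn) (s : S2) : (c • f) s = c * f s := rfl

theorem radialExt_sub (f g : TestFn) : radialExt (f - g : TestFn) = radialExt f - radialExt g := by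
  funext x
  simp only [Pi.sub_apply, radialExt]
  split_ifs
  · rfl
  · rw [sub_zero]

theorem sphere_ne_zero (s : S2) : s.1 ≠ 0 := by
  have hs : ‖s.1‖ = 1 := mem_sphere_zero_iff_norm.1 s.2
  exact norm_ne_zero_iff.1 (by rw [hs]; exact one_ne_zero)

theorem exists_derivBound (f : TestFn) : ∃ A, DerivBound f A := by
  have h : ∀ n : ℕ, ∃ A, ∀ s : S2, ‖iteratedFDeriv ℝ n (radialExt f) s.1‖ ≤ A := fun n => by
    have hc : Continuous fun s : S2 => iteratedFDeriv ℝ n (radialExt f) s.1 := by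
      refine continuous_iff_continuousAt.2 fun s => ?_
      exact ContinuousAt.comp (f := fun s : S2 => s.1) (g := iteratedFDeriv ℝ n (radialExt f))
        ((contDiffAt_radialExt f.1 (sphere_ne_zero s)).continuousAt_iteratedFDeriv
          (by exact WithTop.coe_le_coe.2 le_top)) continuous_subtype_val.continuousAt
    obtain ⟨A, hA⟩ := (isCompact_univ.image hc.norm).isBounded.bddAbove
    exact ⟨A, fun s => hA ⟨s, Set.mem_univ _, rfl⟩⟩
  choose A hA using h
  refine ⟨|A 0| + |A 1| + |A 2|, fun n hn s => (hA n s).trans ?_⟩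
  have h0 := abs_nonneg (A 0)
  have h1 := abs_nonneg (A 1)
  have h2 := abs_nonneg (A 2)
  interval_cases n
  · linarith [le_abs_self (A 0)]
  · linarith [le_abs_self (A 1)]
  · linarith [le_abs_self (A 2)]

theorem eventually_derivBound_sub (f₀ : TestFn) {ε : ℝ} (hε : 0 < ε) :
    ∀ᶠ f in 𝓝 f₀, DerivBound (f - f₀) ε := by
  have h : ∀ n : ℕ, ∀ᶠ f : TestFn in 𝓝 f₀, ∀ s : S2,
      ‖iteratedFDeriv ℝ n (radialExt (f - f₀ : TestFn)) s.1‖ ≤ ε := fun n => by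
    have hc : Continuous (fun f : TestFn => (UniformFun.ofFun
        (fun s : S2 => iteratedFDeriv ℝ n (radialExt f) s.1) : S2 →ᵤ (E3 [×n]→L[ℝ] ℝ))) :=
      continuous_iInf_dom (i := n) continuous_induced_dom
    have h1 := UniformFun.tendsto_iff_tendstoUniformly.1 (hc.tendsto f₀)
    filter_upwards [Metric.tendstoUniformly_iff.1 h1 ε hε] with f hf s
    have h2 := hf s
    rw [dist_comm, dist_eq_norm] at h2
    rw [radialExt_sub, iteratedFDeriv_sub_apply
      ((contDiffAt_radialExt f.1 (sphere_ne_zero s)).of_le (by exact WithTop.coe_le_coe.2 le_top))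
      ((contDiffAt_radialExt f₀.1 (sphere_ne_zero s)).of_le (by exact WithTop.coe_le_coe.2 le_top))]
    exact h2.le
  filter_upwards [h 0, h 1, h 2] with f h0 h1 h2 n hn
  interval_cases n
  exacts [h0, h1, h2]

/-- A linear functional bounded by the derivatives of order at most two is a distribution. -/
def Distr.ofBound (T : TestFn →ₗ[ℝ] ℝ) (C : ℝ) (h : ∀ f A, DerivBound f A → |T f| ≤ C * A) : Distr :=
  (⟨T, continuous_iff_continuousAt.2 fun f₀ => by
    refine Metric.tendsto_nhds.2 fun ε hε => ?_
    have hC : 0 < |C| + 1 := by positivity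
    filter_upwards [eventually_derivBound_sub f₀ (div_pos hε hC)] with f hf
    have h1 := h _ _ hf
    have h2 : T f - T f₀ = T (f - f₀) := (map_sub T f f₀).symm
    have h3 : C * (ε / (|C| + 1)) < ε := by
      rw [mul_div_assoc', div_lt_iff₀ hC]
      nlinarith [le_abs_self C]
    change |T f - T f₀| < ε
    rw [h2]
    exact h1.trans_lt h3⟩ : TestFn →L[ℝ] ℝ)

/-! ### Bilinearity of the pairing and Parseval's identity -/

theorem integrable_mul (f g : TestFn) : Integrable (fun s => f s * g s) area :=
  integrable_area_of_continuous (f.continuous.mul g.continuous)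

theorem pairing_comm (f g : TestFn) : pairing f g = pairing g f := by
  simp only [pairing]
  exact integral_congr_ae (.of_forall fun s => mul_comm (f s) (g s))

theorem pairing_add_left (f g h : TestFn) : pairing (f + g) h = pairing f h + pairing g h := by
  simp only [pairing]
  rw [← integral_add (integrable_mul f h) (integrable_mul g h)]
  exact integral_congr_ae (.of_forall fun s => add_mul (f s) (g s) (h s))

theorem pairing_smul_left (c : ℝ) (f h : TestFn) : pairing (c • f) h = c * pairing f h := by
  simp only [pairing]
  rw [← integral_const_mul]
  exact integral_congr_ae (.of_forall fun s => mul_assoc c (f s) (h s))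

/-- The pairing as a bilinear form. -/
def pairingL : TestFn →ₗ[ℝ] TestFn →ₗ[ℝ] ℝ :=
  LinearMap.mk₂ ℝ pairing pairing_add_left pairing_smul_left
    (fun f g h => by
      rw [pairing_comm, pairing_add_left, pairing_comm g, pairing_comm h])
    (fun c f g => by rw [pairing_comm, pairing_smul_left, pairing_comm g, smul_eq_mul])

/-- The harmonic coefficients as linear functionals. -/
def coeffL (l : ℕ) : TestFn →ₗ[ℝ] ℝ := pairingL.flip (Y l)

theorem coeffL_apply (l : ℕ) (f : TestFn) : coeffL l f = coeff f l := rfl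

theorem coeff_add (f g : TestFn) (l : ℕ) : coeff (f + g) l = coeff f l + coeff g l :=
  map_add (coeffL l) f g

theorem coeff_sub (f g : TestFn) (l : ℕ) : coeff (f - g) l = coeff f l - coeff g l :=
  map_sub (coeffL l) f g

theorem coeff_neg (f : TestFn) (l : ℕ) : coeff (-f) l = -coeff f l := map_neg (coeffL l) f

theorem coeff_smul (c : ℝ) (f : TestFn) (l : ℕ) : coeff (c • f) l = c * coeff f l :=
  map_smul (coeffL l) c f

theorem coeff_zero (l : ℕ) : coeff 0 l = 0 := map_zero (coeffL l)

theorem exists_abs_coeff_le (f : TestFn) :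
    ∃ C, 0 ≤ C ∧ ∀ l : ℕ, |coeff f l| ≤ C * (√(l + 1 / 2) / (l + 1) ^ 2) := by
  obtain ⟨A, hA⟩ := exists_derivBound f
  exact ⟨120 * A, by linarith [(abs_nonneg _).trans (hA.profile_le 0)], fun l => abs_coeff_le hA l⟩

/-- The weight l + 1/2 matches the growth of |ż_l|², which multiplies the Q-part of the mode
coefficients. -/
theorem summable_coeff_mul_sqrt (f : TestFn) :
    Summable fun l : ℕ => ((l : ℝ) + 1 / 2) * coeff f l ^ 2 := by
  obtain ⟨C, hC, h⟩ := exists_abs_coeff_le f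
  refine Summable.of_nonneg_of_le (fun l => by positivity) (fun l => ?_)
    ((summable_one_div_add_one_pow (k := 2) (by norm_num)).mul_left (C ^ 2))
  have hl : (0 : ℝ) ≤ l := Nat.cast_nonneg l
  have h1 : coeff f l ^ 2 ≤ (C * (√(l + 1 / 2) / (l + 1) ^ 2)) ^ 2 := sq_le_sq' (by
    linarith [neg_abs_le (coeff f l), h l]) ((le_abs_self _).trans (h l))
  rw [mul_pow, div_pow, Real.sq_sqrt (by positivity)] at h1
  calc ((l : ℝ) + 1 / 2) * coeff f l ^ 2
      ≤ (l + 1 / 2) * (C ^ 2 * ((l + 1 / 2) / ((l + 1) ^ 2) ^ 2)) := by gcongr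
    _ ≤ C ^ 2 * (1 / ((l : ℝ) + 1) ^ 2) := by
      rw [mul_left_comm]
      gcongr
      rw [mul_div_assoc', div_le_div_iff₀ (by positivity) (by positivity)]
      nlinarith [sq_nonneg (((l : ℝ) + 1) ^ 2)]

theorem summable_coeff_sq (f : TestFn) : Summable fun l : ℕ => coeff f l ^ 2 := by
  refine Summable.of_nonneg_of_le (fun l => sq_nonneg _) (fun l => ?_)
    ((summable_coeff_mul_sqrt f).mul_left 2)
  have hl : (0 : ℝ) ≤ l := Nat.cast_nonneg l
  nlinarith [sq_nonneg (coeff f l)]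

theorem Summable.mul_of_sq {a b : ℕ → ℝ} (ha : Summable fun l => a l ^ 2)
    (hb : Summable fun l => b l ^ 2) : Summable fun l => a l * b l := by
  refine Summable.of_norm_bounded (ha.add hb) fun l => ?_
  rw [Real.norm_eq_abs, abs_le]
  constructor <;> nlinarith [sq_nonneg (a l - b l), sq_nonneg (a l + b l), sq_nonneg (a l), sq_nonneg (b l)]

/-- The distribution with harmonic coefficients `c`. -/
def Distr.ofCoeff (c : ℕ → ℝ) (hc : Summable fun l : ℕ => |c l| * (√(l + 1 / 2) / (l + 1) ^ 2)) : Distr :=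
  Distr.ofBound
    { toFun := fun f => ∑' l, c l * coeff f l
      map_add' := fun f g => by
        have hs : ∀ f, Summable fun l => c l * coeff f l := fun f => by
          obtain ⟨C, hC, h⟩ := exists_abs_coeff_le f
          refine Summable.of_norm_bounded (hc.mul_left C) fun l => ?_
          rw [norm_mul, Real.norm_eq_abs, Real.norm_eq_abs, mul_left_comm]
          gcongr
          exact h l
        rw [← (hs f).tsum_add (hs g)]
        simp only [coeff_add, mul_add]
      map_smul' := fun a f => by
        rw [RingHom.id_apply, smul_eq_mul, ← tsum_mul_left]
        simp only [coeff_smul, mul_left_comm] }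
    (120 * ∑' l : ℕ, |c l| * (√(l + 1 / 2) / (l + 1) ^ 2)) fun f A hA => by
      have hA0 : 0 ≤ A := (abs_nonneg _).trans (hA.profile_le 0)
      rw [mul_assoc, mul_comm (tsum _), ← mul_assoc, ← Real.norm_eq_abs]
      refine tsum_of_norm_bounded (hc.hasSum.mul_left (120 * A)) fun l => ?_
      rw [norm_mul, Real.norm_eq_abs, Real.norm_eq_abs, mul_left_comm]
      gcongr
      exact abs_coeff_le hA l

theorem Distr.ofCoeff_apply (c : ℕ → ℝ) (hc) (f : TestFn) :
    Distr.ofCoeff c hc f = ∑' l, c l * coeff f l := rfl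

/-- One integration by parts; the flux vanishes at ±1. The right side is symmetric in l and m, which
gives orthogonality. -/
theorem integral_legendreP_flux (l m : ℕ) :
    l * (l + 1) * (∫ x in (-1 : ℝ)..1, legendreP m x * legendreP l x) =
      ∫ x in (-1 : ℝ)..1, (1 - x ^ 2) * (deriv (legendreP m) x * deriv (legendreP l) x) := by
  have hc := fun n => continuous_legendreP n
  have hd : ∀ n, Continuous (deriv (legendreP n)) := fun n =>
    (contDiff_legendreP n).continuous_deriv (by simp)
  have h := intervalIntegral.integral_mul_deriv_eq_deriv_mul_of_hasDerivAt (a := -1) (b := 1)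
    (u := legendreP m) (u' := deriv (legendreP m))
    (v := fun x => (l + 1) * (x * legendreP l x - legendreP (l + 1) x))
    (v' := fun x => -(l * (l + 1) * legendreP l x)) (hc m).continuousOn
    (by have := hc l; have := hc (l + 1); fun_prop)
    (fun x _ => ((contDiff_legendreP m).differentiable (by simp) x).hasDerivAt)
    (fun x hx => hasDerivAt_legendreP_flux l (by
      rwa [min_eq_left (by norm_num), max_eq_right (by norm_num)] at hx))
    ((hd m).intervalIntegrable _ _)
    (Continuous.intervalIntegrable (by have := hc l; fun_prop) _ _)
  simp only [legendreP_one, legendreP_neg_one, pow_succ] at h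
  have e : ∀ x ∈ Set.uIcc (-1 : ℝ) 1, deriv (legendreP m) x *
      ((l + 1) * (x * legendreP l x - legendreP (l + 1) x)) =
      (1 - x ^ 2) * (deriv (legendreP m) x * deriv (legendreP l) x) := by
    intro x hx
    rw [Set.uIcc_of_le (by norm_num)] at hx
    rcases hx.1.eq_or_lt with rfl | h0
    · simp [legendreP_neg_one, pow_succ]
    rcases hx.2.eq_or_lt with rfl | h1
    · simp [legendreP_one]
    rw [← legendreP_one_sub_sq_mul_deriv l ⟨h0, h1⟩]
    ring
  rw [intervalIntegral.integral_congr e] at h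
  rw [← intervalIntegral.integral_const_mul]
  have e2 : ∀ x, (l : ℝ) * (l + 1) * (legendreP m x * legendreP l x) =
    -(legendreP m x * -(l * (l + 1) * legendreP l x)) := fun x => by ring
  simp only [e2]
  rw [intervalIntegral.integral_neg, h]
  ring

theorem integral_legendreP_mul_of_ne {l m : ℕ} (h : l ≠ m) :
    ∫ x in (-1 : ℝ)..1, legendreP m x * legendreP l x = 0 := by
  have h1 := integral_legendreP_flux l m
  have h2 := integral_legendreP_flux m l
  simp only [mul_comm (deriv (legendreP l) _), mul_comm (legendreP l _)] at h2
  rw [← h1, ← sub_eq_zero, ← sub_mul] at h2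
  refine (mul_eq_zero.1 h2).resolve_left fun h3 => h ?_
  have h4 : ((m : ℝ) - l) * (m + l + 1) = 0 := by linear_combination h3
  have h5 : (m : ℝ) - l = 0 := (mul_eq_zero.1 h4).resolve_right (by positivity)
  exact_mod_cast (sub_eq_zero.1 h5).symm

/-- The integral of x P_{n+1} P_{n+2} is related to both norms: one instance of Bonnet's recursion
is paired with P_{n+2}, the next with P_{n+1}, and orthogonality removes the third term each time.
Hence (2n+1) times the squared norm is constant. -/
theorem integral_legendreP_sq (n : ℕ) :
    (2 * n + 1) * ∫ x in (-1 : ℝ)..1, legendreP n x * legendreP n x = 2 := by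
  have hc := fun n => continuous_legendreP n
  induction n using Nat.twoStepInduction with
  | zero => simp [legendreP]; norm_num
  | one =>
    simp only [legendreP]
    have : ∫ x in (-1 : ℝ)..1, x * x = 2 / 3 := by
      simp only [← sq]
      rw [integral_pow]
      norm_num
    rw [this]
    norm_num
  | more n _ ih =>
    have hb := fun x => isLegendreLike_legendreP.bonnet n x
    have hb' := fun x => isLegendreLike_legendreP.bonnet (n + 1) x
    have ii : ∀ a b : ℕ, IntervalIntegrable (fun x => legendreP a x * legendreP b x) volume (-1) 1 :=
      fun a b => ((hc a).mul (hc b)).intervalIntegrable _ _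
    have ix : IntervalIntegrable (fun x => x * (legendreP (n + 1) x * legendreP (n + 2) x)) volume
        (-1) 1 := (continuous_id.mul ((hc _).mul (hc _))).intervalIntegrable _ _
    have e1 : ((n : ℝ) + 2) * (∫ x in (-1 : ℝ)..1, legendreP (n + 2) x * legendreP (n + 2) x) =
        (2 * n + 3) * ∫ x in (-1 : ℝ)..1, x * (legendreP (n + 1) x * legendreP (n + 2) x) := by
      have h0 := integral_legendreP_mul_of_ne (show n + 2 ≠ n by omega)
      rw [← sub_eq_zero, ← intervalIntegral.integral_const_mul, ← intervalIntegral.integral_const_mul,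
        ← intervalIntegral.integral_sub ((ii _ _).const_mul _) (ix.const_mul _)]
      rw [← mul_zero (-((n : ℝ) + 1)), ← h0, ← intervalIntegral.integral_const_mul]
      refine intervalIntegral.integral_congr fun x _ => ?_
      linear_combination legendreP (n + 2) x * hb x
    have e2 : (2 * (n : ℝ) + 5) * (∫ x in (-1 : ℝ)..1, x * (legendreP (n + 1) x * legendreP (n + 2) x)) =
        (n + 2) * ∫ x in (-1 : ℝ)..1, legendreP (n + 1) x * legendreP (n + 1) x := by
      have h0 := integral_legendreP_mul_of_ne (show n + 1 ≠ n + 3 by omega)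
      rw [← sub_eq_zero, ← intervalIntegral.integral_const_mul, ← intervalIntegral.integral_const_mul,
        ← intervalIntegral.integral_sub (ix.const_mul _) ((ii _ _).const_mul _)]
      rw [← mul_zero ((n : ℝ) + 3), ← h0, ← intervalIntegral.integral_const_mul]
      refine intervalIntegral.integral_congr fun x _ => ?_
      have := hb' x
      push_cast at this
      have e : legendreP (n + 3) x = legendreP (n + 1 + 2) x := rfl
      have e' : legendreP (n + 2) x = legendreP (n + 1 + 1) x := rfl
      simp only [e, e']
      linear_combination -legendreP (n + 1) x * this
    push_cast at ih ⊢
    set I2 := ∫ x in (-1 : ℝ)..1, legendreP (n + 2) x * legendreP (n + 2) x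
    set I1 := ∫ x in (-1 : ℝ)..1, legendreP (n + 1) x * legendreP (n + 1) x
    have hn : (n : ℝ) + 2 ≠ 0 := by positivity
    refine mul_left_cancel₀ hn ?_
    linear_combination (2 * (n : ℝ) + 5) * e1 + (2 * (n : ℝ) + 3) * e2 + ((n : ℝ) + 2) * ih

theorem coeff_Y (l m : ℕ) : coeff (Y m) l = if l = m then 1 else 0 := by
  have e : ∀ s : S2, Y m s * Y l s = √((2 * m + 1) / (4 * Real.pi)) * √((2 * l + 1) / (4 * Real.pi)) *
      (legendreP m (s.1 2) * legendreP l (s.1 2)) := fun s => by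
    have e1 : ∀ l, Y l s = √((2 * l + 1) / (4 * Real.pi)) * legendreP l (s.1 2) := fun _ => rfl
    rw [e1, e1]
    ring
  rw [coeff, pairing, integral_congr_ae (.of_forall e), integral_const_mul,
    integral_area_comp (h := fun x => legendreP m x * legendreP l x)
      ((continuous_legendreP m).mul (continuous_legendreP l)).continuousOn]
  split_ifs with h
  · subst h
    rw [Real.mul_self_sqrt (by positivity)]
    have := integral_legendreP_sq l
    have hpi := Real.pi_pos.ne'
    rw [show (2 * (l : ℝ) + 1) / (4 * Real.pi) * (2 * Real.pi * ∫ x in (-1 : ℝ)..1,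
      legendreP l x * legendreP l x) = ((2 * (l : ℝ) + 1) * ∫ x in (-1 : ℝ)..1,
      legendreP l x * legendreP l x) / 2 by field_simp; norm_num, this]
    norm_num
  · rw [integral_legendreP_mul_of_ne h]
    simp

end Gowdy

end

/-! ### Completeness of the zonal harmonics, Parseval's identity and mode coefficients. -/

noncomputable section

namespace Gowdy

/-- Bonnet's recursion shows that the span is stable under multiplication by x, and it contains 1.
-/
theorem polynomial_mem_span_legendreP (p : Polynomial ℝ) :
    (fun x => p.eval x) ∈ Submodule.span ℝ (Set.range legendreP) := by
  set S := Submodule.span ℝ (Set.range legendreP) with hS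
  have hP : ∀ n, legendreP n ∈ S := fun n => Submodule.subset_span ⟨n, rfl⟩
  have hx : ∀ g ∈ S, (fun x => x * g x) ∈ S := by
    intro g hg
    induction hg using Submodule.span_induction with
    | mem g hg =>
      obtain ⟨n, rfl⟩ := hg
      rcases n with _ | n
      · exact (show (fun x => x * legendreP 0 x) = legendreP 1 by
          funext x; simp [legendreP]) ▸ hP 1
      · have e : (fun x => x * legendreP (n + 1) x) =
            (((n : ℝ) + 2) / (2 * n + 3)) • legendreP (n + 2) +
              (((n : ℝ) + 1) / (2 * n + 3)) • legendreP n := by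
          funext x
          have := isLegendreLike_legendreP.bonnet n x
          simp only [Pi.add_apply, Pi.smul_apply, smul_eq_mul]
          have h3 : (2 * (n : ℝ) + 3) ≠ 0 := by positivity
          field_simp
          linear_combination -this
        rw [e]
        exact S.add_mem (S.smul_mem _ (hP _)) (S.smul_mem _ (hP _))
    | zero =>
      have : (fun x : ℝ => x * (0 : ℝ → ℝ) x) = 0 := by funext x; simp
      rw [this]
      exact S.zero_mem
    | add g h _ _ ihg ihh =>
      have : (fun x : ℝ => x * (g + h) x) = (fun x => x * g x) + fun x => x * h x := by
        funext x; simp [mul_add]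
      rw [this]
      exact S.add_mem ihg ihh
    | smul c g _ ih =>
      have : (fun x : ℝ => x * (c • g) x) = c • fun x => x * g x := by
        funext x; simp [mul_left_comm]
      rw [this]
      exact S.smul_mem c ih
  have hm : ∀ n : ℕ, (fun x : ℝ => x ^ n) ∈ S := by
    intro n
    induction n with
    | zero => exact (show (fun x : ℝ => x ^ 0) = legendreP 0 by funext x; simp [legendreP]) ▸ hP 0
    | succ n ih => exact (show (fun x : ℝ => x ^ (n + 1)) = fun x => x * x ^ n by
        funext x; ring) ▸ hx _ ih
  induction p using Polynomial.induction_on' with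
  | add p q hp hq =>
    have : (fun x => (p + q).eval x) = (fun x => p.eval x) + fun x => q.eval x := by
      funext x; simp
    rw [this]
    exact S.add_mem hp hq
  | monomial n a =>
    have : (fun x => (Polynomial.monomial n a).eval x) = a • fun x => x ^ n := by
      funext x; simp
    rw [this]
    exact S.smul_mem a (hm n)

theorem exists_span_Y_near (f : TestFn) {ε : ℝ} (hε : 0 < ε) :
    ∃ g ∈ Submodule.span ℝ (Set.range Y), ∀ s, |f s - g s| ≤ ε := by
  have hF : Continuous (profile f) :=
    continuous_iff_continuousAt.2 fun a => (hasDerivAt_profile f a).continuousAt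
  obtain ⟨p, hp⟩ := exists_polynomial_near_of_continuousOn (-1) 1
    (fun x => profile f (Real.arccos x)) (hF.comp Real.continuous_arccos).continuousOn ε hε
  have hspan : ∀ q ∈ Submodule.span ℝ (Set.range legendreP),
      ∃ g ∈ Submodule.span ℝ (Set.range Y), ∀ s : S2, g s = q (s.1 2) := by
    intro q hq
    induction hq using Submodule.span_induction with
    | mem q hq =>
      obtain ⟨n, rfl⟩ := hq
      have h0 : √((2 * n + 1) / (4 * Real.pi)) ≠ 0 := (Real.sqrt_pos.2 (by positivity)).ne'
      refine ⟨(√((2 * n + 1) / (4 * Real.pi)))⁻¹ • Y n,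
        Submodule.smul_mem _ _ (Submodule.subset_span ⟨n, rfl⟩), fun s => ?_⟩
      rw [TestFn.smul_apply]
      have e1 : Y n s = √((2 * n + 1) / (4 * Real.pi)) * legendreP n (s.1 2) := rfl
      rw [e1, inv_mul_cancel_left₀ h0]
    | zero => exact ⟨0, Submodule.zero_mem _, fun s => rfl⟩
    | add q r _ _ ihq ihr =>
      obtain ⟨g, hg, hgs⟩ := ihq
      obtain ⟨h, hh, hhs⟩ := ihr
      refine ⟨g + h, Submodule.add_mem _ hg hh, fun s => ?_⟩
      rw [TestFn.add_apply, hgs, hhs, Pi.add_apply]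
    | smul c q _ ih =>
      obtain ⟨g, hg, hgs⟩ := ih
      refine ⟨c • g, Submodule.smul_mem _ _ hg, fun s => ?_⟩
      rw [TestFn.smul_apply, hgs, Pi.smul_apply, smul_eq_mul]
  obtain ⟨g, hg, hgs⟩ := hspan _ (polynomial_mem_span_legendreP p)
  refine ⟨g, hg, fun s => ?_⟩
  rw [hgs, apply_eq_profile, abs_sub_comm]
  exact (hp _ (abs_le.1 (abs_apply_le_one s 2))).le

/-- The truncated expansion of a test function in spherical harmonics. -/
def trunc (f : TestFn) (N : ℕ) : TestFn := ∑ l ∈ Finset.range N, coeff f l • Y l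

theorem coeff_trunc (f : TestFn) (N l : ℕ) : coeff (trunc f N) l = if l < N then coeff f l else 0 := by
  rw [trunc, ← coeffL_apply, map_sum]
  simp only [coeffL_apply, coeff_smul, coeff_Y, mul_ite, mul_one, mul_zero]
  rw [Finset.sum_ite_eq]
  simp

theorem pairing_self_nonneg (f : TestFn) : 0 ≤ pairing f f :=
  integral_nonneg fun s => mul_self_nonneg (f s)

theorem pairingL_apply (f g : TestFn) : pairingL f g = pairing f g := rfl

theorem pairing_trunc_right (f g : TestFn) (N : ℕ) :
    pairing f (trunc g N) = ∑ l ∈ Finset.range N, coeff f l * coeff g l := by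
  rw [trunc, ← pairingL_apply, map_sum]
  refine Finset.sum_congr rfl fun l _ => ?_
  rw [map_smul, smul_eq_mul, mul_comm]
  rfl

theorem bessel (f : TestFn) : ∑' l, coeff f l * coeff f l ≤ pairing f f := by
  refine Real.tsum_le_of_sum_range_le (fun l => mul_self_nonneg _) fun N => ?_
  have h := pairing_self_nonneg (f - trunc f N)
  have e1 : pairing (trunc f N) (trunc f N) = ∑ l ∈ Finset.range N, coeff f l * coeff f l := by
    rw [pairing_trunc_right]
    refine Finset.sum_congr rfl fun l hl => ?_
    rw [coeff_trunc, if_pos (Finset.mem_range.1 hl)]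
  have e2 := pairing_trunc_right f f N
  have e3 : pairing (f - trunc f N) (f - trunc f N) = pairing f f - pairing f (trunc f N) -
      (pairing f (trunc f N) - pairing (trunc f N) (trunc f N)) := by
    rw [pairing_comm f (trunc f N)]
    simp only [← pairingL_apply, map_sub, LinearMap.sub_apply]
    rw [pairingL_apply f (trunc f N), pairing_comm, ← pairingL_apply]
  rw [e3, e1, e2] at h
  linarith

theorem summable_coeff_mul (f g : TestFn) : Summable fun l => coeff f l * coeff g l :=
  Summable.mul_of_sq (summable_coeff_sq f) (summable_coeff_sq g)

/-- The defect in Parseval's identity, as a bilinear form. -/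
def parsevalDefect : TestFn →ₗ[ℝ] TestFn →ₗ[ℝ] ℝ :=
  pairingL - LinearMap.mk₂ ℝ (fun f g => ∑' l, coeff f l * coeff g l)
    (fun f g h => by
      rw [← (summable_coeff_mul f h).tsum_add (summable_coeff_mul g h)]
      simp only [coeff_add, add_mul])
    (fun c f g => by
      rw [smul_eq_mul, ← tsum_mul_left]
      simp only [coeff_smul, mul_assoc])
    (fun f g h => by
      rw [← (summable_coeff_mul f g).tsum_add (summable_coeff_mul f h)]
      simp only [coeff_add, mul_add])
    (fun c f g => by
      rw [smul_eq_mul, ← tsum_mul_left]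
      simp only [coeff_smul, mul_left_comm])

theorem parsevalDefect_apply (f g : TestFn) :
    parsevalDefect f g = pairing f g - ∑' l, coeff f l * coeff g l := rfl

theorem parsevalDefect_comm (f g : TestFn) : parsevalDefect f g = parsevalDefect g f := by
  rw [parsevalDefect_apply, parsevalDefect_apply, pairing_comm]
  simp only [mul_comm]

/-- The form is nonnegative by Bessel's inequality and annihilates the span of the harmonics.
Subtracting a uniformly close element of that span does not change its value, which is then at most
the small L² norm of the remainder. -/
theorem parsevalDefect_self (f : TestFn) : parsevalDefect f f = 0 := by
  have hY : ∀ g ∈ Submodule.span ℝ (Set.range Y), ∀ f, parsevalDefect f g = 0 := by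
    intro g hg f
    induction hg using Submodule.span_induction with
    | mem g hg =>
      obtain ⟨n, rfl⟩ := hg
      rw [parsevalDefect_apply]
      simp only [coeff_Y, mul_ite, mul_one, mul_zero]
      rw [tsum_ite_eq]
      exact sub_self _
    | zero => exact map_zero _
    | add g h _ _ ihg ihh => rw [map_add, ihg, ihh, add_zero]
    | smul c g _ ih => rw [map_smul, ih, smul_zero]
  have h0 : 0 ≤ parsevalDefect f f := sub_nonneg.2 (bessel f)
  refine le_antisymm (le_of_forall_pos_le_add fun ε hε => ?_) h0
  set A := area.real Set.univ + 1
  have hA : 0 < A := by positivity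
  obtain ⟨g, hg, hfg⟩ := exists_span_Y_near f (ε := √(ε / A)) (Real.sqrt_pos.2 (by positivity))
  have e : parsevalDefect f f = parsevalDefect (f - g) (f - g) := by
    simp only [map_sub, LinearMap.sub_apply]
    rw [hY g hg f, hY g hg g, parsevalDefect_comm g f, hY g hg f]
    ring
  have h1 : pairing (f - g) (f - g) ≤ ε / A * area.real Set.univ := by
    refine (le_abs_self _).trans ?_
    rw [pairing, ← Real.norm_eq_abs]
    refine norm_integral_le_of_norm_le_const (.of_forall fun s => ?_)
    have h2 := hfg s
    rw [TestFn.sub_apply, norm_mul, Real.norm_eq_abs, ← sq,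
      ← Real.sq_sqrt (show 0 ≤ ε / A by positivity)]
    gcongr
  have h3 : 0 ≤ ∑' l, coeff (f - g) l * coeff (f - g) l := tsum_nonneg fun l => mul_self_nonneg _
  have h4 : ε / A * area.real Set.univ ≤ ε := by
    rw [div_mul_eq_mul_div, div_le_iff₀ hA]
    have : area.real Set.univ ≤ A := by simp only [A]; linarith
    gcongr
  rw [e, parsevalDefect_apply]
  linarith

/-- Parseval's identity. -/
theorem hasSum_pairing (f g : TestFn) : HasSum (fun l => coeff f l * coeff g l) (pairing f g) := by
  -- Polarization of the symmetric form.
  have h := parsevalDefect_self (f + g)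
  simp only [map_add, LinearMap.add_apply, parsevalDefect_self] at h
  rw [parsevalDefect_comm g f, zero_add, add_zero, ← two_mul, mul_eq_zero_iff_left two_ne_zero,
    parsevalDefect_apply, sub_eq_zero] at h
  rw [h]
  exact (summable_coeff_mul f g).hasSum

/-! ### Mode coefficients of Cauchy data -/

open ComplexConjugate

theorem modeCoeff_add (z : ℕ → ℝ → ℂ) (t : ℝ) (v w : PhaseSpace) (l : ℕ) :
    modeCoeff z t (v + w) l = modeCoeff z t v l + modeCoeff z t w l := by
  simp only [modeCoeff, Prod.fst_add, Prod.snd_add, coeff_add]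
  push_cast
  ring

theorem modeCoeff_smul (z : ℕ → ℝ → ℂ) (t : ℝ) (c : ℝ) (w : PhaseSpace) (l : ℕ) :
    modeCoeff z t (c • w) l = c * modeCoeff z t w l := by
  simp only [modeCoeff, Prod.smul_fst, Prod.smul_snd, coeff_smul]
  push_cast
  ring

theorem modeCoeff_neg (z : ℕ → ℝ → ℂ) (t : ℝ) (w : PhaseSpace) (l : ℕ) :
    modeCoeff z t (-w) l = -modeCoeff z t w l := by
  simp only [modeCoeff, Prod.fst_neg, Prod.snd_neg, coeff_neg]
  push_cast
  ring

theorem modeCoeff_sub (z : ℕ → ℝ → ℂ) (t : ℝ) (v w : PhaseSpace) (l : ℕ) :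
    modeCoeff z t (v - w) l = modeCoeff z t v l - modeCoeff z t w l := by
  rw [sub_eq_add_neg, modeCoeff_add, modeCoeff_neg, sub_eq_add_neg]

/-- The decay of coefficients of smooth functions compensates the growth √λ of ż. Every phase-space
vector thus defines an element of the one-particle space. -/
theorem ModeData.summable_modeCoeff_sq {z : ℕ → ℝ → ℂ} {t : ℝ} (h : ModeData z t) (w : PhaseSpace) :
    Summable fun l => ‖modeCoeff z t w l‖ ^ 2 := by
  obtain ⟨C, hC, hb⟩ := h.bound
  refine Summable.of_nonneg_of_le (fun l => sq_nonneg _) (fun l => ?_)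
    (((summable_coeff_sq w.2).mul_left (4 * C ^ 2)).add
      ((summable_coeff_mul_sqrt w.1).mul_left (2 * C ^ 2)))
  obtain ⟨h1, h2⟩ := hb l
  have hl : (0 : ℝ) ≤ l := Nat.cast_nonneg l
  have h3 : ‖z l t‖ ^ 2 * (l + 1 / 2) ≤ C ^ 2 := by
    rw [← Real.sq_sqrt (show (0 : ℝ) ≤ l + 1 / 2 by positivity), ← mul_pow]
    gcongr
  have h4 : ‖deriv (z l) t‖ ^ 2 ≤ C ^ 2 * (l + 1 / 2) := by
    rw [← Real.sq_sqrt (show (0 : ℝ) ≤ l + 1 / 2 by positivity), ← mul_pow]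
    gcongr
  have h5 : ‖modeCoeff z t w l‖ ≤ ‖z l t‖ * |coeff w.2 l| + ‖deriv (z l) t‖ * |coeff w.1 l| := by
    refine (norm_sub_le _ _).trans (le_of_eq ?_)
    simp [Complex.norm_I, Complex.norm_real]
  have h6 : ‖modeCoeff z t w l‖ ^ 2 ≤
      (‖z l t‖ * |coeff w.2 l| + ‖deriv (z l) t‖ * |coeff w.1 l|) ^ 2 := by gcongr
  refine h6.trans ?_
  have h7 : ‖z l t‖ ^ 2 ≤ 2 * C ^ 2 := by nlinarith [sq_nonneg ‖z l t‖]
  have h8 := mul_le_mul_of_nonneg_right h7 (sq_nonneg (coeff w.2 l))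
  have h9 := mul_le_mul_of_nonneg_right h4 (sq_nonneg (coeff w.1 l))
  have e2 : |coeff w.2 l| ^ 2 = coeff w.2 l ^ 2 := sq_abs _
  have e1 : |coeff w.1 l| ^ 2 = coeff w.1 l ^ 2 := sq_abs _
  rw [← e2] at h8 ⊢
  rw [← e1] at h9 ⊢
  nlinarith [sq_nonneg (‖z l t‖ * |coeff w.2 l| - ‖deriv (z l) t‖ * |coeff w.1 l|)]

/-- The Wronskian says that the map from data to mode coefficients is symplectic, mode by mode.
Evolution keeps the coefficients, so it will preserve the symplectic form. -/
theorem ModeData.im_modeCoeff {z : ℕ → ℝ → ℂ} {t : ℝ} (h : ModeData z t) (v w : PhaseSpace) (l : ℕ) :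
    (conj (modeCoeff z t v l) * modeCoeff z t w l).im =
      -(1 / 2) * (coeff w.1 l * coeff v.2 l - coeff v.1 l * coeff w.2 l) := by
  have hw := h.wronskian l
  have h1 : conj (modeCoeff z t v l) * modeCoeff z t w l -
      conj (conj (modeCoeff z t v l) * modeCoeff z t w l) =
      ((-(coeff w.1 l * coeff v.2 l - coeff v.1 l * coeff w.2 l) : ℝ) : ℂ) * Complex.I := by
    simp only [modeCoeff, map_mul, map_sub, map_neg, Complex.conj_I, Complex.conj_conj,
      Complex.conj_ofReal]
    push_cast
    linear_combination (-(coeff w.1 l * coeff v.2 l - coeff v.1 l * coeff w.2 l) : ℂ) * hw -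
      (-(coeff w.1 l * coeff v.2 l - coeff v.1 l * coeff w.2 l) : ℂ) *
        (z l t * conj (deriv (z l) t) - conj (z l t) * deriv (z l) t) * (Complex.I_sq)
  rw [Complex.sub_conj] at h1
  have h2 := Complex.ofReal_injective (mul_right_cancel₀ Complex.I_ne_zero h1)
  linarith

theorem ModeData.hasSum_im_modeCoeff {z : ℕ → ℝ → ℂ} {t : ℝ} (h : ModeData z t) (v w : PhaseSpace) :
    HasSum (fun l => (conj (modeCoeff z t v l) * modeCoeff z t w l).im) (-(1 / 2) * symp v w) := by
  simp only [h.im_modeCoeff]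
  exact ((hasSum_pairing w.1 v.2).sub (hasSum_pairing v.1 w.2)).mul_left _

theorem ModeData.sympJ_eq {z : ℕ → ℝ → ℂ} {t : ℝ} (w : PhaseSpace) :
    sympJ z t w = 2 * ∑' l, ‖modeCoeff z t w l‖ ^ 2 := by
  rw [sympJ, ← tsum_mul_left]
  congr 1
  funext l
  have e : conj (modeCoeff z t w l) = Complex.I * (deriv (z l) t * coeff w.1 l - z l t * coeff w.2 l) := by
    simp only [modeCoeff, map_mul, map_sub, Complex.conj_I, Complex.conj_conj, Complex.conj_ofReal]
    ring
  have e2 : ((‖modeCoeff z t w l‖ ^ 2 : ℝ) : ℂ) = modeCoeff z t w l * conj (modeCoeff z t w l) := by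
    rw [Complex.mul_conj']
    push_cast
    ring
  have e3 := congrArg Complex.re e2
  rw [Complex.ofReal_re, e] at e3
  rw [e3]
  simp only [Jcoeff]
  rw [show modeCoeff z t w l * (Complex.I * (deriv (z l) t * coeff w.1 l - z l t * coeff w.2 l)) =
    (coeff w.1 l : ℂ) * (Complex.I * modeCoeff z t w l * deriv (z l) t) -
      (coeff w.2 l : ℂ) * (Complex.I * modeCoeff z t w l * z l t) by ring, Complex.sub_re,
    Complex.re_ofReal_mul, Complex.re_ofReal_mul]
  ring

end Gowdy

end

noncomputable section

namespace Gowdy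

/-! ### Unitary operators from equal Gram matrices -/

section Gram

variable {ι H K : Type*} [NormedAddCommGroup H] [InnerProductSpace ℂ H] 
  [NormedAddCommGroup K] [InnerProductSpace ℂ K] 

theorem denseRange_linearCombination {x : ι → H}
    (hx : Dense (Submodule.span ℂ (Set.range x) : Set H)) :
    DenseRange (Finsupp.linearCombination ℂ x) := by
  rw [DenseRange, ← LinearMap.coe_range, Finsupp.range_linearCombination]
  exact hx

theorem inner_linearCombination_eq {x : ι → H} {y : ι → K}
    (h : ∀ i j, inner ℂ (x i) (x j) = inner ℂ (y i) (y j)) (c d : ι →₀ ℂ) :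
    inner ℂ (Finsupp.linearCombination ℂ x c) (Finsupp.linearCombination ℂ x d) =
      inner ℂ (Finsupp.linearCombination ℂ y c) (Finsupp.linearCombination ℂ y d) := by
  simp only [Finsupp.linearCombination_apply, Finsupp.sum, sum_inner, inner_sum, inner_smul_left,
    inner_smul_right, h]

/-- Two total families with the same Gram matrix are related by a unitary. -/
theorem exists_unitary_of_gram [CompleteSpace H] [CompleteSpace K] {x : ι → H} {y : ι → K}
    (h : ∀ i j, inner ℂ (x i) (x j) = inner ℂ (y i) (y j))
    (hx : Dense (Submodule.span ℂ (Set.range x) : Set H))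
    (hy : Dense (Submodule.span ℂ (Set.range y) : Set K)) :
    ∃ U : H ≃ₗᵢ[ℂ] K, ∀ i, U (x i) = y i := by
  have hn : ∀ c : ι →₀ ℂ, ‖Finsupp.linearCombination ℂ y (LinearEquiv.refl ℂ _ c)‖ =
      ‖Finsupp.linearCombination ℂ x c‖ := by
    intro c
    rw [@norm_eq_sqrt_re_inner ℂ, @norm_eq_sqrt_re_inner ℂ, LinearEquiv.refl_apply,
      inner_linearCombination_eq h]
  refine ⟨(LinearEquiv.refl ℂ (ι →₀ ℂ)).extendOfIsometry (Finsupp.linearCombination ℂ x)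
    (Finsupp.linearCombination ℂ y) (denseRange_linearCombination hx)
    (denseRange_linearCombination hy) hn, fun i => ?_⟩
  have := (LinearEquiv.refl ℂ (ι →₀ ℂ)).extendOfIsometry_eq _ _ (denseRange_linearCombination hx)
    (denseRange_linearCombination hy) hn (Finsupp.single i 1)
  simpa using this

theorem eq_of_eqOn_total {x : ι → H} (hx : Dense (Submodule.span ℂ (Set.range x) : Set H))
    {f g : H →L[ℂ] K} (h : ∀ i, f (x i) = g (x i)) : f = g := by
  refine ContinuousLinearMap.ext_on hx ?_
  rintro _ ⟨i, rfl⟩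
  exact h i

theorem total_of_inner [CompleteSpace H] {x : ι → H}
    (h : ∀ v : H, (∀ i, inner ℂ (x i) v = 0) → v = 0) :
    Dense (Submodule.span ℂ (Set.range x) : Set H) := by
  rw [Submodule.dense_iff_topologicalClosure_eq_top, Submodule.topologicalClosure_eq_top_iff,
    Submodule.eq_bot_iff]
  intro v hv
  exact h v fun i => hv _ (Submodule.subset_span ⟨i, rfl⟩)

end Gram

end Gowdy

end

noncomputable section

namespace Gowdy

/-! ### Measures on the dual space and their Fourier transforms -/

/-- The embedding of the dual space into the space of all functions. -/
def Distr.eval (T : Distr) (f : TestFn) : ℝ := T f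

theorem Distr.measurableSpace_eq :
    instMeasurableSpaceDistr = MeasurableSpace.pi.comap Distr.eval := by
  rw [MeasurableSpace.pi, MeasurableSpace.comap_iSup]
  simp only [MeasurableSpace.comap_comp]
  exact congrArg iSup (funext fun f => by
    rw [← BorelSpace.measurable_eq (α := ℝ)]
    rfl)

theorem Distr.measurable_eval : Measurable Distr.eval := by
  rw [measurable_iff_comap_le]
  exact Distr.measurableSpace_eq.symm.le

theorem Distr.measurable_apply (f : TestFn) : Measurable fun T : Distr => T f :=
  (measurable_pi_apply f).comp Distr.measurable_eval

theorem Distr.measurable_of_apply {α : Type*} [MeasurableSpace α] {F : α → Distr}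
    (h : ∀ f, Measurable fun a => F a f) : Measurable F := by
  rw [measurable_iff_comap_le, Distr.measurableSpace_eq, MeasurableSpace.comap_comp,
    ← measurable_iff_comap_le]
  exact measurable_pi_iff.2 h

theorem Distr.apply_add (T : Distr) (f g : TestFn) : T (f + g) = T f + T g :=
  map_add (show TestFn →L[ℝ] ℝ from T) f g

theorem Distr.apply_smul (T : Distr) (c : ℝ) (f : TestFn) : T (c • f) = c * T f :=
  map_smul (show TestFn →L[ℝ] ℝ from T) c f

theorem Distr.apply_zero (T : Distr) : T 0 = 0 :=
  map_zero (show TestFn →L[ℝ] ℝ from T)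

theorem Distr.apply_neg (T : Distr) (f : TestFn) : T (-f) = -T f := by
  rw [← neg_one_smul ℝ f, T.apply_smul, neg_one_mul]

theorem Distr.apply_sum {ι : Type*} (T : Distr) (s : Finset ι) (f : ι → TestFn) :
    T (∑ i ∈ s, f i) = ∑ i ∈ s, T (f i) :=
  map_sum (show TestFn →L[ℝ] ℝ from T) f s

/-- The character `T ↦ exp (i T f)`. -/
def chr (f : TestFn) (T : Distr) : ℂ := Complex.exp (Complex.I * (T f : ℝ))

theorem measurable_chr (f : TestFn) : Measurable (chr f) :=
  Complex.measurable_exp.comp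
    ((Complex.measurable_ofReal.comp (Distr.measurable_apply f)).const_mul _)

theorem norm_chr (f : TestFn) (T : Distr) : ‖chr f T‖ = 1 := by
  rw [chr, mul_comm, Complex.norm_exp_ofReal_mul_I]

theorem chr_add (f g : TestFn) (T : Distr) : chr (f + g) T = chr f T * chr g T := by
  rw [chr, chr, chr, ← Complex.exp_add, Distr.apply_add]
  push_cast
  ring_nf

theorem chr_neg (f : TestFn) (T : Distr) : chr (-f) T = (starRingEnd ℂ) (chr f T) := by
  rw [chr, chr, ← Complex.exp_conj, Distr.apply_neg, map_mul, Complex.conj_I, Complex.conj_ofReal]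
  push_cast
  ring_nf

theorem chr_zero (T : Distr) : chr 0 T = 1 := by
  rw [chr, Distr.apply_zero]
  simp

theorem integrable_chr_mul {μ : Measure Distr} {g : Distr → ℂ} (hg : Integrable g μ) (f : TestFn) :
    Integrable (fun T => chr f T * g T) μ :=
  hg.bdd_mul (measurable_chr f).aestronglyMeasurable (.of_forall fun T => (norm_chr f T).le)

/-- A finite measure on the dual space is determined by its Fourier transform. -/
theorem measure_ext_of_chr {μ ν : Measure Distr} [IsFiniteMeasure μ] [IsFiniteMeasure ν]
    (h : ∀ f, ∫ T, chr f T ∂μ = ∫ T, chr f T ∂ν) : μ = ν := by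
  classical
  have hmap : μ.map Distr.eval = ν.map Distr.eval := by
    -- Finite-dimensional marginals determine the measure and characteristic functions determine the
    -- marginals. A dual vector on a marginal is evaluation at one finite combination of test
    -- functions, so the characters suffice.
    refine IsProjectiveLimit.unique (P := fun I => (μ.map Distr.eval).map I.restrict)
      (fun I => rfl) (fun I => ?_)
    refine Measure.ext_of_charFunDual (funext fun L => ?_)
    have key : ∀ (κ : Measure Distr) [IsFiniteMeasure κ],
        charFunDual ((κ.map Distr.eval).map I.restrict) L =
          ∫ T, chr (∑ i : I, L (Pi.single i 1) • (i : TestFn)) T ∂κ := by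
      intro κ _
      rw [charFunDual_apply, integral_map (by fun_prop)
        (Measurable.aestronglyMeasurable (by fun_prop)), integral_map
        Distr.measurable_eval.aemeasurable (Measurable.aestronglyMeasurable (by fun_prop))]
      congr 1
      funext T
      rw [chr, mul_comm, Distr.apply_sum]
      congr 3
      conv_lhs => rw [← Finset.univ_sum_single (I.restrict T.eval), map_sum]
      refine Finset.sum_congr rfl fun i _ => ?_
      rw [Distr.apply_smul, mul_comm]
      have : (Pi.single i (I.restrict T.eval i) : I → ℝ) = T i • Pi.single i 1 := by
        rw [← Pi.single_smul, smul_eq_mul, mul_one]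
        rfl
      rw [this, map_smul, smul_eq_mul]
    rw [key, key, h]
  refine Measure.ext fun s hs => ?_
  rw [Distr.measurableSpace_eq] at hs
  obtain ⟨s', hs', rfl⟩ := hs
  rw [← Measure.map_apply Distr.measurable_eval hs', hmap,
    Measure.map_apply Distr.measurable_eval hs']

/-- The positive and negative parts of r, taken as densities, give finite measures with the same
Fourier transform, hence equal measures. -/
theorem ae_eq_zero_of_fourier_real {μ : Measure Distr} [IsFiniteMeasure μ] {r : Distr → ℝ}
    (hr : Integrable r μ) (h : ∀ f, ∫ T, chr f T * (r T : ℂ) ∂μ = 0) : r =ᵐ[μ] 0 := by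
  have hfin : ∀ r : Distr → ℝ, Integrable r μ →
      IsFiniteMeasure (μ.withDensity fun T => ENNReal.ofReal (r T)) := fun r hr =>
    isFiniteMeasure_withDensity_ofReal hr.2
  have := hfin r hr
  have := hfin _ hr.neg
  have hint : ∀ r : Distr → ℝ, Integrable r μ → ∀ f,
      ∫ T, chr f T ∂(μ.withDensity fun T => ENNReal.ofReal (r T)) =
        ∫ T, chr f T * ((max (r T) 0 : ℝ) : ℂ) ∂μ := by
    intro r hr f
    rw [integral_withDensity_eq_integral_toReal_smul₀ hr.1.aemeasurable.ennreal_ofReal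
      (.of_forall fun T => ENNReal.ofReal_lt_top)]
    congr 1
    funext T
    rw [ENNReal.toReal_ofReal', Complex.real_smul, mul_comm]
  have heq : (μ.withDensity fun T => ENNReal.ofReal (r T)) =
      μ.withDensity fun T => ENNReal.ofReal ((-r) T) := by
    refine measure_ext_of_chr fun f => ?_
    have hp : Integrable (fun T => ((max (r T) 0 : ℝ) : ℂ)) μ := hr.pos_part.ofReal
    have hn : Integrable (fun T => ((max ((-r) T) 0 : ℝ) : ℂ)) μ := hr.neg.pos_part.ofReal
    rw [hint r hr, hint _ hr.neg, ← sub_eq_zero, ← integral_sub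
      (integrable_chr_mul hp f) (integrable_chr_mul hn f), ← h f]
    congr 1
    funext T
    rw [← mul_sub, ← Complex.ofReal_sub]
    congr 2
    simp only [Pi.neg_apply]
    rcases le_total (r T) 0 with h0 | h0
    · rw [max_eq_right h0, max_eq_left (by linarith)]
      ring
    · rw [max_eq_left h0, max_eq_right (by linarith)]
      ring
  rw [withDensity_eq_iff hr.1.aemeasurable.ennreal_ofReal hr.neg.1.aemeasurable.ennreal_ofReal
    (by
      have := (isFiniteMeasure_withDensity_ofReal hr.2).measure_univ_lt_top
      rw [withDensity_apply _ MeasurableSet.univ, Measure.restrict_univ] at this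
      exact this.ne)] at heq
  filter_upwards [heq] with T hT
  simp only [Pi.neg_apply] at hT
  show r T = 0
  rcases le_total (r T) 0 with h0 | h0
  · rw [ENNReal.ofReal_of_nonpos h0, eq_comm, ENNReal.ofReal_eq_zero] at hT
    exact le_antisymm h0 (by linarith)
  · rw [ENNReal.ofReal_of_nonpos (p := -r T) (by linarith), ENNReal.ofReal_eq_zero] at hT
    exact le_antisymm hT h0

/-- Conjugation together with f ↦ −f shows that the transform of the conjugate of g vanishes too, so
the real case applies to both the real and the imaginary part. -/
theorem ae_eq_zero_of_fourier {μ : Measure Distr} [IsFiniteMeasure μ] {g : Distr → ℂ}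
    (hg : Integrable g μ) (h : ∀ f, ∫ T, chr f T * g T ∂μ = 0) : g =ᵐ[μ] 0 := by
  have hc : ∀ f, ∫ T, chr f T * (starRingEnd ℂ) (g T) ∂μ = 0 := by
    intro f
    have h1 := congrArg (starRingEnd ℂ) (h (-f))
    rw [← integral_conj, map_zero] at h1
    rw [← h1]
    congr 1
    funext T
    rw [map_mul, chr_neg, Complex.conj_conj]
  have hgc : Integrable (fun T => (starRingEnd ℂ) (g T)) μ :=
    (Complex.conjLIE.integrable_comp_iff (φ := g)).2 hg
  have hre : (fun T => (g T).re) =ᵐ[μ] 0 := by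
    refine ae_eq_zero_of_fourier_real hg.re fun f => ?_
    have e : ∀ T, chr f T * ((g T).re : ℂ) =
        (1 / 2) * (chr f T * g T) + (1 / 2) * (chr f T * (starRingEnd ℂ) (g T)) := by
      intro T
      rw [Complex.re_eq_add_conj]
      ring
    simp only [e]
    rw [integral_add ((integrable_chr_mul hg f).const_mul _) ((integrable_chr_mul hgc f).const_mul _),
      integral_const_mul, integral_const_mul, h, hc]
    simp
  have him : (fun T => (g T).im) =ᵐ[μ] 0 := by
    refine ae_eq_zero_of_fourier_real hg.im fun f => ?_
    have e : ∀ T, chr f T * ((g T).im : ℂ) =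
        (1 / (2 * Complex.I)) * (chr f T * g T) -
          (1 / (2 * Complex.I)) * (chr f T * (starRingEnd ℂ) (g T)) := by
      intro T
      rw [Complex.im_eq_sub_conj]
      ring
    simp only [e]
    rw [integral_sub ((integrable_chr_mul hg f).const_mul _) ((integrable_chr_mul hgc f).const_mul _),
      integral_const_mul, integral_const_mul, h, hc]
    simp
  filter_upwards [hre, him] with T h1 h2
  exact Complex.ext h1 h2

end Gowdy

end

noncomputable section

namespace Gowdy

/-! ### Multiplication by characters -/

variable {μ : ProbabilityMeasure Distr}

theorem memLp_chr_mul (f : TestFn) (ψ : HS μ) : MemLp (fun T => chr f T * ψ T) 2 (μ : Measure Distr) := by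
  refine (Lp.memLp ψ).of_le ((measurable_chr f).aestronglyMeasurable.mul (Lp.aestronglyMeasurable ψ))
    (.of_forall fun T => ?_)
  rw [norm_mul, norm_chr, one_mul]

/-- Multiplication by `exp (i T f)` on `L²(μ)`. -/
def chrMul (f : TestFn) (ψ : HS μ) : HS μ := (memLp_chr_mul f ψ).toLp _

theorem coeFn_chrMul (f : TestFn) (ψ : HS μ) :
    chrMul f ψ =ᵐ[(μ : Measure Distr)] fun T => chr f T * ψ T :=
  (memLp_chr_mul f ψ).coeFn_toLp

theorem coeFn_vac : vac μ =ᵐ[(μ : Measure Distr)] fun _ => (1 : ℂ) := MemLp.coeFn_toLp _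

theorem norm_vac : ‖vac μ‖ = 1 := by
  rw [vac, Lp.norm_toLp, eLpNorm_const _ two_ne_zero (NeZero.ne _)]
  simp

theorem inner_HS (φ ψ : HS μ) :
    inner ℂ φ ψ = ∫ T, (starRingEnd ℂ) (φ T) * ψ T ∂(μ : Measure Distr) := by
  rw [L2.inner_def]
  congr 1
  funext T
  rw [RCLike.inner_apply, mul_comm]

theorem integrable_conj_mul (φ ψ : HS μ) :
    Integrable (fun T => (starRingEnd ℂ) (φ T) * ψ T) (μ : Measure Distr) := by
  refine (L2.integrable_inner (𝕜 := ℂ) φ ψ).congr (.of_forall fun T => ?_)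
  simp only [RCLike.inner_apply]
  rw [mul_comm]

/-- If `Φ` vanishes almost nowhere, the vectors `exp (i T f) Φ` are total. -/
theorem total_chrMul {Φ : HS μ} (hΦ : ∀ᵐ T ∂(μ : Measure Distr), Φ T ≠ 0) :
    Dense (Submodule.span ℂ (Set.range fun f => chrMul f Φ) : Set (HS μ)) := by
  refine total_of_inner fun v hv => ?_
  have h0 := ae_eq_zero_of_fourier (integrable_conj_mul Φ v) fun f => by
    have h1 := hv (-f)
    rw [inner_HS] at h1
    rw [← h1]
    refine integral_congr_ae ?_
    filter_upwards [coeFn_chrMul (-f) Φ] with T hT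
    rw [hT, map_mul, chr_neg, Complex.conj_conj, mul_assoc]
  refine Lp.eq_zero_iff_ae_eq_zero.2 ?_
  filter_upwards [h0, hΦ] with T h1 h2
  exact (mul_eq_zero.1 h1).resolve_left (by simpa using h2)

theorem total_chr : Dense (Submodule.span ℂ (Set.range fun f => chrMul f (vac μ)) : Set (HS μ)) :=
  total_chrMul (by filter_upwards [coeFn_vac (μ := μ)] with T hT; rw [hT]; exact one_ne_zero)

end Gowdy

end

noncomputable section

namespace Gowdy

/-! ### The Gaussian field -/

/-- The law of the mode coordinates `T(Y_ℓ)`. -/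
def gaussSeq (z : ℕ → ℝ → ℂ) (t : ℝ) : Measure (ℕ → ℝ) :=
  Measure.infinitePi fun l => ProbabilityTheory.gaussianReal 0 (‖z l t‖₊ ^ 2)

instance (z : ℕ → ℝ → ℂ) (t : ℝ) : IsProbabilityMeasure (gaussSeq z t) := by
  unfold gaussSeq; infer_instance

theorem gaussSeq_map_restrict (z : ℕ → ℝ → ℂ) (t : ℝ) (n : ℕ) :
    (gaussSeq z t).map (Finset.range n).restrict =
      Measure.pi fun l : Finset.range n => ProbabilityTheory.gaussianReal 0 (‖z l t‖₊ ^ 2) :=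
  Measure.infinitePi_map_restrict _

theorem integral_prod_gaussSeq (z : ℕ → ℝ → ℂ) (t : ℝ) {h : ℕ → ℝ → ℂ} (hh : ∀ l, Measurable (h l))
    (n : ℕ) : ∫ x, ∏ l ∈ Finset.range n, h l (x l) ∂(gaussSeq z t) =
      ∏ l ∈ Finset.range n, ∫ x, h l x ∂(ProbabilityTheory.gaussianReal 0 (‖z l t‖₊ ^ 2)) := by
  have h1 := integral_fintype_prod_eq_prod (𝕜 := ℂ) (fun (l : Finset.range n) x => h l x)
    (μ := fun l : Finset.range n => ProbabilityTheory.gaussianReal 0 (‖z l t‖₊ ^ 2))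
  rw [Finset.prod_coe_sort (Finset.range n) fun l =>
    ∫ x, h l x ∂(ProbabilityTheory.gaussianReal 0 (‖z l t‖₊ ^ 2))] at h1
  rw [← h1, ← gaussSeq_map_restrict, integral_map (by fun_prop)
    (Finset.measurable_fun_prod (f := fun (l : Finset.range n) (x : Finset.range n → ℝ) => h l (x l))
      _ fun l _ => (hh l).comp (measurable_pi_apply l)).aestronglyMeasurable]
  congr 1
  funext x
  exact (Finset.prod_coe_sort (Finset.range n) fun l => h l (x l)).symm

theorem integrable_prod_gaussSeq (z : ℕ → ℝ → ℂ) (t : ℝ) {h : ℕ → ℝ → ℂ} (n : ℕ)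
    (hi : ∀ l < n, Integrable (h l) (ProbabilityTheory.gaussianReal 0 (‖z l t‖₊ ^ 2))) :
    Integrable (fun x => ∏ l ∈ Finset.range n, h l (x l)) (gaussSeq z t) := by
  have h1 := Integrable.fintype_prod (𝕜 := ℂ) (f := fun (l : Finset.range n) x => h l x)
    (μ := fun l : Finset.range n => ProbabilityTheory.gaussianReal 0 (‖z l t‖₊ ^ 2))
    fun l => hi l (Finset.mem_range.1 l.2)
  rw [← gaussSeq_map_restrict] at h1
  refine (h1.comp_aemeasurable (by fun_prop)).congr (.of_forall fun x => ?_)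
  exact (Finset.prod_coe_sort (Finset.range n) fun l => h l (x l))

theorem integral_exp_gaussianReal (v : NNReal) (s : ℝ) :
    ∫ x, Complex.exp (Complex.I * (x * s : ℝ)) ∂(ProbabilityTheory.gaussianReal 0 v) =
      Complex.exp (-(v * s ^ 2 : ℝ) / 2) := by
  have := ProbabilityTheory.charFun_gaussianReal (μ := 0) (v := v) s
  rw [charFun_apply_real] at this
  rw [show (-(v * s ^ 2 : ℝ) / 2 : ℂ) = s * (0 : ℝ) * Complex.I - v * s ^ 2 / 2 by push_cast; ring,
    ← this]
  congr 1
  funext x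
  push_cast
  ring_nf

theorem lintegral_sq_gaussianReal (v : NNReal) :
    ∫⁻ x, ENNReal.ofReal (x ^ 2) ∂(ProbabilityTheory.gaussianReal 0 v) = v := by
  have h := ProbabilityTheory.variance_fun_id_gaussianReal (μ := 0) (v := v)
  have hm := ProbabilityTheory.memLp_id_gaussianReal (μ := 0) (v := v) 2
  rw [ProbabilityTheory.variance_eq_integral (by fun_prop),
    ProbabilityTheory.integral_id_gaussianReal] at h
  simp only [sub_zero] at h
  have h2 : Integrable (fun x : ℝ => x ^ 2) (ProbabilityTheory.gaussianReal 0 v) := hm.integrable_sq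
  rw [← ofReal_integral_eq_lintegral_ofReal h2 (.of_forall fun x => sq_nonneg _), h,
    ENNReal.ofReal_coe_nnreal]

/-- The sequences of mode coordinates which define a distribution. -/
def modeSeq : Set (ℕ → ℝ) :=
  {x | Summable fun l : ℕ => |x l| * (√(l + 1 / 2) / (l + 1) ^ 2)}

theorem measurableSet_modeSeq : MeasurableSet modeSeq := by
  have h : modeSeq = {x : ℕ → ℝ | ∑' l : ℕ, ENNReal.ofReal (|x l| * (√(l + 1 / 2) / (l + 1) ^ 2)) ≠ ⊤} := by
    ext x
    simp only [modeSeq, Set.mem_ofPred_eq]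
    constructor
    · intro h
      exact h.tsum_ofReal_ne_top
    · intro h
      exact (ENNReal.summable_toReal h).congr fun l => ENNReal.toReal_ofReal (by positivity)
  rw [h]
  refine (measurableSet_singleton _).compl.preimage (Measurable.tsum fun l => ?_)
  fun_prop

/-- The expectation of Σ x_ℓ² λ/(ℓ+1)² is finite because λ|z_ℓ|² is bounded. Almost sure finiteness
of this sum and √λ|x_ℓ| ≤ λx_ℓ² + 1 give the absolute summability needed for a distribution. -/
theorem ModeData.ae_mem_modeSeq {z : ℕ → ℝ → ℂ} {t : ℝ} (h : ModeData z t) :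
    ∀ᵐ x ∂(gaussSeq z t), x ∈ modeSeq := by
  obtain ⟨C, hC, hb⟩ := h.bound
  have h1 : ∫⁻ x, ∑' l : ℕ, ENNReal.ofReal (x l ^ 2 * ((l + 1 / 2) / (l + 1) ^ 2)) ∂(gaussSeq z t) ≠ ⊤ := by
    rw [lintegral_tsum fun l => Measurable.aemeasurable (by fun_prop)]
    have h2 : ∀ l : ℕ, ∫⁻ x, ENNReal.ofReal (x l ^ 2 * ((l + 1 / 2) / (l + 1) ^ 2)) ∂(gaussSeq z t) ≤
        ENNReal.ofReal (C ^ 2 * (1 / ((l : ℝ) + 1) ^ 2)) := by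
      intro l
      have h3 : ∀ x : ℕ → ℝ, ENNReal.ofReal (x l ^ 2 * ((l + 1 / 2) / (l + 1) ^ 2)) =
          ENNReal.ofReal (x l ^ 2) * ENNReal.ofReal (((l : ℝ) + 1 / 2) / (l + 1) ^ 2) := fun x =>
        ENNReal.ofReal_mul (sq_nonneg _)
      simp only [h3]
      rw [lintegral_mul_const _ (by fun_prop)]
      have h4 := lintegral_map (μ := gaussSeq z t) (f := fun y : ℝ => ENNReal.ofReal (y ^ 2))
        (g := fun x : ℕ → ℝ => x l) (by fun_prop) (by fun_prop)
      rw [← h4, gaussSeq, Measure.infinitePi_map_eval, lintegral_sq_gaussianReal,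
        show ((‖z l t‖₊ ^ 2 : NNReal) : ENNReal) = ENNReal.ofReal (‖z l t‖ ^ 2) by
          rw [← ENNReal.ofReal_coe_nnreal]; simp,
        ← ENNReal.ofReal_mul (sq_nonneg _)]
      refine ENNReal.ofReal_le_ofReal ?_
      have h5 : ‖z l t‖ ^ 2 * ((l : ℝ) + 1 / 2) ≤ C ^ 2 := by
        rw [← Real.sq_sqrt (show (0 : ℝ) ≤ l + 1 / 2 by positivity), ← mul_pow]
        exact pow_le_pow_left₀ (by positivity) (hb l).1 2
      rw [← mul_div_assoc, ← mul_div_assoc, mul_one]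
      gcongr
    refine ne_top_of_le_ne_top ?_ (ENNReal.tsum_le_tsum h2)
    exact ((summable_one_div_add_one_pow one_lt_two).mul_left _).tsum_ofReal_ne_top
  have h2 := ae_lt_top (Measurable.tsum fun l => by fun_prop) h1
  filter_upwards [h2] with x hx
  have h3 : Summable fun l : ℕ => x l ^ 2 * (((l : ℝ) + 1 / 2) / (l + 1) ^ 2) :=
    (ENNReal.summable_toReal hx.ne).congr fun l => ENNReal.toReal_ofReal (by positivity)
  refine Summable.of_nonneg_of_le (fun l => by positivity) (fun l => ?_)
    (h3.add (summable_one_div_add_one_pow one_lt_two))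
  have e : √((l : ℝ) + 1 / 2) ^ 2 = l + 1 / 2 := Real.sq_sqrt (by positivity)
  rw [← sq_abs (x l), ← mul_div_assoc, ← mul_div_assoc, ← add_div]
  gcongr
  nlinarith [sq_nonneg (|x l| * √((l : ℝ) + 1 / 2) - 1)]

open Classical in
/-- The distribution with given mode coordinates. -/
def modeDistr (x : ℕ → ℝ) : Distr :=
  -- Off `modeSeq`, a null set for the Gaussian sequences considered, the value is the zero
  -- distribution; any fixed value would do.
  if h : x ∈ modeSeq then Distr.ofCoeff x h else Distr.ofCoeff 0 (by simp [summable_zero])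

theorem modeDistr_apply {x : ℕ → ℝ} (hx : x ∈ modeSeq) (f : TestFn) :
    HasSum (fun l => x l * coeff f l) (modeDistr x f) := by
  have e : modeDistr x = Distr.ofCoeff x hx := dif_pos hx
  rw [e]
  obtain ⟨C, hC, h⟩ := exists_abs_coeff_le f
  refine (Summable.of_norm_bounded (Summable.mul_left C hx) fun l => ?_).hasSum
  rw [norm_mul, Real.norm_eq_abs, Real.norm_eq_abs, mul_left_comm]
  gcongr
  exact h l

theorem modeDistr_Y {x : ℕ → ℝ} (hx : x ∈ modeSeq) (l : ℕ) : modeDistr x (Y l) = x l := by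
  have h := modeDistr_apply hx (Y l)
  simp only [coeff_Y, mul_ite, mul_one, mul_zero] at h
  refine h.unique ?_
  convert hasSum_ite_eq l (x l) using 2 with m
  split_ifs with hm <;> simp [hm]

theorem measurable_modeDistr : Measurable modeDistr := by
  classical
  refine Distr.measurable_of_apply fun f => ?_
  refine measurable_of_tendsto_metrizable (f := fun n x => if x ∈ modeSeq then
    ∑ l ∈ Finset.range n, x l * coeff f l else 0) (fun n => ?_) (tendsto_pi_nhds.2 fun x => ?_)
  · exact Measurable.ite measurableSet_modeSeq (by fun_prop) measurable_const
  · by_cases hx : x ∈ modeSeq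
    · simp only [hx, if_true]
      exact (modeDistr_apply hx f).tendsto_sum_nat
    · simp only [hx, if_false]
      have e : modeDistr x = Distr.ofCoeff 0 (by simp [summable_zero]) := dif_neg hx
      rw [e]
      have : (Distr.ofCoeff 0 (by simp [summable_zero])) f = 0 := by
        rw [Distr.ofCoeff_apply]
        simp
      rw [this]
      exact tendsto_const_nhds

theorem ModeData.summable_cov {z : ℕ → ℝ → ℂ} {t : ℝ} (h : ModeData z t) (f : TestFn) :
    Summable fun l => ‖z l t‖ ^ 2 * coeff f l ^ 2 := by
  refine (h.summable_modeCoeff_sq (0, f)).congr fun l => ?_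
  simp only [modeCoeff, coeff_zero]
  simp [mul_pow, Complex.norm_real]

/-- Finite products factorize into one-dimensional characteristic functions; dominated convergence,
with bound 1, passes to infinitely many modes. -/
theorem ModeData.integral_chr_modeDistr {z : ℕ → ℝ → ℂ} {t : ℝ} (h : ModeData z t) (f : TestFn) :
    ∫ x, chr f (modeDistr x) ∂(gaussSeq z t) = Complex.exp (-(covForm z t f : ℂ) / 2) := by
  have h1 : Tendsto (fun n => ∫ x, ∏ l ∈ Finset.range n,
      Complex.exp (Complex.I * (x l * coeff f l : ℝ)) ∂(gaussSeq z t)) atTop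
      (𝓝 (∫ x, chr f (modeDistr x) ∂(gaussSeq z t))) := by
    refine tendsto_integral_of_dominated_convergence (fun _ => 1)
      (fun n => Measurable.aestronglyMeasurable (by fun_prop)) (integrable_const _)
      (fun n => .of_forall fun x => ?_) ?_
    · rw [norm_prod]
      refine Finset.prod_le_one (fun _ _ => norm_nonneg _) fun l _ => ?_
      rw [mul_comm, Complex.norm_exp_ofReal_mul_I]
    · filter_upwards [h.ae_mem_modeSeq] with x hx
      simp only [← Complex.exp_sum, ← Finset.mul_sum, ← Complex.ofReal_sum]
      exact (Complex.continuous_exp.tendsto _).comp ((((Complex.continuous_ofReal.tendsto _).comp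
        (modeDistr_apply hx f).tendsto_sum_nat)).const_mul _)
  have h2 : Tendsto (fun n => ∫ x, ∏ l ∈ Finset.range n,
      Complex.exp (Complex.I * (x l * coeff f l : ℝ)) ∂(gaussSeq z t)) atTop
      (𝓝 (Complex.exp (-(covForm z t f : ℂ) / 2))) := by
    have h3 : ∀ n, ∫ x, ∏ l ∈ Finset.range n,
        Complex.exp (Complex.I * (x l * coeff f l : ℝ)) ∂(gaussSeq z t) =
        Complex.exp (-((∑ l ∈ Finset.range n, ‖z l t‖ ^ 2 * coeff f l ^ 2 : ℝ) : ℂ) / 2) := by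
      intro n
      rw [integral_prod_gaussSeq z t (h := fun l y => Complex.exp (Complex.I * (y * coeff f l : ℝ)))
        fun l => by fun_prop]
      simp only [integral_exp_gaussianReal]
      rw [← Complex.exp_sum, ← Finset.sum_div]
      simp
    simp only [h3]
    exact (Complex.continuous_exp.tendsto _).comp (((Complex.continuous_ofReal.tendsto _).comp
      (h.summable_cov f).hasSum.tendsto_sum_nat).neg.div_const _)
  exact tendsto_nhds_unique h1 h2

/-- Uniqueness of the Fourier transform identifies the field measure with the image of the product
Gaussian. All later integrals are computed mode by mode through this. -/
theorem ModeData.isFieldMeasure_iff {z : ℕ → ℝ → ℂ} {t : ℝ} (h : ModeData z t)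
    (μ : ProbabilityMeasure Distr) :
    IsFieldMeasure z t μ ↔ (μ : Measure Distr) = (gaussSeq z t).map modeDistr := by
  have hf : ∀ f, ∫ T, chr f T ∂((gaussSeq z t).map modeDistr) =
      Complex.exp (-(covForm z t f : ℂ) / 2) := fun f => by
    rw [integral_map measurable_modeDistr.aemeasurable (measurable_chr f).aestronglyMeasurable,
      h.integral_chr_modeDistr]
  have := Measure.isProbabilityMeasure_map (μ := gaussSeq z t) measurable_modeDistr.aemeasurable
  constructor
  · intro hμ
    exact measure_ext_of_chr fun f => (hμ f).trans (hf f).symm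
  · intro hμ f
    rw [hμ]
    exact hf f

theorem ModeData.existsUnique_fieldMeasure {z : ℕ → ℝ → ℂ} {t : ℝ} (h : ModeData z t) :
    ∃! μ : ProbabilityMeasure Distr, IsFieldMeasure z t μ := by
  have := Measure.isProbabilityMeasure_map (μ := gaussSeq z t) measurable_modeDistr.aemeasurable
  refine ⟨⟨(gaussSeq z t).map modeDistr, this⟩, (h.isFieldMeasure_iff _).2 rfl, fun μ hμ => ?_⟩
  exact Subtype.ext ((h.isFieldMeasure_iff μ).1 hμ)

/-- The mode coordinates of a distribution. -/
def modeCoord (T : Distr) (l : ℕ) : ℝ := T (Y l)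

theorem measurable_modeCoord : Measurable modeCoord :=
  measurable_pi_iff.2 fun l => Distr.measurable_apply (Y l)

theorem ModeData.map_modeCoord {z : ℕ → ℝ → ℂ} {t : ℝ} (h : ModeData z t)
    {μ : ProbabilityMeasure Distr} (hμ : IsFieldMeasure z t μ) :
    (μ : Measure Distr).map modeCoord = gaussSeq z t := by
  rw [(h.isFieldMeasure_iff μ).1 hμ, Measure.map_map measurable_modeCoord measurable_modeDistr]
  refine Eq.trans (Measure.map_congr ?_) Measure.map_id
  filter_upwards [h.ae_mem_modeSeq] with x hx
  exact funext fun l => modeDistr_Y hx l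

end Gowdy

end

noncomputable section

namespace Gowdy

open ComplexConjugate

/-! ### Gaussian wave packets on the line -/

/-- The normalization of a Gaussian wave packet. -/
def packetAmp (κ : ℂ) : ℝ := √(√(κ.im / Real.pi))

/-- The Gaussian wave packet of shape `κ` with mean position `q` and mean momentum shift `p`. -/
def packet (κ : ℂ) (q p : ℝ) (x : ℝ) : ℂ :=
  packetAmp κ * Complex.exp (Complex.I * κ * (x - q) ^ 2 / 2 + Complex.I * p * x -
    Complex.I * p * q / 2)

theorem continuous_packet (κ : ℂ) (q p : ℝ) : Continuous (packet κ q p) := by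
  unfold packet; fun_prop

theorem packetAmp_pos {κ : ℂ} (hκ : 0 < κ.im) : 0 < packetAmp κ := by
  have := Real.pi_pos
  unfold packetAmp
  positivity

theorem packet_ne_zero {κ : ℂ} (hκ : 0 < κ.im) (q p x : ℝ) : packet κ q p x ≠ 0 :=
  mul_ne_zero (Complex.ofReal_ne_zero.2 (packetAmp_pos hκ).ne') (Complex.exp_ne_zero _)

theorem packet_conj_mul (κ κ' : ℂ) (q p x : ℝ) :
    conj (packet κ 0 0 x) * packet κ' q p x = (packetAmp κ * packetAmp κ' : ℝ) *
      Complex.exp ((Complex.I * (κ' - conj κ) / 2) * x ^ 2 + Complex.I * (p - κ' * q) * x +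
        Complex.I * (κ' * q - p) * q / 2) := by
  simp only [packet, map_mul, ← Complex.exp_conj, map_add, map_sub, map_div₀, map_pow,
    Complex.conj_I, Complex.conj_ofReal, Complex.ofReal_zero, map_zero, map_ofNat]
  rw [mul_mul_mul_comm, ← Complex.exp_add, ← Complex.ofReal_mul]
  congr 2
  ring

theorem packet_quadratic_re {κ κ' : ℂ} (hκ : 0 < κ.im) (hκ' : 0 < κ'.im) :
    (Complex.I * (κ' - conj κ) / 2).re < 0 := by
  have : (Complex.I * (κ' - conj κ) / 2).re = -(κ.im + κ'.im) / 2 := by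
    rw [show Complex.I * (κ' - conj κ) / 2 = (Complex.I * (κ' - conj κ)) / (2 : ℝ) by push_cast; rfl,
      Complex.div_ofReal_re]
    simp
    ring
  rw [this]
  linarith

theorem normSq_packet (κ : ℂ) (q p x : ℝ) :
    ‖packet κ q p x‖ ^ 2 = √(κ.im / Real.pi) * Real.exp (-κ.im * (x - q) ^ 2) := by
  have h : (Complex.I * κ * (x - q) ^ 2 / 2 + Complex.I * p * x - Complex.I * p * q / 2).re =
      -κ.im * (x - q) ^ 2 / 2 := by
    have e : Complex.I * κ * (x - q) ^ 2 / 2 + Complex.I * p * x - Complex.I * p * q / 2 =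
        Complex.I * κ * (((x - q) ^ 2 / 2 : ℝ) : ℂ) + Complex.I * ((p * x - p * q / 2 : ℝ) : ℂ) := by
      push_cast; ring
    rw [e, Complex.add_re, Complex.re_mul_ofReal, Complex.re_mul_ofReal]
    simp
    ring
  rw [packet, norm_mul, mul_pow, Complex.norm_real, Complex.norm_exp, h, Real.norm_eq_abs, sq_abs,
    packetAmp, Real.sq_sqrt (Real.sqrt_nonneg _), ← Real.exp_nat_mul]
  congr 2
  push_cast
  ring

theorem memLp_packet {κ : ℂ} (hκ : 0 < κ.im) (q p : ℝ) : MemLp (packet κ q p) 2 := by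
  rw [memLp_two_iff_integrable_sq_norm (continuous_packet κ q p).aestronglyMeasurable]
  simp only [normSq_packet]
  exact ((integrable_exp_neg_mul_sq hκ).comp_sub_right q).const_mul _

/-- The scalar product of a centred packet with another packet. -/
def packetOverlap (κ κ' : ℂ) (q p : ℝ) : ℂ := ∫ x, conj (packet κ 0 0 x) * packet κ' q p x

theorem packetOverlap_eq {κ κ' : ℂ} (hκ : 0 < κ.im) (hκ' : 0 < κ'.im) (q p : ℝ) :
    packetOverlap κ κ' q p = (packetAmp κ * packetAmp κ' : ℝ) *
      ((Real.pi / -(Complex.I * (κ' - conj κ) / 2)) ^ (1 / 2 : ℂ) *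
        Complex.exp (Complex.I * (κ' * q - p) * q / 2 -
          (Complex.I * (p - κ' * q)) ^ 2 / (4 * (Complex.I * (κ' - conj κ) / 2)))) := by
  simp only [packetOverlap, packet_conj_mul]
  rw [integral_const_mul, integral_cexp_quadratic (packet_quadratic_re hκ hκ')]

theorem packetOverlap_self {κ : ℂ} (hκ : 0 < κ.im) (q p : ℝ) :
    packetOverlap κ κ q p = Complex.exp (-(‖(p : ℂ) - κ * q‖ ^ 2 / (4 * κ.im) : ℝ)) := by
  have hc : κ - conj κ = 2 * κ.im * Complex.I := by
    rw [Complex.sub_conj]; push_cast; ring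
  have hI : (κ.im : ℂ) ≠ 0 := Complex.ofReal_ne_zero.2 hκ.ne'
  have hb : Complex.I * (κ - conj κ) / 2 = -(κ.im : ℂ) := by
    rw [hc]; linear_combination (κ.im : ℂ) * Complex.I_sq
  rw [packetOverlap_eq hκ hκ, hb, neg_neg]
  have h1 : ((Real.pi : ℂ) / (κ.im : ℂ)) ^ (1 / 2 : ℂ) = (√(Real.pi / κ.im) : ℝ) := by
    rw [Real.sqrt_eq_rpow, Complex.ofReal_cpow (by have := Real.pi_pos; positivity)]
    push_cast
    rfl
  have h2 : packetAmp κ * packetAmp κ * √(Real.pi / κ.im) = 1 := by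
    rw [packetAmp, Real.mul_self_sqrt (Real.sqrt_nonneg _), ← Real.sqrt_mul
      (by have := Real.pi_pos; positivity)]
    have := Real.pi_pos.ne'
    rw [div_mul_div_cancel₀ this, div_self hκ.ne', Real.sqrt_one]
  rw [h1, ← mul_assoc, ← Complex.ofReal_mul, h2, Complex.ofReal_one, one_mul]
  congr 1
  have h3 : ((‖(p : ℂ) - κ * q‖ ^ 2 : ℝ) : ℂ) = (p - κ * q) * (p - conj κ * q) := by
    have := Complex.mul_conj' ((p : ℂ) - κ * q)
    rw [map_sub, map_mul, Complex.conj_ofReal, Complex.conj_ofReal] at this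
    rw [this]
    push_cast
    rfl
  rw [Complex.ofReal_div, h3]
  push_cast
  rw [mul_pow, Complex.I_sq]
  field_simp
  linear_combination (2 * ((p : ℂ) - κ * q) * q) * hc

/-- Translating the integration variable by q centres the left packet and cancels its momentum. The
symmetric phase convention in `packet` leaves exactly the Heisenberg cocycle. -/
theorem integral_packet_conj_mul (κ κ' : ℂ) (q p q' p' : ℝ) :
    ∫ x, conj (packet κ q p x) * packet κ' q' p' x =
      Complex.exp (-(Complex.I / 2) * ((q' * p - q * p' : ℝ) : ℂ)) *
        packetOverlap κ κ' (q' - q) (p' - p) := by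
  rw [packetOverlap, ← integral_const_mul, ← integral_add_right_eq_self
    (fun x => conj (packet κ q p x) * packet κ' q' p' x) q]
  congr 1
  funext x
  simp only [packet, map_mul, ← Complex.exp_conj, map_add, map_sub, map_div₀, map_pow,
    Complex.conj_I, Complex.conj_ofReal, Complex.ofReal_zero, map_zero, map_ofNat]
  rw [mul_mul_mul_comm, ← Complex.exp_add, mul_mul_mul_comm _ (Complex.exp _), ← Complex.exp_add,
    mul_left_comm, ← Complex.exp_add]
  congr 2
  push_cast
  ring

end Gowdy

end

noncomputable section

namespace Gowdy

open ComplexConjugate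

/-! ### Product vectors -/

/-- The shape of the vacuum packet of the `ℓ`-th mode. -/
def shape (z : ℕ → ℝ → ℂ) (t : ℝ) (l : ℕ) : ℂ := conj (deriv (z l) t) / conj (z l t)

variable {z : ℕ → ℝ → ℂ} {t : ℝ}

theorem ModeData.ne_zero (h : ModeData z t) (l : ℕ) : z l t ≠ 0 := fun h0 => by
  have := h.wronskian l
  simp only [h0, zero_mul, map_zero, sub_zero] at this
  exact Complex.I_ne_zero this.symm

/-- The imaginary part is the Wronskian divided by 2|z|². Hence |packet|² is the density of the
Gaussian with variance |z|², and division by the packet is the passage from Lebesgue to Gaussian L²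
space. -/
theorem ModeData.shape_im (h : ModeData z t) (l : ℕ) : (shape z t l).im = 1 / (2 * ‖z l t‖ ^ 2) := by
  have hz := h.ne_zero l
  have hzc : conj (z l t) ≠ 0 := by simpa using hz
  have h1 : shape z t l - conj (shape z t l) = Complex.I / (z l t * conj (z l t)) := by
    rw [shape, map_div₀, Complex.conj_conj, Complex.conj_conj, ← h.wronskian l]
    field_simp
  rw [Complex.sub_conj, Complex.mul_conj'] at h1
  have h2 := congrArg Complex.im h1
  rw [show Complex.I / (‖z l t‖ : ℂ) ^ 2 = ((1 / ‖z l t‖ ^ 2 : ℝ) : ℂ) * Complex.I by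
    push_cast; ring] at h2
  simp only [Complex.im_ofReal_mul, Complex.I_im, mul_one] at h2
  have hn : ‖z l t‖ ≠ 0 := norm_ne_zero_iff.2 hz
  field_simp at h2 ⊢
  linarith

theorem ModeData.shape_im_pos (h : ModeData z t) (l : ℕ) : 0 < (shape z t l).im := by
  have := norm_pos_iff.2 (h.ne_zero l)
  rw [h.shape_im]
  positivity

theorem ModeData.gaussianPDFReal_eq (h : ModeData z t) (l : ℕ) (x : ℝ) :
    ProbabilityTheory.gaussianPDFReal 0 (‖z l t‖₊ ^ 2) x = ‖packet (shape z t l) 0 0 x‖ ^ 2 := by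
  have hn : ‖z l t‖ ≠ 0 := norm_ne_zero_iff.2 (h.ne_zero l)
  have := Real.pi_pos
  rw [normSq_packet, h.shape_im, ProbabilityTheory.gaussianPDFReal, ← Real.sqrt_inv]
  simp only [NNReal.coe_pow, coe_nnnorm]
  congr 2
  · field_simp
  · field_simp

/-- Sequences of one-mode wave functions. -/
structure IsWave (φ : ℕ → ℝ → ℂ) : Prop where
  continuous : ∀ l, Continuous (φ l)
  memLp : ∀ l, MemLp (φ l) 2

theorem IsWave.packet {κ : ℕ → ℂ} (hκ : ∀ l, 0 < (κ l).im) (q p : ℕ → ℝ) :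
    IsWave fun l => packet (κ l) (q l) (p l) :=
  ⟨fun _ => continuous_packet _ _ _, fun l => memLp_packet (hκ l) _ _⟩

theorem IsWave.const_mul {φ : ℕ → ℝ → ℂ} (h : IsWave φ) (c : ℕ → ℂ) :
    IsWave fun l x => c l * φ l x :=
  ⟨fun l => (h.continuous l).const_mul _, fun l => (h.memLp l).const_mul _⟩

/-- The product wave function over the first `n` modes, relative to the vacuum. -/
def prodFn (z : ℕ → ℝ → ℂ) (t : ℝ) (φ : ℕ → ℝ → ℂ) (n : ℕ) (T : Distr) : ℂ :=
  ∏ l ∈ Finset.range n, φ l (T (Y l)) / packet (shape z t l) 0 0 (T (Y l))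

theorem ModeData.continuous_quot (h : ModeData z t) {φ : ℕ → ℝ → ℂ} (hφ : IsWave φ) (l : ℕ) :
    Continuous fun x => φ l x / packet (shape z t l) 0 0 x :=
  (hφ.continuous l).div (continuous_packet _ _ _) fun x => packet_ne_zero (h.shape_im_pos l) 0 0 x

theorem IsWave.integrable {φ φ' : ℕ → ℝ → ℂ} (hφ : IsWave φ) (hφ' : IsWave φ') (l : ℕ) :
    Integrable fun x => conj (φ l x) * φ' l x := by
  have := (hφ.memLp l).star.integrable_mul (hφ'.memLp l)
  exact this

theorem ModeData.pdf_smul_quot (h : ModeData z t) (φ φ' : ℕ → ℝ → ℂ) (l : ℕ) (x : ℝ) :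
    ProbabilityTheory.gaussianPDFReal 0 (‖z l t‖₊ ^ 2) x •
      (conj (φ l x / packet (shape z t l) 0 0 x) * (φ' l x / packet (shape z t l) 0 0 x)) =
      conj (φ l x) * φ' l x := by
  have h1 := packet_ne_zero (h.shape_im_pos l) 0 0 x
  have h2 : conj (packet (shape z t l) 0 0 x) ≠ 0 := by simpa using h1
  rw [h.gaussianPDFReal_eq, Complex.real_smul, map_div₀]
  push_cast
  rw [← Complex.mul_conj']
  field_simp

theorem ModeData.nnnorm_ne_zero (h : ModeData z t) (l : ℕ) : (‖z l t‖₊ ^ 2 : NNReal) ≠ 0 :=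
  pow_ne_zero _ (nnnorm_ne_zero_iff.2 (h.ne_zero l))

theorem ModeData.integral_quot (h : ModeData z t) (φ φ' : ℕ → ℝ → ℂ) (l : ℕ) :
    ∫ x, conj (φ l x / packet (shape z t l) 0 0 x) * (φ' l x / packet (shape z t l) 0 0 x)
      ∂(ProbabilityTheory.gaussianReal 0 (‖z l t‖₊ ^ 2)) = ∫ x, conj (φ l x) * φ' l x := by
  rw [ProbabilityTheory.integral_gaussianReal_eq_integral_smul (h.nnnorm_ne_zero l)]
  simp only [h.pdf_smul_quot]

theorem ModeData.integrable_quot (h : ModeData z t) {φ φ' : ℕ → ℝ → ℂ} (hφ : IsWave φ)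
    (hφ' : IsWave φ') (l : ℕ) : Integrable (fun x => conj (φ l x / packet (shape z t l) 0 0 x) *
      (φ' l x / packet (shape z t l) 0 0 x))
      (ProbabilityTheory.gaussianReal 0 (‖z l t‖₊ ^ 2)) := by
  rw [ProbabilityTheory.gaussianReal_of_var_ne_zero _ (h.nnnorm_ne_zero l),
    integrable_withDensity_iff_integrable_smul' (ProbabilityTheory.measurable_gaussianPDF _ _)
      (.of_forall fun x => ProbabilityTheory.gaussianPDF_lt_top)]
  refine (hφ.integrable hφ' l).congr (.of_forall fun x => ?_)
  simp only [ProbabilityTheory.toReal_gaussianPDF]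
  rw [h.pdf_smul_quot]

variable {μ : ProbabilityMeasure Distr}

theorem conj_prodFn_mul (φ φ' : ℕ → ℝ → ℂ) (n : ℕ) (T : Distr) :
    conj (prodFn z t φ n T) * prodFn z t φ' n T = ∏ l ∈ Finset.range n,
      conj (φ l (modeCoord T l) / packet (shape z t l) 0 0 (modeCoord T l)) *
        (φ' l (modeCoord T l) / packet (shape z t l) 0 0 (modeCoord T l)) := by
  rw [prodFn, prodFn, map_prod, Finset.prod_mul_distrib]
  rfl

theorem ModeData.measurable_prodFn (h : ModeData z t) {φ : ℕ → ℝ → ℂ} (hφ : IsWave φ) (n : ℕ) :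
    Measurable (prodFn z t φ n) :=
  Finset.measurable_fun_prod (f := fun (l : ℕ) (T : Distr) => φ l (T (Y l)) / packet (shape z t l) 0 0 (T (Y l))) _
    fun l _ => (h.continuous_quot hφ l).measurable.comp (Distr.measurable_apply (Y l))

theorem ModeData.integral_conj_prodFn_mul (h : ModeData z t) (hμ : IsFieldMeasure z t μ)
    {φ φ' : ℕ → ℝ → ℂ} (hφ : IsWave φ) (hφ' : IsWave φ') (n : ℕ) :
    ∫ T, conj (prodFn z t φ n T) * prodFn z t φ' n T ∂(μ : Measure Distr) =
      ∏ l ∈ Finset.range n, ∫ x, conj (φ l x) * φ' l x := by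
  have hm : ∀ l, Measurable fun x => conj (φ l x / packet (shape z t l) 0 0 x) *
      (φ' l x / packet (shape z t l) 0 0 x) := fun l =>
    ((Complex.continuous_conj.comp (h.continuous_quot hφ l)).mul (h.continuous_quot hφ' l)).measurable
  simp only [conj_prodFn_mul, ← h.integral_quot]
  rw [← integral_prod_gaussSeq z t hm, ← h.map_modeCoord hμ, integral_map
    measurable_modeCoord.aemeasurable]
  exact (Finset.measurable_fun_prod _ fun l _ =>
    (hm l).comp (measurable_pi_apply l)).aestronglyMeasurable

theorem ModeData.memLp_prodFn (h : ModeData z t) (hμ : IsFieldMeasure z t μ)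
    {φ : ℕ → ℝ → ℂ} (hφ : IsWave φ) (n : ℕ) : MemLp (prodFn z t φ n) 2 (μ : Measure Distr) := by
  rw [memLp_two_iff_integrable_sq_norm (h.measurable_prodFn hφ n).aestronglyMeasurable]
  have h1 := integrable_prod_gaussSeq z t n (h := fun l x =>
    conj (φ l x / packet (shape z t l) 0 0 x) * (φ l x / packet (shape z t l) 0 0 x))
    fun l _ => h.integrable_quot hφ hφ l
  rw [← h.map_modeCoord hμ] at h1
  refine (h1.comp_aemeasurable measurable_modeCoord.aemeasurable).norm.congr (.of_forall fun T => ?_)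
  simp only [Function.comp_def]
  rw [← conj_prodFn_mul, norm_mul, RCLike.norm_conj, sq]

/-- The product wave function as a vector. -/
def ModeData.prodVec (h : ModeData z t) (hμ : IsFieldMeasure z t μ) {φ : ℕ → ℝ → ℂ}
    (hφ : IsWave φ) (n : ℕ) : HS μ := (h.memLp_prodFn hμ hφ n).toLp _

theorem inner_toLp {f g : Distr → ℂ} (hf : MemLp f 2 (μ : Measure Distr))
    (hg : MemLp g 2 (μ : Measure Distr)) :
    inner ℂ (hf.toLp f : HS μ) (hg.toLp g) = ∫ T, conj (f T) * g T ∂(μ : Measure Distr) := by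
  rw [inner_HS]
  refine integral_congr_ae ?_
  filter_upwards [hf.coeFn_toLp, hg.coeFn_toLp] with T h1 h2
  rw [h1, h2]

theorem ModeData.inner_prodVec (h : ModeData z t) (hμ : IsFieldMeasure z t μ)
    {φ φ' : ℕ → ℝ → ℂ} (hφ : IsWave φ) (hφ' : IsWave φ') (n : ℕ) :
    inner ℂ (h.prodVec hμ hφ n) (h.prodVec hμ hφ' n) =
      ∏ l ∈ Finset.range n, ∫ x, conj (φ l x) * φ' l x := by
  rw [prodVec, prodVec, inner_toLp, h.integral_conj_prodFn_mul hμ hφ hφ']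

theorem tendstoL2_iff {F : ℕ → Distr → ℂ} (hF : ∀ n, MemLp (F n) 2 (μ : Measure Distr)) {ψ : HS μ} :
    TendstoL2 μ F ψ ↔ Tendsto (fun n => ((hF n).toLp (F n) : HS μ)) atTop (𝓝 ψ) := by
  rw [TendstoL2, tendsto_iff_norm_sub_tendsto_zero, and_iff_right hF]
  have h1 : ∀ n, eLpNorm (fun T => F n T - ψ T) 2 (μ : Measure Distr) =
      ENNReal.ofReal ‖((hF n).toLp (F n) : HS μ) - ψ‖ := by
    intro n
    rw [Lp.norm_def, ENNReal.ofReal_toReal (Lp.eLpNorm_ne_top _)]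
    refine eLpNorm_congr_ae ?_
    filter_upwards [(hF n).coeFn_toLp, Lp.coeFn_sub ((hF n).toLp (F n) : HS μ) ψ] with T h1 h2
    rw [h2, Pi.sub_apply, h1]
  simp only [h1]
  constructor
  · intro h
    have := (ENNReal.tendsto_toReal ENNReal.zero_ne_top).comp h
    simpa [Function.comp_def] using this
  · intro h
    simpa using ENNReal.tendsto_ofReal h

theorem ModeData.isWave_vac (h : ModeData z t) : IsWave fun l => packet (shape z t l) 0 0 :=
  IsWave.packet h.shape_im_pos _ _

/-- A wave function cut off to the vacuum from the `n`-th mode on. -/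
def cutoff (z : ℕ → ℝ → ℂ) (t : ℝ) (φ : ℕ → ℝ → ℂ) (n l : ℕ) : ℝ → ℂ :=
  if l < n then φ l else packet (shape z t l) 0 0

theorem ModeData.isWave_cutoff (h : ModeData z t) {φ : ℕ → ℝ → ℂ} (hφ : IsWave φ) (n : ℕ) :
    IsWave (cutoff z t φ n) := by
  constructor <;> intro l <;> unfold cutoff <;> split_ifs
  · exact hφ.continuous l
  · exact h.isWave_vac.continuous l
  · exact hφ.memLp l
  · exact h.isWave_vac.memLp l

theorem ModeData.prodFn_cutoff (h : ModeData z t) (φ : ℕ → ℝ → ℂ) {n m : ℕ} (hnm : n ≤ m) :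
    prodFn z t (cutoff z t φ n) m = prodFn z t φ n := by
  funext T
  rw [prodFn, prodFn, ← Finset.prod_subset (Finset.range_mono hnm)]
  · refine Finset.prod_congr rfl fun l hl => ?_
    rw [cutoff, if_pos (Finset.mem_range.1 hl)]
  · intro l _ hl
    rw [cutoff, if_neg (by simpa using hl), div_self (packet_ne_zero (h.shape_im_pos l) _ _ _)]

theorem ModeData.prodVec_cutoff (h : ModeData z t) (hμ : IsFieldMeasure z t μ) {φ : ℕ → ℝ → ℂ}
    (hφ : IsWave φ) {n m : ℕ} (hnm : n ≤ m) :
    h.prodVec hμ (h.isWave_cutoff hφ n) m = h.prodVec hμ hφ n := by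
  unfold prodVec
  congr 1
  exact h.prodFn_cutoff φ hnm

/-- The shorter product equals a longer one whose additional factors are vacuum packets.
Normalization removes the first n factors, and overlaps with the vacuum remain. -/
theorem ModeData.inner_prodVec_of_le (h : ModeData z t) (hμ : IsFieldMeasure z t μ)
    {φ : ℕ → ℝ → ℂ} (hφ : IsWave φ) (h1 : ∀ l, ∫ x, conj (φ l x) * φ l x = 1) {n m : ℕ}
    (hnm : n ≤ m) : inner ℂ (h.prodVec hμ hφ n) (h.prodVec hμ hφ m) =
      ∏ l ∈ Finset.Ico n m, ∫ x, conj (packet (shape z t l) 0 0 x) * φ l x := by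
  rw [← h.prodVec_cutoff hμ hφ hnm, h.inner_prodVec, ← Finset.prod_range_mul_prod_Ico _ hnm,
    Finset.prod_eq_one, one_mul]
  · refine Finset.prod_congr rfl fun l hl => ?_
    rw [cutoff, if_neg (by simpa using (Finset.mem_Ico.1 hl).1)]
  · intro l hl
    rw [cutoff, if_pos (Finset.mem_range.1 hl), h1]

theorem ModeData.norm_prodVec (h : ModeData z t) (hμ : IsFieldMeasure z t μ)
    {φ : ℕ → ℝ → ℂ} (hφ : IsWave φ) (h1 : ∀ l, ∫ x, conj (φ l x) * φ l x = 1) (n : ℕ) :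
    ‖h.prodVec hμ hφ n‖ = 1 := by
  have h2 := h.inner_prodVec_of_le hμ hφ h1 le_rfl (n := n)
  rw [Finset.Ico_self, Finset.prod_empty, inner_self_eq_norm_sq_to_K] at h2
  have h3 : ‖h.prodVec hμ hφ n‖ ^ 2 = 1 := Complex.ofReal_injective (by simpa using h2)
  nlinarith [norm_nonneg (h.prodVec hμ hφ n)]

/-- Infinite products of normalized wave functions converge if the overlaps with the vacuum
converge absolutely to one. -/
theorem ModeData.exists_tendsto_prodVec (h : ModeData z t) (hμ : IsFieldMeasure z t μ)
    {φ : ℕ → ℝ → ℂ} (hφ : IsWave φ) (h1 : ∀ l, ∫ x, conj (φ l x) * φ l x = 1)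
    (hs : Summable fun l => ‖(∫ x, conj (packet (shape z t l) 0 0 x) * φ l x) - 1‖) :
    ∃ ψ, Tendsto (fun n => h.prodVec hμ hφ n) atTop (𝓝 ψ) := by
  refine cauchySeq_tendsto_of_complete ?_
  set o := fun l => (∫ x, conj (packet (shape z t l) 0 0 x) * φ l x) - 1 with ho
  -- For unit vectors the squared distance is 2 − 2 Re⟨·,·⟩. A product of factors 1 + o_ℓ differs
  -- from 1 by at most exp(Σ|o_ℓ|) − 1.
  have hd : ∀ {n m : ℕ}, n ≤ m → ‖h.prodVec hμ hφ n - h.prodVec hμ hφ m‖ ^ 2 ≤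
      2 * (Real.exp (∑ l ∈ Finset.Ico n m, ‖o l‖) - 1) := by
    intro n m hnm
    have h2 := (Finset.Ico n m).norm_prod_one_add_sub_one_le o
    have h3 := h.inner_prodVec_of_le hμ hφ h1 hnm
    rw [@norm_sub_sq ℂ, h.norm_prodVec hμ hφ h1, h.norm_prodVec hμ hφ h1, h3]
    simp only [ho, add_sub_cancel] at h2
    have h4 := Complex.abs_re_le_norm
      ((∏ l ∈ Finset.Ico n m, ∫ x, conj (packet (shape z t l) 0 0 x) * φ l x) - 1)
    rw [Complex.sub_re, Complex.one_re] at h4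
    have h5 := (abs_le.1 h4).1
    simp only [ho, RCLike.re_to_complex]
    linarith
  rw [Metric.cauchySeq_iff']
  intro ε hε
  have hcont : Tendsto (fun x : ℝ => 2 * (Real.exp x - 1)) (𝓝 0) (𝓝 0) := by
    have : ContinuousAt (fun x : ℝ => 2 * (Real.exp x - 1)) 0 := by fun_prop
    simpa [ContinuousAt] using this
  obtain ⟨δ, hδ, hδ'⟩ := Metric.eventually_nhds_iff.1
    (hcont.eventually (gt_mem_nhds (show (0 : ℝ) < ε ^ 2 by positivity)))
  obtain ⟨N, hN⟩ := Metric.cauchySeq_iff'.1 hs.hasSum.tendsto_sum_nat.cauchySeq δ hδ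
  refine ⟨N, fun m hm => ?_⟩
  have h2 := hN m hm
  rw [Real.dist_eq, ← Finset.sum_Ico_eq_sub _ hm] at h2
  have h3 := hδ' (y := ∑ l ∈ Finset.Ico N m, ‖o l‖) (by rw [Real.dist_eq, sub_zero]; exact h2)
  rw [dist_comm, dist_eq_norm]
  exact lt_of_pow_lt_pow_left₀ 2 hε.le ((hd hm).trans_lt h3)

end Gowdy

end

noncomputable section

namespace Gowdy

open ComplexConjugate

/-! ### Algebra of the symplectic form -/

theorem symp_eq (v w : PhaseSpace) : symp v w = pairingL w.1 v.2 - pairingL v.1 w.2 := rfl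

theorem symp_add_left (u v w : PhaseSpace) : symp (u + v) w = symp u w + symp v w := by
  simp only [symp_eq, Prod.fst_add, Prod.snd_add, map_add, LinearMap.add_apply]; ring

theorem symp_add_right (u v w : PhaseSpace) : symp u (v + w) = symp u v + symp u w := by
  simp only [symp_eq, Prod.fst_add, Prod.snd_add, map_add, LinearMap.add_apply]; ring

theorem symp_neg_left (v w : PhaseSpace) : symp (-v) w = -symp v w := by
  simp only [symp_eq, Prod.fst_neg, Prod.snd_neg, map_neg, LinearMap.neg_apply]; ring

theorem symp_smul_left (c : ℝ) (v w : PhaseSpace) : symp (c • v) w = c * symp v w := by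
  simp only [symp_eq, Prod.smul_fst, Prod.smul_snd, map_smul, LinearMap.smul_apply, smul_eq_mul]
  ring

theorem symp_smul_right (c : ℝ) (v w : PhaseSpace) : symp v (c • w) = c * symp v w := by
  simp only [symp_eq, Prod.smul_fst, Prod.smul_snd, map_smul, LinearMap.smul_apply, smul_eq_mul]
  ring

theorem symp_swap (v w : PhaseSpace) : symp v w = -symp w v := by
  simp only [symp]
  rw [pairing_comm w.1, pairing_comm v.1]
  ring

theorem symp_self (v : PhaseSpace) : symp v v = 0 := by
  have := symp_swap v v
  linarith

theorem symp_zero_left (w : PhaseSpace) : symp 0 w = 0 := by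
  simpa using symp_smul_left 0 0 w

theorem symp_zero_right (w : PhaseSpace) : symp w 0 = 0 := by
  simpa using symp_smul_right 0 w 0

theorem hasSum_symp (v w : PhaseSpace) :
    HasSum (fun l => coeff w.1 l * coeff v.2 l - coeff v.1 l * coeff w.2 l) (symp v w) :=
  (hasSum_pairing w.1 v.2).sub (hasSum_pairing v.1 w.2)

/-! ### Infinite products of packets -/

/-- The phase `exp(-iω/2)` in scalar products of displaced vectors. -/
def sympPhase (v w : PhaseSpace) : ℂ := Complex.exp (Complex.I / 2 * (symp v w : ℝ))

theorem norm_sympPhase (v w : PhaseSpace) : ‖sympPhase v w‖ = 1 := by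
  rw [sympPhase, show Complex.I / 2 * (symp v w : ℝ) = ((symp v w / 2 : ℝ) : ℂ) * Complex.I by
    push_cast; ring, Complex.norm_exp_ofReal_mul_I]

theorem conj_sympPhase (v w : PhaseSpace) :
    conj (sympPhase v w) = Complex.exp (-(Complex.I / 2) * (symp v w : ℝ)) := by
  rw [sympPhase, ← Complex.exp_conj, map_mul, map_div₀, Complex.conj_I, Complex.conj_ofReal,
    map_ofNat, neg_div]

/-- The exponent in the overlap of two packets of the same shape. -/
def packetDist (κ : ℂ) (q p : ℝ) : ℝ := ‖(p : ℂ) - κ * q‖ ^ 2 / (4 * κ.im)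

variable {z : ℕ → ℝ → ℂ} {t : ℝ}

/-- The mode coefficient is i z̄ (P − κQ) for the vacuum shape κ, and Im κ = 1/(2|z|²). -/
theorem ModeData.packetDist_shape (h : ModeData z t) (w : PhaseSpace) (l : ℕ) :
    packetDist (shape z t l) (coeff w.1 l) (coeff w.2 l) = ‖modeCoeff z t w l‖ ^ 2 / 2 := by
  have hz := h.ne_zero l
  have hzc : conj (z l t) ≠ 0 := by simpa using hz
  have e : modeCoeff z t w l =
      Complex.I * (conj (z l t) * ((coeff w.2 l : ℂ) - shape z t l * coeff w.1 l)) := by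
    rw [modeCoeff, shape]
    field_simp
  have hn : ‖z l t‖ ≠ 0 := norm_ne_zero_iff.2 hz
  rw [packetDist, e, h.shape_im, norm_mul, norm_mul, Complex.norm_I, RCLike.norm_conj]
  field_simp
  ring

/-- Shapes that agree with the vacuum shapes at time `t` up to finitely many. -/
structure IsShape (z : ℕ → ℝ → ℂ) (t : ℝ) (κ : ℕ → ℂ) : Prop where
  im_pos : ∀ l, 0 < (κ l).im
  eventually_eq : ∀ᶠ l in atTop, κ l = shape z t l

theorem ModeData.isShape (h : ModeData z t) : IsShape z t (shape z t) :=
  ⟨h.shape_im_pos, .of_forall fun _ => rfl⟩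

/-- The packets with shapes `κ` displaced by `w`. -/
def packets (κ : ℕ → ℂ) (w : PhaseSpace) (l : ℕ) : ℝ → ℂ := packet (κ l) (coeff w.1 l) (coeff w.2 l)

theorem IsShape.isWave {κ : ℕ → ℂ} (hκ : IsShape z t κ) (w : PhaseSpace) : IsWave (packets κ w) :=
  IsWave.packet hκ.im_pos _ _

theorem integral_packets (κ κ' : ℕ → ℂ) (v w : PhaseSpace) (l : ℕ) :
    ∫ x, conj (packets κ v l x) * packets κ' w l x =
      Complex.exp (-(Complex.I / 2) *
        ((coeff w.1 l * coeff v.2 l - coeff v.1 l * coeff w.2 l : ℝ) : ℂ)) *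
        packetOverlap (κ l) (κ' l) (coeff (w - v).1 l) (coeff (w - v).2 l) := by
  simp only [packets]
  rw [integral_packet_conj_mul, Prod.fst_sub, Prod.snd_sub, coeff_sub, coeff_sub]

theorem packets_zero (κ : ℕ → ℂ) (l : ℕ) : packets κ 0 l = packet (κ l) 0 0 := by
  simp [packets, coeff_zero]

theorem integral_packets_zero_left (κ κ' : ℕ → ℂ) (w : PhaseSpace) (l : ℕ) :
    ∫ x, conj (packets κ 0 l x) * packets κ' w l x =
      packetOverlap (κ l) (κ' l) (coeff w.1 l) (coeff w.2 l) := by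
  rw [packets_zero]
  rfl

theorem IsShape.integral_packets_self {κ : ℕ → ℂ} (hκ : IsShape z t κ) (w : PhaseSpace) (l : ℕ) :
    ∫ x, conj (packets κ w l x) * packets κ w l x = 1 := by
  rw [integral_packets, packetOverlap_self (hκ.im_pos l), sub_self]
  simp [coeff_zero, mul_comm]

theorem IsShape.summable_packetDist (h : ModeData z t) {κ : ℕ → ℂ} (hκ : IsShape z t κ)
    (w : PhaseSpace) : Summable fun l => packetDist (κ l) (coeff w.1 l) (coeff w.2 l) := by
  refine ((h.summable_modeCoeff_sq w).div_const 2).congr_atTop ?_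
  filter_upwards [hκ.eventually_eq] with l hl
  rw [hl, h.packetDist_shape]

variable {μ : ProbabilityMeasure Distr}

/-- From some mode on the overlap with the vacuum is exp(−|b_ℓ|²/2), and 1 − e⁻ˣ ≤ x reduces
convergence to square-summable mode coefficients. -/
theorem IsShape.exists_tendsto (h : ModeData z t) (hμ : IsFieldMeasure z t μ) {κ : ℕ → ℂ}
    (hκ : IsShape z t κ) (w : PhaseSpace) :
    ∃ ψ, Tendsto (fun n => h.prodVec hμ (hκ.isWave w) n) atTop (𝓝 ψ) := by
  refine h.exists_tendsto_prodVec hμ (hκ.isWave w) (hκ.integral_packets_self w) ?_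
  have hs := h.summable_modeCoeff_sq w
  refine (Summable.of_nonneg_of_le (fun l => norm_nonneg _) (fun l => ?_)
    (hs.div_const 2) : Summable fun l => ‖Complex.exp (-(‖modeCoeff z t w l‖ ^ 2 / 2 : ℝ)) - 1‖).congr_atTop ?_
  · rw [← Complex.ofReal_neg, ← Complex.ofReal_exp, ← Complex.ofReal_one, ← Complex.ofReal_sub,
      Complex.norm_real, Real.norm_eq_abs, abs_of_nonpos]
    · have := Real.add_one_le_exp (-(‖modeCoeff z t w l‖ ^ 2 / 2))
      linarith
    · rw [sub_nonpos, Real.exp_le_one_iff]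
      have := sq_nonneg ‖modeCoeff z t w l‖
      linarith
  · filter_upwards [hκ.eventually_eq] with l hl
    have := packetOverlap_self (h.shape_im_pos l) (coeff w.1 l) (coeff w.2 l)
    rw [← packetDist, h.packetDist_shape] at this
    rw [← this, packetOverlap, packets, hl]

/-- The infinite product of the packets with shapes `κ` displaced by `w`. -/
def IsShape.vec (h : ModeData z t) (hμ : IsFieldMeasure z t μ) {κ : ℕ → ℂ}
    (hκ : IsShape z t κ) (w : PhaseSpace) : HS μ := Classical.choose (hκ.exists_tendsto h hμ w)

theorem IsShape.tendsto_vec (h : ModeData z t) (hμ : IsFieldMeasure z t μ) {κ : ℕ → ℂ}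
    (hκ : IsShape z t κ) (w : PhaseSpace) :
    Tendsto (fun n => h.prodVec hμ (hκ.isWave w) n) atTop (𝓝 (hκ.vec h hμ w)) :=
  Classical.choose_spec (hκ.exists_tendsto h hμ w)

theorem IsShape.tendsto_prod (h : ModeData z t) (hμ : IsFieldMeasure z t μ) {κ κ' : ℕ → ℂ}
    (hκ : IsShape z t κ) (hκ' : IsShape z t κ') (v w : PhaseSpace) :
    Tendsto (fun n => ∏ l ∈ Finset.range n, ∫ x, conj (packets κ v l x) * packets κ' w l x) atTop
      (𝓝 (inner ℂ (hκ.vec h hμ v) (hκ'.vec h hμ w))) := by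
  have := (hκ.tendsto_vec h hμ v).inner (𝕜 := ℂ) (hκ'.tendsto_vec h hμ w)
  simpa only [h.inner_prodVec] using this

/-- The one-mode Heisenberg cocycles multiply to the phase of the full symplectic form by Parseval's
identity. This displacement covariance lets the Weyl operators act on packets of other shapes. -/
theorem IsShape.inner_vec_translate (h : ModeData z t) (hμ : IsFieldMeasure z t μ) {κ κ' : ℕ → ℂ}
    (hκ : IsShape z t κ) (hκ' : IsShape z t κ') (v w : PhaseSpace) :
    inner ℂ (hκ.vec h hμ v) (hκ'.vec h hμ w) =
      conj (sympPhase v w) * inner ℂ (hκ.vec h hμ 0) (hκ'.vec h hμ (w - v)) := by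
  refine tendsto_nhds_unique (hκ.tendsto_prod h hμ hκ' v w) ?_
  have h1 : Tendsto (fun n => Complex.exp (-(Complex.I / 2) * ((∑ l ∈ Finset.range n,
      (coeff w.1 l * coeff v.2 l - coeff v.1 l * coeff w.2 l) : ℝ) : ℂ))) atTop
      (𝓝 (conj (sympPhase v w))) := by
    rw [conj_sympPhase]
    exact (Complex.continuous_exp.tendsto _).comp (((Complex.continuous_ofReal.tendsto _).comp
      (hasSum_symp v w).tendsto_sum_nat).const_mul _)
  refine (h1.mul (hκ.tendsto_prod h hμ hκ' 0 (w - v))).congr fun n => ?_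
  rw [Complex.ofReal_sum, Finset.mul_sum, Complex.exp_sum, ← Finset.prod_mul_distrib]
  refine Finset.prod_congr rfl fun l _ => ?_
  rw [integral_packets κ κ' v, integral_packets_zero_left]

theorem IsShape.inner_vec_zero (h : ModeData z t) (hμ : IsFieldMeasure z t μ) {κ : ℕ → ℂ}
    (hκ : IsShape z t κ) (w : PhaseSpace) :
    inner ℂ (hκ.vec h hμ 0) (hκ.vec h hμ w) =
      Complex.exp (-(∑' l, packetDist (κ l) (coeff w.1 l) (coeff w.2 l) : ℝ)) := by
  refine tendsto_nhds_unique (hκ.tendsto_prod h hμ hκ 0 w) ?_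
  have e : ∀ l q p, packetOverlap (κ l) (κ l) q p = Complex.exp (-(packetDist (κ l) q p : ℝ)) :=
    fun l q p => packetOverlap_self (hκ.im_pos l) q p
  simp only [integral_packets_zero_left, e]
  simp only [← Complex.exp_sum, Finset.sum_neg_distrib, ← Complex.ofReal_sum]
  exact (Complex.continuous_exp.tendsto _).comp ((Complex.continuous_ofReal.tendsto _).comp
    (hκ.summable_packetDist h w).hasSum.tendsto_sum_nat).neg

theorem IsShape.norm_vec (h : ModeData z t) (hμ : IsFieldMeasure z t μ) {κ : ℕ → ℂ}
    (hκ : IsShape z t κ) (w : PhaseSpace) : ‖hκ.vec h hμ w‖ = 1 := by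
  refine tendsto_nhds_unique (hκ.tendsto_vec h hμ w).norm ?_
  simp only [h.norm_prodVec hμ (hκ.isWave w) (hκ.integral_packets_self w)]
  exact tendsto_const_nhds

end Gowdy

end

noncomputable section

namespace Gowdy

open ComplexConjugate

/-! ### The Schrödinger representation -/

variable {z : ℕ → ℝ → ℂ} {t : ℝ} {μ : ProbabilityMeasure Distr}

/-- The displaced vacuum. -/
def ModeData.coh (h : ModeData z t) (hμ : IsFieldMeasure z t μ) (w : PhaseSpace) : HS μ :=
  h.isShape.vec h hμ w

theorem ModeData.tsum_packetDist (h : ModeData z t) (w : PhaseSpace) :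
    ∑' l, packetDist (shape z t l) (coeff w.1 l) (coeff w.2 l) = sympJ z t w / 4 := by
  simp only [h.packetDist_shape]
  rw [ModeData.sympJ_eq, tsum_div_const]
  ring

theorem ModeData.inner_coh (h : ModeData z t) (hμ : IsFieldMeasure z t μ) (v w : PhaseSpace) :
    inner ℂ (h.coh hμ v) (h.coh hμ w) =
      conj (sympPhase v w) * Complex.exp (-(sympJ z t (w - v) : ℂ) / 4) := by
  rw [coh, coh, h.isShape.inner_vec_translate, h.isShape.inner_vec_zero, h.tsum_packetDist]
  push_cast
  rw [neg_div]

theorem integral_chr_eq (hμ : IsFieldMeasure z t μ) (f : TestFn) :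
    ∫ T, chr f T ∂(μ : Measure Distr) = Complex.exp (-(covForm z t f : ℂ) / 2) := hμ f

theorem ModeData.prodFn_config (h : ModeData z t) (f : TestFn) (n : ℕ) :
    prodFn z t (packets (shape z t) (0, f)) n = chr (trunc f n) := by
  funext T
  rw [prodFn, chr, trunc, Distr.apply_sum]
  push_cast
  rw [Finset.mul_sum, Complex.exp_sum]
  refine Finset.prod_congr rfl fun l _ => ?_
  rw [div_eq_iff (packet_ne_zero (h.shape_im_pos l) _ _ _), packets, packet, packet, coeff_zero,
    mul_left_comm, ← Complex.exp_add, Distr.apply_smul]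
  congr 2
  push_cast
  ring

theorem ModeData.tendsto_covForm_trunc (h : ModeData z t) (f : TestFn) :
    Tendsto (fun n => covForm z t (trunc f n - f)) atTop (𝓝 0) := by
  have hs := (h.summable_cov f).hasSum
  have e : ∀ n, covForm z t (trunc f n - f) = (∑' l, ‖z l t‖ ^ 2 * coeff f l ^ 2) -
      ∑ l ∈ Finset.range n, ‖z l t‖ ^ 2 * coeff f l ^ 2 := by
    intro n
    rw [covForm]
    have h1 : HasSum (fun l => if l ∈ Finset.range n then ‖z l t‖ ^ 2 * coeff f l ^ 2 else 0)
        (∑ l ∈ Finset.range n, ‖z l t‖ ^ 2 * coeff f l ^ 2) := by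
      have : HasSum (fun l => if l ∈ Finset.range n then ‖z l t‖ ^ 2 * coeff f l ^ 2 else 0)
          (∑ l ∈ Finset.range n, if l ∈ Finset.range n then ‖z l t‖ ^ 2 * coeff f l ^ 2 else 0) :=
        hasSum_sum_of_ne_finset_zero fun l hl => if_neg hl
      rwa [Finset.sum_congr rfl fun l hl => if_pos hl] at this
    refine ((hs.sub h1).congr_fun fun l => ?_).tsum_eq
    rw [coeff_sub, coeff_trunc]
    by_cases h2 : l < n <;> simp [h2]
  simp only [e]
  have := hs.tendsto_sum_nat.const_sub (∑' l, ‖z l t‖ ^ 2 * coeff f l ^ 2)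
  rwa [sub_self] at this

theorem memLp_chr (f : TestFn) : MemLp (chr f) 2 (μ : Measure Distr) :=
  MemLp.of_bound (measurable_chr f).aestronglyMeasurable 1 (.of_forall fun T => (norm_chr f T).le)

theorem chrMul_vac (f : TestFn) : chrMul f (vac μ) = (memLp_chr f).toLp (chr f) := by
  refine (MemLp.toLp_eq_toLp_iff _ _).2 ?_
  filter_upwards [coeFn_vac (μ := μ)] with T hT
  rw [hT, mul_one]

theorem norm_chrMul (f : TestFn) (ψ : HS μ) : ‖chrMul f ψ‖ = ‖ψ‖ := by
  rw [Lp.norm_def, Lp.norm_def]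
  congr 1
  refine eLpNorm_congr_norm_ae ?_
  filter_upwards [coeFn_chrMul f ψ] with T hT
  rw [hT, norm_mul, norm_chr, one_mul]

/-- Multiplication by a character as an isometry. -/
def chrMulL (f : TestFn) : HS μ →ₗᵢ[ℂ] HS μ where
  toFun := chrMul f
  map_add' := fun φ ψ => by
    refine Lp.ext ?_
    filter_upwards [coeFn_chrMul f (φ + ψ), coeFn_chrMul f φ, coeFn_chrMul f ψ,
      Lp.coeFn_add φ ψ, Lp.coeFn_add (chrMul f φ) (chrMul f ψ)] with T h1 h2 h3 h4 h5
    rw [h1, h5, Pi.add_apply, h2, h3, h4, Pi.add_apply, mul_add]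
  map_smul' := fun c ψ => by
    refine Lp.ext ?_
    filter_upwards [coeFn_chrMul f (c • ψ), coeFn_chrMul f ψ, Lp.coeFn_smul c ψ,
      Lp.coeFn_smul c (chrMul f ψ)] with T h1 h2 h3 h4
    rw [h1, RingHom.id_apply, h4, Pi.smul_apply, h2, h3, Pi.smul_apply, smul_eq_mul, smul_eq_mul,
      mul_left_comm]
  norm_map' := norm_chrMul f

theorem chrMul_chrMul (f g : TestFn) (ψ : HS μ) : chrMul f (chrMul g ψ) = chrMul (f + g) ψ := by
  refine Lp.ext ?_
  filter_upwards [coeFn_chrMul f (chrMul g ψ), coeFn_chrMul g ψ, coeFn_chrMul (f + g) ψ]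
    with T h1 h2 h3
  rw [h1, h2, h3, chr_add, mul_assoc]

theorem chrMul_zero (ψ : HS μ) : chrMul 0 ψ = ψ := by
  refine Lp.ext ?_
  filter_upwards [coeFn_chrMul 0 ψ] with T h1
  rw [h1, chr_zero, one_mul]

/-- Finite products with pure momentum shifts are the characters of truncations of f. Their inner
products with the character of f are values of the Fourier transform and tend to 1, and unit vectors
with inner product 1 coincide. -/
theorem ModeData.coh_config (h : ModeData z t) (hμ : IsFieldMeasure z t μ) (f : TestFn) :
    h.coh hμ (0, f) = chrMul f (vac μ) := by
  have h1 := (h.isShape.tendsto_vec h hμ (0, f)).inner (𝕜 := ℂ)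
    (tendsto_const_nhds (x := chrMul f (vac μ)))
  have h2 : ∀ n, inner ℂ (h.prodVec hμ (h.isShape.isWave (0, f)) n) (chrMul f (vac μ)) =
      Complex.exp (-(covForm z t (trunc f n - f) : ℂ) / 2) := by
    intro n
    rw [chrMul_vac, prodVec, inner_toLp, ← integral_chr_eq hμ]
    have e : covForm z t (trunc f n - f) = covForm z t (f - trunc f n) := by
      simp only [covForm, coeff_sub]
      congr 1; funext l; ring
    rw [integral_chr_eq hμ, e, ← integral_chr_eq hμ]
    congr 1
    funext T
    rw [h.prodFn_config, ← chr_neg, ← chr_add, neg_add_eq_sub]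
  simp only [h2] at h1
  have h3 : Tendsto (fun n => Complex.exp (-(covForm z t (trunc f n - f) : ℂ) / 2)) atTop (𝓝 1) := by
    have h4 : ContinuousAt (fun x : ℝ => Complex.exp (-(x : ℂ) / 2)) 0 := by fun_prop
    have := Tendsto.comp h4 (h.tendsto_covForm_trunc f)
    simpa [Function.comp_def] using this
  have h4 := tendsto_nhds_unique h1 h3
  exact (inner_eq_one_iff_of_norm_eq_one (h.isShape.norm_vec h hμ _)
    (by rw [norm_chrMul, norm_vac])).1 h4

theorem ModeData.coh_zero (h : ModeData z t) (hμ : IsFieldMeasure z t μ) :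
    h.coh hμ 0 = vac μ := by
  have := h.coh_config hμ 0
  rwa [chrMul_zero] at this

theorem ModeData.total_coh (h : ModeData z t) (hμ : IsFieldMeasure z t μ) :
    Dense (Submodule.span ℂ (Set.range (h.coh hμ)) : Set (HS μ)) := by
  refine total_chr.mono (Submodule.span_mono ?_)
  rintro _ ⟨f, rfl⟩
  exact ⟨(0, f), h.coh_config hμ f⟩

theorem eq_zero_of_total {ι H : Type*} [NormedAddCommGroup H] [InnerProductSpace ℂ H]
    {x : ι → H} (hx : Dense (Submodule.span ℂ (Set.range x) : Set H)) {v : H}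
    (hv : ∀ i, inner ℂ (x i) v = 0) : v = 0 := by
  refine hx.eq_zero_of_inner_right ℂ fun u hu => ?_
  induction hu using Submodule.span_induction with
  | mem _ hu => obtain ⟨i, rfl⟩ := hu; exact hv i
  | zero => exact inner_zero_left _
  | add a b _ _ ha hb => rw [inner_add_left, ha, hb, add_zero]
  | smul c a _ ha => rw [inner_smul_left, ha, mul_zero]

theorem eq_of_total {ι H : Type*} [NormedAddCommGroup H] [InnerProductSpace ℂ H]
    {x : ι → H} (hx : Dense (Submodule.span ℂ (Set.range x) : Set H)) {u v : H}
    (hv : ∀ i, inner ℂ (x i) u = inner ℂ (x i) v) : u = v :=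
  sub_eq_zero.1 (eq_zero_of_total hx fun i => by rw [inner_sub_right, hv, sub_self])

theorem sympPhase_add_right (u v w : PhaseSpace) :
    sympPhase u (v + w) = sympPhase u v * sympPhase u w := by
  rw [sympPhase, sympPhase, sympPhase, ← Complex.exp_add, symp_add_right]
  push_cast; ring_nf

theorem sympPhase_add_left (u v w : PhaseSpace) :
    sympPhase (u + v) w = sympPhase u w * sympPhase v w := by
  rw [sympPhase, sympPhase, sympPhase, ← Complex.exp_add, symp_add_left]
  push_cast; ring_nf

theorem sympPhase_self (v : PhaseSpace) : sympPhase v v = 1 := by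
  simp [sympPhase, symp_self]

theorem sympPhase_ne_zero (v w : PhaseSpace) : sympPhase v w ≠ 0 := Complex.exp_ne_zero _

theorem sympPhase_mul_conj (v w : PhaseSpace) : sympPhase v w * conj (sympPhase v w) = 1 := by
  rw [Complex.mul_conj', norm_sympPhase]; simp

theorem conj_sympPhase_eq (v w : PhaseSpace) : conj (sympPhase v w) = sympPhase w v := by
  rw [conj_sympPhase, sympPhase, symp_swap v w]
  push_cast; ring_nf

/-- Translation by w leaves the kernel exp(−ω(Jv, v)/4) of differences unchanged, and the prefactor
compensates the change of the symplectic phase. The Gram matrices therefore agree. -/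
theorem ModeData.exists_weyl (h : ModeData z t) (hμ : IsFieldMeasure z t μ) (w : PhaseSpace) :
    ∃ U : HS μ ≃ₗᵢ[ℂ] HS μ, ∀ v, U (h.coh hμ v) = sympPhase w v • h.coh hμ (w + v) := by
  refine exists_unitary_of_gram (fun u v => ?_) (h.total_coh hμ) (total_of_inner fun ψ hψ => ?_)
  · rw [inner_smul_left, inner_smul_right, h.inner_coh, h.inner_coh, add_sub_add_left_eq_sub]
    simp only [sympPhase_add_left, sympPhase_add_right, sympPhase_self, map_mul, map_one,
      conj_sympPhase_eq]
    have e1 := sympPhase_mul_conj u w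
    have e2 := sympPhase_mul_conj v w
    rw [conj_sympPhase_eq] at e1 e2
    linear_combination (-(sympPhase v u * sympPhase w v * sympPhase v w *
      Complex.exp (-(sympJ z t (v - u) : ℂ) / 4))) * e1 -
        (sympPhase v u * Complex.exp (-(sympJ z t (v - u) : ℂ) / 4)) * e2
  · refine eq_zero_of_total (h.total_coh hμ) fun v => ?_
    have h1 := hψ (v - w)
    rw [inner_smul_left, add_sub_cancel, mul_eq_zero] at h1
    exact h1.resolve_left (by simpa using sympPhase_ne_zero _ _)

/-- The Weyl operators of the Schrödinger representation. -/
def ModeData.weyl (h : ModeData z t) (hμ : IsFieldMeasure z t μ) : WeylFamily μ :=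
  fun w => Classical.choose (h.exists_weyl hμ w)

theorem ModeData.weyl_coh (h : ModeData z t) (hμ : IsFieldMeasure z t μ) (w v : PhaseSpace) :
    h.weyl hμ w (h.coh hμ v) = sympPhase w v • h.coh hμ (w + v) :=
  Classical.choose_spec (h.exists_weyl hμ w) v

theorem isometry_ext_of_total {ι H K : Type*} [NormedAddCommGroup H] [InnerProductSpace ℂ H]
    [NormedAddCommGroup K] [InnerProductSpace ℂ K] {x : ι → H}
    (hx : Dense (Submodule.span ℂ (Set.range x) : Set H)) {f g : H →ₗᵢ[ℂ] K}
    (hfg : ∀ i, f (x i) = g (x i)) (ψ : H) : f ψ = g ψ := by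
  have := eq_of_eqOn_total hx (f := f.toContinuousLinearMap) (g := g.toContinuousLinearMap) hfg
  exact congrArg (fun F : H →L[ℂ] K => F ψ) this

theorem ModeData.isSchrodingerRep_weyl (h : ModeData z t) (hμ : IsFieldMeasure z t μ) :
    IsSchrodingerRep z t μ (h.weyl hμ) := by
  refine ⟨fun w₁ w₂ ψ => ?_, fun f ψ => ?_, fun w => ?_⟩
  · rw [← sympPhase]
    have h1 := eq_of_eqOn_total (h.total_coh hμ)
      (f := ((h.weyl hμ w₂).trans (h.weyl hμ w₁)).toLinearIsometry.toContinuousLinearMap)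
      (g := sympPhase w₁ w₂ • (h.weyl hμ (w₁ + w₂)).toLinearIsometry.toContinuousLinearMap)
      fun v => by
        show h.weyl hμ w₁ (h.weyl hμ w₂ (h.coh hμ v)) =
          sympPhase w₁ w₂ • h.weyl hμ (w₁ + w₂) (h.coh hμ v)
        rw [h.weyl_coh, map_smul, h.weyl_coh, h.weyl_coh, smul_smul, smul_smul,
          sympPhase_add_left, sympPhase_add_right, add_assoc]
        congr 1
        ring
    exact congrArg (fun F : HS μ →L[ℂ] HS μ => F ψ) h1
  · have h1 : h.weyl hμ (0, f) ψ = chrMul f ψ := by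
      refine isometry_ext_of_total total_chr (f := (h.weyl hμ (0, f)).toLinearIsometry)
        (g := chrMulL f) (fun g => ?_) ψ
      show h.weyl hμ (0, f) (chrMul g (vac μ)) = chrMul f (chrMul g (vac μ))
      rw [chrMul_chrMul, ← h.coh_config hμ g, h.weyl_coh, ← h.coh_config hμ]
      have : sympPhase (0, f) (0, g) = 1 := by
        rw [sympPhase, symp_eq]
        simp
      rw [this, one_smul, Prod.mk_add_mk, add_zero]
    rw [h1]
    exact coeFn_chrMul f ψ
  · rw [← h.coh_zero hμ, h.weyl_coh, inner_smul_right, h.inner_coh, add_zero, sub_zero]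
    have : sympPhase w 0 = 1 ∧ sympPhase 0 w = 1 := by
      constructor <;> simp [sympPhase, symp_zero_left, symp_zero_right]
    rw [this.1, this.2]
    simp

end Gowdy

end

noncomputable section

namespace Gowdy

open ComplexConjugate

/-! ### General properties of the representations -/

variable {z : ℕ → ℝ → ℂ} {t : ℝ} {μ : ProbabilityMeasure Distr} {W : WeylFamily μ}

theorem IsSchrodingerRep.mul (hW : IsSchrodingerRep z t μ W) (v w : PhaseSpace) (ψ : HS μ) :
    W v (W w ψ) = sympPhase v w • W (v + w) ψ := hW.weyl v w ψ

theorem sympPhase_zero_left (w : PhaseSpace) : sympPhase 0 w = 1 := by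
  simp [sympPhase, symp_zero_left]

theorem sympPhase_zero_right (w : PhaseSpace) : sympPhase w 0 = 1 := by
  simp [sympPhase, symp_zero_right]

theorem sympPhase_neg_left (v w : PhaseSpace) : sympPhase (-v) w = sympPhase w v := by
  rw [sympPhase, sympPhase, symp_neg_left, symp_swap w v]

theorem IsSchrodingerRep.zero (hW : IsSchrodingerRep z t μ W) (ψ : HS μ) : W 0 ψ = ψ := by
  have h := hW.mul 0 0 ψ
  rw [sympPhase_zero_left, one_smul, add_zero] at h
  exact (W 0).injective h

theorem IsSchrodingerRep.neg_apply (hW : IsSchrodingerRep z t μ W) (w : PhaseSpace) (ψ : HS μ) :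
    W (-w) (W w ψ) = ψ := by
  rw [hW.mul, neg_add_cancel, hW.zero, sympPhase_neg_left, sympPhase_self, one_smul]

theorem IsSchrodingerRep.apply_neg (hW : IsSchrodingerRep z t μ W) (w : PhaseSpace) (ψ : HS μ) :
    W w (W (-w) ψ) = ψ := by
  have := hW.neg_apply (-w) ψ
  rwa [neg_neg] at this

theorem IsSchrodingerRep.config_eq (hW : IsSchrodingerRep z t μ W) (f : TestFn) (ψ : HS μ) :
    W (0, f) ψ = chrMul f ψ :=
  Lp.ext ((hW.config f ψ).trans (coeFn_chrMul f ψ).symm)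

theorem IsSchrodingerRep.inner_left (hW : IsSchrodingerRep z t μ W) (w : PhaseSpace) (φ ψ : HS μ) :
    inner ℂ (W w φ) ψ = inner ℂ φ (W (-w) ψ) := by
  rw [← (W w).inner_map_map φ, hW.apply_neg]

theorem IsSchrodingerRep.inner_vac (hW : IsSchrodingerRep z t μ W) (v w : PhaseSpace) :
    inner ℂ (W v (vac μ)) (W w (vac μ)) =
      conj (sympPhase v w) * Complex.exp (-(sympJ z t (w - v) : ℂ) / 4) := by
  rw [hW.inner_left, hW.mul, inner_smul_right, hW.state, sympPhase_neg_left, conj_sympPhase_eq,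
    neg_add_eq_sub]

/-- The characters applied to 1 are total and arise from W(0, f). Matrix elements between them
reduce, by the Weyl relations, to vacuum expectation values, which are prescribed. -/
theorem IsSchrodingerRep.unique {W' : WeylFamily μ} (hW : IsSchrodingerRep z t μ W)
    (hW' : IsSchrodingerRep z t μ W') : W = W' := by
  funext w
  refine LinearIsometryEquiv.ext fun ψ => ?_
  refine isometry_ext_of_total total_chr (f := (W w).toLinearIsometry)
    (g := (W' w).toLinearIsometry) (fun f => ?_) ψ
  refine eq_of_total total_chr fun g => ?_
  show inner ℂ (chrMul g (vac μ)) (W w (chrMul f (vac μ))) =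
    inner ℂ (chrMul g (vac μ)) (W' w (chrMul f (vac μ)))
  conv_lhs => rw [← hW.config_eq, ← hW.config_eq, hW.mul, inner_smul_right, hW.inner_vac]
  conv_rhs => rw [← hW'.config_eq, ← hW'.config_eq, hW'.mul, inner_smul_right, hW'.inner_vac]

theorem ModeData.existsUnique_rep (h : ModeData z t) (hμ : IsFieldMeasure z t μ) :
    ∃! W : WeylFamily μ, IsSchrodingerRep z t μ W :=
  ⟨h.weyl hμ, h.isSchrodingerRep_weyl hμ, fun _ hW => hW.unique (h.isSchrodingerRep_weyl hμ)⟩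

theorem IsSchrodingerRep.apply_coh (hW : IsSchrodingerRep z t μ W) (h : ModeData z t)
    (hμ : IsFieldMeasure z t μ) (w v : PhaseSpace) :
    W w (h.coh hμ v) = sympPhase w v • h.coh hμ (w + v) := by
  rw [hW.unique (h.isSchrodingerRep_weyl hμ), h.weyl_coh]

theorem IsSchrodingerRep.apply_vac (hW : IsSchrodingerRep z t μ W) (h : ModeData z t)
    (hμ : IsFieldMeasure z t μ) (w : PhaseSpace) : W w (vac μ) = h.coh hμ w := by
  rw [← h.coh_zero hμ, hW.apply_coh h hμ, sympPhase_zero_right, one_smul, add_zero]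

theorem IsSchrodingerRep.total_vac (hW : IsSchrodingerRep z t μ W) (h : ModeData z t)
    (hμ : IsFieldMeasure z t μ) :
    Dense (Submodule.span ℂ (Set.range fun w => W w (vac μ)) : Set (HS μ)) := by
  simp only [hW.apply_vac h hμ]
  exact h.total_coh hμ

/-- The Weyl operators displace infinite products of packets. -/
theorem IsSchrodingerRep.apply_vec (hW : IsSchrodingerRep z t μ W) (h : ModeData z t)
    (hμ : IsFieldMeasure z t μ) {κ : ℕ → ℂ} (hκ : IsShape z t κ) (w v : PhaseSpace) :
    W w (hκ.vec h hμ v) = sympPhase w v • hκ.vec h hμ (w + v) := by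
  -- Both sides are tested against coherent vectors, to which the adjoint W(−w) can be applied
  -- explicitly.
  refine eq_of_total (h.total_coh hμ) fun u => ?_
  rw [← inner_conj_symm, hW.inner_left, inner_conj_symm, hW.apply_coh h hμ, inner_smul_left,
    inner_smul_right, ModeData.coh, ModeData.coh, h.isShape.inner_vec_translate,
    h.isShape.inner_vec_translate (v := u)]
  have e : v - (-w + u) = w + v - u := by abel
  rw [e]
  simp only [sympPhase_add_left, sympPhase_add_right, sympPhase_neg_left, map_mul,
    conj_sympPhase_eq]
  ring

end Gowdy

end

noncomputable section

namespace Gowdy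

open ComplexConjugate

/-! ### Bogoliubov coefficients -/

variable {z : ℕ → ℝ → ℂ} {t₀ t₁ : ℝ}

theorem bogAlpha_normSq_sub (h₀ : ModeData z t₀) (h₁ : ModeData z t₁) (l : ℕ) :
    ‖bogAlpha z t₁ t₀ l‖ ^ 2 - ‖bogBeta z t₁ t₀ l‖ ^ 2 = 1 := by
  have w0 := h₀.wronskian l
  have w1 := h₁.wronskian l
  apply Complex.ofReal_injective
  push_cast
  rw [← Complex.mul_conj', ← Complex.mul_conj', bogAlpha, bogBeta]
  simp only [map_mul, map_sub, Complex.conj_I, Complex.conj_conj]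
  linear_combination (-(z l t₀ * conj (deriv (z l) t₀) - conj (z l t₀) * deriv (z l) t₀) *
    Complex.I ^ 2) * w1 * (-1) + (-Complex.I ^ 3) * w0 * (-1) + (Complex.I ^ 2 - 1) * Complex.I_sq

theorem bogAlpha_mul_sub (h₁ : ModeData z t₁) (l : ℕ) :
    bogAlpha z t₁ t₀ l * conj (z l t₁) - bogBeta z t₁ t₀ l * z l t₁ = conj (z l t₀) := by
  have w1 := h₁.wronskian l
  rw [bogAlpha, bogBeta]
  linear_combination (-Complex.I * conj (z l t₀)) * w1 - conj (z l t₀) * Complex.I_sq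

/-- The deviation from one of the ratio of vacuum widths. -/
def bogEta (z : ℕ → ℝ → ℂ) (t₁ t₀ : ℝ) (l : ℕ) : ℂ :=
  bogBeta z t₁ t₀ l * z l t₁ / conj (z l t₀)

/-- This is the ratio that appears in the Gaussian integral of two vacuum packets; |1 + η| contains
|α|, the only part of it that survives in the modulus of the overlap. -/
theorem one_add_bogEta (h₀ : ModeData z t₀) (h₁ : ModeData z t₁) (l : ℕ) :
    1 + bogEta z t₁ t₀ l = bogAlpha z t₁ t₀ l * conj (z l t₁) / conj (z l t₀) := by
  have hz : conj (z l t₀) ≠ 0 := by simpa using h₀.ne_zero l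
  have := bogAlpha_mul_sub (t₀ := t₀) h₁ l
  rw [bogEta, eq_div_iff hz, add_mul, div_mul_cancel₀ _ hz]
  linear_combination -this

theorem ModeData.one_le_two_mul_norm {t : ℝ} (h : ModeData z t) (l : ℕ) :
    1 ≤ 2 * (‖z l t‖ * ‖deriv (z l) t‖) := by
  have h1 := congrArg norm (h.wronskian l)
  have h2 := norm_sub_le (z l t * conj (deriv (z l) t)) (conj (z l t) * deriv (z l) t)
  rw [h1] at h2
  simp only [norm_mul, RCLike.norm_conj, Complex.norm_I] at h2
  linarith

/-- The ratio |z(t₁)|/|z(t₀)| is bounded: the Wronskian gives 2|z||ż| ≥ 1, so |z(t₀)| cannot be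
smaller than a multiple of λ^(-1/2). -/
theorem exists_norm_bogEta_le (h₀ : ModeData z t₀) (h₁ : ModeData z t₁) :
    ∃ C, 0 ≤ C ∧ ∀ l, ‖bogEta z t₁ t₀ l‖ ≤ C * ‖bogBeta z t₁ t₀ l‖ := by
  obtain ⟨A, hA, hA'⟩ := h₀.bound
  obtain ⟨B, hB, hB'⟩ := h₁.bound
  refine ⟨2 * A * B, by positivity, fun l => ?_⟩
  have hz : 0 < ‖z l t₀‖ := norm_pos_iff.2 (h₀.ne_zero l)
  have h1 := h₀.one_le_two_mul_norm l
  have h2 := (hA' l).2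
  have h3 := (hB' l).1
  have h4 : ‖z l t₁‖ ≤ 2 * A * B * ‖z l t₀‖ := by
    calc ‖z l t₁‖ ≤ ‖z l t₁‖ * (2 * (‖z l t₀‖ * ‖deriv (z l) t₀‖)) :=
          le_mul_of_one_le_right (norm_nonneg _) h1
      _ ≤ ‖z l t₁‖ * (2 * (‖z l t₀‖ * (A * √(l + 1 / 2)))) := by gcongr
      _ = 2 * A * (‖z l t₁‖ * √(l + 1 / 2)) * ‖z l t₀‖ := by ring
      _ ≤ 2 * A * B * ‖z l t₀‖ := by gcongr
  rw [bogEta, norm_div, norm_mul, RCLike.norm_conj, div_le_iff₀ hz]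
  nlinarith [norm_nonneg (bogBeta z t₁ t₀ l)]

theorem ModeData.exists_normSq_le {t : ℝ} (h : ModeData z t) : ∃ C, 0 ≤ C ∧ ∀ l, ‖z l t‖ ^ 2 ≤ C := by
  obtain ⟨C, hC, hb⟩ := h.bound
  refine ⟨2 * C ^ 2, by positivity, fun l => ?_⟩
  have h1 : ‖z l t‖ ^ 2 * ((l : ℝ) + 1 / 2) ≤ C ^ 2 := by
    rw [← Real.sq_sqrt (show (0 : ℝ) ≤ l + 1 / 2 by positivity), ← mul_pow]
    exact pow_le_pow_left₀ (by positivity) (hb l).1 2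
  nlinarith [sq_nonneg ‖z l t‖, Nat.cast_nonneg (α := ℝ) l,
    mul_nonneg (sq_nonneg ‖z l t‖) (Nat.cast_nonneg (α := ℝ) l)]

/-- The relation z̄₀ = αz̄₁ − βz₁ places |z₀| between (|α| − |β|)|z₁| and (|α| + |β|)|z₁|. With |α|²
= 1 + |β|² the difference of squares is O(|β|). -/
theorem summable_normSq_sub_sq (h₀ : ModeData z t₀) (h₁ : ModeData z t₁)
    (hβ : Summable fun l => ‖bogBeta z t₁ t₀ l‖ ^ 2) :
    Summable fun l => (‖z l t₁‖ ^ 2 - ‖z l t₀‖ ^ 2) ^ 2 := by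
  obtain ⟨C, hC, hz⟩ := h₁.exists_normSq_le
  obtain ⟨B, hB, hβB⟩ := exists_le_of_summable_sq hβ
  refine Summable.of_nonneg_of_le (fun l => sq_nonneg _) (fun l => ?_)
    (hβ.mul_left ((C * (4 * B + 2)) ^ 2))
  rw [← mul_pow, sq_le_sq, abs_sub_comm]
  refine le_trans ?_ (le_abs_self _)
  have h1 := bogAlpha_normSq_sub h₀ h₁ l
  have h2 := bogAlpha_mul_sub (t₀ := t₀) h₁ l
  have hb := hβB l
  rw [abs_of_nonneg (norm_nonneg _)] at hb
  have hz1 := hz l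
  set a := ‖bogAlpha z t₁ t₀ l‖
  set b := ‖bogBeta z t₁ t₀ l‖
  have ha0 : 0 ≤ a := norm_nonneg _
  have hb0 : 0 ≤ b := norm_nonneg _
  have h3 : ‖z l t₀‖ ≤ (a + b) * ‖z l t₁‖ := by
    have := norm_sub_le (bogAlpha z t₁ t₀ l * conj (z l t₁)) (bogBeta z t₁ t₀ l * z l t₁)
    rw [h2, norm_mul, norm_mul, RCLike.norm_conj, RCLike.norm_conj] at this
    linarith
  have h4 : (a - b) * ‖z l t₁‖ ≤ ‖z l t₀‖ := by
    have := norm_sub_norm_le (bogAlpha z t₁ t₀ l * conj (z l t₁)) (bogBeta z t₁ t₀ l * z l t₁)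
    rw [h2, norm_mul, norm_mul, RCLike.norm_conj, RCLike.norm_conj] at this
    linarith
  have hab : b ≤ a := by nlinarith
  have hab1 : a ≤ 1 + b := by nlinarith
  have h5 : ‖z l t₀‖ ^ 2 ≤ ((a + b) * ‖z l t₁‖) ^ 2 := by gcongr
  have h6 : ((a - b) * ‖z l t₁‖) ^ 2 ≤ ‖z l t₀‖ ^ 2 :=
    pow_le_pow_left₀ (mul_nonneg (by linarith) (norm_nonneg _)) h4 2
  rw [mul_pow] at h5 h6
  have h7 : |‖z l t₀‖ ^ 2 - ‖z l t₁‖ ^ 2| ≤ (2 * b ^ 2 + 2 * a * b) * ‖z l t₁‖ ^ 2 := by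
    have hp := mul_nonneg (sq_nonneg b) (sq_nonneg ‖z l t₁‖)
    have e : a ^ 2 = 1 + b ^ 2 := by linarith
    rw [abs_le]
    constructor
    · have : (a - b) ^ 2 * ‖z l t₁‖ ^ 2 = (1 + 2 * b ^ 2 - 2 * a * b) * ‖z l t₁‖ ^ 2 := by
        rw [sub_sq, e]; ring
      nlinarith
    · have : (a + b) ^ 2 * ‖z l t₁‖ ^ 2 = (1 + 2 * b ^ 2 + 2 * a * b) * ‖z l t₁‖ ^ 2 := by
        rw [add_sq, e]; ring
      nlinarith
  refine h7.trans ?_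
  have h8 : 2 * b ^ 2 + 2 * a * b ≤ (4 * B + 2) * b := by nlinarith
  calc (2 * b ^ 2 + 2 * a * b) * ‖z l t₁‖ ^ 2 ≤ ((4 * B + 2) * b) * C := by gcongr
    _ = C * (4 * B + 2) * b := by ring

/-- The Gaussian integral yields (1 + η)^(-1/2) up to a positive factor. The inserted phase cancels
the linear part of the argument, which leaves log(1+η) − η = O(|η|²); the modulus |α|^(-1/2) is of
second order by itself. -/
theorem packetOverlap_vac (h₀ : ModeData z t₀) (h₁ : ModeData z t₁) {l : ℕ}
    (hη : ‖bogEta z t₁ t₀ l‖ < 1) :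
    Complex.exp (Complex.I * ((bogEta z t₁ t₀ l).im / 2 : ℝ)) *
      packetOverlap (shape z t₁ l) (shape z t₀ l) 0 0 =
    Complex.exp (-(Real.log ‖bogAlpha z t₁ t₀ l‖ / 2 : ℝ) -
      Complex.I / 2 * ((Complex.log (1 + bogEta z t₁ t₀ l) - bogEta z t₁ t₀ l).im : ℝ)) := by
  have hz0 := h₀.ne_zero l
  have hz1 := h₁.ne_zero l
  have hc0 : conj (z l t₀) ≠ 0 := by simpa using hz0
  have hc1 : conj (z l t₁) ≠ 0 := by simpa using hz1
  have hn0 : 0 < ‖z l t₀‖ := norm_pos_iff.2 hz0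
  have hn1 : 0 < ‖z l t₁‖ := norm_pos_iff.2 hz1
  have hpi := Real.pi_pos
  have hα : 0 < ‖bogAlpha z t₁ t₀ l‖ := by
    have := bogAlpha_normSq_sub h₀ h₁ l
    refine lt_of_le_of_ne (norm_nonneg _) fun h => ?_
    rw [← h] at this
    nlinarith [sq_nonneg ‖bogBeta z t₁ t₀ l‖]
  set η := bogEta z t₁ t₀ l with hηd
  have h1η : 1 + η ≠ 0 := by
    intro h
    have : η = -1 := by linear_combination h
    rw [this] at hη
    simp at hη
  have hslit : 1 + η ∈ Complex.slitPlane := Complex.mem_slitPlane_of_norm_lt_one hη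
  -- the quadratic coefficient
  have hB : (Real.pi : ℂ) / -(Complex.I * (shape z t₀ l - conj (shape z t₁ l)) / 2) =
      ((2 * Real.pi * ‖z l t₁‖ ^ 2 : ℝ) : ℂ) * (1 + η)⁻¹ := by
    have e : -(Complex.I * (shape z t₀ l - conj (shape z t₁ l)) / 2) =
        (1 + η) / (2 * (z l t₁ * conj (z l t₁))) := by
      rw [one_add_bogEta h₀ h₁, shape, shape, bogAlpha, map_div₀, Complex.conj_conj,
        Complex.conj_conj]
      field_simp
      ring
    rw [e, Complex.mul_conj']
    push_cast
    field_simp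
  have hlog : Complex.log (((2 * Real.pi * ‖z l t₁‖ ^ 2 : ℝ) : ℂ) * (1 + η)⁻¹) =
      Real.log (2 * Real.pi * ‖z l t₁‖ ^ 2) - Complex.log (1 + η) := by
    rw [Complex.log_ofReal_mul (by positivity) (inv_ne_zero h1η),
      Complex.log_inv _ (Complex.slitPlane_arg_ne_pi hslit), sub_eq_add_neg]
  have hR : packetAmp (shape z t₁ l) * packetAmp (shape z t₀ l) *
      Real.exp (Real.log (2 * Real.pi * ‖z l t₁‖ ^ 2) / 2) =
      Real.exp (Real.log (‖z l t₁‖ / ‖z l t₀‖) / 2) := by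
    rw [Real.exp_half, Real.exp_half, Real.exp_log (by positivity), Real.exp_log (by positivity),
      packetAmp, packetAmp, ← Real.sqrt_mul (Real.sqrt_nonneg _), ← Real.sqrt_mul (by positivity),
      h₀.shape_im, h₁.shape_im, ← Real.sqrt_mul (by positivity)]
    congr 1
    rw [show 1 / (2 * ‖z l t₁‖ ^ 2) / Real.pi * (1 / (2 * ‖z l t₀‖ ^ 2) / Real.pi) =
      (1 / (2 * Real.pi * ‖z l t₁‖ * ‖z l t₀‖)) ^ 2 by field_simp,
      Real.sqrt_sq (by positivity)]
    field_simp
  -- The positive amplitudes contribute √(|z₁|/|z₀|). Their logarithm cancels half of the real part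
  -- of log(1+η) and leaves −log|α|/2.
  have hre : Real.log (‖z l t₁‖ / ‖z l t₀‖) =
      (Complex.log (1 + η)).re - Real.log ‖bogAlpha z t₁ t₀ l‖ := by
    rw [Complex.log_re, one_add_bogEta h₀ h₁, norm_div, norm_mul, RCLike.norm_conj,
      RCLike.norm_conj, mul_div_assoc, Real.log_mul hα.ne' (by positivity)]
    ring
  rw [packetOverlap_eq (h₁.shape_im_pos l) (h₀.shape_im_pos l), hB,
    Complex.cpow_def_of_ne_zero (mul_ne_zero (Complex.ofReal_ne_zero.2 (by positivity))
      (inv_ne_zero h1η)), hlog]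
  have e2 : (Real.log (2 * Real.pi * ‖z l t₁‖ ^ 2) - Complex.log (1 + η)) * (1 / 2 : ℂ) =
      ((Real.log (2 * Real.pi * ‖z l t₁‖ ^ 2) / 2 : ℝ) : ℂ) - Complex.log (1 + η) / 2 := by
    push_cast; ring
  rw [e2, sub_eq_add_neg _ (Complex.log (1 + η) / 2), Complex.exp_add, ← Complex.ofReal_exp,
    ← mul_assoc, ← mul_assoc, ← mul_assoc, mul_assoc (Complex.exp _) (Complex.ofReal _),
    ← Complex.ofReal_mul, hR, Complex.ofReal_exp, ← Complex.exp_add, ← Complex.exp_add,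
    ← Complex.exp_add, hre]
  congr 1
  have e3 := Complex.re_add_im (Complex.log (1 + η))
  rw [Complex.sub_im]
  push_cast
  linear_combination (1 / 2 : ℂ) * e3

theorem norm_packetOverlap_sub_one_le (h₀ : ModeData z t₀) (h₁ : ModeData z t₁) {l : ℕ}
    (hη : ‖bogEta z t₁ t₀ l‖ ≤ 1 / 2) (hβ : ‖bogBeta z t₁ t₀ l‖ ≤ 1) :
    ‖Complex.exp (Complex.I * ((bogEta z t₁ t₀ l).im / 2 : ℝ)) *
      packetOverlap (shape z t₁ l) (shape z t₀ l) 0 0 - 1‖ ≤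
      ‖bogBeta z t₁ t₀ l‖ ^ 2 + ‖bogEta z t₁ t₀ l‖ ^ 2 := by
  rw [packetOverlap_vac h₀ h₁ (by linarith)]
  have hα := bogAlpha_normSq_sub h₀ h₁ l
  have h1 := Complex.norm_log_one_add_sub_self_le (z := bogEta z t₁ t₀ l) (by linarith)
  set η := bogEta z t₁ t₀ l
  set b := ‖bogBeta z t₁ t₀ l‖
  set a := ‖bogAlpha z t₁ t₀ l‖
  have hb0 : 0 ≤ b := norm_nonneg _
  have ha1 : 1 ≤ a := by
    have : 0 ≤ a := norm_nonneg _
    nlinarith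
  have h2 : (1 - ‖η‖)⁻¹ ≤ 2 := by
    rw [inv_le_comm₀ (by linarith) (by norm_num)]
    linarith
  have h3 : ‖Complex.log (1 + η) - η‖ ≤ ‖η‖ ^ 2 := by
    refine h1.trans ?_
    nlinarith [mul_le_mul_of_nonneg_left h2 (sq_nonneg ‖η‖)]
  have h4 : Real.log a ≤ b ^ 2 / 2 := by
    have := Real.log_le_sub_one_of_pos (show 0 < a ^ 2 by positivity)
    rw [Real.log_pow] at this
    push_cast at this
    linarith
  have h5 : 0 ≤ Real.log a := Real.log_nonneg ha1
  have h6 : ‖-(Real.log a / 2 : ℝ) - Complex.I / 2 *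
      ((Complex.log (1 + η) - η).im : ℝ)‖ ≤ b ^ 2 / 4 + ‖η‖ ^ 2 / 2 := by
    refine (norm_sub_le _ _).trans ?_
    have hI : ‖Complex.I / 2‖ = 1 / 2 := by simp
    rw [norm_neg, norm_mul, Complex.norm_real, Complex.norm_real, hI, Real.norm_eq_abs,
      Real.norm_eq_abs, abs_of_nonneg (by positivity)]
    have := (Complex.abs_im_le_norm (Complex.log (1 + η) - η)).trans h3
    linarith
  have h7 : b ^ 2 / 4 + ‖η‖ ^ 2 / 2 ≤ 1 := by nlinarith [norm_nonneg η]
  have h8 := Complex.norm_exp_sub_one_le (h6.trans h7)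
  nlinarith [sq_nonneg b]

theorem summable_packetOverlap_sub_one (h₀ : ModeData z t₀) (h₁ : ModeData z t₁)
    (hβ : Summable fun l => ‖bogBeta z t₁ t₀ l‖ ^ 2) :
    Summable fun l => ‖Complex.exp (Complex.I * ((bogEta z t₁ t₀ l).im / 2 : ℝ)) *
      packetOverlap (shape z t₁ l) (shape z t₀ l) 0 0 - 1‖ := by
  obtain ⟨C, hC, hη⟩ := exists_norm_bogEta_le h₀ h₁
  have hβ0 : Tendsto (fun l => ‖bogBeta z t₁ t₀ l‖) atTop (𝓝 0) := by
    have := hβ.tendsto_atTop_zero.sqrt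
    simpa [Real.sqrt_sq] using this
  have hη0 : Tendsto (fun l => ‖bogEta z t₁ t₀ l‖) atTop (𝓝 0) :=
    squeeze_zero (fun l => norm_nonneg _) hη (by simpa using hβ0.const_mul C)
  refine Summable.of_norm_bounded_eventually_nat (hβ.mul_left (1 + C ^ 2)) ?_
  filter_upwards [hη0.eventually (ge_mem_nhds (show (0 : ℝ) < 1 / 2 by norm_num)),
    hβ0.eventually (ge_mem_nhds one_pos)] with l h1 h2
  rw [norm_norm]
  refine (norm_packetOverlap_sub_one_le h₀ h₁ h1 h2).trans ?_
  have := pow_le_pow_left₀ (norm_nonneg _) (hη l) 2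
  rw [mul_pow] at this
  linarith

end Gowdy

end

noncomputable section

namespace Gowdy

open ComplexConjugate

/-! ### The image of the vacuum -/

variable {z : ℕ → ℝ → ℂ} {t₀ t₁ : ℝ} {μ₀ μ₁ : ProbabilityMeasure Distr}

theorem shape_sub_shape (h₀ : ModeData z t₀) (h₁ : ModeData z t₁) (l : ℕ) :
    Complex.I * (shape z t₀ l - shape z t₁ l) / 2 =
      -(1 / 2) * (bogBeta z t₁ t₀ l / (conj (z l t₀) * conj (z l t₁))) := by
  have hc0 : conj (z l t₀) ≠ 0 := by simpa using h₀.ne_zero l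
  have hc1 : conj (z l t₁) ≠ 0 := by simpa using h₁.ne_zero l
  rw [shape, shape, bogBeta]
  field_simp
  ring

theorem packetAmp_shape (h : ModeData z t₀) (l : ℕ) :
    packetAmp (shape z t₀ l) = √√(1 / (2 * Real.pi)) / ‖z l t₀‖ ^ (1 / 2 : ℝ) := by
  have hn : 0 < ‖z l t₀‖ := norm_pos_iff.2 (h.ne_zero l)
  have := Real.pi_pos
  rw [packetAmp, h.shape_im, ← Real.sqrt_eq_rpow, ← Real.sqrt_div (Real.sqrt_nonneg _)]
  congr 1
  rw [show 1 / (2 * ‖z l t₀‖ ^ 2) / Real.pi = (1 / (2 * Real.pi)) / ‖z l t₀‖ ^ 2 by field_simp,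
    Real.sqrt_div (by positivity), Real.sqrt_sq hn.le]

/-- The vacuum packets at time `t₀`, relative to time `t₁`, multiply to the vacuum products. -/
theorem prodFn_vac (h₀ : ModeData z t₀) (h₁ : ModeData z t₁) (n : ℕ) :
    prodFn z t₁ (packets (shape z t₀) 0) n = vacProd z t₀ t₁ n := by
  funext T
  refine Finset.prod_congr rfl fun l _ => ?_
  have hn0 : 0 < ‖z l t₀‖ := norm_pos_iff.2 (h₀.ne_zero l)
  have hn1 : 0 < ‖z l t₁‖ := norm_pos_iff.2 (h₁.ne_zero l)
  have hpi := Real.pi_pos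
  rw [div_eq_iff (packet_ne_zero (h₁.shape_im_pos l) _ _ _), packets_zero, packet, packet,
    ← shape_sub_shape h₀ h₁, packetAmp_shape h₀, packetAmp_shape h₁, mul_mul_mul_comm,
    ← Complex.exp_add, ← Complex.ofReal_mul]
  congr 2
  · have : ‖z l t₁‖ ^ (1 / 2 : ℝ) ≠ 0 := (Real.rpow_pos_of_pos hn1 _).ne'
    field_simp
  · push_cast
    ring

/-- The vacuum shapes at time `t₀` for the first `n` modes and at time `t₁` for the others. -/
def mixedShape (z : ℕ → ℝ → ℂ) (t₀ t₁ : ℝ) (n l : ℕ) : ℂ :=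
  if l < n then shape z t₀ l else shape z t₁ l

theorem isShape_mixedShape (h₀ : ModeData z t₀) (h₁ : ModeData z t₁) (n : ℕ) :
    IsShape z t₁ (mixedShape z t₀ t₁ n) := by
  refine ⟨fun l => ?_, ?_⟩
  · unfold mixedShape
    split_ifs
    · exact h₀.shape_im_pos l
    · exact h₁.shape_im_pos l
  · filter_upwards [eventually_ge_atTop n] with l hl
    rw [mixedShape, if_neg (by omega)]

theorem isWave_packets (h₀ : ModeData z t₀) (w : PhaseSpace) : IsWave (packets (shape z t₀) w) :=
  h₀.isShape.isWave w

/-- The normalized vector of the vacuum product over the first `n` modes. -/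
def vacProdVec (h₀ : ModeData z t₀) (h₁ : ModeData z t₁) (hμ₁ : IsFieldMeasure z t₁ μ₁) (n : ℕ) :
    HS μ₁ := h₁.prodVec hμ₁ (isWave_packets h₀ 0) n

theorem memLp_vacProd (h₀ : ModeData z t₀) (h₁ : ModeData z t₁) (hμ₁ : IsFieldMeasure z t₁ μ₁)
    (n : ℕ) : MemLp (vacProd z t₀ t₁ n) 2 (μ₁ : Measure Distr) := by
  rw [← prodFn_vac h₀ h₁]
  exact h₁.memLp_prodFn hμ₁ (isWave_packets h₀ 0) n

theorem vacProdVec_eq (h₀ : ModeData z t₀) (h₁ : ModeData z t₁) (hμ₁ : IsFieldMeasure z t₁ μ₁)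
    (n : ℕ) : vacProdVec h₀ h₁ hμ₁ n = (memLp_vacProd h₀ h₁ hμ₁ n).toLp _ := by
  rw [vacProdVec, ModeData.prodVec]
  exact (MemLp.toLp_eq_toLp_iff _ _).2 (.of_forall fun T => by rw [prodFn_vac h₀ h₁])

theorem norm_vacProdVec (h₀ : ModeData z t₀) (h₁ : ModeData z t₁) (hμ₁ : IsFieldMeasure z t₁ μ₁)
    (n : ℕ) : ‖vacProdVec h₀ h₁ hμ₁ n‖ = 1 :=
  h₁.norm_prodVec hμ₁ (isWave_packets h₀ 0) (h₀.isShape.integral_packets_self 0) n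

theorem eLpNorm_vacProd (h₀ : ModeData z t₀) (h₁ : ModeData z t₁) (hμ₁ : IsFieldMeasure z t₁ μ₁)
    (n : ℕ) : eLpNorm (vacProd z t₀ t₁ n) 2 (μ₁ : Measure Distr) = 1 := by
  have h1 := norm_vacProdVec h₀ h₁ hμ₁ n
  rw [vacProdVec_eq, Lp.norm_toLp, ENNReal.toReal_eq_one_iff] at h1
  exact h1

/-- A finite vacuum product is the undisplaced infinite product with finitely many altered shapes.
This makes the action of the Weyl operators on it explicit. -/
theorem vec_mixedShape_zero (h₀ : ModeData z t₀) (h₁ : ModeData z t₁)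
    (hμ₁ : IsFieldMeasure z t₁ μ₁) (n : ℕ) :
    (isShape_mixedShape h₀ h₁ n).vec h₁ hμ₁ 0 = vacProdVec h₀ h₁ hμ₁ n := by
  refine tendsto_nhds_unique ((isShape_mixedShape h₀ h₁ n).tendsto_vec h₁ hμ₁ 0)
    (tendsto_const_nhds.congr' ?_)
  filter_upwards [eventually_ge_atTop n] with m hm
  rw [vacProdVec, ← h₁.prodVec_cutoff hμ₁ _ hm]
  unfold ModeData.prodVec
  congr 1
  refine congrArg (fun φ => prodFn z t₁ φ m) (funext fun l => ?_)
  rw [cutoff, packets_zero, packets_zero, mixedShape]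
  split_ifs <;> rfl

/-- The exponent is a sum over modes whose first n terms belong to t₀ and the rest to t₁. Both
series converge, so the limit is the exponent of the vacuum at t₀. -/
theorem inner_vec_mixedShape (h₀ : ModeData z t₀) (h₁ : ModeData z t₁)
    (hμ₁ : IsFieldMeasure z t₁ μ₁) (w : PhaseSpace) :
    Tendsto (fun n => inner ℂ ((isShape_mixedShape h₀ h₁ n).vec h₁ hμ₁ 0)
      ((isShape_mixedShape h₀ h₁ n).vec h₁ hμ₁ w)) atTop
      (𝓝 (Complex.exp (-(sympJ z t₀ w : ℂ) / 4))) := by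
  set a := fun l => packetDist (shape z t₀ l) (coeff w.1 l) (coeff w.2 l)
  set c := fun l => packetDist (shape z t₁ l) (coeff w.1 l) (coeff w.2 l)
  have ha : Summable a := h₀.isShape.summable_packetDist h₀ w
  have hc : Summable c := h₁.isShape.summable_packetDist h₁ w
  have e : ∀ n, ∑' l, packetDist (mixedShape z t₀ t₁ n l) (coeff w.1 l) (coeff w.2 l) =
      ∑' l, c l + ∑ l ∈ Finset.range n, (a l - c l) := by
    intro n
    have h1 : HasSum (fun l => if l ∈ Finset.range n then a l - c l else 0)
        (∑ l ∈ Finset.range n, (a l - c l)) := by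
      have : HasSum (fun l => if l ∈ Finset.range n then a l - c l else 0)
          (∑ l ∈ Finset.range n, if l ∈ Finset.range n then a l - c l else 0) :=
        hasSum_sum_of_ne_finset_zero fun l hl => if_neg hl
      rwa [Finset.sum_congr rfl fun l hl => if_pos hl] at this
    refine ((hc.hasSum.add h1).congr_fun fun l => ?_).tsum_eq
    by_cases h2 : l < n <;> simp [h2, mixedShape, a, c]
  have h2 : Tendsto (fun n => ∑' l, c l + ∑ l ∈ Finset.range n, (a l - c l)) atTop
      (𝓝 (sympJ z t₀ w / 4)) := by
    have h3 := ((ha.hasSum.sub hc.hasSum).tendsto_sum_nat).const_add (∑' l, c l)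
    rwa [add_sub_cancel, h₀.tsum_packetDist] at h3
  simp only [IsShape.inner_vec_zero, e]
  have h4 := (Complex.continuous_exp.tendsto _).comp
    ((Complex.continuous_ofReal.tendsto _).comp h2).neg
  push_cast at h4
  rw [neg_div]
  simpa [Function.comp_def] using h4

theorem vacPhase_eq (n : ℕ) :
    vacPhase z t₀ t₁ n = ∑ l ∈ Finset.range n, (bogEta z t₁ t₀ l).im / 2 := by
  rw [vacPhase, Finset.mul_sum]
  refine Finset.sum_congr rfl fun l _ => ?_
  rw [bogEta]
  ring

/-- The phase of the vacuum product over the first `n` modes. -/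
def vacPhaseFactor (z : ℕ → ℝ → ℂ) (t₀ t₁ : ℝ) (n : ℕ) : ℂ :=
  Complex.exp (Complex.I * (vacPhase z t₀ t₁ n : ℝ))

theorem norm_vacPhaseFactor (n : ℕ) : ‖vacPhaseFactor z t₀ t₁ n‖ = 1 := by
  rw [vacPhaseFactor, mul_comm, Complex.norm_exp_ofReal_mul_I]

theorem exists_tendsto_vacProdVec (h₀ : ModeData z t₀) (h₁ : ModeData z t₁)
    (hμ₁ : IsFieldMeasure z t₁ μ₁) (hβ : Summable fun l => ‖bogBeta z t₁ t₀ l‖ ^ 2) :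
    ∃ Φ, Tendsto (fun n => vacPhaseFactor z t₀ t₁ n • vacProdVec h₀ h₁ hμ₁ n) atTop (𝓝 Φ) := by
  set c := fun l => Complex.exp (Complex.I * ((bogEta z t₁ t₀ l).im / 2 : ℝ)) with hcd
  have hw := (isWave_packets h₀ 0).const_mul c
  have hc : ∀ l, conj (c l) * c l = 1 := by
    intro l
    rw [mul_comm, Complex.mul_conj', hcd]
    simp only
    rw [mul_comm Complex.I, Complex.norm_exp_ofReal_mul_I]
    simp
  obtain ⟨Φ, hΦ⟩ := h₁.exists_tendsto_prodVec hμ₁ hw (fun l => by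
    simp only [map_mul, mul_mul_mul_comm _ (conj (packets (shape z t₀) 0 l _)), hc, one_mul]
    exact h₀.isShape.integral_packets_self 0 l) (by
    refine (summable_packetOverlap_sub_one h₀ h₁ hβ).congr fun l => ?_
    simp only [mul_left_comm _ (c l)]
    rw [integral_const_mul, packetOverlap, packets_zero])
  refine ⟨Φ, hΦ.congr fun n => ?_⟩
  rw [vacProdVec, ModeData.prodVec, ModeData.prodVec, ← MemLp.toLp_const_smul]
  refine (MemLp.toLp_eq_toLp_iff _ _).2 (.of_forall fun T => ?_)
  simp only [prodFn, Pi.smul_apply, smul_eq_mul, mul_div_assoc]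
  rw [Finset.prod_mul_distrib, vacPhaseFactor, vacPhase_eq, Complex.ofReal_sum, Finset.mul_sum,
    Complex.exp_sum]

end Gowdy

end

noncomputable section

namespace Gowdy

open ComplexConjugate

/-! ### Unitary equivalence of the representations -/

variable {z : ℕ → ℝ → ℂ} {t₀ t₁ : ℝ} {μ₀ μ₁ : ProbabilityMeasure Distr} {W₀ : WeylFamily μ₀}
  {W₁ : WeylFamily μ₁}

/-- The phases cancel in expectation values, so those of Φ are the limits computed for the mixed
shapes: Φ induces the state of time t₀. -/
theorem tendsto_weyl_vacProdVec (h₀ : ModeData z t₀) (h₁ : ModeData z t₁)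
    (hμ₁ : IsFieldMeasure z t₁ μ₁) (hW₁ : IsSchrodingerRep z t₁ μ₁ W₁) {Φ : HS μ₁}
    (hΦ : Tendsto (fun n => vacPhaseFactor z t₀ t₁ n • vacProdVec h₀ h₁ hμ₁ n) atTop (𝓝 Φ))
    (w : PhaseSpace) : inner ℂ Φ (W₁ w Φ) = Complex.exp (-(sympJ z t₀ w : ℂ) / 4) := by
  refine tendsto_nhds_unique (hΦ.inner (𝕜 := ℂ) (((W₁ w).continuous.tendsto Φ).comp hΦ)) ?_
  refine (inner_vec_mixedShape h₀ h₁ hμ₁ w).congr fun n => ?_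
  simp only [Function.comp_apply]
  rw [map_smul, inner_smul_left, inner_smul_right, ← mul_assoc, mul_comm (conj _), Complex.mul_conj',
    norm_vacPhaseFactor, ← vec_mixedShape_zero, hW₁.apply_vec h₁ hμ₁, sympPhase_zero_right, add_zero]
  simp

theorem ModeData.sympJ_config {t : ℝ} (z : ℕ → ℝ → ℂ) (f : TestFn) :
    sympJ z t (0, f) = 2 * covForm z t f := by
  rw [ModeData.sympJ_eq, covForm]
  congr 2
  funext l
  simp only [modeCoeff, coeff_zero]
  simp [mul_pow, Complex.norm_real]

/-- The squared modulus of a vector with the vacuum expectation values of time `t₀` is the density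
of the field measure of time `t₀`. -/
theorem withDensity_eq (hμ₀ : IsFieldMeasure z t₀ μ₀) (hW₁ : IsSchrodingerRep z t₁ μ₁ W₁)
    {Φ : HS μ₁} (hΦ : ∀ w, inner ℂ Φ (W₁ w Φ) = Complex.exp (-(sympJ z t₀ w : ℂ) / 4)) :
    (μ₁ : Measure Distr).withDensity (fun T => ENNReal.ofReal (‖Φ T‖ ^ 2)) = μ₀ := by
  have hi : Integrable (fun T => ‖Φ T‖ ^ 2) (μ₁ : Measure Distr) := (Lp.memLp Φ).integrable_norm_pow two_ne_zero
  have := isFiniteMeasure_withDensity_ofReal hi.2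
  refine measure_ext_of_chr fun f => ?_
  rw [integral_chr_eq hμ₀, integral_withDensity_eq_integral_toReal_smul₀
    hi.1.aemeasurable.ennreal_ofReal (.of_forall fun T => ENNReal.ofReal_lt_top)]
  have h1 := hΦ (0, f)
  rw [hW₁.config_eq, inner_HS, ModeData.sympJ_config] at h1
  rw [show -(covForm z t₀ f : ℂ) / 2 = -((2 * covForm z t₀ f : ℝ) : ℂ) / 4 by push_cast; ring, ← h1]
  refine integral_congr_ae ?_
  filter_upwards [coeFn_chrMul f Φ] with T hT
  rw [hT, ENNReal.toReal_ofReal (sq_nonneg _), Complex.real_smul, mul_left_comm, mul_comm (conj _),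
    Complex.mul_conj', mul_comm]
  push_cast
  rfl

theorem absolutelyContinuous_fieldMeasure (h₀ : ModeData z t₀) (h₁ : ModeData z t₁)
    (hβ : Summable fun l => ‖bogBeta z t₁ t₀ l‖ ^ 2) (hμ₀ : IsFieldMeasure z t₀ μ₀)
    (hμ₁ : IsFieldMeasure z t₁ μ₁) (hW₁ : IsSchrodingerRep z t₁ μ₁ W₁) :
    (μ₀ : Measure Distr) ≪ (μ₁ : Measure Distr) := by
  obtain ⟨Φ, hΦ⟩ := exists_tendsto_vacProdVec h₀ h₁ hμ₁ hβ
  rw [← withDensity_eq hμ₀ hW₁ (tendsto_weyl_vacProdVec h₀ h₁ hμ₁ hW₁ hΦ)]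
  exact withDensity_absolutelyContinuous _ _

/-- The GNS argument: equal states give equal Gram matrices of the two Weyl orbits. Cyclicity of Φ
is the point that requires absolute continuity in the reverse direction: |Φ|² is the density of μ₀
in μ₁, so Φ vanishes only on a μ₀-null set, hence on a μ₁-null set. -/
theorem exists_intertwiner (h₀ : ModeData z t₀)
    (hμ₀ : IsFieldMeasure z t₀ μ₀)
    (hW₀ : IsSchrodingerRep z t₀ μ₀ W₀) (hW₁ : IsSchrodingerRep z t₁ μ₁ W₁)
    (hac : (μ₁ : Measure Distr) ≪ (μ₀ : Measure Distr)) {Φ : HS μ₁}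
    (hΦ : ∀ w, inner ℂ Φ (W₁ w Φ) = Complex.exp (-(sympJ z t₀ w : ℂ) / 4)) :
    ∃ V : HS μ₀ ≃ₗᵢ[ℂ] HS μ₁, Intertwines W₀ W₁ V ∧ V (vac μ₀) = Φ := by
  have hne : ∀ᵐ T ∂(μ₁ : Measure Distr), Φ T ≠ 0 := by
    refine hac.ae_le ?_
    have hi : Integrable (fun T => ‖Φ T‖ ^ 2) (μ₁ : Measure Distr) := (Lp.memLp Φ).integrable_norm_pow two_ne_zero
    rw [← withDensity_eq hμ₀ hW₁ hΦ]
    refine (ae_withDensity_iff' hi.1.aemeasurable.ennreal_ofReal).2 (.of_forall fun T hT h => hT ?_)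
    rw [h]
    simp
  have htot : Dense (Submodule.span ℂ (Set.range fun w => W₁ w Φ) : Set (HS μ₁)) := by
    refine (total_chrMul hne).mono (Submodule.span_mono ?_)
    rintro _ ⟨f, rfl⟩
    exact ⟨(0, f), hW₁.config_eq f Φ⟩
  obtain ⟨V, hV⟩ := exists_unitary_of_gram (x := fun w => W₀ w (vac μ₀)) (y := fun w => W₁ w Φ)
    (fun v w => by
      rw [hW₀.inner_vac, hW₁.inner_left, hW₁.mul, inner_smul_right, hΦ, sympPhase_neg_left,
        conj_sympPhase_eq, neg_add_eq_sub]) (hW₀.total_vac h₀ hμ₀) htot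
  refine ⟨V, fun w ψ => ?_, ?_⟩
  · refine isometry_ext_of_total (hW₀.total_vac h₀ hμ₀)
      (f := ((W₀ w).trans V).toLinearIsometry) (g := (V.trans (W₁ w)).toLinearIsometry)
      (fun v => ?_) ψ
    show V (W₀ w (W₀ v (vac μ₀))) = W₁ w (V (W₀ v (vac μ₀)))
    rw [hW₀.mul, map_smul, hV, hV, hW₁.mul]
  · have := hV 0
    rwa [hW₀.zero, hW₁.zero] at this

/-! ### Implementation of the dynamics -/

/-- At either time the symplectic form is the same sum of imaginary parts of mode coefficients, and
evolution does not change these coefficients. -/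
theorem Evolves.symp_eq {v v' w w' : PhaseSpace} (h₀ : ModeData z t₀) (h₁ : ModeData z t₁)
    (hv : Evolves z t₀ t₁ v v') (hw : Evolves z t₀ t₁ w w') : symp v' w' = symp v w := by
  have e0 := h₀.hasSum_im_modeCoeff v w
  have e1 := h₁.hasSum_im_modeCoeff v' w'
  simp only [hv _, hw _] at e1
  have := e0.unique e1
  linarith

theorem Evolves.sympJ_eq {w w' : PhaseSpace} (hw : Evolves z t₀ t₁ w w') :
    sympJ z t₁ w' = sympJ z t₀ w := by
  rw [ModeData.sympJ_eq, ModeData.sympJ_eq]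
  simp only [hw _]

theorem Evolves.add {v v' w w' : PhaseSpace} (hv : Evolves z t₀ t₁ v v')
    (hw : Evolves z t₀ t₁ w w') : Evolves z t₀ t₁ (v + w) (v' + w') := fun l => by
  rw [modeCoeff_add, modeCoeff_add, hv, hw]

theorem Evolves.sub {v v' w w' : PhaseSpace} (hv : Evolves z t₀ t₁ v v')
    (hw : Evolves z t₀ t₁ w w') : Evolves z t₀ t₁ (v - w) (v' - w') := fun l => by
  rw [modeCoeff_sub, modeCoeff_sub, hv, hw]

theorem Evolves.symm {w w' : PhaseSpace} (hw : Evolves z t₀ t₁ w w') : Evolves z t₁ t₀ w' w :=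
  fun l => (hw l).symm

theorem coeff_sum_smul_Y (c : ℕ → ℝ) (n l : ℕ) :
    coeff (∑ m ∈ Finset.range n, c m • Y m) l = if l < n then c l else 0 := by
  rw [← coeffL_apply, map_sum]
  simp only [coeffL_apply, coeff_smul, coeff_Y, mul_ite, mul_one, mul_zero]
  rw [Finset.sum_ite_eq]
  simp

/-- With finitely many modes the evolved datum is a finite sum of harmonics, so no smoothness
question arises. Such data already generate a total set (`total_chrMul_trunc`). -/
theorem exists_evolves (h₁ : ModeData z t₁) (f : TestFn) (n : ℕ) :
    ∃ w', Evolves z t₀ t₁ (0, trunc f n) w' := by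
  refine ⟨(∑ m ∈ Finset.range n, (2 * (modeCoeff z t₀ (0, f) m * z m t₁).re) • Y m,
    ∑ m ∈ Finset.range n, (2 * (modeCoeff z t₀ (0, f) m * deriv (z m) t₁).re) • Y m), fun l => ?_⟩
  simp only [modeCoeff, coeff_sum_smul_Y, coeff_trunc, coeff_zero]
  split_ifs with hl
  · have hre : ∀ x : ℂ, ((2 * x.re : ℝ) : ℂ) = x + conj x := fun x => by
      rw [Complex.add_conj]
    rw [hre, hre]
    simp only [map_mul, Complex.conj_I, Complex.conj_conj, Complex.conj_ofReal,
      Complex.ofReal_zero, mul_zero, sub_zero]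
    have := h₁.wronskian l
    linear_combination (-Complex.I * (Complex.I * conj (z l t₀) * coeff f l)) * this -
      (Complex.I * conj (z l t₀) * coeff f l) * Complex.I_sq
  · simp

theorem total_chrMul_trunc (h₀ : ModeData z t₀) (hμ₀ : IsFieldMeasure z t₀ μ₀) :
    Dense (Submodule.span ℂ (Set.range fun p : TestFn × ℕ => chrMul (trunc p.1 p.2) (vac μ₀)) :
      Set (HS μ₀)) := by
  refine total_of_inner fun v hv => ?_
  refine eq_zero_of_total total_chr fun f => ?_
  have h1 : Tendsto (fun n => h₀.prodVec hμ₀ (h₀.isShape.isWave (0, f)) n) atTop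
      (𝓝 (chrMul f (vac μ₀))) := by
    rw [← h₀.coh_config hμ₀]
    exact h₀.isShape.tendsto_vec h₀ hμ₀ (0, f)
  refine tendsto_nhds_unique (h1.inner (𝕜 := ℂ) tendsto_const_nhds) (tendsto_const_nhds.congr fun n => ?_)
  rw [← hv (f, n)]
  congr 1
  rw [chrMul_vac, ModeData.prodVec]
  exact (MemLp.toLp_eq_toLp_iff _ _).2 (.of_forall fun T => by rw [h₀.prodFn_config])

end Gowdy

end

/-! ### Implementation of the evolution, generators and the Bogoliubov relations. -/

noncomputable section

namespace Gowdy

open ComplexConjugate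

variable {z : ℕ → ℝ → ℂ} {t t₀ t₁ : ℝ} {μ μ₀ μ₁ : ProbabilityMeasure Distr} {W : WeylFamily μ}
  {W₀ : WeylFamily μ₀} {W₁ : WeylFamily μ₁}

/-- The evolution of Cauchy data is implemented by a unitary between the two time slices. -/
theorem exists_evolution_unitary (h₀ : ModeData z t₀) (h₁ : ModeData z t₁)
    (hμ₀ : IsFieldMeasure z t₀ μ₀) (hμ₁ : IsFieldMeasure z t₁ μ₁)
    (hW₀ : IsSchrodingerRep z t₀ μ₀ W₀) (hW₁ : IsSchrodingerRep z t₁ μ₁ W₁) :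
    ∃ X : HS μ₀ ≃ₗᵢ[ℂ] HS μ₁, ∀ w w', Evolves z t₀ t₁ w w' → ∀ ψ, X (W₀ w ψ) = W₁ w' (X ψ) := by
  -- Stated for arbitrary times because totality is needed for the orbit at t₀ and, by reversing the
  -- evolution, for the orbit at t₁.
  have total : ∀ {t₀ t₁ : ℝ} {μ : ProbabilityMeasure Distr} {W : WeylFamily μ}, ModeData z t₀ →
      ModeData z t₁ → IsFieldMeasure z t₀ μ → IsSchrodingerRep z t₀ μ W →
      ∀ v, (∀ w w', Evolves z t₀ t₁ w w' → inner ℂ (W w (vac μ)) v = 0) → v = 0 := by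
    intro t₀ t₁ μ W h₀ h₁ hμ hW v hv
    refine eq_zero_of_total (total_chrMul_trunc h₀ hμ) fun p => ?_
    obtain ⟨w', hw'⟩ := exists_evolves (t₀ := t₀) h₁ p.1 p.2
    rw [← hW.config_eq]
    exact hv _ _ hw'
  set ι := {p : PhaseSpace × PhaseSpace // Evolves z t₀ t₁ p.1 p.2}
  have hx : Dense (Submodule.span ℂ (Set.range fun p : ι => W₀ p.1.1 (vac μ₀)) : Set (HS μ₀)) :=
    total_of_inner fun v hv => total h₀ h₁ hμ₀ hW₀ v fun w w' hw => hv ⟨(w, w'), hw⟩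
  obtain ⟨X, hX⟩ := exists_unitary_of_gram (x := fun p : ι => W₀ p.1.1 (vac μ₀))
    (y := fun p : ι => W₁ p.1.2 (vac μ₁)) (fun p q => by
      rw [hW₀.inner_vac, hW₁.inner_vac, (q.2.sub p.2).sympJ_eq, sympPhase, sympPhase,
        Evolves.symp_eq h₀ h₁ p.2 q.2]) hx
    (total_of_inner fun v hv => total h₁ h₀ hμ₁ hW₁ v fun w w' hw => hv ⟨(w', w), hw.symm⟩)
  refine ⟨X, fun w w' hw ψ => ?_⟩
  refine isometry_ext_of_total hx (f := ((W₀ w).trans X).toLinearIsometry)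
    (g := (X.trans (W₁ w')).toLinearIsometry) (fun p => ?_) ψ
  show X (W₀ w (W₀ p.1.1 (vac μ₀))) = W₁ w' (X (W₀ p.1.1 (vac μ₀)))
  rw [hX p, hW₀.mul, hW₁.mul, map_smul, hX ⟨(w + p.1.1, w' + p.1.2), hw.add p.2⟩, sympPhase,
    sympPhase, Evolves.symp_eq h₀ h₁ hw p.2]

/-- The unitary X between the slices always exists; composing X⁻¹ with an equivalence V of the two
representations brings it back to a single Hilbert space. -/
theorem exists_dynamics (h₀ : ModeData z t₀) (h₁ : ModeData z t₁)
    (hμ₀ : IsFieldMeasure z t₀ μ₀) (hμ₁ : IsFieldMeasure z t₁ μ₁)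
    (hW₀ : IsSchrodingerRep z t₀ μ₀ W₀) (hW₁ : IsSchrodingerRep z t₁ μ₁ W₁)
    {V : HS μ₀ ≃ₗᵢ[ℂ] HS μ₁} (hV : Intertwines W₀ W₁ V) :
    ∃ U : HS μ₀ ≃ₗᵢ[ℂ] HS μ₀, ∀ w w' : PhaseSpace, Evolves z t₀ t₁ w w' →
      ∀ ψ : HS μ₀, U.symm (W₀ w (U ψ)) = W₀ w' ψ := by
  obtain ⟨X, hX⟩ := exists_evolution_unitary h₀ h₁ hμ₀ hμ₁ hW₀ hW₁
  refine ⟨V.trans X.symm, fun w w' hw ψ => ?_⟩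
  show V.symm (X (W₀ w (X.symm (V ψ)))) = W₀ w' ψ
  rw [hX w w' hw, X.apply_symm_apply, ← hV, V.symm_apply_apply]

/-! ### Generators -/

theorem IsGen.unique {w : PhaseSpace} {ψ χ χ' : HS μ} (h : IsGen W w ψ χ) (h' : IsGen W w ψ χ') :
    χ = χ' :=
  smul_right_injective _ Complex.I_ne_zero (HasDerivAt.unique h h')

theorem IsGen.map {V : HS μ₀ ≃ₗᵢ[ℂ] HS μ₁} (hV : Intertwines W₀ W₁ V) {w : PhaseSpace}
    {ψ χ : HS μ₀} (h : IsGen W₀ w ψ χ) : IsGen W₁ w (V ψ) (V χ) := by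
  have h1 := (V.toContinuousLinearEquiv.toContinuousLinearMap.restrictScalars ℝ).hasFDerivAt.comp_hasDerivAt
    (0 : ℝ) h
  have h2 : HasDerivAt (fun s : ℝ => V (W₀ (s • w) ψ)) (V (Complex.I • χ)) 0 := h1
  simp only [hV _ _, map_smul] at h2
  exact h2

theorem Intertwines.symm {V : HS μ₀ ≃ₗᵢ[ℂ] HS μ₁} (hV : Intertwines W₀ W₁ V) :
    Intertwines W₁ W₀ V.symm := fun w ψ => by
  rw [V.symm_apply_eq, hV, V.apply_symm_apply]

theorem IsGen.map_iff {V : HS μ₀ ≃ₗᵢ[ℂ] HS μ₁} (hV : Intertwines W₀ W₁ V) {w : PhaseSpace}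
    {ψ χ : HS μ₀} : IsGen W₁ w (V ψ) (V χ) ↔ IsGen W₀ w ψ χ := by
  refine ⟨fun h => ?_, fun h => h.map hV⟩
  have := h.map hV.symm
  rwa [V.symm_apply_apply, V.symm_apply_apply] at this

/-- The coefficients of P̂ and Q̂ in αb(t₁) + βb†(t₁) are those in b(t₀). Thus the Bogoliubov
transformation is a linear identity between operators of one representation. -/
theorem bog_combination_annih (h₁ : ModeData z t₁) (l : ℕ) :
    bogAlpha z t₁ t₀ l * (Complex.I * conj (z l t₁)) -
        bogBeta z t₁ t₀ l * (Complex.I * z l t₁) = Complex.I * conj (z l t₀) ∧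
      bogAlpha z t₁ t₀ l * (Complex.I * conj (deriv (z l) t₁)) -
        bogBeta z t₁ t₀ l * (Complex.I * deriv (z l) t₁) = Complex.I * conj (deriv (z l) t₀) := by
  have w1 := h₁.wronskian l
  constructor
  · linear_combination Complex.I * bogAlpha_mul_sub (t₀ := t₀) h₁ l
  · rw [bogAlpha, bogBeta]
    linear_combination (conj (deriv (z l) t₀) * (-Complex.I ^ 2)) * w1 -
      Complex.I * conj (deriv (z l) t₀) * Complex.I_sq

theorem bog_combination (h₁ : ModeData z t₁) (l : ℕ) (q p : HS μ) :
    bogAlpha z t₁ t₀ l • ((Complex.I * conj (z l t₁)) • p - (Complex.I * conj (deriv (z l) t₁)) • q) +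
      bogBeta z t₁ t₀ l • ((Complex.I * deriv (z l) t₁) • q - (Complex.I * z l t₁) • p) =
      (Complex.I * conj (z l t₀)) • p - (Complex.I * conj (deriv (z l) t₀)) • q := by
  obtain ⟨e1, e2⟩ := bog_combination_annih (t₀ := t₀) h₁ l
  rw [← e1, ← e2]
  module

theorem bog_combination_conj (h₁ : ModeData z t₁) (l : ℕ) (q p : HS μ) :
    conj (bogBeta z t₁ t₀ l) •
        ((Complex.I * conj (z l t₁)) • p - (Complex.I * conj (deriv (z l) t₁)) • q) +
      conj (bogAlpha z t₁ t₀ l) • ((Complex.I * deriv (z l) t₁) • q - (Complex.I * z l t₁) • p) =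
      (Complex.I * deriv (z l) t₀) • q - (Complex.I * z l t₀) • p := by
  obtain ⟨e1, e2⟩ := bog_combination_annih (t₀ := t₀) h₁ l
  have e1' := congrArg conj e1
  have e2' := congrArg conj e2
  simp only [map_sub, map_mul, Complex.conj_I, Complex.conj_conj] at e1' e2'
  have e3 : Complex.I * z l t₀ = conj (bogAlpha z t₁ t₀ l) * (Complex.I * z l t₁) -
      conj (bogBeta z t₁ t₀ l) * (Complex.I * conj (z l t₁)) := by linear_combination e1'
  have e4 : Complex.I * deriv (z l) t₀ = conj (bogAlpha z t₁ t₀ l) * (Complex.I * deriv (z l) t₁) -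
      conj (bogBeta z t₁ t₀ l) * (Complex.I * conj (deriv (z l) t₁)) := by linear_combination e2'
  rw [e3, e4]
  module

theorem Intertwines.bogoliubov (h₁ : ModeData z t₁)
    {V : HS μ₀ ≃ₗᵢ[ℂ] HS μ₁} (hV : Intertwines W₀ W₁ V) : Bogoliubov z t₀ t₁ W₀ W₁ V := by
  intro l ψ χ
  constructor
  · constructor
    · rintro ⟨q, p, hq, hp, rfl⟩
      refine ⟨_, _, ⟨V q, V p, hq.map hV, hp.map hV, rfl⟩, ⟨V q, V p, hq.map hV, hp.map hV, rfl⟩, ?_⟩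
      rw [bog_combination h₁, map_sub, map_smul, map_smul]
    · rintro ⟨a, c, ⟨q, p, hq, hp, rfl⟩, ⟨q', p', hq', hp', rfl⟩, e⟩
      -- Generators are single-valued, so the annihilation and creation parts share the same q and
      -- p.
      obtain rfl := hq'.unique hq
      obtain rfl := hp'.unique hp
      rw [bog_combination h₁] at e
      refine ⟨V.symm q', V.symm p', ?_, ?_, ?_⟩
      · rwa [← IsGen.map_iff hV, V.apply_symm_apply]
      · rwa [← IsGen.map_iff hV, V.apply_symm_apply]
      · rw [← map_smul, ← map_smul, ← map_sub, ← e, V.symm_apply_apply]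
  · constructor
    · rintro ⟨q, p, hq, hp, rfl⟩
      refine ⟨_, _, ⟨V q, V p, hq.map hV, hp.map hV, rfl⟩, ⟨V q, V p, hq.map hV, hp.map hV, rfl⟩, ?_⟩
      rw [bog_combination_conj h₁, map_sub, map_smul, map_smul]
    · rintro ⟨a, c, ⟨q, p, hq, hp, rfl⟩, ⟨q', p', hq', hp', rfl⟩, e⟩
      obtain rfl := hq'.unique hq
      obtain rfl := hp'.unique hp
      rw [bog_combination_conj h₁] at e
      refine ⟨V.symm q', V.symm p', ?_, ?_, ?_⟩
      · rwa [← IsGen.map_iff hV, V.apply_symm_apply]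
      · rwa [← IsGen.map_iff hV, V.apply_symm_apply]
      · rw [← map_smul, ← map_smul, ← map_sub, ← e, V.symm_apply_apply]

/-- Operators satisfying the Bogoliubov relations transport the generators. -/
theorem Bogoliubov.isGen (h₀ : ModeData z t₀) (h₁ : ModeData z t₁)
    {V : HS μ₀ ≃ₗᵢ[ℂ] HS μ₁} (hV : Bogoliubov z t₀ t₁ W₀ W₁ V) {l : ℕ} {ψ q p : HS μ₀}
    (hq : IsGen W₀ (0, Y l) ψ q) (hp : IsGen W₀ (-Y l, 0) ψ p) :
    IsGen W₁ (0, Y l) (V ψ) (V q) := by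
  obtain ⟨a, c, ⟨q₁, p₁, hq₁, hp₁, rfl⟩, ⟨q₂, p₂, hq₂, hp₂, rfl⟩, e1⟩ :=
    (hV l ψ _).1.1 ⟨q, p, hq, hp, rfl⟩
  obtain ⟨a', c', ⟨q₃, p₃, hq₃, hp₃, rfl⟩, ⟨q₄, p₄, hq₄, hp₄, rfl⟩, e2⟩ :=
    (hV l ψ _).2.1 ⟨q, p, hq, hp, rfl⟩
  obtain rfl := hq₂.unique hq₁
  obtain rfl := hp₂.unique hp₁
  obtain rfl := hq₃.unique hq₂
  obtain rfl := hp₃.unique hp₂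
  obtain rfl := hq₄.unique hq₃
  obtain rfl := hp₄.unique hp₃
  rw [bog_combination h₁, map_sub, map_smul, map_smul] at e1
  rw [bog_combination_conj h₁, map_sub, map_smul, map_smul] at e2
  have hw := h₀.wronskian l
  -- The combination z b + z̄ b† eliminates p and returns q by the Wronskian, which isolates the
  -- position generator.
  have e3 : V q = q₄ := by
    have e4 := congrArg₂ (fun x y : HS μ₁ => z l t₀ • x + conj (z l t₀) • y) e1 e2
    simp only [smul_sub, smul_smul] at e4
    have e5 : ∀ p q : HS μ₁, (z l t₀ * (Complex.I * conj (z l t₀))) • p -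
        (z l t₀ * (Complex.I * conj (deriv (z l) t₀))) • q +
        ((conj (z l t₀) * (Complex.I * deriv (z l) t₀)) • q -
          (conj (z l t₀) * (Complex.I * z l t₀)) • p) = q := by
      intro p q
      have e6 : (z l t₀ * (Complex.I * conj (z l t₀))) • p -
        (z l t₀ * (Complex.I * conj (deriv (z l) t₀))) • q +
        ((conj (z l t₀) * (Complex.I * deriv (z l) t₀)) • q -
          (conj (z l t₀) * (Complex.I * z l t₀)) • p) =
        (-Complex.I * (z l t₀ * conj (deriv (z l) t₀) - conj (z l t₀) * deriv (z l) t₀)) • q := by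
        module
      rw [e6, hw, neg_mul, Complex.I_mul_I, neg_neg, one_smul]
    rwa [e5, e5] at e4
  rwa [e3]

end Gowdy

end

noncomputable section

namespace Gowdy

open ComplexConjugate

/-! ### Differentiability of displaced vacua -/

/-- A curve with Gaussian Gram kernel is differentiable. -/
theorem exists_hasDerivAt_of_gram {H : Type*} [NormedAddCommGroup H] [InnerProductSpace ℂ H]
    [CompleteSpace H] [NormedSpace ℝ H] [IsScalarTower ℝ ℂ H] {Ω : ℝ → H} {c : ℝ}
    (hΩ : ∀ s t, inner ℂ (Ω s) (Ω t) = (Real.exp (-(c * (t - s) ^ 2)) : ℝ)) :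
    ∃ χ, HasDerivAt Ω χ 0 := by
  -- E is (eˣ − 1)/x, continuous at 0 too. It expresses the Gram kernel of the difference quotients
  -- as a continuous K with no division by s or t, so the quotients are Cauchy at 0.
  set E : ℝ → ℝ := dslope Real.exp 0 with hE
  have hEc : Continuous E := by
    rw [continuous_iff_continuousAt]
    intro x
    by_cases hx : x = 0
    · rw [hx]
      exact continuousAt_dslope_same.2 Real.differentiable_exp.differentiableAt
    · exact (continuousAt_dslope_of_ne hx).2 Real.continuous_exp.continuousAt
  have hEx : ∀ x, Real.exp x = 1 + x * E x := by
    intro x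
    have := sub_smul_dslope Real.exp 0 x
    rw [sub_zero, smul_eq_mul, Real.exp_zero] at this
    linarith
  set K : ℝ × ℝ → ℝ := fun p => Real.exp (-(c * p.1 ^ 2)) * Real.exp (-(c * p.2 ^ 2)) * (2 * c) *
    E (2 * c * p.1 * p.2) + c ^ 2 * p.1 * p.2 * E (-(c * p.1 ^ 2)) * E (-(c * p.2 ^ 2)) with hK
  have hKc : Continuous K := by fun_prop
  set g : ℝ → H := fun s => s⁻¹ • (Ω (0 + s) - Ω 0)
  have hinner : ∀ s t, s ≠ 0 → t ≠ 0 → inner ℂ (g s) (g t) = (K (s, t) : ℝ) := by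
    intro s t hs ht
    have h1 : ∀ (r : ℝ) (x : H), r • x = (r : ℂ) • x := fun r x => (algebraMap_smul ℂ r x).symm
    simp only [g, h1, zero_add, inner_smul_left, inner_smul_right, inner_sub_left, inner_sub_right,
      hΩ, Complex.conj_ofReal, sub_zero, zero_sub, neg_sq]
    rw [show -(c * (t - s) ^ 2) = -(c * s ^ 2) + -(c * t ^ 2) + 2 * c * s * t by ring,
      Real.exp_add, Real.exp_add, hEx (2 * c * s * t)]
    have h2 := hEx (-(c * s ^ 2))
    have h3 := hEx (-(c * t ^ 2))
    have h0 : Real.exp (-(c * 0 ^ 2)) = 1 := by simp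
    rw [h0]
    simp only [hK, ← Complex.ofReal_mul, ← Complex.ofReal_sub]
    congr 1
    have h4 : c ^ 2 * s * t * E (-(c * s ^ 2)) * E (-(c * t ^ 2)) * (s * t) =
        (Real.exp (-(c * s ^ 2)) - 1) * (Real.exp (-(c * t ^ 2)) - 1) := by
      rw [h2, h3]; ring
    rw [← mul_sub, ← mul_assoc, ← mul_inv, inv_mul_eq_iff_eq_mul₀ (mul_ne_zero ht hs)]
    linear_combination -h4
  have hdist : ∀ s t, s ≠ 0 → t ≠ 0 →
      dist (g s) (g t) = √(K (s, s) + K (t, t) - 2 * K (s, t)) := by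
    intro s t hs ht
    have h1 := @norm_sub_sq ℂ _ _ _ _ (g s) (g t)
    rw [@norm_sq_eq_re_inner ℂ _ _ _ _ (g s), @norm_sq_eq_re_inner ℂ _ _ _ _ (g t),
      hinner s s hs hs, hinner t t ht ht, hinner s t hs ht] at h1
    rw [dist_eq_norm, ← Real.sqrt_sq (norm_nonneg (g s - g t)), h1]
    congr 1
    simp only [RCLike.re_to_complex, Complex.ofReal_re]
    ring
  have hcauchy : Cauchy (map g (𝓝[≠] 0)) := by
    rw [cauchy_map_iff', Metric.uniformity_eq_comap_nhds_zero, tendsto_comap_iff]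
    have h1 : Tendsto (fun p : ℝ × ℝ => √(K (p.1, p.1) + K (p.2, p.2) - 2 * K (p.1, p.2)))
        (𝓝[≠] 0 ×ˢ 𝓝[≠] 0) (𝓝 0) := by
      have h2 : Continuous fun p : ℝ × ℝ => √(K (p.1, p.1) + K (p.2, p.2) - 2 * K (p.1, p.2)) := by
        fun_prop
      have h3 := h2.tendsto (0, 0)
      have h4 : √(K (0, 0) + K (0, 0) - 2 * K (0, 0)) = 0 := by
        rw [← two_mul, sub_self, Real.sqrt_zero]
      simp only [h4] at h3
      refine h3.mono_left ?_
      rw [nhds_prod_eq]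
      exact prod_mono nhdsWithin_le_nhds nhdsWithin_le_nhds
    refine h1.congr' ?_
    filter_upwards [prod_mem_prod (self_mem_nhdsWithin (a := (0 : ℝ)) (s := {0}ᶜ))
      (self_mem_nhdsWithin (a := (0 : ℝ)) (s := {0}ᶜ))] with p hp
    exact (hdist p.1 p.2 hp.1 hp.2).symm
  obtain ⟨χ, hχ⟩ := cauchy_map_iff_exists_tendsto.1 hcauchy
  exact ⟨χ, hasDerivAt_iff_tendsto_slope_zero.2 hχ⟩

variable {z : ℕ → ℝ → ℂ} {t t₀ t₁ : ℝ} {μ μ₀ μ₁ : ProbabilityMeasure Distr} {W : WeylFamily μ}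
  {W₀ : WeylFamily μ₀} {W₁ : WeylFamily μ₁}

theorem sympJ_smul (r : ℝ) (u : PhaseSpace) : sympJ z t (r • u) = r ^ 2 * sympJ z t u := by
  rw [ModeData.sympJ_eq, ModeData.sympJ_eq, mul_left_comm, ← tsum_mul_left (a := r ^ 2)]
  congr 2
  funext l
  rw [modeCoeff_smul, norm_mul, mul_pow, Complex.norm_real, Real.norm_eq_abs, sq_abs]

theorem sympPhase_smul_smul (r s : ℝ) (u : PhaseSpace) : sympPhase (r • u) (s • u) = 1 := by
  rw [sympPhase, symp_smul_left, symp_smul_right, symp_self]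
  simp

/-- On the vacuum the orbit has a Gaussian Gram kernel and is differentiable. Commuting W(su) past
W(w) costs only the smooth phase exp(isω(u, w)), so displaced vacua lie in the domain as well. -/
theorem IsSchrodingerRep.exists_isGen (hW : IsSchrodingerRep z t μ W) (u w : PhaseSpace) :
    ∃ χ, IsGen W u (W w (vac μ)) χ := by
  obtain ⟨χ, hχ⟩ := exists_hasDerivAt_of_gram (Ω := fun s : ℝ => W (s • u) (vac μ))
    (c := sympJ z t u / 4) fun r s => by
      rw [hW.inner_vac, sympPhase_smul_smul, ← sub_smul, sympJ_smul, map_one, one_mul]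
      push_cast
      ring_nf
  have h1 : HasDerivAt (fun s : ℝ => W w (W (s • u) (vac μ))) (W w χ) 0 :=
    ((W w).toContinuousLinearEquiv.toContinuousLinearMap.restrictScalars ℝ).hasFDerivAt.comp_hasDerivAt
      (0 : ℝ) hχ
  have h2 : HasDerivAt (fun s : ℝ => Complex.exp (Complex.I * (s * symp u w : ℝ)))
      (Complex.exp (Complex.I * ((0 : ℝ) * symp u w : ℝ)) * (Complex.I * (symp u w : ℝ))) 0 := by
    have h3 : HasDerivAt (fun s : ℝ => ((s * symp u w : ℝ) : ℂ)) ((1 * symp u w : ℝ) : ℂ) 0 :=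
      ((hasDerivAt_id (0 : ℝ)).mul_const (symp u w)).ofReal_comp
    rw [one_mul] at h3
    exact (h3.const_mul Complex.I).cexp
  have h3 := h2.smul h1
  refine ⟨-Complex.I • (Complex.exp (Complex.I * ((0 : ℝ) * symp u w : ℝ)) • W w χ +
    (Complex.exp (Complex.I * ((0 : ℝ) * symp u w : ℝ)) * (Complex.I * (symp u w : ℝ))) •
      W w (W ((0 : ℝ) • u) (vac μ))), ?_⟩
  rw [IsGen, smul_smul, mul_neg, Complex.I_mul_I, neg_neg, one_smul]
  refine h3.congr_of_eventuallyEq (.of_forall fun s => ?_)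
  show W (s • u) (W w (vac μ)) = Complex.exp (Complex.I * (s * symp u w : ℝ)) • W w (W (s • u) (vac μ))
  rw [hW.mul, hW.mul, smul_smul, add_comm w]
  congr 1
  rw [sympPhase, sympPhase, ← Complex.exp_add, symp_smul_left, symp_smul_right, symp_swap w u]
  push_cast
  ring_nf

theorem IsGen.smul {w : PhaseSpace} {ψ χ : HS μ} (h : IsGen W w ψ χ) (c : ℂ) :
    IsGen W w (c • ψ) (c • χ) := by
  have := HasDerivAt.const_smul c h
  rw [IsGen, smul_comm Complex.I]
  refine this.congr_of_eventuallyEq (.of_forall fun s => ?_)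
  show W (s • w) (c • ψ) = c • W (s • w) ψ
  rw [map_smul]

/-- A unitary which maps the generator on an invariant set of vectors commutes there with the
group. -/
theorem IsSchrodingerRep.commute_of_isGen (hW : IsSchrodingerRep z t μ W) {u : PhaseSpace}
    {X : HS μ ≃ₗᵢ[ℂ] HS μ} {ψ : HS μ}
    (hX : ∀ s : ℝ, ∃ q, IsGen W u (W (s • u) ψ) q ∧ IsGen W u (X (W (s • u) ψ)) (X q)) (s : ℝ) :
    X (W (s • u) ψ) = W (s • u) (X ψ) := by
  -- This curve is constant: its increment from s to r has the norm of XW((r−s)u)ψ' − W((r−s)u)Xψ',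
  -- which is o(r − s) because the two generators agree there.
  set φ : ℝ → HS μ := fun s => W (-(s • u)) (X (W (s • u) ψ)) with hφ
  have hd : ∀ s, HasDerivAt φ 0 s := by
    intro s
    obtain ⟨q, hq, hXq⟩ := hX s
    set ψ' := W (s • u) ψ
    have h1 : HasDerivAt (fun r : ℝ => X (W (r • u) ψ') - W (r • u) (X ψ')) 0 0 := by
      have h2 : HasDerivAt (fun r : ℝ => X (W (r • u) ψ')) (X (Complex.I • q)) 0 :=
        (X.toContinuousLinearEquiv.toContinuousLinearMap.restrictScalars ℝ).hasFDerivAt.comp_hasDerivAt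
          (0 : ℝ) hq
      have h3 := h2.sub hXq
      rwa [map_smul, sub_self] at h3
    have h4 : HasDerivAt (fun r : ℝ => X (W ((r - s) • u) ψ') - W ((r - s) • u) (X ψ')) 0 s := by
      refine HasDerivAt.comp_sub_const
        (f := fun r : ℝ => X (W (r • u) ψ') - W (r • u) (X ψ')) s s ?_
      rwa [sub_self]
    rw [hasDerivAt_iff_isLittleO] at h4 ⊢
    refine Asymptotics.IsLittleO.of_norm_left (h4.norm_left.congr_left fun r => ?_)
    have h5 : φ r - φ s = W (-(s • u)) (W (-((r - s) • u))
        (X (W ((r - s) • u) ψ') - W ((r - s) • u) (X ψ'))) := by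
      have h6 : W ((r - s) • u) ψ' = W (r • u) ψ := by
        rw [hW.mul, sympPhase_smul_smul, one_smul, ← add_smul, sub_add_cancel]
      rw [map_sub, hW.neg_apply, map_sub, h6, hW.mul, ← neg_smul, ← neg_smul, sympPhase_smul_smul,
        one_smul, ← add_smul, show -s + -(r - s) = -r by ring]
      simp only [hφ, neg_smul]
      rfl
    simp only [smul_zero, sub_zero]
    rw [h5, LinearIsometryEquiv.norm_map, LinearIsometryEquiv.norm_map]
    simp only [sub_self, zero_smul, hW.zero, sub_zero]
  have h5 := is_const_of_deriv_eq_zero (fun s => (hd s).differentiableAt) (fun s => (hd s).deriv) s 0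
  simp only [hφ, zero_smul, neg_zero, hW.zero] at h5
  have h6 := congrArg (W (s • u)) h5
  rwa [hW.apply_neg] at h6

theorem symp_config (f g : TestFn) : symp (0, f) (0, g) = 0 := by
  rw [symp_eq]; simp

/-- X = V⁻¹V' fixes the vacuum and, since it transports the position generators, commutes on
displaced vacua with each exp(isQ̂_ℓ). By induction on the number of modes it fixes all truncated
characters, which are total. -/
theorem Bogoliubov.eq_of_vac (h₀ : ModeData z t₀) (h₁ : ModeData z t₁)
    (hμ₀ : IsFieldMeasure z t₀ μ₀) (hW₀ : IsSchrodingerRep z t₀ μ₀ W₀)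
    {V V' : HS μ₀ ≃ₗᵢ[ℂ] HS μ₁} (hV : Intertwines W₀ W₁ V) (hV' : Bogoliubov z t₀ t₁ W₀ W₁ V')
    (hvac : V' (vac μ₀) = V (vac μ₀)) : V' = V := by
  set X : HS μ₀ ≃ₗᵢ[ℂ] HS μ₀ := V'.trans V.symm
  have hcomm : ∀ (l : ℕ) (s : ℝ) (w : PhaseSpace),
      X (W₀ (s • (0, Y l)) (W₀ w (vac μ₀))) = W₀ (s • (0, Y l)) (X (W₀ w (vac μ₀))) := by
    intro l s w
    refine hW₀.commute_of_isGen (fun s => ?_) s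
    obtain ⟨q, hq⟩ := hW₀.exists_isGen (0, Y l) (s • (0, Y l) + w)
    obtain ⟨p, hp⟩ := hW₀.exists_isGen (-Y l, 0) (s • (0, Y l) + w)
    rw [hW₀.mul]
    refine ⟨_, hq.smul _, ?_⟩
    rw [map_smul, map_smul]
    exact ((hV'.isGen h₀ h₁ hq hp).map hV.symm).smul _
  have hX : ∀ (f : TestFn) (n : ℕ), X (W₀ (0, trunc f n) (vac μ₀)) = W₀ (0, trunc f n) (vac μ₀) := by
    intro f n
    induction n with
    | zero =>
      have e : ((0, trunc f 0) : PhaseSpace) = 0 := by simp [trunc]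
      rw [e, hW₀.zero]
      show V.symm (V' (vac μ₀)) = vac μ₀
      rw [hvac, V.symm_apply_apply]
    | succ n ih =>
      have e : ((0, trunc f (n + 1)) : PhaseSpace) = coeff f n • (0, Y n) + (0, trunc f n) := by
        rw [trunc, Finset.sum_range_succ, ← trunc]
        ext1
        · simp
        · simp [add_comm]
      have e2 : W₀ (0, trunc f (n + 1)) (vac μ₀) =
          W₀ (coeff f n • (0, Y n)) (W₀ (0, trunc f n) (vac μ₀)) := by
        rw [hW₀.mul, ← e, sympPhase, symp_smul_left, symp_config]
        simp
      rw [e2, hcomm, ih]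
  refine LinearIsometryEquiv.ext fun ψ => ?_
  refine isometry_ext_of_total (total_chrMul_trunc h₀ hμ₀) (f := V'.toLinearIsometry)
    (g := V.toLinearIsometry) (fun p => ?_) ψ
  show V' (chrMul (trunc p.1 p.2) (vac μ₀)) = V (chrMul (trunc p.1 p.2) (vac μ₀))
  rw [← hW₀.config_eq]
  have h1 : V.symm (V' (W₀ (0, trunc p.1 p.2) (vac μ₀))) = W₀ (0, trunc p.1 p.2) (vac μ₀) :=
    hX p.1 p.2
  rwa [V.symm_apply_eq] at h1

end Gowdy

end

noncomputable section

namespace Gowdy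

open ComplexConjugate

/-! ### The phases of the vacuum -/

/-- A sequence of angles with increments tending to zero converges if its exponentials converge. -/
theorem exists_tendsto_of_tendsto_exp {χ : ℕ → ℝ} {u : ℂ}
    (hχ : Tendsto (fun n => χ (n + 1) - χ n) atTop (𝓝 0))
    (hu : Tendsto (fun n => Complex.exp (Complex.I * (χ n : ℝ))) atTop (𝓝 u)) :
    ∃ c : ℝ, Tendsto χ atTop (𝓝 c) := by
  have hn : ∀ x : ℝ, ‖Complex.exp (Complex.I * (x : ℝ))‖ = 1 := fun x => by
    rw [mul_comm, Complex.norm_exp_ofReal_mul_I]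
  have hu1 : ‖u‖ = 1 := tendsto_nhds_unique hu.norm (by simp only [hn]; exact tendsto_const_nhds)
  have hu0 : u ≠ 0 := norm_ne_zero_iff.1 (by rw [hu1]; exact one_ne_zero)
  set θ : ℕ → ℝ := fun n => Complex.arg (Complex.exp (Complex.I * (χ n : ℝ)) / u) with hθd
  have hθ : Tendsto θ atTop (𝓝 0) := by
    have h1 : Tendsto (fun n => Complex.exp (Complex.I * (χ n : ℝ)) / u) atTop (𝓝 1) := by
      have := hu.div_const u
      rwa [div_self hu0] at this
    have h2 := (Complex.continuousAt_arg Complex.one_mem_slitPlane).tendsto.comp h1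
    rwa [Complex.arg_one] at h2
  -- The angle differs from its principal value relative to u by a multiple of 2π. As the increments
  -- of χ and θ tend to 0, this integer is eventually constant.
  have hk : ∀ n, ∃ k : ℤ, χ n = θ n + Complex.arg u + k * (2 * Real.pi) := by
    intro n
    have e1 := Complex.norm_mul_exp_arg_mul_I (Complex.exp (Complex.I * (χ n : ℝ)) / u)
    have e2 := Complex.norm_mul_exp_arg_mul_I u
    rw [norm_div, hn, hu1, div_one, Complex.ofReal_one, one_mul] at e1
    rw [hu1, Complex.ofReal_one, one_mul] at e2
    have e3 : Complex.exp (Complex.I * (χ n : ℝ)) =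
        Complex.exp ((θ n : ℂ) * Complex.I + Complex.arg u * Complex.I) := by
      rw [Complex.exp_add, e1, e2, div_mul_cancel₀ _ hu0]
    obtain ⟨k, hk⟩ := Complex.exp_eq_exp_iff_exists_int.1 e3
    refine ⟨k, Complex.ofReal_injective (mul_left_cancel₀ Complex.I_ne_zero ?_)⟩
    push_cast
    linear_combination hk
  choose k hk using hk
  have hinc : ∀ᶠ n in atTop, k (n + 1) = k n := by
    have h1 : Tendsto (fun n => (χ (n + 1) - χ n) - (θ (n + 1) - θ n)) atTop (𝓝 0) := by
      simpa using hχ.sub (((tendsto_add_atTop_iff_nat 1).2 hθ).sub hθ)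
    filter_upwards [h1.abs.eventually (gt_mem_nhds (show |(0 : ℝ)| < 1 by simp))] with n h2
    have h3 : (χ (n + 1) - χ n) - (θ (n + 1) - θ n) = ((k (n + 1) - k n : ℤ) : ℝ) * (2 * Real.pi) := by
      rw [hk (n + 1), hk n]; push_cast; ring
    rw [h3, abs_mul, abs_of_pos Real.two_pi_pos] at h2
    by_contra hne
    have h4 : (1 : ℝ) ≤ |((k (n + 1) - k n : ℤ) : ℝ)| := by
      rw [← Int.cast_abs]
      exact_mod_cast Int.one_le_abs (sub_ne_zero.2 hne)
    nlinarith [Real.pi_gt_three]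
  obtain ⟨N, hN⟩ := eventually_atTop.1 hinc
  have hconst : ∀ n, N ≤ n → k n = k N := fun n hn => by
    induction n, hn using Nat.le_induction with
    | base => rfl
    | succ m hm ih => rw [hN m hm, ih]
  refine ⟨0 + Complex.arg u + k N * (2 * Real.pi), ((hθ.add_const _).add_const _).congr' ?_⟩
  filter_upwards [eventually_ge_atTop N] with n hn
  rw [hk n, hconst n hn]

variable {z : ℕ → ℝ → ℂ} {t₀ t₁ : ℝ} {μ₀ μ₁ : ProbabilityMeasure Distr} {W₀ : WeylFamily μ₀}
  {W₁ : WeylFamily μ₁}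

/-- Each increment is Im η_ℓ/2, which tends to 0 under square summability; this excludes winding
when convergence of exp(iχ_n) is lifted to χ_n. -/
theorem tendsto_vacPhase_succ_sub (h₀ : ModeData z t₀) (h₁ : ModeData z t₁)
    (hβ : Summable fun l => ‖bogBeta z t₁ t₀ l‖ ^ 2) :
    Tendsto (fun n => vacPhase z t₀ t₁ (n + 1) - vacPhase z t₀ t₁ n) atTop (𝓝 0) := by
  obtain ⟨C, hC, hη⟩ := exists_norm_bogEta_le h₀ h₁
  have hβ0 : Tendsto (fun l => ‖bogBeta z t₁ t₀ l‖) atTop (𝓝 0) := by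
    have := hβ.tendsto_atTop_zero.sqrt
    simpa [Real.sqrt_sq] using this
  have hη0 : Tendsto (fun l => bogEta z t₁ t₀ l) atTop (𝓝 0) :=
    squeeze_zero_norm hη (by simpa using hβ0.const_mul C)
  have h1 := ((Complex.continuous_im.tendsto _).comp hη0).div_const 2
  rw [Complex.zero_im, zero_div] at h1
  refine h1.congr fun n => ?_
  rw [vacPhase_eq, vacPhase_eq, Finset.sum_range_succ, add_sub_cancel_left]
  rfl

theorem exists_tendsto_vacPhase (h₀ : ModeData z t₀) (h₁ : ModeData z t₁)
    (hβ : Summable fun l => ‖bogBeta z t₁ t₀ l‖) :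
    ∃ c : ℝ, Tendsto (vacPhase z t₀ t₁) atTop (𝓝 c) := by
  obtain ⟨C, hC, hη⟩ := exists_norm_bogEta_le h₀ h₁
  have h1 : Summable fun l => (bogEta z t₁ t₀ l).im / 2 := by
    refine Summable.of_norm_bounded (hβ.mul_left C) fun l => ?_
    rw [Real.norm_eq_abs, abs_div, abs_two]
    have := (Complex.abs_im_le_norm (bogEta z t₁ t₀ l)).trans (hη l)
    linarith [abs_nonneg (bogEta z t₁ t₀ l).im]
  refine ⟨_, h1.hasSum.tendsto_sum_nat.congr fun n => ?_⟩
  rw [vacPhase_eq]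

theorem tendstoL2_vacProd_iff (h₀ : ModeData z t₀) (h₁ : ModeData z t₁)
    (hμ₁ : IsFieldMeasure z t₁ μ₁) {ψ : HS μ₁} :
    TendstoL2 μ₁ (vacProd z t₀ t₁) ψ ↔ Tendsto (vacProdVec h₀ h₁ hμ₁) atTop (𝓝 ψ) := by
  rw [tendstoL2_iff (memLp_vacProd h₀ h₁ hμ₁)]
  exact iff_of_eq (congrArg (Tendsto · atTop (𝓝 ψ)) (funext fun n => (vacProdVec_eq h₀ h₁ hμ₁ n).symm))

theorem tendstoL2_vacPhase_mul_vacProd_iff (h₀ : ModeData z t₀) (h₁ : ModeData z t₁)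
    (hμ₁ : IsFieldMeasure z t₁ μ₁) {ψ : HS μ₁} :
    TendstoL2 μ₁ (fun n T => Complex.exp (Complex.I * (vacPhase z t₀ t₁ n : ℝ)) *
        vacProd z t₀ t₁ n T) ψ ↔
      Tendsto (fun n => vacPhaseFactor z t₀ t₁ n • vacProdVec h₀ h₁ hμ₁ n) atTop (𝓝 ψ) := by
  rw [tendstoL2_iff fun n => (memLp_vacProd h₀ h₁ hμ₁ n).const_mul _]
  have e : ∀ n, ((memLp_vacProd h₀ h₁ hμ₁ n).const_mul
      (Complex.exp (Complex.I * (vacPhase z t₀ t₁ n : ℝ)))).toLp _ =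
      vacPhaseFactor z t₀ t₁ n • vacProdVec h₀ h₁ hμ₁ n := fun n => by
    rw [vacProdVec_eq]
    rfl
  exact iff_of_eq (congrArg (Tendsto · atTop (𝓝 ψ)) (funext e))

/-- Multiplication of an isometry by a phase. -/
def phaseMul {u : ℂ} (hu : ‖u‖ = 1) (V : HS μ₀ ≃ₗᵢ[ℂ] HS μ₁) : HS μ₀ ≃ₗᵢ[ℂ] HS μ₁ where
  toLinearEquiv := V.toLinearEquiv.trans
    (LinearEquiv.smulOfNeZero ℂ (HS μ₁) u (norm_ne_zero_iff.1 (by rw [hu]; exact one_ne_zero)))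
  norm_map' x := by
    show ‖u • V x‖ = ‖x‖
    rw [norm_smul, hu, one_mul, V.norm_map]

theorem phaseMul_apply {u : ℂ} (hu : ‖u‖ = 1) (V : HS μ₀ ≃ₗᵢ[ℂ] HS μ₁) (ψ : HS μ₀) :
    phaseMul hu V ψ = u • V ψ := rfl

theorem Intertwines.phaseMul {u : ℂ} (hu : ‖u‖ = 1) {V : HS μ₀ ≃ₗᵢ[ℂ] HS μ₁}
    (hV : Intertwines W₀ W₁ V) : Intertwines W₀ W₁ (phaseMul hu V) := fun w ψ => by
  rw [phaseMul_apply, phaseMul_apply, hV, map_smul]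

/-- If both f_n and e^{iχ_n} f_n converge, so does their inner product e^{iχ_n}, and χ_n follows
because its increments vanish. Conversely a limit c of χ_n is absorbed by the constant phase e^{-ic}
in V. -/
theorem exists_intertwines_tendstoL2_iff (h₀ : ModeData z t₀) (h₁ : ModeData z t₁)
    (hμ₁ : IsFieldMeasure z t₁ μ₁) (hβ : Summable fun l => ‖bogBeta z t₁ t₀ l‖ ^ 2)
    {V : HS μ₀ ≃ₗᵢ[ℂ] HS μ₁} (hV : Intertwines W₀ W₁ V)
    (hvac : Tendsto (fun n => vacPhaseFactor z t₀ t₁ n • vacProdVec h₀ h₁ hμ₁ n) atTop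
      (𝓝 (V (vac μ₀)))) :
    (∃ V : HS μ₀ ≃ₗᵢ[ℂ] HS μ₁, Intertwines W₀ W₁ V ∧
        TendstoL2 μ₁ (vacProd z t₀ t₁) (V (vac μ₀))) ↔
      ∃ c : ℝ, Tendsto (vacPhase z t₀ t₁) atTop (𝓝 c) := by
  simp only [tendstoL2_vacProd_iff h₀ h₁ hμ₁]
  constructor
  · rintro ⟨V', -, hV'⟩
    refine exists_tendsto_of_tendsto_exp (tendsto_vacPhase_succ_sub h₀ h₁ hβ)
      ((hV'.inner (𝕜 := ℂ) hvac).congr fun n => ?_)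
    rw [inner_smul_right, inner_self_eq_norm_sq_to_K, norm_vacProdVec]
    simp [vacPhaseFactor]
  · rintro ⟨c, hc⟩
    have hu : ‖Complex.exp (-(c : ℝ) * Complex.I)‖ = 1 := by
      rw [← Complex.ofReal_neg, Complex.norm_exp_ofReal_mul_I]
    refine ⟨phaseMul hu V, hV.phaseMul hu, ?_⟩
    have h1 : Tendsto (fun n => Complex.exp (-(vacPhase z t₀ t₁ n : ℝ) * Complex.I)) atTop
        (𝓝 (Complex.exp (-(c : ℝ) * Complex.I))) :=
      (Complex.continuous_exp.tendsto _).comp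
        ((((Complex.continuous_ofReal.tendsto c).comp hc).neg).mul_const _)
    refine (h1.smul hvac).congr fun n => ?_
    rw [smul_smul, vacPhaseFactor, ← Complex.exp_add]
    ring_nf
    simp

theorem summable_norm_bogBeta_sq_modeFn {ρ ν : ℕ → ℝ} (hρ : ∀ l, 0 < ρ l)
    (hρ2 : Summable fun l => (ρ l - √(Real.pi / 2)) ^ 2) (hν2 : Summable fun l => ν l ^ 2)
    (h₀ : t₀ ∈ Set.Ioo 0 Real.pi) (h₁ : t₁ ∈ Set.Ioo 0 Real.pi) :
    Summable fun l => ‖bogBeta (modeFn ρ ν) t₁ t₀ l‖ ^ 2 := by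
  obtain ⟨C, hC, hb⟩ := bogBeta_modeFn_le hρ hρ2 hν2 h₀ h₁
  refine Summable.of_nonneg_of_le (fun l => sq_nonneg _) (fun l => ?_)
    ((summable_modeDev_sq hρ2 hν2).mul_left (C ^ 2))
  rw [← mul_pow]
  exact pow_le_pow_left₀ (norm_nonneg _) (hb l) 2

theorem summable_norm_bogBeta_modeFn {ρ ν : ℕ → ℝ} (hρ : ∀ l, 0 < ρ l)
    (hρ2 : Summable fun l => (ρ l - √(Real.pi / 2)) ^ 2) (hν2 : Summable fun l => ν l ^ 2)
    (hρ1 : Summable fun l => |ρ l - √(Real.pi / 2)|) (hν1 : Summable fun l => |ν l|)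
    (h₀ : t₀ ∈ Set.Ioo 0 Real.pi) (h₁ : t₁ ∈ Set.Ioo 0 Real.pi) :
    Summable fun l => ‖bogBeta (modeFn ρ ν) t₁ t₀ l‖ := by
  obtain ⟨C, hC, hb⟩ := bogBeta_modeFn_le hρ hρ2 hν2 h₀ h₁
  exact Summable.of_nonneg_of_le (fun l => norm_nonneg _) hb
    ((summable_modeDev hρ1 hν1).mul_left C)

end Gowdy

end

open Gowdy in
theorem mainTheorem7 (ρ ν : ℕ → ℝ) (hρ : ∀ l, 0 < ρ l)
    (hρ2 : Summable fun l => (ρ l - Real.sqrt (Real.pi / 2)) ^ 2)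
    (hν2 : Summable fun l => ν l ^ 2) :
    -- existence and uniqueness of the Gaussian measures and of the Schrödinger representations
    (∀ t ∈ Set.Ioo 0 Real.pi, ∃! μ : ProbabilityMeasure Distr, IsFieldMeasure (modeFn ρ ν) t μ) ∧
    (∀ t ∈ Set.Ioo 0 Real.pi, ∀ μ : ProbabilityMeasure Distr, IsFieldMeasure (modeFn ρ ν) t μ →
      ∃! W : WeylFamily μ, IsSchrodingerRep (modeFn ρ ν) t μ W) ∧
    ∀ t₀ ∈ Set.Ioo 0 Real.pi, ∀ t₁ ∈ Set.Ioo 0 Real.pi,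
    ∀ μ₀ μ₁ : ProbabilityMeasure Distr,
      IsFieldMeasure (modeFn ρ ν) t₀ μ₀ → IsFieldMeasure (modeFn ρ ν) t₁ μ₁ →
    ∀ (W₀ : WeylFamily μ₀) (W₁ : WeylFamily μ₁),
      IsSchrodingerRep (modeFn ρ ν) t₀ μ₀ W₀ → IsSchrodingerRep (modeFn ρ ν) t₁ μ₁ W₁ →
    -- unitary implementability of the dynamics
    (Summable fun l => ‖bogBeta (modeFn ρ ν) t₁ t₀ l‖ ^ 2) ∧
    (∃ U : HS μ₀ ≃ₗᵢ[ℂ] HS μ₀, ∀ w w' : PhaseSpace, Evolves (modeFn ρ ν) t₀ t₁ w w' →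
      ∀ ψ : HS μ₀, U.symm (W₀ w (U ψ)) = W₀ w' ψ) ∧
    -- unitary equivalence and the action of the intertwiner on the vacuum
    (∀ n, eLpNorm (vacProd (modeFn ρ ν) t₀ t₁ n) 2 (μ₁ : Measure Distr) = 1) ∧
    (∃ V : HS μ₀ ≃ₗᵢ[ℂ] HS μ₁, Intertwines W₀ W₁ V ∧ Bogoliubov (modeFn ρ ν) t₀ t₁ W₀ W₁ V ∧
      TendstoL2 μ₁ (fun n T => Complex.exp (Complex.I * (vacPhase (modeFn ρ ν) t₀ t₁ n : ℝ)) *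
        vacProd (modeFn ρ ν) t₀ t₁ n T) (V (vac μ₀)) ∧
      ∀ V' : HS μ₀ ≃ₗᵢ[ℂ] HS μ₁, Bogoliubov (modeFn ρ ν) t₀ t₁ W₀ W₁ V' →
        V' (vac μ₀) = V (vac μ₀) → V' = V) ∧
    ((∃ V : HS μ₀ ≃ₗᵢ[ℂ] HS μ₁, Intertwines W₀ W₁ V ∧
        TendstoL2 μ₁ (vacProd (modeFn ρ ν) t₀ t₁) (V (vac μ₀))) ↔
      ∃ c : ℝ, Tendsto (vacPhase (modeFn ρ ν) t₀ t₁) atTop (𝓝 c)) ∧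
    ((Summable fun l => |ρ l - Real.sqrt (Real.pi / 2)|) → (Summable fun l => |ν l|) →
      ∃ c : ℝ, Tendsto (vacPhase (modeFn ρ ν) t₀ t₁) atTop (𝓝 c)) ∧
    -- mutual absolute continuity
    (Summable fun l => (‖modeFn ρ ν l t₁‖ ^ 2 - ‖modeFn ρ ν l t₀‖ ^ 2) ^ 2) ∧
    (μ₀ : Measure Distr) ≪ (μ₁ : Measure Distr) ∧
    (μ₁ : Measure Distr) ≪ (μ₀ : Measure Distr) := by
  have hM : ∀ {t}, t ∈ Set.Ioo 0 Real.pi → ModeData (modeFn ρ ν) t := modeData_modeFn hρ hρ2 hν2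
  refine ⟨fun t ht => (hM ht).existsUnique_fieldMeasure,
    fun t ht μ hμ => (hM ht).existsUnique_rep hμ, ?_⟩
  intro t₀ ht₀ t₁ ht₁ μ₀ μ₁ hμ₀ hμ₁ W₀ W₁ hW₀ hW₁
  have h₀ := hM ht₀
  have h₁ := hM ht₁
  have hβ := summable_norm_bogBeta_sq_modeFn hρ hρ2 hν2 ht₀ ht₁
  have hac₀ := absolutelyContinuous_fieldMeasure h₀ h₁ hβ hμ₀ hμ₁ hW₁
  have hac₁ := absolutelyContinuous_fieldMeasure h₁ h₀
    (summable_norm_bogBeta_sq_modeFn hρ hρ2 hν2 ht₁ ht₀) hμ₁ hμ₀ hW₀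
  obtain ⟨Φ, hΦ⟩ := exists_tendsto_vacProdVec h₀ h₁ hμ₁ hβ
  -- Replacing Φ by the image of the vacuum turns its defining limit into the required limit for V.
  obtain ⟨V, hV, rfl⟩ := exists_intertwiner h₀ hμ₀ hW₀ hW₁ hac₁
    (tendsto_weyl_vacProdVec h₀ h₁ hμ₁ hW₁ hΦ)
  exact ⟨hβ, exists_dynamics h₀ h₁ hμ₀ hμ₁ hW₀ hW₁ hV, eLpNorm_vacProd h₀ h₁ hμ₁,
    ⟨V, hV, hV.bogoliubov h₁, (tendstoL2_vacPhase_mul_vacProd_iff h₀ h₁ hμ₁).2 hΦ,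
      fun V' hV' => hV'.eq_of_vac h₀ h₁ hμ₀ hW₀ hV⟩,
    exists_intertwines_tendstoL2_iff h₀ h₁ hμ₁ hβ hV hΦ,
    fun hρ1 hν1 => exists_tendsto_vacPhase h₀ h₁
      (summable_norm_bogBeta_modeFn hρ hρ2 hν2 hρ1 hν1 ht₀ ht₁),
    summable_normSq_sub_sq h₀ h₁ hβ, hac₀, hac₁⟩
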